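/- Let $R$ be a noetherian commutative ring that is flat over $\mathbb{Z}$, let $S=\operatorname{Spec}R$, let $X$ be a noetherian scheme and let $f:X\to S$ be a flat and separated morphism. Let $q_0\ge 0$ and suppose that the $\mathcal{O}_S$-module $R^qf_*\mathcal{O}_X$ is locally free of finite rank for all $q\ge q_0$. *Deformation cohomology.* For a scheme $Z$ put $\hat{\mathbb{G}}_m(Z)=\ker(\Gamma(Z,\mathcal{O}_Z)^\times\to\Gamma(Z_{\rm red},\mathcal{O})^\times)$. For an $S$-scheme $T$ let $f_T:X_T=X\times_ST\to T$ be the projection, and let $\tilde E_T$ be the sheaf of abelian groups on $X_T$ given by $\tilde E_T(U)=\ker(\hat{\mathbb{G}}_m(U)\to\hat{\mathbb{G}}_m(U\times_TT_{\rm red}))$. Put $\Phi^q(X/S,\hat{\mathbb{G}}_m)(T)=\Gamma(T,R^qf_{T*}\tilde E_T)$. *Functors on nilpotent algebras.* A nilpotent $R$-algebra is a commutative $R$-algebra $N$ without unit such that $N^r=0$ for some $r$; then $R\oplus N$ is a unital $R$-algebra. The functor $\Phi^q=\Phi^q(X/S,\hat{\mathbb{G}}_m)$ is regarded as the functor $N\mapsto\ker\bigl(\Phi^q(\operatorname{Spec}(R\oplus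 N))\to\Phi^q(\operatorname{Spec}R)\bigr)$ from nilpotent $R$-algebras to abelian groups. For a functor $H$ from nilpotent $R$-algebras to abelian groups let $H(xR[[x]])=\varprojlim_nH(xR[x]/x^nR[x])$. Let $\Lambda$ be the functor with $\Lambda(N)=\{1+n_1t+\dots+n_rt^r\mid r\ge 0,\ n_i\in N\}\subset(R\oplus N)[t]^\times$, and let $\mathbb{E}_R=\operatorname{End}(\Lambda)^{op}$ be the Cartier ring; it acts on $\operatorname{Hom}(\Lambda,H)$ by composition. If $$\operatorname{ev}_H:\operatorname{Hom}(\Lambda,H)\to H(xR[[x]]),\qquad \varphi\mapsto\varphi(1-xt),$$ is bijective, then $H(xR[[x]])$ with the left $\mathbb{E}_R$-module structure transported along $\operatorname{ev}_H$ is called the Cartier module of $H$. *Witt vectors.* Let $\mathbb{W}\mathcal{O}_X$ be the sheaf of big Witt vectors, with underlying sheaf of abelian groups $U\mapsto 1+x\,\Gamma(U,\mathcal{O}_X)[[x]]$ (under multiplication). For every open $U\subset X$ the group $\mathbb{W}\mathcal{O}_X(U)$ is the group of curves $H_U(xR[[x]])$ of the functor $H_U(N)=\ker(\tilde E_{\operatorname{Spec}(R\oplus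 N)}(U)\to\tilde E_S(U))$. Then: 1. The map $\operatorname{ev}_{\Phi^{q_0}}$ is bijective, so that $\Phi^{q_0}(X/S,\hat{\mathbb{G}}_m)$ has a Cartier module. 2. For every open $U\subset X$ the map $\operatorname{ev}_{H_U}:\operatorname{Hom}(\Lambda,H_U)\to H_U(xR[[x]])=\mathbb{W}\mathcal{O}_X(U)$ is bijective, and the resulting $\mathbb{E}_R$-module structures make $\mathbb{W}\mathcal{O}_X$ a sheaf of left $\mathbb{E}_R$-modules; in particular $\mathbb{E}_R$ acts on $H^{q_0}(X,\mathbb{W}\mathcal{O}_X)$. 3. The Cartier module of $\Phi^{q_0}(X/S,\hat{\mathbb{G}}_m)$ is $H^{q_0}(X,\mathbb{W}\mathcal{O}_X)$: the canonical maps $H^{q_0}(X,\mathbb{W}\mathcal{O}_X)\to\Phi^{q_0}(X/S,\hat{\mathbb{G}}_m)(\operatorname{Spec}R[x]/x^n)$, induced by reduction of power series modulo $x^n$, define an isomorphism of left $\mathbb{E}_R$-modules $$H^{q_0}(X,\mathbb{W}\mathcal{O}_X)\xrightarrow{\ \cong\ }\Phi^{q_0}(X/S,\hat{\mathbb{G}}_m)(xR[[x]]).$$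 -/

import Mathlib

open CategoryTheory AlgebraicGeometry TopologicalSpace Opposite

universe u

noncomputable section

namespace CartierWitt

/-! ### Nilpotent algebras and the Cartier ring -/

/-- A nilpotent `R`-algebra: a commutative `R`-algebra `N` without unit such that `N ^ r = 0` for
some `r`. The power of `N` is taken as the power of the ideal `N` of `R ⊕ N`. -/
structure NilAlg (R : Type u) [CommRing R] where
  carrier : Type u
  [ring : NonUnitalCommRing carrier]
  [module : Module R carrier]
  [tower : IsScalarTower R carrier carrier]
  [comm : SMulCommClass R carrier carrier]
  nilpotent : IsNilpotent (RingHom.ker (Unitization.fstHom R carrier))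

attribute [instance] NilAlg.ring NilAlg.module NilAlg.tower NilAlg.comm

variable {R : Type u} [CommRing R]

/-- The (unital) `R`-algebra `R ⊕ N`. -/
abbrev NilAlg.Aug (N : NilAlg R) : Type u := Unitization R N.carrier

instance : Category (NilAlg R) where
  Hom N N' := N.carrier →ₙₐ[R] N'.carrier
  id N := NonUnitalAlgHom.id R N.carrier
  comp f g := g.comp f

/-- The homomorphism of algebras underlying a morphism of nilpotent `R`-algebras. -/
def NilAlg.hom {N N' : NilAlg R} (φ : N ⟶ N') : N.carrier →ₙₐ[R] N'.carrier := φ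

/-- The homomorphism `R ⊕ N → R ⊕ N'` induced by `N → N'`. -/
def NilAlg.augMap {N N' : NilAlg R} (φ : N ⟶ N') : N.Aug →ₐ[R] N'.Aug :=
  Unitization.lift ((Unitization.inrNonUnitalAlgHom R N'.carrier).comp (NilAlg.hom φ))

lemma NilAlg.augMap_apply {N N' : NilAlg R} (φ : N ⟶ N') (a : N.Aug) :
    NilAlg.augMap φ a = Unitization.inl a.fst + (NilAlg.hom φ a.snd : N'.Aug) := by
  rfl

lemma NilAlg.augMap_inr {N N' : NilAlg R} (φ : N ⟶ N') (n : N.carrier) :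
    NilAlg.augMap φ (n : N.Aug) = (NilAlg.hom φ n : N'.Aug) := by
  simp [NilAlg.augMap_apply]

lemma NilAlg.augMap_id (N : NilAlg R) : NilAlg.augMap (𝟙 N) = AlgHom.id R N.Aug :=
  AlgHom.ext fun a => Unitization.inl_fst_add_inr_snd_eq a

lemma NilAlg.augMap_comp {N N' N'' : NilAlg R} (φ : N ⟶ N') (ψ : N' ⟶ N'') :
    NilAlg.augMap (φ ≫ ψ) = (NilAlg.augMap ψ).comp (NilAlg.augMap φ) := by
  refine AlgHom.ext fun a => ?_
  have h : NilAlg.hom (φ ≫ ψ) a.snd = NilAlg.hom ψ (NilAlg.hom φ a.snd) := rfl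
  simp [NilAlg.augMap_apply, h]

lemma NilAlg.fst_augMap {N N' : NilAlg R} (φ : N ⟶ N') (a : N.Aug) :
    (NilAlg.augMap φ a).fst = a.fst := by
  simp [NilAlg.augMap_apply]

lemma NilAlg.isNilpotent_of_fst (N : NilAlg R) (a : N.Aug) (h : a.fst = 0) : IsNilpotent a := by
  obtain ⟨k, hk⟩ := N.nilpotent
  refine ⟨k, ?_⟩
  have h1 := Ideal.pow_mem_pow
    (show a ∈ RingHom.ker (Unitization.fstHom R N.carrier) from h) k
  rwa [hk] at h1

/-- The zero algebra, for which `R ⊕ 0 = R`. -/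
def NilAlg.zero (R : Type u) [CommRing R] : NilAlg R where
  carrier := PUnit.{u + 1}
  nilpotent := ⟨1, by
    rw [pow_one, Ideal.zero_eq_bot, eq_bot_iff]
    intro a ha
    exact Unitization.ext ha (Subsingleton.elim _ _)⟩

/-- The map `N → 0`. -/
def NilAlg.toZero (N : NilAlg R) : N ⟶ NilAlg.zero R := (0 : N.carrier →ₙₐ[R] PUnit.{u + 1})

lemma NilAlg.comp_toZero {N N' : NilAlg R} (φ : N ⟶ N') : φ ≫ N'.toZero = N.toZero :=
  NonUnitalAlgHom.ext fun _ => rfl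

/-- A nilpotent ideal of an `R`-algebra, as a nilpotent `R`-algebra. -/
def NilAlg.ofIdeal {A : Type u} [CommRing A] [Algebra R A] (I : Ideal A) (hI : IsNilpotent I) :
    NilAlg R :=
  letI : IsScalarTower R I I := ⟨fun r a b => Subtype.ext (smul_mul_assoc r (a : A) (b : A))⟩
  { carrier := I
    nilpotent := by
      obtain ⟨k, hk⟩ := hI
      let φ : Unitization R I →ₐ[R] A := Unitization.lift
        { toFun := fun a => (a : A)
          map_smul' := fun _ _ => rfl
          map_zero' := rfl
          map_add' := fun _ _ => rfl
          map_mul' := fun _ _ => rfl }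
      have hle : RingHom.ker (Unitization.fstHom R I) ≤ Ideal.comap φ I := by
        intro a ha
        have h0 : a.fst = 0 := ha
        rw [Ideal.mem_comap, ← Unitization.inl_fst_add_inr_snd_eq a, h0]
        simp [φ]
      refine ⟨k + 1, ?_⟩
      rw [Ideal.zero_eq_bot, eq_bot_iff]
      intro a ha
      have h1 : a ∈ RingHom.ker (Unitization.fstHom R I) :=
        Ideal.pow_le_self (Nat.succ_ne_zero k) ha
      have h2 : φ a = 0 := by
        have h3 : φ a ∈ I ^ k := by
          have h4 : a ∈ (Ideal.comap φ I) ^ k :=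
            Ideal.pow_right_mono hle k (Ideal.pow_le_pow_right (Nat.le_succ k) ha)
          exact Ideal.le_comap_pow φ k h4
        simpa [hk] using h3
      have h0 : a.fst = 0 := h1
      refine Unitization.ext h0 (Subtype.ext ?_)
      rw [← Unitization.inl_fst_add_inr_snd_eq a, h0] at h2
      simpa [φ] using h2 }

section Truncated

open Polynomial

/-- The ring `R[x] / x ^ n`. -/
abbrev TruncPoly (R : Type u) [CommRing R] (n : ℕ) : Type u :=
  R[X] ⧸ Ideal.span {(X : R[X]) ^ n}

/-- The class of `x` in `R[x] / x ^ n`. -/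
def TruncPoly.x (R : Type u) [CommRing R] (n : ℕ) : TruncPoly R n :=
  Ideal.Quotient.mk _ X

lemma TruncPoly.x_pow (R : Type u) [CommRing R] (n : ℕ) : TruncPoly.x R n ^ n = 0 := by
  rw [TruncPoly.x, ← map_pow, Ideal.Quotient.eq_zero_iff_mem]
  exact Ideal.subset_span rfl

/-- The nilpotent `R`-algebra `x R[x] / x ^ n R[x]`. -/
def truncAlg (R : Type u) [CommRing R] (n : ℕ) : NilAlg R :=
  NilAlg.ofIdeal (A := TruncPoly R n) (Ideal.span {TruncPoly.x R n})
    ⟨n, by rw [Ideal.span_singleton_pow, TruncPoly.x_pow]; simp⟩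

/-- The element `x` of `x R[x] / x ^ n R[x]`. -/
def truncAlg.x (R : Type u) [CommRing R] (n : ℕ) : (truncAlg R n).carrier :=
  (⟨TruncPoly.x R n, Ideal.subset_span rfl⟩ : Ideal.span {TruncPoly.x R n})

/-- The projection `R[x] / x ^ (n + 1) → R[x] / x ^ n`. -/
def TruncPoly.proj (R : Type u) [CommRing R] (n : ℕ) : TruncPoly R (n + 1) →ₐ[R] TruncPoly R n :=
  Ideal.Quotient.factorₐ R (Ideal.span_singleton_le_span_singleton.2 (pow_dvd_pow X n.le_succ))

/-- The projection `x R[x] / x ^ (n + 1) R[x] → x R[x] / x ^ n R[x]`. -/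
def truncAlg.proj (R : Type u) [CommRing R] (n : ℕ) : truncAlg R (n + 1) ⟶ truncAlg R n :=
  ({ toFun := fun a => ⟨TruncPoly.proj R n a.1, by
        obtain ⟨b, hb⟩ := Ideal.mem_span_singleton'.1 a.2
        refine Ideal.mem_span_singleton'.2 ⟨TruncPoly.proj R n b, ?_⟩
        rw [← hb, map_mul]
        rfl⟩
     map_smul' := fun r a => Subtype.ext (map_smul (TruncPoly.proj R n) r a.1)
     map_zero' := Subtype.ext (map_zero (TruncPoly.proj R n))
     map_add' := fun a b => Subtype.ext (map_add (TruncPoly.proj R n) a.1 b.1)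
     map_mul' := fun a b => Subtype.ext (map_mul (TruncPoly.proj R n) a.1 b.1) } :
    (truncAlg R (n + 1)).carrier →ₙₐ[R] (truncAlg R n).carrier)

lemma truncAlg.proj_x (n : ℕ) :
    NilAlg.hom (truncAlg.proj R n) (truncAlg.x R (n + 1)) = truncAlg.x R n := rfl

/-- The group `Λ(N)` of polynomials `1 + n₁ t + ⋯ + n_r t ^ r` with `nᵢ ∈ N`, inside the group of
units of `(R ⊕ N)[t]`: the constant coefficient is `1`, and the polynomial maps to `1` in `R[t]`. -/
def lambdaSubgroup (N : NilAlg R) : Subgroup (N.Aug[X])ˣ :=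
  (Units.map (Polynomial.constantCoeff : N.Aug[X] →+* N.Aug).toMonoidHom).ker ⊓
    (Units.map (Polynomial.mapRingHom
      (Unitization.fstHom R N.carrier : N.Aug →+* R)).toMonoidHom).ker

lemma mem_lambdaSubgroup {N : NilAlg R} {p : (N.Aug[X])ˣ} : p ∈ lambdaSubgroup N ↔
    (p : N.Aug[X]).coeff 0 = 1 ∧ ∀ i, i ≠ 0 → ((p : N.Aug[X]).coeff i).fst = 0 := by
  simp only [lambdaSubgroup, Subgroup.mem_inf, MonoidHom.mem_ker, Units.ext_iff]
  refine and_congr_right fun h0 => ⟨fun h i hi => ?_, fun h => ?_⟩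
  · have h1 := congrArg (fun r => coeff r i) h
    simp only [Units.val_one, coeff_one, if_neg hi] at h1
    rw [← h1]
    exact (coeff_map (Unitization.fstHom R N.carrier : N.Aug →+* R) i).symm
  · have h0' : (p : N.Aug[X]).coeff 0 = 1 := h0
    refine Polynomial.ext fun i => ?_
    refine (coeff_map (Unitization.fstHom R N.carrier : N.Aug →+* R) i).trans ?_
    by_cases hi : i = 0
    · simp [hi, h0']
    · exact (h i hi).trans (by simp [coeff_one, hi])

/-- The map `Λ(N) → Λ(N')` induced by `N → N'`. -/
def lambdaMap {N N' : NilAlg R} (φ : N ⟶ N') : lambdaSubgroup N →* lambdaSubgroup N' :=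
  ((Units.map (Polynomial.mapRingHom
    (NilAlg.augMap φ : N.Aug →+* N'.Aug)).toMonoidHom).comp
      (lambdaSubgroup N).subtype).codRestrict (lambdaSubgroup N') (fun p => by
    have hp := mem_lambdaSubgroup.1 p.2
    refine mem_lambdaSubgroup.2 ⟨?_, fun i hi => ?_⟩
    · exact (coeff_map _ _).trans (by rw [Subgroup.subtype_apply, hp.1, map_one])
    · exact (congrArg (fun a : N'.Aug => a.fst) (coeff_map _ _)).trans
        ((NilAlg.fst_augMap φ _).trans (hp.2 i hi)))

lemma lambdaMap_coe {N N' : NilAlg R} (φ : N ⟶ N') (p : lambdaSubgroup N) :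
    (((lambdaMap φ p : lambdaSubgroup N') : (N'.Aug[X])ˣ) : N'.Aug[X]) =
      ((p : (N.Aug[X])ˣ) : N.Aug[X]).map (NilAlg.augMap φ : N.Aug →+* N'.Aug) := rfl

lemma lambdaMap_id (N : NilAlg R) : lambdaMap (𝟙 N) = MonoidHom.id _ := by
  refine MonoidHom.ext fun p => Subtype.ext (Units.ext ?_)
  rw [lambdaMap_coe, NilAlg.augMap_id]
  exact Polynomial.map_id

lemma lambdaMap_comp {N N' N'' : NilAlg R} (φ : N ⟶ N') (ψ : N' ⟶ N'') :
    lambdaMap (φ ≫ ψ) = (lambdaMap ψ).comp (lambdaMap φ) := by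
  refine MonoidHom.ext fun p => Subtype.ext (Units.ext ?_)
  rw [MonoidHom.comp_apply, lambdaMap_coe, lambdaMap_coe, lambdaMap_coe, NilAlg.augMap_comp,
    Polynomial.map_map]
  rfl

/-- The functor `Λ` from nilpotent `R`-algebras to abelian groups. -/
def Lambda (R : Type u) [CommRing R] : NilAlg R ⥤ AddCommGrpCat.{u} where
  obj N := AddCommGrpCat.of (Additive (lambdaSubgroup N))
  map φ := AddCommGrpCat.ofHom (lambdaMap φ).toAdditive
  map_id N := by
    rw [lambdaMap_id]
    rfl
  map_comp φ ψ := by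
    rw [lambdaMap_comp]
    rfl

/-- The Cartier ring `𝔼_R = End(Λ)ᵒᵖ`. -/
abbrev CartierRing (R : Type u) [CommRing R] : Type (u + 1) := (End (Lambda R))ᵐᵒᵖ

/-- The element `1 - x t` of `Λ(x R[x] / x ^ n R[x])`. -/
def lambdaElt (R : Type u) [CommRing R] (n : ℕ) : lambdaSubgroup (truncAlg R n) :=
  ⟨(show IsUnit (1 - C ((truncAlg.x R n : (truncAlg R n).Aug)) * X) from
      IsNilpotent.isUnit_one_sub (Commute.isNilpotent_mul_right (Commute.all _ _)
        ((NilAlg.isNilpotent_of_fst _ _ rfl).map C))).unit, by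
    refine mem_lambdaSubgroup.2 ⟨by simp, fun i hi => ?_⟩
    rw [IsUnit.unit_spec, coeff_sub, coeff_one, if_neg hi, coeff_C_mul, coeff_X]
    split_ifs <;> simp⟩

lemma lambdaMap_lambdaElt (n : ℕ) :
    lambdaMap (truncAlg.proj R n) (lambdaElt R (n + 1)) = lambdaElt R n := by
  apply Subtype.ext
  apply Units.ext
  rw [lambdaMap_coe]
  simp [lambdaElt, NilAlg.augMap_inr, truncAlg.proj_x]

end Truncated

/-- The group `H(x R[[x]])`, the inverse limit of the groups `H(x R[x] / x ^ n R[x])`. -/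
def curves (H : NilAlg R ⥤ AddCommGrpCat.{u}) :
    AddSubgroup (∀ n : ℕ, H.obj (truncAlg R n)) where
  carrier := {c | ∀ n, H.map (truncAlg.proj R n) (c (n + 1)) = c n}
  zero_mem' := fun n => map_zero _
  add_mem' {c d} hc hd := fun n => by
    rw [Pi.add_apply, map_add, hc n, hd n, Pi.add_apply]
  neg_mem' {c} hc := fun n => by
    rw [Pi.neg_apply, map_neg, hc n, Pi.neg_apply]

/-- The map `Hom(Λ, H) → H(x R[[x]])`, `φ ↦ φ(1 - x t)`. -/
def evalCurve (H : NilAlg R ⥤ AddCommGrpCat.{u}) : (Lambda R ⟶ H) →+ curves H where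
  toFun φ := ⟨fun n => φ.app (truncAlg R n) (Additive.ofMul (lambdaElt R n)), fun n => by
    have h := ConcreteCategory.congr_hom (φ.naturality (truncAlg.proj R n))
      (Additive.ofMul (lambdaElt R (n + 1)))
    refine h.symm.trans ?_
    exact congrArg (fun p => φ.app (truncAlg R n) (Additive.ofMul p)) (lambdaMap_lambdaElt n)⟩
  map_zero' := rfl
  map_add' _ _ := rfl

/-- For a functor `G` on the algebras `R ⊕ N`, the functor `N ↦ ker(G(R ⊕ N) → G(R))`. -/
def reducedPart (G : NilAlg R ⥤ AddCommGrpCat.{u}) : NilAlg R ⥤ AddCommGrpCat.{u} where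
  obj N := AddCommGrpCat.of (G.map N.toZero).hom.ker
  map {N N'} φ := AddCommGrpCat.ofHom
    (((G.map φ).hom.comp (G.map N.toZero).hom.ker.subtype).codRestrict _ (fun a => by
      have h : G.map φ ≫ G.map N'.toZero = G.map N.toZero := by
        rw [← G.map_comp, NilAlg.comp_toZero]
      rw [AddMonoidHom.mem_ker]
      exact (ConcreteCategory.congr_hom h a.1).trans a.2))
  map_id N := by
    refine AddCommGrpCat.ext fun a => Subtype.ext ?_
    exact ConcreteCategory.congr_hom (G.map_id N) a.1
  map_comp φ ψ := by
    refine AddCommGrpCat.ext fun a => Subtype.ext ?_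
    exact ConcreteCategory.congr_hom (G.map_comp φ ψ) a.1

/-! ### Sheaves of units and the sheaf of big Witt vectors -/

/-- Criterion for a presheaf of abelian groups on a scheme, whose sections are given by families of
functions, to be a sheaf. -/
lemma isSheaf_of_coordinates {Y : Scheme.{u}} (P : TopCat.Presheaf AddCommGrpCat.{u} Y)
    {κ : Type} (c : ∀ (U : Y.Opens), κ → P.obj (op U) → Γ(Y, U))
    (nat : ∀ {U V : Y.Opens} (i : V ⟶ U) (k : κ) (s : P.obj (op U)),
      c V k (P.map i.op s) = Y.presheaf.map i.op (c U k s))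
    (inj : ∀ (U : Y.Opens) (s t : P.obj (op U)), (∀ k, c U k s = c U k t) → s = t)
    (loc : ∀ {ι : Type u} (U : ι → Y.Opens) (a : κ → Γ(Y, iSup U)),
      (∀ i, ∃ s : P.obj (op (U i)), ∀ k,
        c (U i) k s = Y.presheaf.map (Opens.leSupr U i).op (a k)) →
      ∃ s : P.obj (op (iSup U)), ∀ k, c (iSup U) k s = a k) :
    P.IsSheaf := by
  rw [TopCat.Presheaf.isSheaf_iff_isSheafUniqueGluing]
  intro ι U sf hsf
  have h1 : ∀ k, ∃ a : Γ(Y, iSup U), ∀ i,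
      Y.presheaf.map (Opens.leSupr U i).op a = c (U i) k (sf i) := by
    intro k
    obtain ⟨a, ha, -⟩ := Y.sheaf.existsUnique_gluing U (fun i => c (U i) k (sf i)) (by
      intro i j
      have h2 := congrArg (c _ k) (hsf i j)
      rw [nat, nat] at h2
      exact h2)
    exact ⟨a, ha⟩
  choose a ha using h1
  obtain ⟨s, hs⟩ := loc U a (fun i => ⟨sf i, fun k => (ha k i).symm⟩)
  refine ⟨s, fun i => inj _ _ _ fun k => ?_, fun t ht => inj _ _ _ fun k => ?_⟩
  · rw [nat, hs, ha]
  · rw [hs]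
    refine Y.sheaf.eq_of_locally_eq U _ _ fun i => ?_
    have h3 := congrArg (c _ k) (ht i)
    rw [nat] at h3
    exact h3.trans (ha k i).symm

/-- The kernel of `Γ(Y, U)ˣ → Γ(Z, ψ⁻¹ U)ˣ` for a morphism of schemes `ψ : Z ⟶ Y`. -/
def unitsKer {Z Y : Scheme.{u}} (ψ : Z ⟶ Y) (U : Y.Opens) : Subgroup (Γ(Y, U))ˣ :=
  (Units.map (ψ.app U).hom.toMonoidHom).ker

lemma mem_unitsKer {Z Y : Scheme.{u}} {ψ : Z ⟶ Y} {U : Y.Opens} {a : (Γ(Y, U))ˣ} :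
    a ∈ unitsKer ψ U ↔ ψ.app U (a : Γ(Y, U)) = 1 := by
  simp only [unitsKer, MonoidHom.mem_ker, Units.ext_iff]
  rfl

lemma unitsKer_map {Z Y : Scheme.{u}} {ψ : Z ⟶ Y} {U V : Y.Opens} (i : V ⟶ U) {a : (Γ(Y, U))ˣ}
    (ha : a ∈ unitsKer ψ U) :
    Units.map (Y.presheaf.map i.op).hom.toMonoidHom a ∈ unitsKer ψ V := by
  rw [mem_unitsKer] at ha ⊢
  have h := ConcreteCategory.congr_hom (ψ.naturality i.op) (a : Γ(Y, U))
  refine h.trans ?_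
  exact (congrArg (Z.presheaf.map ((Opens.map ψ.base).map i).op) ha).trans (map_one _)

lemma unitsKer_app {Z Y Z' Y' : Scheme.{u}} {ψ : Z ⟶ Y} {ψ' : Z' ⟶ Y'} {h : Y' ⟶ Y} {k : Z' ⟶ Z}
    (w : k ≫ ψ = ψ' ≫ h) {U : Y.Opens} {a : (Γ(Y, U))ˣ} (ha : a ∈ unitsKer ψ U) :
    Units.map (h.app U).hom.toMonoidHom a ∈ unitsKer ψ' (h ⁻¹ᵁ U) := by
  rw [mem_unitsKer] at ha ⊢
  have h1 : ∀ (g : Z' ⟶ Y), g = k ≫ ψ → g.app U (a : Γ(Y, U)) = 1 := by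
    rintro _ rfl
    rw [Scheme.Hom.comp_app]
    exact (congrArg (k.app (ψ ⁻¹ᵁ U)) ha).trans (map_one _)
  have h2 := h1 (ψ' ≫ h) w.symm
  rw [Scheme.Hom.comp_app] at h2
  exact h2

/-- For morphisms `ψ₁ : Z₁ ⟶ Y` and `ψ₂ : Z₂ ⟶ Y`, the presheaf on `Y` of the units that restrict to
`1` along `ψ₁` and along `ψ₂`. -/
def unitsKerPresheaf {Z₁ Z₂ Y : Scheme.{u}} (ψ₁ : Z₁ ⟶ Y) (ψ₂ : Z₂ ⟶ Y) :
    TopCat.Presheaf AddCommGrpCat.{u} Y where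
  obj U := AddCommGrpCat.of (Additive ↥(unitsKer ψ₁ U.unop ⊓ unitsKer ψ₂ U.unop))
  map {U V} i := AddCommGrpCat.ofHom (MonoidHom.toAdditive
    (((Units.map (Y.presheaf.map i).hom.toMonoidHom).comp
      (unitsKer ψ₁ U.unop ⊓ unitsKer ψ₂ U.unop).subtype).codRestrict
        (unitsKer ψ₁ V.unop ⊓ unitsKer ψ₂ V.unop)
        (fun a => ⟨unitsKer_map i.unop a.2.1, unitsKer_map i.unop a.2.2⟩)))
  map_id U := by
    refine AddCommGrpCat.ext fun a => Additive.toMul.injective (Subtype.ext (Units.ext ?_))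
    exact ConcreteCategory.congr_hom (Y.presheaf.map_id U) _
  map_comp i j := by
    refine AddCommGrpCat.ext fun a => Additive.toMul.injective (Subtype.ext (Units.ext ?_))
    exact ConcreteCategory.congr_hom (Y.presheaf.map_comp i j) _

lemma mem_unitsKer_of_locally {Z Y : Scheme.{u}} {ψ : Z ⟶ Y} {ι : Type u} {U : ι → Y.Opens}
    {a : (Γ(Y, iSup U))ˣ}
    (h : ∀ i, Units.map (Y.presheaf.map (Opens.leSupr U i).op).hom.toMonoidHom a ∈
      unitsKer ψ (U i)) : a ∈ unitsKer ψ (iSup U) := by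
  rw [mem_unitsKer]
  refine Z.sheaf.eq_of_locally_eq' (fun i => ψ ⁻¹ᵁ (U i)) (ψ ⁻¹ᵁ (iSup U))
    (fun i => (Opens.map ψ.base).map (Opens.leSupr U i)) ?_ _ _ fun i => ?_
  · intro z hz
    obtain ⟨i, hi⟩ := Opens.mem_iSup.1 (show ψ z ∈ iSup U from hz)
    exact Opens.mem_iSup.2 ⟨i, hi⟩
  · have h1 := mem_unitsKer.1 (h i)
    have h2 := ConcreteCategory.congr_hom (ψ.naturality (Opens.leSupr U i).op)
      (a : Γ(Y, iSup U))
    exact (h2.symm.trans h1).trans (map_one _).symm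

lemma isUnit_of_locally {Y : Scheme.{u}} {ι : Type u} {U : ι → Y.Opens} {a : Γ(Y, iSup U)}
    (h : ∀ i, IsUnit (Y.presheaf.map (Opens.leSupr U i).op a)) : IsUnit a := by
  choose b hb using fun i => (h i).exists_right_inv
  have key : ∀ {V W : Y.Opens} (j : W ⟶ V) (x y : Γ(Y, V)),
      Y.presheaf.map j.op (x * y) = Y.presheaf.map j.op x * Y.presheaf.map j.op y :=
    fun j x y => map_mul _ x y
  obtain ⟨c, hc, -⟩ := Y.sheaf.existsUnique_gluing U b (by
    intro i j
    let x : Γ(Y, U i ⊓ U j) := Y.presheaf.map (homOfLE (inf_le_left.trans (le_iSup U i)) :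
      U i ⊓ U j ⟶ iSup U).op a
    have e1 : x * Y.presheaf.map (Opens.infLELeft (U i) (U j)).op (b i) = 1 := by
      have := congrArg (Y.presheaf.map (Opens.infLELeft (U i) (U j)).op) (hb i)
      rw [key, map_one, ← ConcreteCategory.comp_apply, ← Functor.map_comp] at this
      exact this
    have e2 : x * Y.presheaf.map (Opens.infLERight (U i) (U j)).op (b j) = 1 := by
      have := congrArg (Y.presheaf.map (Opens.infLERight (U i) (U j)).op) (hb j)
      rw [key, map_one, ← ConcreteCategory.comp_apply, ← Functor.map_comp] at this
      exact this
    exact left_inv_eq_right_inv ((mul_comm _ _).trans e1) e2)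
  refine IsUnit.of_mul_eq_one c ?_
  refine Y.sheaf.eq_of_locally_eq U _ _ fun i => ?_
  refine (key (Opens.leSupr U i) a c).trans ?_
  refine (congrArg _ (hc i)).trans ((hb i).trans (map_one _).symm)

lemma unitsKerPresheaf_isSheaf {Z₁ Z₂ Y : Scheme.{u}} (ψ₁ : Z₁ ⟶ Y) (ψ₂ : Z₂ ⟶ Y) :
    (unitsKerPresheaf ψ₁ ψ₂).IsSheaf := by
  refine isSheaf_of_coordinates (κ := Unit) _
    (fun U _ (s : Additive ↥(unitsKer ψ₁ U ⊓ unitsKer ψ₂ U)) =>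
      (((Additive.toMul s : ↥(unitsKer ψ₁ U ⊓ unitsKer ψ₂ U)) : (Γ(Y, U))ˣ) : Γ(Y, U)))
    (fun _ _ _ => rfl) ?_ ?_
  · intro U s t h
    exact Additive.toMul.injective (Subtype.ext (Units.ext (h ())))
  · intro ι U a h
    have h1 : IsUnit (a ()) := isUnit_of_locally fun i => by
      obtain ⟨s, hs⟩ := h i
      rw [← hs ()]
      exact Units.isUnit _
    have h2 : ∀ i, ∃ s : ↥(unitsKer ψ₁ (U i) ⊓ unitsKer ψ₂ (U i)), (s : (Γ(Y, U i))ˣ) =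
        Units.map (Y.presheaf.map (Opens.leSupr U i).op).hom.toMonoidHom h1.unit := fun i => by
      obtain ⟨s, hs⟩ := h i
      exact ⟨Additive.toMul s, Units.ext (hs ())⟩
    refine ⟨Additive.ofMul ⟨h1.unit, mem_unitsKer_of_locally fun i => ?_,
      mem_unitsKer_of_locally fun i => ?_⟩, fun _ => rfl⟩
    · obtain ⟨s, hs⟩ := h2 i
      rw [← hs]
      exact s.2.1
    · obtain ⟨s, hs⟩ := h2 i
      rw [← hs]
      exact s.2.2

/-- The sheaf attached to `unitsKerPresheaf`. -/
def unitsKerSheaf {Z₁ Z₂ Y : Scheme.{u}} (ψ₁ : Z₁ ⟶ Y) (ψ₂ : Z₂ ⟶ Y) :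
    TopCat.Sheaf AddCommGrpCat.{u} Y :=
  ⟨unitsKerPresheaf ψ₁ ψ₂, unitsKerPresheaf_isSheaf ψ₁ ψ₂⟩

/-- The group of big Witt vectors of `A`, in the form `1 + x A[[x]]` with multiplication. -/
def wittSubgroup (A : Type u) [CommRing A] : Subgroup (PowerSeries A)ˣ :=
  (Units.map (PowerSeries.constantCoeff (R := A)).toMonoidHom).ker

lemma mem_wittSubgroup {A : Type u} [CommRing A] {p : (PowerSeries A)ˣ} :
    p ∈ wittSubgroup A ↔ PowerSeries.constantCoeff (p : PowerSeries A) = 1 := by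
  simp only [wittSubgroup, MonoidHom.mem_ker, Units.ext_iff]
  rfl

/-- The homomorphism of big Witt vectors induced by a homomorphism of rings. -/
def wittMap {A B : Type u} [CommRing A] [CommRing B] (φ : A →+* B) :
    wittSubgroup A →* wittSubgroup B :=
  ((Units.map (PowerSeries.map φ).toMonoidHom).comp (wittSubgroup A).subtype).codRestrict
    (wittSubgroup B) (fun p => by
      refine mem_wittSubgroup.2 ?_
      have h : PowerSeries.coeff 0 (PowerSeries.map φ ((p : (PowerSeries A)ˣ) : PowerSeries A)) =
          φ (PowerSeries.coeff 0 ((p : (PowerSeries A)ˣ) : PowerSeries A)) :=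
        PowerSeries.coeff_map φ 0 _
      rw [PowerSeries.coeff_zero_eq_constantCoeff_apply,
        PowerSeries.coeff_zero_eq_constantCoeff_apply, mem_wittSubgroup.1 p.2, map_one] at h
      exact h)

lemma coeff_wittMap {A B : Type u} [CommRing A] [CommRing B] (φ : A →+* B) (p : wittSubgroup A)
    (k : ℕ) : PowerSeries.coeff k ((wittMap φ p : (PowerSeries B)ˣ) : PowerSeries B) =
      φ (PowerSeries.coeff k ((p : (PowerSeries A)ˣ) : PowerSeries A)) :=
  PowerSeries.coeff_map φ k _

/-- The presheaf `U ↦ 1 + x Γ(X, U)[[x]]`. -/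
def wittPresheaf (X : Scheme.{u}) : TopCat.Presheaf AddCommGrpCat.{u} X where
  obj U := AddCommGrpCat.of (Additive (wittSubgroup Γ(X, U.unop)))
  map i := AddCommGrpCat.ofHom (MonoidHom.toAdditive (wittMap (X.presheaf.map i).hom))
  map_id U := by
    refine AddCommGrpCat.ext fun a => Additive.toMul.injective (Subtype.ext (Units.ext ?_))
    refine PowerSeries.ext fun k => (coeff_wittMap _ _ k).trans ?_
    exact ConcreteCategory.congr_hom (X.presheaf.map_id U) _
  map_comp i j := by
    refine AddCommGrpCat.ext fun a => Additive.toMul.injective (Subtype.ext (Units.ext ?_))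
    refine PowerSeries.ext fun k => (coeff_wittMap _ _ k).trans ?_
    refine (ConcreteCategory.congr_hom (X.presheaf.map_comp i j) _).trans ?_
    refine Eq.trans ?_ (coeff_wittMap _ _ k).symm
    exact congrArg (X.presheaf.map j) (coeff_wittMap (X.presheaf.map i).hom _ k).symm

lemma wittPresheaf_isSheaf (X : Scheme.{u}) : (wittPresheaf X).IsSheaf := by
  refine isSheaf_of_coordinates (κ := ℕ) _
    (fun U k (s : Additive (wittSubgroup Γ(X, U))) =>
      PowerSeries.coeff k (((Additive.toMul s : wittSubgroup Γ(X, U)) : (PowerSeries Γ(X, U))ˣ) :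
        PowerSeries Γ(X, U)))
    (fun _ k _ => coeff_wittMap _ _ k) ?_ ?_
  · intro U s t h
    exact Additive.toMul.injective (Subtype.ext (Units.ext (PowerSeries.ext h)))
  · intro ι U a h
    have h0 : a 0 = 1 := by
      refine X.sheaf.eq_of_locally_eq U _ _ fun i => ?_
      obtain ⟨s, hs⟩ := h i
      refine (hs 0).symm.trans (Eq.trans ?_ (map_one _).symm)
      rw [PowerSeries.coeff_zero_eq_constantCoeff_apply]
      exact mem_wittSubgroup.1 (Additive.toMul s).2
    have h1 : PowerSeries.constantCoeff (PowerSeries.mk a) = 1 := by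
      rw [← PowerSeries.coeff_zero_eq_constantCoeff_apply, PowerSeries.coeff_mk, h0]
    have h2 : IsUnit (PowerSeries.mk a) := by
      rw [PowerSeries.isUnit_iff_constantCoeff, h1]
      exact isUnit_one
    exact ⟨Additive.ofMul ⟨h2.unit, mem_wittSubgroup.2 h1⟩, fun k => PowerSeries.coeff_mk k a⟩

/-- The sheaf `𝕎𝒪_X` of big Witt vectors, `U ↦ 1 + x Γ(X, U)[[x]]`. -/
def wittSheaf (X : Scheme.{u}) : TopCat.Sheaf AddCommGrpCat.{u} X :=
  ⟨wittPresheaf X, wittPresheaf_isSheaf X⟩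

/-! ### Reduced schemes and the sheaves `Ẽ_T` for `E = 𝔾̂_m` -/

/-- The closed immersion `Y_red ⟶ Y`. -/
abbrev redι (Y : Scheme.{u}) : Y.nilradical.subscheme ⟶ Y := Y.nilradical.subschemeι

instance isReduced_red (Y : Scheme.{u}) : IsReduced Y.nilradical.subscheme := by
  have h : ∀ i, IsReduced (Y.nilradical.subschemeCover.openCover.X i) := fun i => by
    have : _root_.IsReduced (Γ(Y, i.1) ⧸ Y.nilradical.ideal i) := by
      rw [← Ideal.isRadical_iff_quotient_reduced]
      exact Ideal.radical_isRadical _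
    exact inferInstanceAs (IsReduced (Spec (.of (Γ(Y, i.1) ⧸ Y.nilradical.ideal i))))
  exact IsReduced.of_openCover _ Y.nilradical.subschemeCover.openCover

lemma exists_red_comp {Y' Y : Scheme.{u}} (h : Y' ⟶ Y) :
    ∃ k : Y'.nilradical.subscheme ⟶ Y.nilradical.subscheme, k ≫ redι Y = redι Y' ≫ h := by
  have hle : (redι Y).ker ≤ (redι Y' ≫ h).ker := by
    rw [Scheme.IdealSheafData.ker_subschemeι, Scheme.Hom.ker,
      Scheme.IdealSheafData.le_ofIdeals_iff]
    intro U a ha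
    have h1 : a ∈ (⊥ : Ideal Γ(Y, U.1)).radical := ha
    have h2 : IsNilpotent a := h1
    exact (h2.map ((redι Y' ≫ h).app U.1).hom).eq_zero
  exact ⟨IsClosedImmersion.lift (redι Y) (redι Y' ≫ h) hle, IsClosedImmersion.lift_fac _ _ _⟩

lemma unitsKer_appLE {Z Y Z' Y' : Scheme.{u}} {ψ : Z ⟶ Y} {ψ' : Z' ⟶ Y'} {h : Y' ⟶ Y}
    {k : Z' ⟶ Z} (w : k ≫ ψ = ψ' ≫ h) {U : Y.Opens} {V : Y'.Opens} (e : V ≤ h ⁻¹ᵁ U)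
    {a : (Γ(Y, U))ˣ} (ha : a ∈ unitsKer ψ U) :
    Units.map (h.appLE U V e).hom.toMonoidHom a ∈ unitsKer ψ' V :=
  unitsKer_map (homOfLE e) (unitsKer_app w ha)

section Tilde

variable {X S T : Scheme.{u}} (f : X ⟶ S) (g : T ⟶ S)

/-- The base change `X ×_S T_red ⟶ X ×_S T` of `T_red ⟶ T`. -/
abbrev baseChangeRed :
    Limits.pullback (Limits.pullback.snd f g) (redι T) ⟶ Limits.pullback f g :=
  Limits.pullback.fst (Limits.pullback.snd f g) (redι T)

/-- The sheaf `Ẽ_T` on `X_T = X ×_S T` for `E = 𝔾̂_m`: the sections over `U` are the elements of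
`𝔾̂_m(U) = ker(Γ(U)ˣ → Γ(U_red)ˣ)` whose image in `𝔾̂_m(U ×_T T_red)` is trivial. -/
def tildeGm : TopCat.Sheaf AddCommGrpCat.{u} (Limits.pullback f g : Scheme.{u}) :=
  unitsKerSheaf (redι (Limits.pullback f g)) (baseChangeRed f g)

end Tilde

/-! ### Derived functors of sections and of direct images -/

instance pushforward_additive {Y Z : TopCat.{u}} (f : Y ⟶ Z) :
    (TopCat.Sheaf.pushforward AddCommGrpCat.{u} f).Additive where
  map_add := rfl

/-- The functor `Γ(Y, -)` on abelian sheaves. -/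
def globalSections (Y : TopCat.{u}) : TopCat.Sheaf AddCommGrpCat.{u} Y ⥤ AddCommGrpCat.{u} :=
  TopCat.Sheaf.forget AddCommGrpCat.{u} Y ⋙ (evaluation _ _).obj (op ⊤)

instance globalSections_additive (Y : TopCat.{u}) : (globalSections Y).Additive where
  map_add := rfl

instance globalSections_preservesFiniteLimits (Y : TopCat.{u}) :
    Limits.PreservesFiniteLimits (globalSections Y) := by
  have : Limits.PreservesFiniteLimits (TopCat.Sheaf.forget AddCommGrpCat.{u} Y) :=
    inferInstanceAs (Limits.PreservesFiniteLimits (sheafToPresheaf _ _))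
  have : Limits.PreservesFiniteLimits
      ((evaluation (Opens Y)ᵒᵖ AddCommGrpCat.{u}).obj (op ⊤)) :=
    ⟨fun J _ _ => inferInstance⟩
  exact Limits.comp_preservesFiniteLimits _ _

/-- The cohomology `H^q(Y, -)` of abelian sheaves. -/
abbrev cohomology (Y : TopCat.{u}) (q : ℕ) :
    TopCat.Sheaf AddCommGrpCat.{u} Y ⥤ AddCommGrpCat.{u} :=
  (globalSections Y).rightDerived q

/-- The higher direct image `R^q f_*` of abelian sheaves. -/
abbrev higherDirectImage {Y Z : TopCat.{u}} (f : Y ⟶ Z) (q : ℕ) :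
    TopCat.Sheaf AddCommGrpCat.{u} Y ⥤ TopCat.Sheaf AddCommGrpCat.{u} Z :=
  (TopCat.Sheaf.pushforward AddCommGrpCat.{u} f).rightDerived q

/-- The group `Φ^q(X/S, 𝔾̂_m)(g : T ⟶ S) = Γ(T, R^q f_{T*} Ẽ_T)`. -/
def deformationCohomology {X S T : Scheme.{u}} (f : X ⟶ S) (q : ℕ) (g : T ⟶ S) :
    AddCommGrpCat.{u} :=
  (globalSections T).obj
    ((higherDirectImage (Limits.pullback.snd f g).base q).obj (tildeGm f g))

section Edge

variable {A B : Type*} [Category A] [Category B] [Abelian A] [Abelian B]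
  (G : A ⥤ B) [G.Additive] [Limits.PreservesFiniteLimits G]

/-- The canonical map from the cycles of `G(C)` to `G` of the cycles of `C`, for a left exact
functor `G`. -/
def cyclesComparison (C : ShortComplex A) : (C.map G).cycles ⟶ G.obj C.cycles :=
  (Limits.isLimitForkMapOfIsLimit' G C.iCycles_g C.cyclesIsKernel).lift
    (Limits.KernelFork.ofι (C.map G).iCycles (C.map G).iCycles_g)

lemma cyclesComparison_comp (C : ShortComplex A) :
    cyclesComparison G C ≫ G.map C.iCycles = (C.map G).iCycles :=
  (Limits.isLimitForkMapOfIsLimit' G C.iCycles_g C.cyclesIsKernel).fac _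
    Limits.WalkingParallelPair.zero

/-- The canonical map `H(G(C)) ⟶ G(H(C))` for a left exact functor `G`. -/
def homologyComparison (C : ShortComplex A) : (C.map G).homology ⟶ G.obj C.homology :=
  (C.map G).descHomology (cyclesComparison G C ≫ G.map C.homologyπ) (by
    have h : (C.map G).toCycles ≫ cyclesComparison G C = (G.map C.toCycles : G.obj C.X₁ ⟶ _) := by
      have h1 : (G.map C.toCycles : G.obj C.X₁ ⟶ _) ≫ G.map C.iCycles = G.map C.f := by
        rw [← G.map_comp, ShortComplex.toCycles_i]
      refine (cancel_mono (G.map C.iCycles)).1 (Eq.trans ?_ h1.symm)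
      rw [Category.assoc, cyclesComparison_comp]
      exact (C.map G).toCycles_i
    have h2 : (G.map C.toCycles : G.obj C.X₁ ⟶ _) ≫ G.map C.homologyπ = 0 := by
      rw [← G.map_comp, ShortComplex.toCycles_comp_homologyπ, G.map_zero]
    rw [← Category.assoc]
    exact (congrArg (· ≫ G.map C.homologyπ) h).trans h2)

end Edge

/-- The canonical map `H^q(Y, F) ⟶ Γ(Z, R^q f_* F)`. -/
def edgeMap {Y Z : TopCat.{u}} (f : Y ⟶ Z) (q : ℕ) (F : TopCat.Sheaf AddCommGrpCat.{u} Y) :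
    (cohomology Y q).obj F ⟶ (globalSections Z).obj ((higherDirectImage f q).obj F) :=
  ((injectiveResolution F).isoRightDerivedObj (globalSections Y) q).hom ≫
    homologyComparison (globalSections Z)
      ((((TopCat.Sheaf.pushforward AddCommGrpCat.{u} f).mapHomologicalComplex _).obj
        (injectiveResolution F).cocomplex).sc q) ≫
    (globalSections Z).map ((injectiveResolution F).isoRightDerivedObj
      (TopCat.Sheaf.pushforward AddCommGrpCat.{u} f) q).inv

section Homeo

variable {A A' B B' : Type*} [Category A] [Category A'] [Category B] [Category B']
  [Abelian A] [Abelian A'] [Abelian B] [Abelian B']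

/-- The image of an injective resolution under an equivalence. -/
def mapResolution (P : A' ⥤ A) [P.Additive] [P.IsEquivalence] {F : A'}
    (I : InjectiveResolution F) : InjectiveResolution (P.obj F) where
  cocomplex := (P.mapHomologicalComplex _).obj I.cocomplex
  injective n := Injective.injective_of_adjoint P.asEquivalence.symm.toAdjunction
    (I.cocomplex.X n)
  ι := (HomologicalComplex.singleMapHomologicalComplex P (ComplexShape.up ℕ) 0).inv.app F ≫
    (P.mapHomologicalComplex _).map I.ι

/-- For equivalences `P`, `Q` and an isomorphism `P ⋙ L ≅ L' ⋙ Q`, the induced isomorphism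
`R^q L (P F) ≅ Q (R^q L' F)`. -/
def derivedBaseChange [HasInjectiveResolutions A] [HasInjectiveResolutions A']
    (P : A' ⥤ A) [P.Additive] [P.IsEquivalence] (Q : B' ⥤ B) [Q.Additive] [Q.IsEquivalence]
    (L : A ⥤ B) [L.Additive] (L' : A' ⥤ B') [L'.Additive] (α : P ⋙ L ≅ L' ⋙ Q) (q : ℕ) (F : A') :
    (L.rightDerived q).obj (P.obj F) ≅ Q.obj ((L'.rightDerived q).obj F) :=
  (mapResolution P (injectiveResolution F)).isoRightDerivedObj L q ≪≫
    (HomologicalComplex.homologyFunctor B (ComplexShape.up ℕ) q).mapIso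
      ((NatIso.mapHomologicalComplex α (ComplexShape.up ℕ)).app
        (injectiveResolution F).cocomplex) ≪≫
    (((L'.mapHomologicalComplex _).obj (injectiveResolution F).cocomplex).sc q).mapHomologyIso Q ≪≫
    Q.mapIso ((injectiveResolution F).isoRightDerivedObj L' q).symm

instance pushforward_isEquivalence {Y Z : TopCat.{u}} (p : Y ⟶ Z) [IsIso p] :
    (TopCat.Sheaf.pushforward AddCommGrpCat.{u} p).IsEquivalence := by
  have h1 : TopCat.Sheaf.pushforward AddCommGrpCat.{u} p ⋙
      TopCat.Sheaf.pushforward AddCommGrpCat.{u} (inv p) = 𝟭 _ := by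
    change TopCat.Sheaf.pushforward AddCommGrpCat.{u} (p ≫ inv p) = 𝟭 _
    rw [IsIso.hom_inv_id]
    rfl
  have h2 : TopCat.Sheaf.pushforward AddCommGrpCat.{u} (inv p) ⋙
      TopCat.Sheaf.pushforward AddCommGrpCat.{u} p = 𝟭 _ := by
    change TopCat.Sheaf.pushforward AddCommGrpCat.{u} (inv p ≫ p) = 𝟭 _
    rw [IsIso.inv_hom_id]
    rfl
  exact (CategoryTheory.Equivalence.mk (TopCat.Sheaf.pushforward AddCommGrpCat.{u} p)
    (TopCat.Sheaf.pushforward AddCommGrpCat.{u} (inv p))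
    (eqToIso h1.symm) (eqToIso h2)).isEquivalence_functor

/-- For a commutative square `p ≫ f = f' ≫ t` of topological spaces with homeomorphisms `p`, `t`,
the canonical isomorphism `R^q f_* (p_* F) ≅ t_* (R^q f'_* F)`. -/
def higherDirectImageIso {Y Y' Z Z' : TopCat.{u}} {f : Y ⟶ Z} {f' : Y' ⟶ Z'} {p : Y' ⟶ Y}
    {t : Z' ⟶ Z} [IsIso p] [IsIso t] (w : p ≫ f = f' ≫ t) (q : ℕ)
    (F : TopCat.Sheaf AddCommGrpCat.{u} Y') :
    (higherDirectImage f q).obj ((TopCat.Sheaf.pushforward AddCommGrpCat.{u} p).obj F) ≅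
      (TopCat.Sheaf.pushforward AddCommGrpCat.{u} t).obj ((higherDirectImage f' q).obj F) :=
  derivedBaseChange _ _ _ _ (eqToIso (by
    change TopCat.Sheaf.pushforward AddCommGrpCat.{u} (p ≫ f) =
      TopCat.Sheaf.pushforward AddCommGrpCat.{u} (f' ≫ t)
    rw [w])) q F

end Homeo

/-! ### The functor `Φ^q(X/S, 𝔾̂_m)` on nilpotent algebras -/

/-- The structure morphism `Spec (R ⊕ N) ⟶ Spec R`. -/
abbrev NilAlg.toSpec (N : NilAlg R) : Spec (.of N.Aug) ⟶ Spec (.of R) :=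
  Spec.map (CommRingCat.ofHom (algebraMap R N.Aug))

/-- The morphism `Spec (R ⊕ N') ⟶ Spec (R ⊕ N)` induced by `N → N'`. -/
abbrev NilAlg.specMap {N N' : NilAlg R} (φ : N ⟶ N') : Spec (.of N'.Aug) ⟶ Spec (.of N.Aug) :=
  Spec.map (CommRingCat.ofHom (NilAlg.augMap φ : N.Aug →+* N'.Aug))

lemma NilAlg.specMap_toSpec {N N' : NilAlg R} (φ : N ⟶ N') :
    NilAlg.specMap φ ≫ N.toSpec = N'.toSpec := by
  rw [← Spec.map_comp, ← CommRingCat.ofHom_comp]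
  congr 2
  exact (NilAlg.augMap φ).comp_algebraMap

lemma NilAlg.specMap_id (N : NilAlg R) : NilAlg.specMap (𝟙 N) = 𝟙 _ := by
  rw [← Spec.map_id, NilAlg.specMap, NilAlg.augMap_id]
  rfl

lemma NilAlg.specMap_comp {N N' N'' : NilAlg R} (φ : N ⟶ N') (ψ : N' ⟶ N'') :
    NilAlg.specMap (φ ≫ ψ) = NilAlg.specMap ψ ≫ NilAlg.specMap φ := by
  rw [← Spec.map_comp, ← CommRingCat.ofHom_comp, NilAlg.specMap, NilAlg.augMap_comp]
  rfl

/-- The section `Spec R ⟶ Spec (R ⊕ N)`. -/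
abbrev NilAlg.zeroSection (N : NilAlg R) : Spec (.of R) ⟶ Spec (.of N.Aug) :=
  Spec.map (CommRingCat.ofHom (Unitization.fstHom R N.carrier : N.Aug →+* R))

lemma NilAlg.zeroSection_toSpec (N : NilAlg R) : N.zeroSection ≫ N.toSpec = 𝟙 _ := by
  rw [← Spec.map_comp, ← CommRingCat.ofHom_comp, ← Spec.map_id]
  congr 2

instance NilAlg.zeroSection_surjective (N : NilAlg R) : Surjective N.zeroSection := by
  refine ⟨(PrimeSpectrum.isHomeomorph_comap (Unitization.fstHom R N.carrier : N.Aug →+* R)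
    (fun r => ⟨1, one_pos, Unitization.inl r, by simp⟩) ?_).bijective.2⟩
  intro a ha
  exact N.isNilpotent_of_fst a ha

lemma isIso_base_of_section {Y Y' : Scheme.{u}} (p : Y' ⟶ Y) (s : Y ⟶ Y') (h : s ≫ p = 𝟙 Y)
    [Surjective s] : IsIso p.base := by
  refine ⟨s.base, ?_, ?_⟩
  · ext y
    obtain ⟨x, rfl⟩ := s.surjective y
    have h1 : p (s x) = x := congrArg (fun k : Y ⟶ Y => k x) h
    exact congrArg s h1
  · exact congrArg (fun k : Y ⟶ Y => k.base) h

instance NilAlg.isIso_toSpec_base (N : NilAlg R) : IsIso N.toSpec.base :=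
  isIso_base_of_section _ _ N.zeroSection_toSpec

section Phi

variable {X : Scheme.{u}} (f : X ⟶ Spec (.of R))

/-- The scheme `X_N = X ×_S Spec (R ⊕ N)`, for `S = Spec R`. -/
abbrev thickening (N : NilAlg R) : Scheme.{u} := Limits.pullback f N.toSpec

/-- The projection `X_N ⟶ X`. -/
abbrev thickeningFst (N : NilAlg R) : thickening f N ⟶ X := Limits.pullback.fst f N.toSpec

/-- The projection `X_N ⟶ Spec (R ⊕ N)`. -/
abbrev thickeningSnd (N : NilAlg R) : thickening f N ⟶ Spec (.of N.Aug) :=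
  Limits.pullback.snd f N.toSpec

/-- The morphism `X_N' ⟶ X_N` induced by `N → N'`. -/
def thickeningMap {N N' : NilAlg R} (φ : N ⟶ N') : thickening f N' ⟶ thickening f N :=
  Limits.pullback.lift (thickeningFst f N') (thickeningSnd f N' ≫ NilAlg.specMap φ) (by
    rw [Category.assoc, NilAlg.specMap_toSpec, Limits.pullback.condition])

lemma thickeningMap_fst {N N' : NilAlg R} (φ : N ⟶ N') :
    thickeningMap f φ ≫ thickeningFst f N = thickeningFst f N' :=
  Limits.pullback.lift_fst _ _ _

lemma thickeningMap_snd {N N' : NilAlg R} (φ : N ⟶ N') :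
    thickeningMap f φ ≫ thickeningSnd f N = thickeningSnd f N' ≫ NilAlg.specMap φ :=
  Limits.pullback.lift_snd _ _ _

lemma thickeningMap_id (N : NilAlg R) : thickeningMap f (𝟙 N) = 𝟙 _ := by
  refine Limits.pullback.hom_ext ?_ ?_
  · rw [thickeningMap_fst, Category.id_comp]
  · rw [thickeningMap_snd, Category.id_comp, NilAlg.specMap_id, Category.comp_id]

lemma thickeningMap_comp {N N' N'' : NilAlg R} (φ : N ⟶ N') (ψ : N' ⟶ N'') :
    thickeningMap f (φ ≫ ψ) = thickeningMap f ψ ≫ thickeningMap f φ := by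
  refine Limits.pullback.hom_ext ?_ ?_
  · rw [thickeningMap_fst, Category.assoc, thickeningMap_fst, thickeningMap_fst]
  · rw [thickeningMap_snd, Category.assoc, thickeningMap_snd, ← Category.assoc, thickeningMap_snd,
      Category.assoc, NilAlg.specMap_comp]

/-- The section `X ⟶ X_N`. -/
def thickeningSection (N : NilAlg R) : X ⟶ thickening f N :=
  Limits.pullback.lift (𝟙 X) (f ≫ N.zeroSection) (by
    rw [Category.assoc, N.zeroSection_toSpec, Category.id_comp, Category.comp_id])

lemma thickeningSection_fst (N : NilAlg R) :
    thickeningSection f N ≫ thickeningFst f N = 𝟙 X :=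
  Limits.pullback.lift_fst _ _ _

instance thickeningSection_surjective (N : NilAlg R) : Surjective (thickeningSection f N) := by
  have h1 : thickeningSection f N ≫ thickeningSnd f N = f ≫ N.zeroSection :=
    Limits.pullback.lift_snd _ _ _
  have h : IsPullback (thickeningSection f N) f (thickeningSnd f N) N.zeroSection := by
    refine IsPullback.of_right (h₁₂ := thickeningFst f N) (h₂₂ := N.toSpec) (v₁₃ := f) ?_ h1
      (IsPullback.of_hasPullback _ _)
    rw [thickeningSection_fst, N.zeroSection_toSpec]
    exact IsPullback.of_horiz_isIso ⟨by rw [Category.id_comp, Category.comp_id]⟩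
  exact MorphismProperty.of_isPullback (P := @Surjective) h.flip inferInstance

instance isIso_thickeningFst_base (N : NilAlg R) : IsIso (thickeningFst f N).base :=
  isIso_base_of_section _ _ (thickeningSection_fst f N)

/-- The sheaf `Ẽ_T` for `T = Spec (R ⊕ N)`, transported to `X` along the homeomorphism
`X_N ⟶ X`. -/
def pushTildeObj (N : NilAlg R) : TopCat.Sheaf AddCommGrpCat.{u} X :=
  (TopCat.Sheaf.pushforward AddCommGrpCat.{u} (thickeningFst f N).base).obj (tildeGm f N.toSpec)

lemma exists_baseChangeRed {N N' : NilAlg R} (φ : N ⟶ N') :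
    ∃ k, k ≫ baseChangeRed f N.toSpec = baseChangeRed f N'.toSpec ≫ thickeningMap f φ := by
  obtain ⟨r, hr⟩ := exists_red_comp (NilAlg.specMap φ)
  refine ⟨Limits.pullback.lift (baseChangeRed f N'.toSpec ≫ thickeningMap f φ)
    (Limits.pullback.snd _ _ ≫ r) ?_, Limits.pullback.lift_fst _ _ _⟩
  rw [Category.assoc, thickeningMap_snd, Category.assoc, hr, ← Category.assoc,
    Limits.pullback.condition, Category.assoc]

lemma le_thickeningMap {N N' : NilAlg R} (φ : N ⟶ N') (U : X.Opens) :
    thickeningFst f N' ⁻¹ᵁ U ≤ thickeningMap f φ ⁻¹ᵁ (thickeningFst f N ⁻¹ᵁ U) := by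
  rw [← Scheme.Hom.comp_preimage, thickeningMap_fst]

/-- The restriction of sections of `Ẽ` along `X_N' ⟶ X_N`. -/
def pushTildeApp {N N' : NilAlg R} (φ : N ⟶ N') (U : X.Opens) :
    ↥(unitsKer (redι (thickening f N)) (thickeningFst f N ⁻¹ᵁ U) ⊓
      unitsKer (baseChangeRed f N.toSpec) (thickeningFst f N ⁻¹ᵁ U)) →*
    ↥(unitsKer (redι (thickening f N')) (thickeningFst f N' ⁻¹ᵁ U) ⊓
      unitsKer (baseChangeRed f N'.toSpec) (thickeningFst f N' ⁻¹ᵁ U)) :=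
  ((Units.map ((thickeningMap f φ).appLE _ _ (le_thickeningMap f φ U)).hom.toMonoidHom).comp
    (Subgroup.subtype _)).codRestrict _ (fun a => by
      obtain ⟨k, hk⟩ := exists_red_comp (thickeningMap f φ)
      obtain ⟨l, hl⟩ := exists_baseChangeRed f φ
      exact ⟨unitsKer_appLE hk _ a.2.1, unitsKer_appLE hl _ a.2.2⟩)

/-- The functor `N ↦ Ẽ_T`, `T = Spec (R ⊕ N)`, with values in sheaves on `X`. -/
def pushTilde : NilAlg R ⥤ TopCat.Sheaf AddCommGrpCat.{u} X where
  obj N := pushTildeObj f N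
  map {N N'} φ := ⟨{
    app := fun U => AddCommGrpCat.ofHom (pushTildeApp f φ U.unop).toAdditive
    naturality := fun U V i => by
      refine AddCommGrpCat.ext fun a => Additive.toMul.injective (Subtype.ext (Units.ext ?_))
      have h : (thickening f N).presheaf.map
            ((Opens.map (thickeningFst f N).base).map i.unop).op ≫
          (thickeningMap f φ).appLE _ _ (le_thickeningMap f φ V.unop) =
          (thickeningMap f φ).appLE _ _ (le_thickeningMap f φ U.unop) ≫
            (thickening f N').presheaf.map
              ((Opens.map (thickeningFst f N').base).map i.unop).op := by
        rw [Scheme.Hom.map_appLE, Scheme.Hom.appLE_map]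
      exact ConcreteCategory.congr_hom h _ }⟩
  map_id N := by
    refine ObjectProperty.hom_ext _ (NatTrans.ext (funext fun U => AddCommGrpCat.ext fun a =>
      Additive.toMul.injective (Subtype.ext (Units.ext ?_))))
    have h : ∀ (k : thickening f N ⟶ thickening f N) (hk : k = 𝟙 _) (V : (thickening f N).Opens)
        (e : V ≤ k ⁻¹ᵁ V), k.appLE V V e = 𝟙 _ := by
      rintro _ rfl V e
      exact Scheme.Hom.appLE_eq_app _
    exact ConcreteCategory.congr_hom
      (h _ (thickeningMap_id f N) _ (le_thickeningMap f (𝟙 N) U.unop)) _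
  map_comp {N N' N''} φ ψ := by
    refine ObjectProperty.hom_ext _ (NatTrans.ext (funext fun U => AddCommGrpCat.ext fun a =>
      Additive.toMul.injective (Subtype.ext (Units.ext ?_))))
    have h : ∀ (k : thickening f N'' ⟶ thickening f N)
        (hk : k = thickeningMap f ψ ≫ thickeningMap f φ)
        (e : thickeningFst f N'' ⁻¹ᵁ U.unop ≤ k ⁻¹ᵁ (thickeningFst f N ⁻¹ᵁ U.unop)),
        k.appLE _ _ e = (thickeningMap f φ).appLE _ _ (le_thickeningMap f φ U.unop) ≫
          (thickeningMap f ψ).appLE _ _ (le_thickeningMap f ψ U.unop) := by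
      rintro _ rfl e
      rw [Scheme.Hom.appLE_comp_appLE]
    exact ConcreteCategory.congr_hom (h _ (thickeningMap_comp f φ ψ) (le_thickeningMap f _ _)) _

/-- The canonical isomorphism between `Γ(S, R^q f_* (pr_* Ẽ_T))` and
`Φ^q(T) = Γ(T, R^q f_{T*} Ẽ_T)` for `T = Spec (R ⊕ N)` and the homeomorphism `pr : X_T ⟶ X`. -/
def phiIso (q : ℕ) (N : NilAlg R) :
    (pushTilde f ⋙ higherDirectImage f.base q ⋙ globalSections (Spec (.of R))).obj N ≅
      deformationCohomology f q N.toSpec :=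
  (globalSections (Spec (.of R))).mapIso (higherDirectImageIso
    (f := f.base) (f' := (thickeningSnd f N).base) (p := (thickeningFst f N).base)
    (t := N.toSpec.base)
    (congrArg (fun k : thickening f N ⟶ Spec (.of R) => k.base) Limits.pullback.condition)
    q (tildeGm f N.toSpec))

/-- The functor `N ↦ Φ^q(X/S, 𝔾̂_m)(Spec (R ⊕ N))`. -/
def phi (q : ℕ) : NilAlg R ⥤ AddCommGrpCat.{u} :=
  (pushTilde f ⋙ higherDirectImage f.base q ⋙ globalSections (Spec (.of R))).copyObj
    (fun N => deformationCohomology f q N.toSpec) (phiIso f q)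

/-- The functor `N ↦ ker(Φ^q(Spec (R ⊕ N)) → Φ^q(Spec R))` attached to `Φ^q(X/S, 𝔾̂_m)`. -/
def phiNil (q : ℕ) : NilAlg R ⥤ AddCommGrpCat.{u} := reducedPart (phi f q)

end Phi

/-! ### Truncation of Witt vectors -/

/-- For a homomorphism `φ : A → B` and `ξ : B` with `ξ ^ m = 0`, the homomorphism `A[[x]] → B`,
`∑ aᵢ xⁱ ↦ ∑ φ(aᵢ) ξⁱ`. -/
def nilEval {A B : Type u} [CommRing A] [CommRing B] (φ : A →+* B) (ξ : B) (m : ℕ)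
    (hξ : ξ ^ m = 0) : PowerSeries A →+* B where
  toFun p := (PowerSeries.trunc (m + 1) p).eval₂ φ ξ
  map_zero' := by simp
  map_add' p q := by rw [map_add, Polynomial.eval₂_add]
  map_one' := by rw [PowerSeries.trunc_one, Polynomial.eval₂_one]
  map_mul' p q := by
    have h : ∀ P : Polynomial A, (PowerSeries.trunc (m + 1) (P : PowerSeries A)).eval₂ φ ξ =
        P.eval₂ φ ξ := by
      intro P
      rw [PowerSeries.eval₂_trunc_eq_sum_range,
        Polynomial.eval₂_eq_sum_range' φ (n := P.natDegree + 1 + (m + 1)) (by omega)]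
      simp only [Polynomial.coeff_coe]
      refine Finset.sum_subset (Finset.range_mono (by omega)) fun i _ hi => ?_
      rw [Finset.mem_range, not_lt] at hi
      rw [pow_eq_zero_of_le (by omega : m ≤ i) hξ, mul_zero]
    rw [← PowerSeries.trunc_trunc_mul_trunc, ← Polynomial.coe_mul, h, Polynomial.eval₂_mul]

lemma nilEval_apply {A B : Type u} [CommRing A] [CommRing B] (φ : A →+* B) (ξ : B) (m : ℕ)
    (hξ : ξ ^ m = 0) (p : PowerSeries A) :
    nilEval φ ξ m hξ p = ∑ i ∈ Finset.range (m + 1), φ (PowerSeries.coeff i p) * ξ ^ i :=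
  PowerSeries.eval₂_trunc_eq_sum_range _ _ _ _

/-- The homomorphism `A → Γ(Y, U)` for a scheme `Y` over `Spec A`. -/
def structMap {A : Type u} [CommRing A] {Y : Scheme.{u}} (f : Y ⟶ Spec (.of A)) (U : Y.Opens) :
    A →+* Γ(Y, U) :=
  (f.appLE ⊤ U le_top).hom.comp (Scheme.ΓSpecIso (.of A)).inv.hom

lemma map_structMap {A : Type u} [CommRing A] {Y : Scheme.{u}} (f : Y ⟶ Spec (.of A))
    {U V : Y.Opens} (i : V ⟶ U) (a : A) :
    Y.presheaf.map i.op (structMap f U a) = structMap f V a :=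
  ConcreteCategory.congr_hom (f.appLE_map (U := ⊤) (V := U) le_top i.op) _

lemma truncAlg.inr_x_pow (n : ℕ) : ((truncAlg.x R n : (truncAlg R n).Aug)) ^ (n + 1) = 0 := by
  have h : ∀ k : ℕ, ∃ y : (truncAlg R n).carrier,
      ((truncAlg.x R n : (truncAlg R n).Aug)) ^ (k + 1) = (y : (truncAlg R n).Aug) ∧
        (show Ideal.span {TruncPoly.x R n} from y : TruncPoly R n) =
          TruncPoly.x R n ^ (k + 1) := by
    intro k
    induction k with
    | zero => exact ⟨truncAlg.x R n, by simp, by rw [zero_add, pow_one]; rfl⟩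
    | succ k ih =>
      obtain ⟨y, hy, hy'⟩ := ih
      refine ⟨y * truncAlg.x R n, ?_, ?_⟩
      · rw [pow_succ, hy, Unitization.inr_mul]
      · rw [pow_succ, ← hy']
        rfl
  obtain ⟨y, hy, hy'⟩ := h n
  have h0 : y = 0 := by
    refine Subtype.ext (hy'.trans ?_)
    rw [pow_succ, TruncPoly.x_pow, zero_mul]
    rfl
  rw [hy, h0, Unitization.inr_zero]

section WittToTilde

variable {X : Scheme.{u}} (f : X ⟶ Spec (.of R))

/-- The element `x` of `Γ(X_N, U)` for `N = x R[x] / x ^ n R[x]`. -/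
def xi (n : ℕ) (U : X.Opens) :
    Γ(thickening f (truncAlg R n), thickeningFst f (truncAlg R n) ⁻¹ᵁ U) :=
  structMap (thickeningSnd f (truncAlg R n)) _ (truncAlg.x R n : (truncAlg R n).Aug)

lemma xi_pow (n : ℕ) (U : X.Opens) : xi f n U ^ (n + 1) = 0 := by
  rw [xi, ← map_pow, truncAlg.inr_x_pow, map_zero]

/-- The homomorphism `Γ(X, U)[[x]] → Γ(X_N, U)`, `∑ aᵢ xⁱ ↦ ∑ aᵢ xⁱ`, for
`N = x R[x] / x ^ n R[x]`. -/
def truncEval (n : ℕ) (U : X.Opens) : PowerSeries Γ(X, U) →+*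
    Γ(thickening f (truncAlg R n), thickeningFst f (truncAlg R n) ⁻¹ᵁ U) :=
  nilEval ((thickeningFst f (truncAlg R n)).app U).hom (xi f n U) (n + 1) (xi_pow f n U)

lemma map_truncEval {n : ℕ} {U : X.Opens} {B : Type u} [CommRing B]
    (ψ : Γ(thickening f (truncAlg R n), thickeningFst f (truncAlg R n) ⁻¹ᵁ U) →+* B)
    (hψ : ψ (xi f n U) = 0) (p : PowerSeries Γ(X, U)) (hp : PowerSeries.constantCoeff p = 1) :
    ψ (truncEval f n U p) = 1 := by
  rw [truncEval, nilEval_apply, map_sum, Finset.sum_eq_single 0]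
  · rw [PowerSeries.coeff_zero_eq_constantCoeff_apply, hp]
    simp
  · intro i _ hi
    rw [map_mul, map_pow, hψ, zero_pow hi, mul_zero]
  · simp

lemma red_xi (n : ℕ) (U : X.Opens) :
    ((redι (thickening f (truncAlg R n))).app (thickeningFst f (truncAlg R n) ⁻¹ᵁ U)).hom
      (xi f n U) = 0 :=
  IsNilpotent.eq_zero (IsNilpotent.map ⟨_, xi_pow f n U⟩ _)

lemma app_appLE_eq_zero {P Y T T' : Scheme.{u}} {b : P ⟶ Y} {g : Y ⟶ T} {s : P ⟶ T'}
    {r : T' ⟶ T} (w : b ≫ g = s ≫ r) {W : T.Opens} (V : Y.Opens) (e : V ≤ g ⁻¹ᵁ W) {c : Γ(T, W)}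
    (hc : r.app W c = 0) : b.app V (g.appLE W V e c) = 0 := by
  have h : ∀ (k : P ⟶ T) (_ : k = s ≫ r) (V' : P.Opens) (e' : V' ≤ k ⁻¹ᵁ W),
      k.appLE W V' e' c = 0 := by
    rintro _ rfl V' e'
    rw [Scheme.Hom.comp_appLE]
    exact (congrArg (s.appLE (r ⁻¹ᵁ W) V' e') hc).trans (map_zero _)
  rw [Scheme.Hom.app_eq_appLE, ← ConcreteCategory.comp_apply, Scheme.Hom.appLE_comp_appLE]
  exact h _ w _ _

lemma baseChangeRed_xi (n : ℕ) (U : X.Opens) :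
    ((baseChangeRed f (truncAlg R n).toSpec).app (thickeningFst f (truncAlg R n) ⁻¹ᵁ U)).hom
      (xi f n U) = 0 := by
  set T := Spec (.of (truncAlg R n).Aug)
  set c : Γ(T, ⊤) := (Scheme.ΓSpecIso (.of (truncAlg R n).Aug)).inv.hom
    (truncAlg.x R n : (truncAlg R n).Aug) with hc
  have hc0 : (redι T).app ⊤ c = 0 := by
    refine IsNilpotent.eq_zero (IsNilpotent.map ⟨n + 1, ?_⟩ ((redι T).app ⊤).hom)
    rw [hc, ← map_pow, truncAlg.inr_x_pow, map_zero]
  exact app_appLE_eq_zero Limits.pullback.condition _ _ hc0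

/-- The homomorphism `1 + x Γ(X, U)[[x]] → Ẽ_T(U)` for `T = Spec (R[x] / x ^ n)`. -/
def wittToTildeApp (n : ℕ) (U : X.Opens) : wittSubgroup Γ(X, U) →*
    ↥(unitsKer (redι (thickening f (truncAlg R n))) (thickeningFst f (truncAlg R n) ⁻¹ᵁ U) ⊓
      unitsKer (baseChangeRed f (truncAlg R n).toSpec) (thickeningFst f (truncAlg R n) ⁻¹ᵁ U)) :=
  ((Units.map (truncEval f n U).toMonoidHom).comp (Subgroup.subtype _)).codRestrict _ (fun p =>
    ⟨mem_unitsKer.2 (map_truncEval f _ (red_xi f n U) _ (mem_wittSubgroup.1 p.2)),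
      mem_unitsKer.2 (map_truncEval f _ (baseChangeRed_xi f n U) _ (mem_wittSubgroup.1 p.2))⟩)

lemma truncEval_map (n : ℕ) {U V : X.Opens} (i : V ⟶ U) (p : PowerSeries Γ(X, U)) :
    truncEval f n V (PowerSeries.map (X.presheaf.map i.op).hom p) =
      (thickening f (truncAlg R n)).presheaf.map
        ((Opens.map (thickeningFst f (truncAlg R n)).base).map i).op (truncEval f n U p) := by
  have h : ∀ a : Γ(X, U), (thickeningFst f (truncAlg R n)).app V (X.presheaf.map i.op a) =
      (thickening f (truncAlg R n)).presheaf.map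
        ((Opens.map (thickeningFst f (truncAlg R n)).base).map i).op
          ((thickeningFst f (truncAlg R n)).app U a) :=
    fun a => ConcreteCategory.congr_hom ((thickeningFst f (truncAlg R n)).naturality i.op) a
  have hx : xi f n V = (thickening f (truncAlg R n)).presheaf.map
      ((Opens.map (thickeningFst f (truncAlg R n)).base).map i).op (xi f n U) :=
    (map_structMap _ _ _).symm
  rw [truncEval, truncEval, nilEval_apply, nilEval_apply, map_sum]
  refine Finset.sum_congr rfl fun k _ => ?_
  rw [PowerSeries.coeff_map, hx, ← map_pow]
  refine (congrArg (· * _) (h _)).trans ?_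
  exact (map_mul ((thickening f (truncAlg R n)).presheaf.map
      ((Opens.map (thickeningFst f (truncAlg R n)).base).map i).op).hom _ _).symm

/-- The homomorphism of sheaves `𝕎𝒪_X ⟶ Ẽ_T` for `T = Spec (R[x] / x ^ n)`, which sends the power
series `1 + a₁ x + a₂ x² + ⋯` to its class modulo `x ^ n`. -/
def wittToTilde (n : ℕ) : wittSheaf X ⟶ (pushTilde f).obj (truncAlg R n) :=
  ⟨{ app := fun U => AddCommGrpCat.ofHom (wittToTildeApp f n U.unop).toAdditive
     naturality := fun U V i => by
       refine AddCommGrpCat.ext fun p => Additive.toMul.injective (Subtype.ext (Units.ext ?_))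
       exact truncEval_map f n i.unop _ }⟩

end WittToTilde

/-! ### Local freeness of `R^q f_* 𝒪_X` -/

/-- The structure sheaf `𝒪_X` as a presheaf of abelian groups. -/
def structPresheaf (X : Scheme.{u}) : TopCat.Presheaf AddCommGrpCat.{u} X where
  obj U := AddCommGrpCat.of Γ(X, U.unop)
  map i := AddCommGrpCat.ofHom (X.presheaf.map i).hom.toAddMonoidHom
  map_id U := AddCommGrpCat.ext fun a => ConcreteCategory.congr_hom (X.presheaf.map_id U) a
  map_comp i j := AddCommGrpCat.ext fun a =>
    ConcreteCategory.congr_hom (X.presheaf.map_comp i j) a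

/-- The structure sheaf `𝒪_X` as a sheaf of abelian groups. -/
def structSheaf (X : Scheme.{u}) : TopCat.Sheaf AddCommGrpCat.{u} X :=
  ⟨structPresheaf X, isSheaf_of_coordinates (κ := Unit) _ (fun _ _ s => s) (fun _ _ _ => rfl)
    (fun _ _ _ h => h ()) (fun _ a _ => ⟨a (), fun _ => rfl⟩)⟩

section LocallyFree

variable {X : Scheme.{u}} (f : X ⟶ Spec (.of R))

/-- Multiplication by `r ∈ R` on `𝒪_X`. -/
def mulStruct (r : R) : structSheaf X ⟶ structSheaf X :=
  ⟨{ app := fun U => AddCommGrpCat.ofHom (AddMonoidHom.mulLeft (structMap f U.unop r))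
     naturality := fun U V i => AddCommGrpCat.ext fun a => by
       refine Eq.trans ?_ (map_mul (X.presheaf.map i).hom (structMap f U.unop r) a).symm
       exact congrArg (· * X.presheaf.map i a) (map_structMap f i.unop r).symm }⟩

/-- The sheaf `R^q f_* 𝒪_X` on `S = Spec R`. -/
abbrev directImageStruct (q : ℕ) : TopCat.Sheaf AddCommGrpCat.{u} (Spec (.of R)) :=
  (higherDirectImage f.base q).obj (structSheaf X)

/-- The `𝒪_S`-module `R^q f_* 𝒪_X` on `S = Spec R` is locally free of finite rank: every point of
`S` has an open neighbourhood `U` over which it is isomorphic to `𝒪_S ^ n` for some `n`. The action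
of `R` on `R^q f_* 𝒪_X` is induced by functoriality from its action on `𝒪_X`; a homomorphism between
`𝒪_S`-modules on the affine scheme `S` is `𝒪_S`-linear as soon as it is `R`-linear. -/
def IsLocallyFreeOfFiniteRank (q : ℕ) : Prop :=
  ∀ s : Spec (.of R), ∃ U : (Spec (.of R)).Opens, s ∈ U ∧ ∃ (n : ℕ)
    (e : ∀ V : (Spec (.of R)).Opens, V ≤ U →
      ((directImageStruct f q).obj.obj (op V) ≃+ (Fin n → Γ(Spec (.of R), V)))),
    (∀ (V W : (Spec (.of R)).Opens) (hV : V ≤ U) (hW : W ≤ V)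
      (m : (directImageStruct f q).obj.obj (op V)) (k : Fin n),
      e W (hW.trans hV) ((directImageStruct f q).obj.map (homOfLE hW).op m) k =
        (Spec (.of R)).presheaf.map (homOfLE hW).op (e V hV m k)) ∧
    ∀ (V : (Spec (.of R)).Opens) (hV : V ≤ U) (r : R)
      (m : (directImageStruct f q).obj.obj (op V)) (k : Fin n),
      e V hV (((higherDirectImage f.base q).map (mulStruct f r)).hom.app (op V) m) k =
        structMap (𝟙 (Spec (.of R))) V r * e V hV m k

end LocallyFree

/-! ### Cartier modules and Witt vector cohomology -/

section Cartier

variable {X : Scheme.{u}} (f : X ⟶ Spec (.of R))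

/-- The functor `N ↦ ker(Ẽ_T(U) → Ẽ_S(U))`, `T = Spec (R ⊕ N)`, for an open `U ⊆ X`. -/
def tildeNil (U : X.Opens) : NilAlg R ⥤ AddCommGrpCat.{u} :=
  reducedPart (pushTilde f ⋙ TopCat.Sheaf.forget AddCommGrpCat.{u} X ⋙
    (evaluation _ _).obj (op U))

/-- The big Witt vector `ω` over `U` is the value of `φ : Λ ⟶ ker(Ẽ_T(U) → Ẽ_S(U))` at `1 - x t`,
under the identification of the group of curves of the target with `1 + x Γ(X, U)[[x]]`. -/
def IsWittVectorOf {U : X.Opens} (φ : Lambda R ⟶ tildeNil f U)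
    (ω : (wittSheaf X).obj.obj (op U)) : Prop :=
  ∀ n : ℕ, ((evalCurve (tildeNil f U) φ).1 n).1 = (wittToTilde f n).hom.app (op U) ω

/-- `ρ` is the action of the Cartier ring on `𝕎𝒪_X`: for every open `U`, evaluation at `1 - x t`
is a bijection of `Hom(Λ, ker(Ẽ_T(U) → Ẽ_S(U)))` with `𝕎𝒪_X(U)` that respects the actions. -/
structure IsCartierAction (ρ : CartierRing R →+* End (wittSheaf X)) : Prop where
  existsUnique_witt : ∀ (U : X.Opens) (φ : Lambda R ⟶ tildeNil f U),
    ∃! ω : (wittSheaf X).obj.obj (op U), IsWittVectorOf f φ ω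
  existsUnique_hom : ∀ (U : X.Opens) (ω : (wittSheaf X).obj.obj (op U)),
    ∃! φ : Lambda R ⟶ tildeNil f U, IsWittVectorOf f φ ω
  smul : ∀ (U : X.Opens) (φ : Lambda R ⟶ tildeNil f U) (ω : (wittSheaf X).obj.obj (op U))
    (a : CartierRing R), IsWittVectorOf f φ ω →
      IsWittVectorOf f (a • φ) ((ρ a).hom.app (op U) ω)

/-- The canonical map from `H^q(X, 𝕎𝒪_X)` to `Φ^q(X/S, 𝔾̂_m)(Spec (R[x] / x ^ n))`. -/
def wittToPhi (q n : ℕ) :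
    (cohomology X q).obj (wittSheaf X) ⟶ (phi f q).obj (truncAlg R n) :=
  (cohomology X q).map (wittToTilde f n) ≫
    edgeMap f.base q ((pushTilde f).obj (truncAlg R n)) ≫ (phiIso f q (truncAlg R n)).hom

end Cartier

end CartierWitt

end

/-! Write F_n for `redTrunc f n`, the kernel of Ẽ_T ⟶ Ẽ_S for T the spectrum of R ⊕ x R[x]/x^n. For
n ≥ 1 its sections over an affine open are the power series 1 + a₁x + ⋯ modulo x^n, so 𝕎𝒪_X is the
limit of the F_n, and F_(k+2) is an extension of F_(k+1) by 𝒪_X, embedded as b ↦ 1 + b x^(k+1).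
Cohomology over an open subset W is Ext out of the free abelian sheaf on W, which supplies the
Mayer–Vietoris sequence and the long exact sequences.

Torsion. Since X is noetherian and separated over S, Mayer–Vietoris induction over affine opens
shows that H^p(W ∩ f⁻¹D(h), 𝒪_X) is the localization of H^p(W, 𝒪_X) at h. Hence V ↦ H^q(f⁻¹V, 𝒪_X)
is separated on the basic opens of S and embeds there into sections of R^q f_* 𝒪_X. That sheaf is
locally free in degree q = q₀ and R is flat over ℤ, so H^q(f⁻¹D(g), 𝒪_X) is torsion free.

The weight argument. The substitution x ↦ 2x acts on F_n, and on the copy of 𝒪_X in F_(k+2) it is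
multiplication by 2^(k+1). The product of the operators ψ - 2^i for 1 ≤ i ≤ k kills the cohomology
of F_(k+1), which has only the weights 2, …, 2^k, but it acts on the target of the connecting map
out of F_(k+1) as a nonzero integer. So connecting maps into a torsion free H^q(𝒪_X) vanish
(`cohδ_layerComplex_eq_zero`). Consequently H^q(𝒪_X) embeds into H^q(F_(k+2)), every H^q(F_(k+1)) is
torsion free, and H^(q-1)(F_(k+2)) → H^(q-1)(F_(k+1)) is surjective.

The surjectivity is used twice. It carries the gluing property from 𝒪_X to the F_n, so that H^q(X,
F_n) is the group of global sections of R^q f_* F_n for n ≥ 1, and hence the kernel of Φ^q(T) →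
Φ^q(S) (`toDirect_redTrunc_bijective`, `cohToPhi_bijective`). It also makes the lim¹ term in the
Milnor sequence 0 → 𝕎𝒪_X → ∏ F_n → ∏ F_n → 0 vanish, so that H^q(X, 𝕎𝒪_X) is the inverse limit of
the H^q(X, F_n) (`cohMap_wittToRed_injective`, `exists_cohMap_wittToRed`).

Homomorphisms out of Λ. An element p = ∏(1 - ξᵢt) of Λ(N) should send a Witt vector ω to ∏ ω(ξᵢ).
The resultant of the reversed polynomial of p and a truncation of ω makes sense of this without the
roots. It gives `lambdaHom`, and every class in H^q(X, 𝕎𝒪_X) becomes a homomorphism out of Λ with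
the prescribed curve. Conversely (`evalCurve_injective`), a homomorphism that kills 1 - xt kills all
1 - jxt. A logarithmic derivative and a Vandermonde determinant express a nonzero power of 1 -
(xt)^(i+1) through these; torsion freeness and injectivity of x ↦ x^(i+1) then give zero on the
generators 1 - νt^(i+1) of Λ.

The Cartier ring. An endomorphism a of Λ acts on 𝕎𝒪_X through the elements a(1 - xt). Injectivity of
evaluation for the functors of sections shows that this is compatible with all of Λ
(`cartierHom_lambdaHom`), which yields both the module axioms and the linearity of the comparison
map. -/

noncomputable section

namespace CartierWitt

/-! ### Cohomology over open subsets, as extension groups -/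

section Site

variable {C : Type u} [Category.{u} C] (J : GrothendieckTopology C)

/-- The free abelian sheaf on an object of a site. -/
def freeSheaf : C ⥤ Sheaf J AddCommGrpCat.{u} :=
  yoneda ⋙ (Functor.whiskeringRight _ _ _).obj AddCommGrpCat.free ⋙ presheafToSheaf J _

variable {J}

/-- Homomorphisms out of the free abelian sheaf on `W` are sections over `W`. -/
def freeSheafEquiv (F : Sheaf J AddCommGrpCat.{u}) (W : C) :
    ((freeSheaf J).obj W ⟶ F) ≃ F.obj.obj (op W) :=
  ((sheafificationAdjunction J AddCommGrpCat.{u}).homEquiv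
    (yoneda.obj W ⋙ AddCommGrpCat.free) F).trans
  (((AddCommGrpCat.adj.{u}.whiskerRight Cᵒᵖ).homEquiv (yoneda.obj W) F.obj).trans
    yonedaEquiv)

lemma freeSheafEquiv_comp {F G : Sheaf J AddCommGrpCat.{u}} {W : C}
    (g : (freeSheaf J).obj W ⟶ F) (φ : F ⟶ G) :
    freeSheafEquiv G W (g ≫ φ) = φ.hom.app (op W) (freeSheafEquiv F W g) := by
  have h1 := (sheafificationAdjunction J AddCommGrpCat.{u}).homEquiv_naturality_right
    (X := yoneda.obj W ⋙ AddCommGrpCat.free) g φ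
  have h2 := (AddCommGrpCat.adj.{u}.whiskerRight Cᵒᵖ).homEquiv_naturality_right
    (X := yoneda.obj W) ((sheafificationAdjunction J AddCommGrpCat.{u}).homEquiv
    (yoneda.obj W ⋙ AddCommGrpCat.free) F g) φ.hom
  refine (congrArg (fun z => yonedaEquiv
    ((AddCommGrpCat.adj.{u}.whiskerRight Cᵒᵖ).homEquiv (yoneda.obj W) G.obj z)) h1).trans ?_
  exact (congrArg yonedaEquiv h2).trans (yonedaEquiv_comp _ _)

lemma freeSheafEquiv_map {F : Sheaf J AddCommGrpCat.{u}} {V W : C} (i : V ⟶ W)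
    (g : (freeSheaf J).obj W ⟶ F) :
    freeSheafEquiv F V ((freeSheaf J).map i ≫ g) = F.obj.map i.op (freeSheafEquiv F W g) := by
  have h1 := (sheafificationAdjunction J AddCommGrpCat.{u}).homEquiv_naturality_left
    (Functor.whiskerRight (yoneda.map i) AddCommGrpCat.free) g
  have h2 := (AddCommGrpCat.adj.{u}.whiskerRight Cᵒᵖ).homEquiv_naturality_left
    (yoneda.map i) ((sheafificationAdjunction J AddCommGrpCat.{u}).homEquiv
    (yoneda.obj W ⋙ AddCommGrpCat.free) F g)
  refine (congrArg (fun z => yonedaEquiv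
    ((AddCommGrpCat.adj.{u}.whiskerRight Cᵒᵖ).homEquiv (yoneda.obj V) F.obj z)) h1).trans ?_
  exact (congrArg yonedaEquiv h2).trans (yonedaEquiv_naturality _ _).symm

end Site

/-! ### Sheaf cohomology on a space as Ext out of free abelian sheaves on open subsets -/

section Coh

variable {Y : TopCat.{u}}

/-- The free abelian sheaf on an open subset. -/
def freeOn (W : Opens Y) : TopCat.Sheaf AddCommGrpCat.{u} Y :=
  (freeSheaf (Opens.grothendieckTopology Y)).obj W

/-- The homomorphism of free abelian sheaves attached to an inclusion. -/
def freeMap {V W : Opens Y} (i : V ≤ W) : freeOn V ⟶ freeOn W :=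
  (freeSheaf (Opens.grothendieckTopology Y)).map (homOfLE i)

lemma freeMap_refl (W : Opens Y) : freeMap (le_refl W) = 𝟙 _ :=
  (freeSheaf (Opens.grothendieckTopology Y)).map_id W

lemma freeMap_comp {U V W : Opens Y} (i : U ≤ V) (j : V ≤ W) :
    freeMap i ≫ freeMap j = freeMap (i.trans j) :=
  ((freeSheaf (Opens.grothendieckTopology Y)).map_comp (homOfLE i) (homOfLE j)).symm

/-- Homomorphisms out of the free abelian sheaf on `W` are sections over `W`. -/
def secEquiv (F : TopCat.Sheaf AddCommGrpCat.{u} Y) (W : Opens Y) :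
    (freeOn W ⟶ F) ≃ F.obj.obj (op W) :=
  freeSheafEquiv (J := Opens.grothendieckTopology Y) F W

lemma secEquiv_comp {F G : TopCat.Sheaf AddCommGrpCat.{u} Y} {W : Opens Y}
    (g : freeOn W ⟶ F) (φ : F ⟶ G) :
    secEquiv G W (g ≫ φ) = φ.hom.app (op W) (secEquiv F W g) :=
  freeSheafEquiv_comp (J := Opens.grothendieckTopology Y) g φ

lemma secEquiv_map {F : TopCat.Sheaf AddCommGrpCat.{u} Y} {V W : Opens Y} (i : V ≤ W)
    (g : freeOn W ⟶ F) :
    secEquiv F V (freeMap i ≫ g) = F.obj.map (homOfLE i).op (secEquiv F W g) :=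
  freeSheafEquiv_map (J := Opens.grothendieckTopology Y) (homOfLE i) g

lemma secEquiv_add {F : TopCat.Sheaf AddCommGrpCat.{u} Y} {W : Opens Y}
    (g h : freeOn W ⟶ F) :
    secEquiv F W (g + h) = secEquiv F W g + secEquiv F W h := by
  -- By naturality the bijection is evaluation of k at the universal section, the image of the
  -- identity; this is visibly additive in k.
  have e : ∀ k : freeOn W ⟶ F,
      secEquiv F W k = k.hom.app (op W) (secEquiv _ W (𝟙 _)) := fun k => by
    rw [← secEquiv_comp, Category.id_comp]
  rw [e (g + h), e g, e h]
  rfl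

/-- Homomorphisms out of the free abelian sheaf on `W` are sections over `W`. -/
def secAddEquiv (F : TopCat.Sheaf AddCommGrpCat.{u} Y) (W : Opens Y) :
    (freeOn W ⟶ F) ≃+ F.obj.obj (op W) :=
  { secEquiv F W with map_add' := secEquiv_add }

lemma secAddEquiv_comp {F G : TopCat.Sheaf AddCommGrpCat.{u} Y} {W : Opens Y}
    (g : freeOn W ⟶ F) (φ : F ⟶ G) :
    secAddEquiv G W (g ≫ φ) = φ.hom.app (op W) (secAddEquiv F W g) := secEquiv_comp g φ

lemma secAddEquiv_map {F : TopCat.Sheaf AddCommGrpCat.{u} Y} {V W : Opens Y} (i : V ≤ W)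
    (g : freeOn W ⟶ F) :
    secAddEquiv F V (freeMap i ≫ g) = F.obj.map (homOfLE i).op (secAddEquiv F W g) :=
  secEquiv_map i g

lemma secAddEquiv_symm_comp {F G : TopCat.Sheaf AddCommGrpCat.{u} Y} {W : Opens Y}
    (s : F.obj.obj (op W)) (φ : F ⟶ G) :
    (secAddEquiv F W).symm s ≫ φ = (secAddEquiv G W).symm (φ.hom.app (op W) s) := by
  rw [AddEquiv.eq_symm_apply, secAddEquiv_comp, AddEquiv.apply_symm_apply]

lemma freeMap_secAddEquiv_symm {F : TopCat.Sheaf AddCommGrpCat.{u} Y} {V W : Opens Y} (i : V ≤ W)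
    (s : F.obj.obj (op W)) : freeMap i ≫ (secAddEquiv F W).symm s =
      (secAddEquiv F V).symm (F.obj.map (homOfLE i).op s) := by
  rw [AddEquiv.eq_symm_apply, secAddEquiv_map, AddEquiv.apply_symm_apply]

open Abelian

/-- The cohomology of `F` over the open subset `W`. -/
abbrev coh (F : TopCat.Sheaf AddCommGrpCat.{u} Y) (q : ℕ) (W : Opens Y) : Type u :=
  Ext.{u} (freeOn W) F q

/-- Restriction of cohomology classes. -/
def cohRes (F : TopCat.Sheaf AddCommGrpCat.{u} Y) (q : ℕ) {V W : Opens Y} (i : V ≤ W) :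
    coh F q W →+ coh F q V :=
  (Ext.mk₀ (freeMap i)).precomp F (zero_add q)

/-- Functoriality of cohomology. -/
def cohMap {F G : TopCat.Sheaf AddCommGrpCat.{u} Y} (φ : F ⟶ G) (q : ℕ) (W : Opens Y) :
    coh F q W →+ coh G q W :=
  (Ext.mk₀ φ).postcomp (freeOn W) (add_zero q)

lemma cohRes_apply {F : TopCat.Sheaf AddCommGrpCat.{u} Y} {q : ℕ} {V W : Opens Y} (i : V ≤ W)
    (x : coh F q W) : cohRes F q i x = (Ext.mk₀ (freeMap i)).comp x (zero_add q) := rfl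

lemma cohMap_apply {F G : TopCat.Sheaf AddCommGrpCat.{u} Y} (φ : F ⟶ G) {q : ℕ} {W : Opens Y}
    (x : coh F q W) : cohMap φ q W x = x.comp (Ext.mk₀ φ) (add_zero q) := rfl

lemma cohRes_refl {F : TopCat.Sheaf AddCommGrpCat.{u} Y} {q : ℕ} {W : Opens Y}
    (x : coh F q W) : cohRes F q (le_refl W) x = x := by
  rw [cohRes_apply, freeMap_refl, Ext.mk₀_id_comp]

lemma cohRes_cohRes {F : TopCat.Sheaf AddCommGrpCat.{u} Y} {q : ℕ} {U V W : Opens Y} (i : U ≤ V)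
    (j : V ≤ W) (x : coh F q W) :
    cohRes F q i (cohRes F q j x) = cohRes F q (i.trans j) x := by
  rw [cohRes_apply, cohRes_apply, Ext.mk₀_comp_mk₀_assoc, freeMap_comp, cohRes_apply]

lemma cohMap_id {F : TopCat.Sheaf AddCommGrpCat.{u} Y} {q : ℕ} {W : Opens Y}
    (x : coh F q W) : cohMap (𝟙 F) q W x = x := by
  rw [cohMap_apply, Ext.comp_mk₀_id]

lemma cohMap_comp {F G H : TopCat.Sheaf AddCommGrpCat.{u} Y} (φ : F ⟶ G) (ψ : G ⟶ H) {q : ℕ}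
    {W : Opens Y} (x : coh F q W) :
    cohMap (φ ≫ ψ) q W x = cohMap ψ q W (cohMap φ q W x) := by
  simp [cohMap_apply]

lemma cohMap_zero {F G : TopCat.Sheaf AddCommGrpCat.{u} Y} {q : ℕ} {W : Opens Y}
    (x : coh F q W) : cohMap (0 : F ⟶ G) q W x = 0 := by
  simp [cohMap_apply]

lemma cohMap_add {F G : TopCat.Sheaf AddCommGrpCat.{u} Y} (φ ψ : F ⟶ G) {q : ℕ} {W : Opens Y}
    (x : coh F q W) : cohMap (φ + ψ) q W x = cohMap φ q W x + cohMap ψ q W x := by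
  simp [cohMap_apply, Ext.mk₀_add]

lemma cohMap_nsmul {F G : TopCat.Sheaf AddCommGrpCat.{u} Y} (n : ℕ) (φ : F ⟶ G) {q : ℕ}
    {W : Opens Y} (x : coh F q W) : cohMap (n • φ) q W x = n • cohMap φ q W x := by
  induction n with
  | zero => rw [zero_nsmul, zero_nsmul, cohMap_zero]
  | succ n ih => rw [succ_nsmul, succ_nsmul, cohMap_add, ih]

lemma cohMap_cohRes {F G : TopCat.Sheaf AddCommGrpCat.{u} Y} (φ : F ⟶ G) {q : ℕ} {V W : Opens Y}
    (i : V ≤ W) (x : coh F q W) :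
    cohMap φ q V (cohRes F q i x) = cohRes G q i (cohMap φ q W x) := by
  simp [cohMap_apply, cohRes_apply]

/-- Cohomology in degree zero consists of the sections. -/
def cohZero (F : TopCat.Sheaf AddCommGrpCat.{u} Y) (W : Opens Y) :
    coh F 0 W ≃+ F.obj.obj (op W) :=
  Ext.addEquiv₀.trans (secAddEquiv F W)

lemma cohZero_symm_apply {F : TopCat.Sheaf AddCommGrpCat.{u} Y} {W : Opens Y}
    (s : F.obj.obj (op W)) : (cohZero F W).symm s = Ext.mk₀ ((secAddEquiv F W).symm s) := rfl

lemma cohRes_cohZero_symm {F : TopCat.Sheaf AddCommGrpCat.{u} Y} {V W : Opens Y} (i : V ≤ W)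
    (s : F.obj.obj (op W)) : cohRes F 0 i ((cohZero F W).symm s) =
      (cohZero F V).symm (F.obj.map (homOfLE i).op s) := by
  rw [cohZero_symm_apply, cohZero_symm_apply, cohRes_apply, Ext.mk₀_comp_mk₀,
    freeMap_secAddEquiv_symm]

lemma cohMap_cohZero_symm {F G : TopCat.Sheaf AddCommGrpCat.{u} Y} (φ : F ⟶ G) {W : Opens Y}
    (s : F.obj.obj (op W)) : cohMap φ 0 W ((cohZero F W).symm s) =
      (cohZero G W).symm (φ.hom.app (op W) s) := by
  rw [cohZero_symm_apply, cohZero_symm_apply, cohMap_apply, Ext.mk₀_comp_mk₀,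
    secAddEquiv_symm_comp]

lemma cohZero_cohMap {F G : TopCat.Sheaf AddCommGrpCat.{u} Y} (φ : F ⟶ G) {W : Opens Y}
    (x : coh F 0 W) : cohZero G W (cohMap φ 0 W x) = φ.hom.app (op W) (cohZero F W x) := by
  obtain ⟨s, rfl⟩ := (cohZero F W).symm.surjective x
  rw [cohMap_cohZero_symm, AddEquiv.apply_symm_apply, AddEquiv.apply_symm_apply]

end Coh

/-! ### The Mayer–Vietoris sequence -/

section MayerVietoris

open Abelian

variable {Y : TopCat.{u}} {F : TopCat.Sheaf AddCommGrpCat.{u} Y} {q : ℕ} {I U V W : Opens Y}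

/-- The short complex of free abelian sheaves attached to a union of two open subsets. -/
abbrev mvComplex (hW : W = U ⊔ V) (hI : I = U ⊓ V) :
    ShortComplex (TopCat.Sheaf AddCommGrpCat.{u} Y) :=
  ShortComplex.mk
    (Limits.biprod.lift (freeMap (hI.le.trans inf_le_left)) (-freeMap (hI.le.trans inf_le_right)) :
      freeOn I ⟶ freeOn U ⊞ freeOn V)
    (Limits.biprod.desc (freeMap (le_sup_left.trans hW.ge)) (freeMap (le_sup_right.trans hW.ge)))
    (by rw [Limits.biprod.lift_desc, Preadditive.neg_comp, freeMap_comp, freeMap_comp,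
      add_neg_cancel])

/-- `W` and `I` are variables with equations because later the union and the intersection arise as
images of opens of another space, equal to `U ⊔ V` and `U ⊓ V` only propositionally. -/
lemma mvComplex_shortExact (hW : W = U ⊔ V) (hI : I = U ⊓ V) :
    (mvComplex hW hI).ShortExact :=
  (Opens.mayerVietorisSquare'
    { X₁ := I
      X₂ := U
      X₃ := V
      X₄ := W
      f₁₂ := homOfLE (hI.le.trans inf_le_left)
      f₁₃ := homOfLE (hI.le.trans inf_le_right)
      f₂₄ := homOfLE (le_sup_left.trans hW.ge)
      f₃₄ := homOfLE (le_sup_right.trans hW.ge)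
      fac := Subsingleton.elim _ _ } hW hI).shortComplex_shortExact

/-- The connecting homomorphism of the Mayer–Vietoris sequence. -/
def mvδ (F : TopCat.Sheaf AddCommGrpCat.{u} Y) (q : ℕ) {I U V W : Opens Y} (hW : W = U ⊔ V)
    (hI : I = U ⊓ V) : coh F q I →+ coh F (q + 1) W :=
  (mvComplex_shortExact hW hI).extClass.precomp F (add_comm 1 q)

lemma mvδ_apply (hW : W = U ⊔ V) (hI : I = U ⊓ V) (x : coh F q I) :
    mvδ F q hW hI x = (mvComplex_shortExact hW hI).extClass.comp x (add_comm 1 q) := rfl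

lemma cohMap_mvδ {G : TopCat.Sheaf AddCommGrpCat.{u} Y} (φ : F ⟶ G) (hW : W = U ⊔ V)
    (hI : I = U ⊓ V) (x : coh F q I) :
    cohMap φ (q + 1) W (mvδ F q hW hI x) = mvδ G q hW hI (cohMap φ q I x) := by
  rw [cohMap_apply, cohMap_apply, mvδ_apply, mvδ_apply]
  exact Ext.comp_assoc_of_third_deg_zero _ _ _ _

lemma mvComplex_f_comp (hW : W = U ⊔ V) (hI : I = U ⊓ V) (a : coh F q U) (b : coh F q V) :
    (Ext.mk₀ (mvComplex hW hI).f).comp (Ext.biprodAddEquiv.symm (a, b)) (zero_add q) =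
      cohRes F q (hI.le.trans inf_le_left) a - cohRes F q (hI.le.trans inf_le_right) b := by
  rw [Ext.biprodAddEquiv_symm_apply, Ext.comp_add, Ext.mk₀_comp_mk₀_assoc,
    Ext.mk₀_comp_mk₀_assoc, Limits.biprod.lift_fst, Limits.biprod.lift_snd, Ext.mk₀_neg,
    Ext.neg_comp, sub_eq_add_neg]
  rfl

lemma mv_exact_res (hW : W = U ⊔ V) (hI : I = U ⊓ V) (a : coh F q U) (b : coh F q V)
    (h : cohRes F q (hI.le.trans inf_le_left) a = cohRes F q (hI.le.trans inf_le_right) b) :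
    ∃ x : coh F q W, cohRes F q (le_sup_left.trans hW.ge) x = a ∧
      cohRes F q (le_sup_right.trans hW.ge) x = b := by
  obtain ⟨x, hx⟩ := Ext.contravariant_sequence_exact₂ (mvComplex_shortExact hW hI) (Y := F)
    (Ext.biprodAddEquiv.symm (a, b) : Ext (freeOn U ⊞ freeOn V) F q) (by
      rw [mvComplex_f_comp, h, sub_self])
  have h1 := congrArg Ext.biprodAddEquiv hx
  rw [AddEquiv.apply_symm_apply, Prod.ext_iff] at h1
  refine ⟨x, Eq.trans ?_ h1.1, Eq.trans ?_ h1.2⟩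
  · rw [Ext.biprodAddEquiv_apply_fst, Ext.mk₀_comp_mk₀_assoc, Limits.biprod.inl_desc]
    rfl
  · rw [Ext.biprodAddEquiv_apply_snd, Ext.mk₀_comp_mk₀_assoc, Limits.biprod.inr_desc]
    rfl

lemma mv_exact_δ (hW : W = U ⊔ V) (hI : I = U ⊓ V) (x : coh F (q + 1) W)
    (h1 : cohRes F _ (le_sup_left.trans hW.ge) x = 0)
    (h2 : cohRes F _ (le_sup_right.trans hW.ge) x = 0) : ∃ y, mvδ F q hW hI y = x := by
  refine Ext.contravariant_sequence_exact₃ (mvComplex_shortExact hW hI) F x ?_ (add_comm 1 q)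
  refine Ext.biprodAddEquiv.injective (Prod.ext ?_ ?_)
  · rw [map_zero, Ext.biprodAddEquiv_apply_fst, Ext.mk₀_comp_mk₀_assoc, Limits.biprod.inl_desc]
    exact h1
  · rw [map_zero, Ext.biprodAddEquiv_apply_snd, Ext.mk₀_comp_mk₀_assoc, Limits.biprod.inr_desc]
    exact h2

lemma mv_exact_sub (hW : W = U ⊔ V) (hI : I = U ⊓ V) (y : coh F q I)
    (h : mvδ F q hW hI y = 0) : ∃ (a : coh F q U) (b : coh F q V),
      cohRes F q (hI.le.trans inf_le_left) a - cohRes F q (hI.le.trans inf_le_right) b = y := by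
  obtain ⟨x, hx⟩ := Ext.contravariant_sequence_exact₁ (mvComplex_shortExact hW hI) (Y := F) y
    (add_comm 1 q) h
  obtain ⟨⟨a, b⟩, rfl⟩ := Ext.biprodAddEquiv.symm.surjective x
  exact ⟨a, b, by rw [← hx, mvComplex_f_comp]⟩

lemma mvδ_sub (hW : W = U ⊔ V) (hI : I = U ⊓ V) (a : coh F q U) (b : coh F q V) :
    mvδ F q hW hI (cohRes F q (hI.le.trans inf_le_left) a -
      cohRes F q (hI.le.trans inf_le_right) b) = 0 := by
  rw [← mvComplex_f_comp hW hI, mvδ_apply]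
  exact ShortComplex.ShortExact.extClass_comp_assoc _ _

/-- The connecting map is composition with an extension class, and shrinking the cover gives a
morphism of short exact sequences under which extension classes are natural. -/
lemma cohRes_mvδ {I' U' V' W' : Opens Y} (hW : W = U ⊔ V) (hI : I = U ⊓ V) (hW' : W' = U' ⊔ V')
    (hI' : I' = U' ⊓ V') (hU : U' ≤ U) (hV : V' ≤ V) (hWW : W' ≤ W) (hII : I' ≤ I)
    (y : coh F q I) :
    cohRes F (q + 1) hWW (mvδ F q hW hI y) = mvδ F q hW' hI' (cohRes F q hII y) := by
  let t : mvComplex hW' hI' ⟶ mvComplex hW hI :=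
    { τ₁ := freeMap hII
      τ₂ := Limits.biprod.map (freeMap hU) (freeMap hV)
      τ₃ := freeMap hWW
      comm₁₂ := by
        refine Limits.biprod.hom_ext _ _ ?_ ?_
        · simp [freeMap_comp]
        · simp [freeMap_comp]
      comm₂₃ := by
        refine Limits.biprod.hom_ext' _ _ ?_ ?_
        · simp [freeMap_comp]
        · simp [freeMap_comp] }
  have h := ShortComplex.ShortExact.extClass_naturality (mvComplex_shortExact hW' hI')
    (mvComplex_shortExact hW hI) t
  rw [cohRes_apply, cohRes_apply, mvδ_apply, mvδ_apply]
  rw [← Ext.comp_assoc _ _ _ (zero_add 1) (add_comm 1 q) (by omega)]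
  refine (congrArg (fun z => Ext.comp z y (add_comm 1 q)) h.symm).trans ?_
  exact Ext.comp_assoc_of_second_deg_zero _ _ _ _

/-- A class that dies on both parts is a boundary, and `hs` says that the connecting map is zero.
This is how surjectivity in degree q becomes separatedness in degree q + 1. -/
lemma coh_eq_zero_of_sup (hW : W = U ⊔ V) (hI : I = U ⊓ V) (x : coh F (q + 1) W)
    (h1 : cohRes F _ (le_sup_left.trans hW.ge) x = 0)
    (h2 : cohRes F _ (le_sup_right.trans hW.ge) x = 0)
    (hs : ∀ y : coh F q I, ∃ (a : coh F q U) (b : coh F q V),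
      cohRes F q (hI.le.trans inf_le_left) a - cohRes F q (hI.le.trans inf_le_right) b = y) :
    x = 0 := by
  obtain ⟨y, rfl⟩ := mv_exact_δ hW hI x h1 h2
  obtain ⟨a, b, rfl⟩ := hs y
  exact mvδ_sub hW hI a b

end MayerVietoris

/-! ### Long exact sequences -/

section LongExact

open Abelian

variable {Y : TopCat.{u}} {S : ShortComplex (TopCat.Sheaf AddCommGrpCat.{u} Y)}
  (hS : S.ShortExact) {q : ℕ} {W : Opens Y}

/-- The connecting homomorphism. -/
def cohδ (q : ℕ) (W : Opens Y) : coh S.X₃ q W →+ coh S.X₁ (q + 1) W :=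
  hS.extClass.postcomp (freeOn W) rfl

lemma cohδ_exact₁ (x : coh S.X₁ (q + 1) W) (h : cohMap S.f _ W x = 0) :
    ∃ y, cohδ hS q W y = x :=
  Ext.covariant_sequence_exact₁ _ hS x h rfl

include hS in
lemma cohMap_exact (x : coh S.X₂ q W) (h : cohMap S.g _ W x = 0) :
    ∃ y, cohMap S.f q W y = x :=
  Ext.covariant_sequence_exact₂ _ hS x h

lemma cohδ_exact₃ (x : coh S.X₃ q W) (h : cohδ hS q W x = 0) :
    ∃ y, cohMap S.g q W y = x :=
  Ext.covariant_sequence_exact₃ _ hS x rfl h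

lemma cohδ_cohMap (x : coh S.X₂ q W) : cohδ hS q W (cohMap S.g q W x) = 0 := by
  change (x.comp (Ext.mk₀ S.g) (add_zero q)).comp hS.extClass rfl = 0
  rw [Ext.comp_assoc_of_second_deg_zero, ShortComplex.ShortExact.comp_extClass, Ext.comp_zero]

lemma cohδ_naturality {S' : ShortComplex (TopCat.Sheaf AddCommGrpCat.{u} Y)}
    (hS' : S'.ShortExact) (t : S ⟶ S') (x : coh S.X₃ q W) :
    cohδ hS' q W (cohMap t.τ₃ q W x) = cohMap t.τ₁ (q + 1) W (cohδ hS q W x) := by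
  change (x.comp (Ext.mk₀ t.τ₃) (add_zero q)).comp hS'.extClass rfl =
    (x.comp hS.extClass rfl).comp (Ext.mk₀ t.τ₁) (add_zero _)
  rw [Ext.comp_assoc_of_second_deg_zero, Ext.comp_assoc_of_third_deg_zero,
    ShortComplex.ShortExact.extClass_naturality hS hS' t]

include hS in
lemma cohMap_zero_injective (x : coh S.X₁ 0 W) (h : cohMap S.f 0 W x = 0) : x = 0 := by
  have := hS.mono_f
  exact Ext.postcomp_mk₀_injective_of_mono (freeOn W) S.f (h.trans (map_zero _).symm)

end LongExact

/-! ### Exactness criteria on a basis and local triviality of cohomology classes -/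

section Basis

open Abelian

variable {Y : TopCat.{u}} {B : Set (Opens Y)}

lemma sheaf_eq_of_locally_eq {F : TopCat.Sheaf AddCommGrpCat.{u} Y} {W : Opens Y}
    (s t : F.obj.obj (op W))
    (h : ∀ x ∈ W, ∃ V : Opens Y, ∃ i : V ≤ W, x ∈ V ∧
      F.obj.map (homOfLE i).op s = F.obj.map (homOfLE i).op t) : s = t := by
  choose V i hx hV using h
  refine TopCat.Sheaf.eq_of_locally_eq' F (fun x : W => V x.1 x.2) W
    (fun x => homOfLE (i x.1 x.2)) (fun x hxW => ?_) s t (fun x => hV x.1 x.2)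
  exact Opens.mem_iSup.2 ⟨⟨x, hxW⟩, hx x hxW⟩

lemma exists_basis_le (hB : Opens.IsBasis B) {W : Opens Y} {x : Y} (hx : x ∈ W) :
    ∃ V ∈ B, x ∈ V ∧ V ≤ W :=
  Opens.isBasis_iff_nbhd.1 hB hx

lemma epi_of_surjective_on_basis (hB : Opens.IsBasis B) {M Q : TopCat.Sheaf AddCommGrpCat.{u} Y}
    (g : M ⟶ Q) (hg : ∀ U ∈ B, ∀ s : Q.obj.obj (op U), ∃ t, g.hom.app (op U) t = s) : Epi g := by
  refine Preadditive.epi_of_cancel_zero _ fun {P} t ht => ?_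
  refine ObjectProperty.hom_ext _ (NatTrans.ext (funext fun W => AddCommGrpCat.ext fun s => ?_))
  refine sheaf_eq_of_locally_eq (F := P) (W := W.unop) _ _ fun x hx => ?_
  obtain ⟨V, hVB, hxV, hVW⟩ := exists_basis_le hB hx
  refine ⟨V, hVW, hxV, ?_⟩
  have h1 := ConcreteCategory.congr_hom (t.hom.naturality (homOfLE hVW).op) s
  obtain ⟨m, hm⟩ := hg V hVB (Q.obj.map (homOfLE hVW).op s)
  have h2 : t.hom.app (op V) (g.hom.app (op V) m) = 0 :=
    ConcreteCategory.congr_hom (congrArg (fun k : M ⟶ P => k.hom.app (op V)) ht) m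
  refine h1.symm.trans (Eq.trans ?_ (map_zero _).symm)
  rw [hm] at h2
  exact h2

lemma mono_of_injective_on_basis (hB : Opens.IsBasis B) {M Q : TopCat.Sheaf AddCommGrpCat.{u} Y}
    (g : M ⟶ Q) (hg : ∀ U ∈ B, ∀ s : M.obj.obj (op U), g.hom.app (op U) s = 0 → s = 0) :
    Mono g := by
  refine Preadditive.mono_of_cancel_zero _ fun {P} t ht => ?_
  refine ObjectProperty.hom_ext _ (NatTrans.ext (funext fun W => AddCommGrpCat.ext fun s => ?_))
  refine sheaf_eq_of_locally_eq (F := M) (W := W.unop) _ _ fun x hx => ?_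
  obtain ⟨V, hVB, hxV, hVW⟩ := exists_basis_le hB hx
  refine ⟨V, hVW, hxV, ?_⟩
  have h1 := ConcreteCategory.congr_hom (t.hom.naturality (homOfLE hVW).op) s
  refine h1.symm.trans (Eq.trans ?_ (map_zero _).symm)
  exact hg V hVB _ (ConcreteCategory.congr_hom (congrArg (fun k : P ⟶ Q => k.hom.app (op V)) ht) _)

/-- Exactness of sections is available over affine opens only, where it is strictly stronger than
exactness of sheaves. -/
lemma shortExact_of_basis (hB : Opens.IsBasis B)
    (S : ShortComplex (TopCat.Sheaf AddCommGrpCat.{u} Y))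
    (h1 : ∀ U ∈ B, ∀ s, S.f.hom.app (op U) s = 0 → s = 0)
    (h2 : ∀ U ∈ B, ∀ s, S.g.hom.app (op U) s = 0 → ∃ t, S.f.hom.app (op U) t = s)
    (h3 : ∀ U ∈ B, ∀ s, ∃ t, S.g.hom.app (op U) t = s) : S.ShortExact := by
  have : Mono S.f := mono_of_injective_on_basis hB _ h1
  have : Epi S.g := epi_of_surjective_on_basis hB _ h3
  -- Exactness in the middle is surjectivity onto the kernel sheaf, whose sections are the kernel on
  -- sections; this is again tested on the basis.
  have : Epi (Limits.kernel.lift S.g S.f S.zero) := by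
    refine epi_of_surjective_on_basis hB _ fun U hU s => ?_
    have hs : S.g.hom.app (op U) ((Limits.kernel.ι S.g).hom.app (op U) s) = 0 :=
      ConcreteCategory.congr_hom (congrArg (fun k => k.hom.app (op U))
        (Limits.kernel.condition S.g)) s
    obtain ⟨t, ht⟩ := h2 U hU _ hs
    refine ⟨t, ?_⟩
    apply (secAddEquiv _ U).symm.injective
    rw [← secAddEquiv_symm_comp, ← cancel_mono (Limits.kernel.ι S.g), Category.assoc,
      Limits.kernel.lift_ι, secAddEquiv_symm_comp, secAddEquiv_symm_comp, ht]
  exact { exact := S.exact_iff_epi_kernel_lift.2 this }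

variable {F : TopCat.Sheaf AddCommGrpCat.{u} Y} {q : ℕ} {W : Opens Y}

lemma cohδ_cohRes {S : ShortComplex (TopCat.Sheaf AddCommGrpCat.{u} Y)} (hS : S.ShortExact)
    {V W : Opens Y} (i : V ≤ W) (x : coh S.X₃ q W) :
    cohδ hS q V (cohRes _ q i x) = cohRes _ _ i (cohδ hS q W x) :=
  Ext.comp_assoc _ _ _ (zero_add q) rfl (by omega)

/-- The short complex `F ⟶ I ⟶ I / F` for an injective sheaf `I` containing `F`. -/
abbrev injComplex (F : TopCat.Sheaf AddCommGrpCat.{u} Y) :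
    ShortComplex (TopCat.Sheaf AddCommGrpCat.{u} Y) :=
  ShortComplex.mk (Injective.ι F) (Limits.cokernel.π (Injective.ι F))
    (Limits.cokernel.condition _)

lemma injComplex_shortExact (F : TopCat.Sheaf AddCommGrpCat.{u} Y) :
    (injComplex F).ShortExact where
  exact := ShortComplex.exact_cokernel _
  mono_f := inferInstanceAs (Mono (Injective.ι F))
  epi_g := inferInstanceAs (Epi (Limits.cokernel.π (Injective.ι F)))

lemma exists_cohδ_injComplex (x : coh F (q + 1) W) :
    ∃ y, cohδ (injComplex_shortExact F) q W y = x := by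
  refine cohδ_exact₁ (injComplex_shortExact F) x ?_
  have : Injective (injComplex F).X₂ := inferInstanceAs (Injective (Injective.under F))
  exact Ext.eq_zero_of_injective _

lemma exists_local_lift {M Q : TopCat.Sheaf AddCommGrpCat.{u} Y} (g : M ⟶ Q) [Epi g]
    (s : Q.obj.obj (op W)) {x : Y} (hx : x ∈ W) : ∃ (V : Opens Y) (i : V ≤ W),
      x ∈ V ∧ ∃ t : M.obj.obj (op V), g.hom.app (op V) t = Q.obj.map (homOfLE i).op s := by
  have h1 : TopCat.Presheaf.IsLocallySurjective g.hom :=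
    (TopCat.Sheaf.isLocallySurjective_iff_epi g).mpr inferInstance
  obtain ⟨V, i, ⟨t, ht⟩, hxV⟩ := (TopCat.Presheaf.isLocallySurjective_iff g.hom).mp h1 W s x hx
  exact ⟨V, i, hxV, t, ht⟩

/-- Dimension shifting along F ⟶ I ⟶ I/F with I injective reduces to degree one, where the class is
the boundary of a section of I/F and this section lifts to I locally. -/
lemma exists_cohRes_eq_zero (x : coh F (q + 1) W) {y : Y} (hy : y ∈ W) :
    ∃ (V : Opens Y) (i : V ≤ W), y ∈ V ∧ cohRes F _ i x = 0 := by
  induction q generalizing F W with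
  | zero =>
    obtain ⟨z, rfl⟩ := exists_cohδ_injComplex x
    obtain ⟨s, rfl⟩ := (cohZero _ W).symm.surjective z
    have : Epi (injComplex F).g := (injComplex_shortExact F).epi_g
    obtain ⟨V, i, hyV, t, ht⟩ := exists_local_lift (injComplex F).g s hy
    refine ⟨V, i, hyV, ?_⟩
    refine (cohδ_cohRes (injComplex_shortExact F) i _).symm.trans ?_
    rw [cohRes_cohZero_symm, ← ht, ← cohMap_cohZero_symm, cohδ_cohMap]
  | succ q ih =>
    obtain ⟨z, rfl⟩ := exists_cohδ_injComplex x
    obtain ⟨V, i, hyV, hV⟩ := ih z hy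
    exact ⟨V, i, hyV, (cohδ_cohRes (injComplex_shortExact F) i _).symm.trans (by rw [hV, map_zero])⟩

end Basis

/-! ### Presheaves that satisfy the sheaf condition for two basic open subsets -/

section TwoCover

variable {Z : Scheme.{u}} (A : TopCat.Presheaf AddCommGrpCat.{u} Z)

/-- Restriction of sections of a presheaf of abelian groups. -/
def pRes {V W : Z.Opens} (i : V ≤ W) : A.obj (op W) →+ A.obj (op V) := (A.map (homOfLE i).op).hom

lemma pRes_pRes {U V W : Z.Opens} (i : U ≤ V) (j : V ≤ W) (x : A.obj (op W)) :
    pRes A i (pRes A j x) = pRes A (i.trans j) x :=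
  (ConcreteCategory.congr_hom (A.map_comp (homOfLE j).op (homOfLE i).op) x).symm

lemma pRes_refl {W : Z.Opens} (x : A.obj (op W)) : pRes A (le_refl W) x = x :=
  ConcreteCategory.congr_hom (A.map_id (op W)) x

/-- A class of affine open subsets that is closed under passage to basic open subsets. -/
structure IsBasicClass (B : Set Z.Opens) : Prop where
  isAffineOpen : ∀ {U}, U ∈ B → IsAffineOpen U
  basicOpen_mem : ∀ {U}, U ∈ B → ∀ a : Γ(Z, U), Z.basicOpen a ∈ B

variable (B : Set Z.Opens)

/-- Sections of `A` over an open subset in the class `B` that vanish on both parts of a cover by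
two basic open subsets vanish. -/
def SepTwo : Prop :=
  (∀ x : A.obj (op ⊥), x = 0) ∧ ∀ (U : Z.Opens) (_ : U ∈ B) (a b : Γ(Z, U)),
    a + b = 1 → ∀ x : A.obj (op U), pRes A (Z.basicOpen_le a) x = 0 →
      pRes A (Z.basicOpen_le b) x = 0 → x = 0

/-- Sections of `A` over the parts of a cover of an open subset in the class `B` by two basic open
subsets can be glued. -/
def GlueTwo : Prop :=
  ∀ (U : Z.Opens) (_ : U ∈ B) (a b : Γ(Z, U)), a + b = 1 →
    ∀ (y : A.obj (op (Z.basicOpen a))) (z : A.obj (op (Z.basicOpen b))),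
      pRes A (inf_le_left : Z.basicOpen a ⊓ Z.basicOpen b ≤ _) y = pRes A inf_le_right z →
      ∃ x : A.obj (op U), pRes A (Z.basicOpen_le a) x = y ∧ pRes A (Z.basicOpen_le b) x = z

variable {A B}

/-- On D(a + b) the sum is invertible; dividing by it turns a and b into functions with sum 1. This
is what makes the two-element covers of `SepTwo` and `GlueTwo` sufficient. -/
lemma exists_normalized {U : Z.Opens} (a b : Γ(Z, U)) :
    ∃ a' b' : Γ(Z, Z.basicOpen (a + b)), a' + b' = 1 ∧
      Z.basicOpen a' = Z.basicOpen (a + b) ⊓ Z.basicOpen a ∧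
      Z.basicOpen b' = Z.basicOpen (a + b) ⊓ Z.basicOpen b := by
  have hu : IsUnit ((Z.presheaf.map (homOfLE (Z.basicOpen_le (a + b))).op).hom (a + b)) :=
    RingedSpace.isUnit_res_basicOpen _ _
  obtain ⟨v, hv⟩ := hu
  have key : ∀ c : Γ(Z, U), Z.basicOpen ((↑v⁻¹ : Γ(Z, Z.basicOpen (a + b))) *
      (Z.presheaf.map (homOfLE (Z.basicOpen_le (a + b))).op).hom c) =
        Z.basicOpen (a + b) ⊓ Z.basicOpen c := by
    intro c
    rw [Scheme.basicOpen_mul, Scheme.basicOpen_of_isUnit _ (Units.isUnit _)]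
    refine (congrArg _ (Scheme.basicOpen_res _ _ _)).trans ?_
    rw [← inf_assoc, inf_idem]
  refine ⟨_, _, ?_, key a, key b⟩
  rw [← mul_add, ← map_add, ← hv]
  exact Units.inv_mul v

lemma SepTwo.eq_zero_on_add (hB : IsBasicClass B) (hA : SepTwo A B) {U : Z.Opens} (hU : U ∈ B) (a b
    : Γ(Z, U))
    (x : A.obj (op (Z.basicOpen (a + b))))
    (ha : pRes A (inf_le_left : Z.basicOpen (a + b) ⊓ Z.basicOpen a ≤ _) x = 0)
    (hb : pRes A (inf_le_left : Z.basicOpen (a + b) ⊓ Z.basicOpen b ≤ _) x = 0) : x = 0 := by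
  obtain ⟨a', b', h1, h2, h3⟩ := exists_normalized a b
  refine hA.2 _ (hB.basicOpen_mem hU _) a' b' h1 x ?_ ?_
  · have := congrArg (pRes A h2.le) ha
    rwa [pRes_pRes, map_zero] at this
  · have := congrArg (pRes A h3.le) hb
    rwa [pRes_pRes, map_zero] at this

/-- The functions c with x = 0 on D(c) form an ideal: closure under sums is the two-element case on
D(a + b). If x is locally zero, these D(c) cover the affine open U, so the ideal is the unit ideal
and contains 1. -/
lemma SepTwo.eq_zero (hB : IsBasicClass B) (hA : SepTwo A B) {U : Z.Opens} (hU : U ∈ B) (x : A.obj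
    (op U))
    (h : ∀ z ∈ U, ∃ (V : Z.Opens) (i : V ≤ U), z ∈ V ∧ pRes A i x = 0) : x = 0 := by
  let J : Ideal Γ(Z, U) :=
    { carrier := {c | pRes A (Z.basicOpen_le c) x = 0}
      zero_mem' := by
        have h1 : Z.basicOpen (0 : Γ(Z, U)) ≤ ⊥ := (Z.basicOpen_zero U).le
        have h2 := congrArg (pRes A h1) (hA.1 (pRes A bot_le x))
        rwa [pRes_pRes, map_zero] at h2
      add_mem' := fun {a b} ha hb => by
        refine hA.eq_zero_on_add hB hU a b _ ?_ ?_
        · have := congrArg (pRes A (inf_le_right : Z.basicOpen (a + b) ⊓ Z.basicOpen a ≤ _)) ha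
          rw [pRes_pRes, map_zero] at this
          rwa [pRes_pRes]
        · have := congrArg (pRes A (inf_le_right : Z.basicOpen (a + b) ⊓ Z.basicOpen b ≤ _)) hb
          rw [pRes_pRes, map_zero] at this
          rwa [pRes_pRes]
      smul_mem' := fun c a ha => by
        have h1 : Z.basicOpen (c • a) ≤ Z.basicOpen a := by
          rw [smul_eq_mul, Scheme.basicOpen_mul]
          exact inf_le_right
        have := congrArg (pRes A h1) ha
        rwa [pRes_pRes, map_zero] at this }
  have hJ : J = ⊤ := by
    rw [← Ideal.span_eq J]
    refine (hB.isAffineOpen hU).self_le_iSup_basicOpen_iff.1 fun z hz => ?_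
    obtain ⟨V, i, hzV, hV⟩ := h z hz
    obtain ⟨c, hc, hzc⟩ := (hB.isAffineOpen hU).exists_basicOpen_le ⟨z, hzV⟩ hz
    refine Opens.mem_iSup.2 ⟨⟨c, ?_⟩, hzc⟩
    have := congrArg (pRes A hc) hV
    rwa [pRes_pRes, map_zero] at this
  have h1 : (1 : Γ(Z, U)) ∈ J := hJ ▸ Submodule.mem_top
  have h2 : U ≤ Z.basicOpen (1 : Γ(Z, U)) := Z.basicOpen_one.ge
  have := congrArg (pRes A h2) (show pRes A (Z.basicOpen_le 1) x = 0 from h1)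
  rwa [pRes_pRes, map_zero, pRes_refl] at this

lemma SepTwo.eq_of_locally_eq (hB : IsBasicClass B) (hA : SepTwo A B) {U : Z.Opens} (hU : U ∈ B)
    (x y : A.obj (op U))
    (h : ∀ z ∈ U, ∃ (V : Z.Opens) (i : V ≤ U), z ∈ V ∧ pRes A i x = pRes A i y) : x = y := by
  rw [← sub_eq_zero]
  refine hA.eq_zero hB hU _ fun z hz => ?_
  obtain ⟨V, i, hzV, hV⟩ := h z hz
  exact ⟨V, i, hzV, by rw [map_sub, hV, sub_self]⟩

/-- The same ideal argument, now for the functions a such that D(a) carries a section that agrees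
with all the given ones. The two-element case glues over D(a + b), and separatedness supplies the
required compatibilities. -/
lemma SepTwo.exists_glue (hB : IsBasicClass B) (hA : SepTwo A B) (hA' : GlueTwo A B) {U : Z.Opens}
    (hU : U ∈ B)
    {ι : Type*} (c : ι → Γ(Z, U)) (hc : U ≤ ⨆ i, Z.basicOpen (c i))
    (x : ∀ i, A.obj (op (Z.basicOpen (c i))))
    (hx : ∀ i j, pRes A (inf_le_left : Z.basicOpen (c i) ⊓ Z.basicOpen (c j) ≤ _) (x i) =
      pRes A inf_le_right (x j)) :
    ∃ y : A.obj (op U), ∀ i, pRes A (Z.basicOpen_le (c i)) y = x i := by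
  have haff : ∀ a b : Γ(Z, U), Z.basicOpen a ⊓ Z.basicOpen b ∈ B := fun a b => by
    rw [← Scheme.basicOpen_mul]
    exact hB.basicOpen_mem hU _
  let J : Ideal Γ(Z, U) :=
    { carrier := {a | ∃ y : A.obj (op (Z.basicOpen a)), ∀ i,
        pRes A (inf_le_left : Z.basicOpen a ⊓ Z.basicOpen (c i) ≤ _) y =
          pRes A inf_le_right (x i)}
      zero_mem' := by
        refine ⟨0, fun i => ?_⟩
        have h1 : Z.basicOpen (0 : Γ(Z, U)) ⊓ Z.basicOpen (c i) ≤ ⊥ :=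
          inf_le_left.trans (Z.basicOpen_zero U).le
        have h2 := congrArg (pRes A h1) (hA.1 (pRes A bot_le (x i)))
        rw [pRes_pRes, map_zero] at h2
        rw [map_zero, h2]
      add_mem' := fun {a b} ha hb => by
        obtain ⟨y, hy⟩ := ha
        obtain ⟨z, hz⟩ := hb
        obtain ⟨a', b', h1, h2, h3⟩ := exists_normalized a b
        have ea : Z.basicOpen a' ≤ Z.basicOpen a := h2.le.trans inf_le_right
        have eb : Z.basicOpen b' ≤ Z.basicOpen b := h3.le.trans inf_le_right
        obtain ⟨w, hw1, hw2⟩ := hA' _ (hB.basicOpen_mem hU (a + b)) a' b' h1 (pRes A ea y) (pRes A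
            eb z) (by
          -- On D(a') ∩ D(b') the restrictions of y and z are compared on the cover by the D(c i),
          -- where both are restrictions of x i.
          have haf : Z.basicOpen a' ⊓ Z.basicOpen b' ∈ B := by
            rw [← Scheme.basicOpen_mul]
            exact hB.basicOpen_mem (hB.basicOpen_mem hU (a + b)) _
          refine hA.eq_of_locally_eq hB haf _ _ fun p hp => ?_
          obtain ⟨i, hi⟩ := Opens.mem_iSup.1
            (hc (Z.basicOpen_le a (ea (inf_le_left (a := Z.basicOpen a') hp))))
          refine ⟨Z.basicOpen a' ⊓ Z.basicOpen b' ⊓ Z.basicOpen (c i), inf_le_left, ⟨hp, hi⟩, ?_⟩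
          have e1 := congrArg (pRes A (show Z.basicOpen a' ⊓ Z.basicOpen b' ⊓ Z.basicOpen (c i) ≤
            Z.basicOpen a ⊓ Z.basicOpen (c i) from
              inf_le_inf_right _ (inf_le_left.trans ea))) (hy i)
          have e2 := congrArg (pRes A (show Z.basicOpen a' ⊓ Z.basicOpen b' ⊓ Z.basicOpen (c i) ≤
            Z.basicOpen b ⊓ Z.basicOpen (c i) from
              inf_le_inf_right _ (inf_le_right.trans eb))) (hz i)
          simp only [pRes_pRes] at e1 e2 ⊢
          rw [e1, e2])
        refine ⟨w, fun i => hA.eq_of_locally_eq hB (haff _ _) _ _ fun p hp => ?_⟩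
        have hp' : p ∈ Z.basicOpen a ∨ p ∈ Z.basicOpen b :=
          Z.basicOpen_add_le a b (inf_le_left (a := Z.basicOpen (a + b)) hp)
        rcases hp' with hp' | hp'
        · refine ⟨Z.basicOpen (a + b) ⊓ Z.basicOpen (c i) ⊓ Z.basicOpen a, inf_le_left,
            ⟨hp, hp'⟩, ?_⟩
          have e1 := congrArg (pRes A (show Z.basicOpen (a + b) ⊓ Z.basicOpen (c i) ⊓
            Z.basicOpen a ≤ Z.basicOpen a' from h2.ge.trans' (le_inf (inf_le_left.trans inf_le_left)
              inf_le_right))) hw1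
          have e2 := congrArg (pRes A (show Z.basicOpen (a + b) ⊓ Z.basicOpen (c i) ⊓
            Z.basicOpen a ≤ Z.basicOpen a ⊓ Z.basicOpen (c i) from
              le_inf inf_le_right (inf_le_left.trans inf_le_right))) (hy i)
          simp only [pRes_pRes] at e1 e2 ⊢
          rw [e1, e2]
        · refine ⟨Z.basicOpen (a + b) ⊓ Z.basicOpen (c i) ⊓ Z.basicOpen b, inf_le_left,
            ⟨hp, hp'⟩, ?_⟩
          have e1 := congrArg (pRes A (show Z.basicOpen (a + b) ⊓ Z.basicOpen (c i) ⊓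
            Z.basicOpen b ≤ Z.basicOpen b' from h3.ge.trans' (le_inf (inf_le_left.trans inf_le_left)
              inf_le_right))) hw2
          have e2 := congrArg (pRes A (show Z.basicOpen (a + b) ⊓ Z.basicOpen (c i) ⊓
            Z.basicOpen b ≤ Z.basicOpen b ⊓ Z.basicOpen (c i) from
              le_inf inf_le_right (inf_le_left.trans inf_le_right))) (hz i)
          simp only [pRes_pRes] at e1 e2 ⊢
          rw [e1, e2]
      smul_mem' := fun d a ha => by
        obtain ⟨y, hy⟩ := ha
        have h1 : Z.basicOpen (d • a) ≤ Z.basicOpen a := by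
          rw [smul_eq_mul, Scheme.basicOpen_mul]
          exact inf_le_right
        refine ⟨pRes A h1 y, fun i => ?_⟩
        have := congrArg (pRes A (inf_le_inf_right (Z.basicOpen (c i)) h1)) (hy i)
        simp only [pRes_pRes] at this ⊢
        exact this }
  have hJ : J = ⊤ := by
    rw [← Ideal.span_eq J]
    refine (hB.isAffineOpen hU).self_le_iSup_basicOpen_iff.1 fun z hz => ?_
    obtain ⟨i, hi⟩ := Opens.mem_iSup.1 (hc hz)
    exact Opens.mem_iSup.2 ⟨⟨c i, x i, fun j => hx i j⟩, hi⟩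
  obtain ⟨y, hy⟩ := show (1 : Γ(Z, U)) ∈ J from hJ ▸ Submodule.mem_top
  have h2 : U ≤ Z.basicOpen (1 : Γ(Z, U)) := Z.basicOpen_one.ge
  refine ⟨pRes A h2 y, fun i => ?_⟩
  have := congrArg (pRes A (le_inf ((Z.basicOpen_le (c i)).trans h2) (le_refl (Z.basicOpen (c i)))))
    (hy i)
  simp only [pRes_pRes, pRes_refl] at this ⊢
  exact this

end TwoCover

/-! ### Vanishing of cohomology over affine open subsets -/

section CohPresheaf

open Abelian

variable {Y : TopCat.{u}}

/-- The free abelian sheaf on the empty set is zero, since every sheaf has only one section there;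
so its identity is zero and Ext out of it vanishes. -/
lemma coh_bot (F : TopCat.Sheaf AddCommGrpCat.{u} Y) (q : ℕ) (x : coh F q (⊥ : Opens Y)) :
    x = 0 := by
  have h : ∀ (G : TopCat.Sheaf AddCommGrpCat.{u} Y) (k : freeOn (⊥ : Opens Y) ⟶ G), k = 0 := by
    intro G k
    refine (secAddEquiv G ⊥).injective (sheaf_eq_of_locally_eq _ _ fun y hy => ?_)
    exact absurd hy (by simp)
  rw [← Ext.mk₀_id_comp x, h _ (𝟙 _), Ext.mk₀_zero, Ext.zero_comp]

/-- The presheaf `V ↦ H^q(g(V), F)` for a monotone map `g` between sets of open subsets. -/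
def cohPresheaf {Z : Scheme.{u}} {g : Z.Opens → Opens Y} (hg : Monotone g)
    (F : TopCat.Sheaf AddCommGrpCat.{u} Y) (q : ℕ) : TopCat.Presheaf AddCommGrpCat.{u} Z where
  obj V := AddCommGrpCat.of (coh F q (g V.unop))
  map i := AddCommGrpCat.ofHom (cohRes F q (hg i.unop.le))
  map_id _ := AddCommGrpCat.ext fun x => cohRes_refl x
  map_comp i j := AddCommGrpCat.ext fun x => (cohRes_cohRes (hg j.unop.le) (hg i.unop.le) x).symm

lemma basicOpen_sup_of_add_eq_one {Z : Scheme.{u}} {U : Z.Opens} {a b : Γ(Z, U)}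
    (h : a + b = 1) : U = Z.basicOpen a ⊔ Z.basicOpen b := by
  refine le_antisymm ?_ (sup_le (Z.basicOpen_le a) (Z.basicOpen_le b))
  refine le_trans ?_ (Z.basicOpen_add_le a b)
  rw [h]
  exact Z.basicOpen_one.ge

variable {Z : Scheme.{u}} {g : Z.Opens → Opens Y} (hg : Monotone g)
  (F : TopCat.Sheaf AddCommGrpCat.{u} Y) (q : ℕ)

/-- The Mayer-Vietoris sequence for two basic open subsets splits into short exact pieces in
degree `q`. -/
def CohSurjTwo (g : Z.Opens → Opens Y) (F : TopCat.Sheaf AddCommGrpCat.{u} Y) (q : ℕ)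
    (B : Set Z.Opens) : Prop :=
  ∀ (U : Z.Opens) (_ : U ∈ B) (a b : Γ(Z, U)), a + b = 1 →
    ∀ (I : Opens Y) (hI : I = g (Z.basicOpen a) ⊓ g (Z.basicOpen b)) (y : coh F q I),
      ∃ (s : coh F q (g (Z.basicOpen a))) (t : coh F q (g (Z.basicOpen b))),
        cohRes F q (hI.le.trans inf_le_left) s - cohRes F q (hI.le.trans inf_le_right) t = y

variable {B : Set Z.Opens} (hsup : ∀ U V, g (U ⊔ V) = g U ⊔ g V)
  (hinf : ∀ U V, g (U ⊓ V) = g U ⊓ g V) (hbot : g ⊥ = ⊥)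

include hsup in
lemma sup_of_add_eq_one {U : Z.Opens} {a b : Γ(Z, U)} (h : a + b = 1) :
    g U = g (Z.basicOpen a) ⊔ g (Z.basicOpen b) := by
  rw [← hsup, ← basicOpen_sup_of_add_eq_one h]

include hsup hbot in
-- Where the differences of restrictions are surjective in degree q, the connecting map into degree
-- q + 1 is zero, so a class in degree q + 1 is determined by its restrictions to the two parts.
lemma sepTwo_cohPresheaf (h : CohSurjTwo g F q B) : SepTwo (cohPresheaf hg F (q + 1)) B := by
  refine ⟨fun x => ?_, fun U hU a b hab x ha hb => ?_⟩
  · have h1 := coh_bot F (q + 1) (cohRes F (q + 1) hbot.ge x)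
    have h2 := congrArg (cohRes F (q + 1) hbot.le) h1
    exact (cohRes_refl x).symm.trans ((cohRes_cohRes hbot.le hbot.ge x).symm.trans
      (h2.trans (map_zero _)))
  · exact coh_eq_zero_of_sup (sup_of_add_eq_one hsup hab) rfl x ha hb (h U hU a b hab _ rfl)

include hsup hinf in
-- This is exactness of the Mayer–Vietoris sequence in the middle; unlike separatedness it needs
-- nothing about the sheaf.
lemma glueTwo_cohPresheaf : GlueTwo (cohPresheaf hg F q) B := by
  intro U hU a b hab y z hyz
  exact mv_exact_res (sup_of_add_eq_one hsup hab) (hinf _ _) y z hyz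

end CohPresheaf

/-! ### Affine vanishing from two-element covers, and the case of the structure sheaf -/

section Affine

variable {X : Scheme.{u}}

lemma isBasicClass_affine : IsBasicClass {U : X.Opens | IsAffineOpen U} where
  isAffineOpen h := h
  basicOpen_mem h a := IsAffineOpen.basicOpen h a

/-- All sections over the intersection of two basic open subsets that cover an affine open subset
are differences. -/
def SecSurjTwo (F : TopCat.Sheaf AddCommGrpCat.{u} X) : Prop :=
  ∀ (U : X.Opens) (_ : IsAffineOpen U) (a b : Γ(X, U)), a + b = 1 →
    ∀ y : F.obj.obj (op (X.basicOpen a ⊓ X.basicOpen b)),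
      ∃ (s : F.obj.obj (op (X.basicOpen a))) (t : F.obj.obj (op (X.basicOpen b))),
        F.obj.map (homOfLE inf_le_left).op s - F.obj.map (homOfLE inf_le_right).op t = y

/-- The higher cohomology of `F` over affine open subsets vanishes. -/
def AffineAcyclic (F : TopCat.Sheaf AddCommGrpCat.{u} X) : Prop :=
  ∀ (q : ℕ) (U : X.Opens), IsAffineOpen U → ∀ x : coh F (q + 1) U, x = 0

/-- Classes of positive degree vanish locally, so it suffices that the presheaf H^(q+1) is separated
on affine opens. For q = 0 the hypothesis on sections says this; for q > 0 the intersection of two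
basic opens is affine, and H^q vanishes on it by induction. -/
lemma SecSurjTwo.affineAcyclic {F : TopCat.Sheaf AddCommGrpCat.{u} X} (hF : SecSurjTwo F) :
    AffineAcyclic F := by
  intro q
  have step : ∀ q : ℕ, CohSurjTwo (Y := X) (id : X.Opens → X.Opens) F q
      {U : X.Opens | IsAffineOpen U} →
      ∀ (U : X.Opens), IsAffineOpen U → ∀ x : coh F (q + 1) U, x = 0 := by
    intro q h U hU x
    refine (sepTwo_cohPresheaf (Y := X) (Z := X) (g := id) monotone_id F q (fun _ _ => rfl) rfl
      h).eq_zero isBasicClass_affine hU x fun z hz => ?_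
    exact exists_cohRes_eq_zero x hz
  induction q with
  | zero =>
    refine step 0 fun U hU a b hab I hI y => ?_
    subst hI
    obtain ⟨y, rfl⟩ := (cohZero F _).symm.surjective y
    obtain ⟨s, t, rfl⟩ := hF U hU a b hab y
    refine ⟨(cohZero F _).symm s, (cohZero F _).symm t, ?_⟩
    rw [map_sub, cohRes_cohZero_symm, cohRes_cohZero_symm]
  | succ q ih =>
    refine step (q + 1) fun U hU a b hab I hI y => ⟨0, 0, ?_⟩
    subst hI
    rw [map_zero, map_zero, sub_zero]
    refine (ih _ ?_ y).symm
    have h1 : IsAffineOpen (X.basicOpen a ⊓ X.basicOpen b) := by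
      rw [← Scheme.basicOpen_mul]
      exact hU.basicOpen _
    exact h1

lemma exists_pow_mul_add {A : Type*} [CommRing A] {a b : A} (h : a + b = 1) (n : ℕ) :
    ∃ u v : A, u * a ^ n + v * b ^ n = 1 := by
  have h1 : IsCoprime a b := ⟨1, 1, by rw [one_mul, one_mul, h]⟩
  exact h1.pow

lemma exists_basicOpen_mul {U : X.Opens} (hU : IsAffineOpen U) (a : Γ(X, U)) {V : X.Opens}
    (hV : V = X.basicOpen a) (y : Γ(X, V)) : ∃ (n : ℕ) (s : Γ(X, U)),
      X.presheaf.map (homOfLE (hV.le.trans (X.basicOpen_le a))).op s =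
        X.presheaf.map (homOfLE (hV.le.trans (X.basicOpen_le a))).op a ^ n * y := by
  subst hV
  have := hU.isLocalization_basicOpen a
  obtain ⟨n, s, hs⟩ := IsLocalization.Away.surj a y
  exact ⟨n, s, hs.symm.trans (mul_comm _ _)⟩

lemma exists_pow_mul_eq_zero {U : X.Opens} (hU : IsAffineOpen U) (a : Γ(X, U)) {V : X.Opens}
    (hV : V = X.basicOpen a) (s : Γ(X, U))
    (h : X.presheaf.map (homOfLE (hV.le.trans (X.basicOpen_le a))).op s = 0) :
    ∃ n : ℕ, a ^ n * s = 0 := by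
  subst hV
  have := hU.isLocalization_basicOpen a
  obtain ⟨n, hn⟩ := IsLocalization.Away.exists_of_eq (S := Γ(X, X.basicOpen a)) (x := a)
    (a := s) (b := 0) (h.trans (map_zero _).symm)
  exact ⟨n, hn.trans (mul_zero _)⟩

/-- A partition of unity: y is a function on D(a) ∩ D(b) and becomes regular on D(a) after
multiplication by a power of b, and on D(b) after multiplication by a power of a. -/
lemma secSurjTwo_structSheaf : SecSurjTwo (structSheaf X) := by
  intro U hU a b hab (y : Γ(X, X.basicOpen a ⊓ X.basicOpen b))
  have res : ∀ {V W T : X.Opens} (i : V ≤ W) (j : W ≤ T) (z : Γ(X, T)),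
      (X.presheaf.map (homOfLE i).op).hom ((X.presheaf.map (homOfLE j).op).hom z) =
        (X.presheaf.map (homOfLE (i.trans j)).op).hom z := fun i j z =>
    (ConcreteCategory.congr_hom (X.presheaf.map_comp (homOfLE j).op (homOfLE i).op) z).symm
  have e1 : X.basicOpen a ⊓ X.basicOpen b =
      X.basicOpen ((X.presheaf.map (homOfLE (X.basicOpen_le a)).op).hom b) :=
    (Scheme.basicOpen_res X b (homOfLE (X.basicOpen_le a)).op).symm
  have e2 : X.basicOpen a ⊓ X.basicOpen b =
      X.basicOpen ((X.presheaf.map (homOfLE (X.basicOpen_le b)).op).hom a) :=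
    (inf_comm _ _).trans (Scheme.basicOpen_res X a (homOfLE (X.basicOpen_le b)).op).symm
  obtain ⟨n, s, hs⟩ := exists_basicOpen_mul (hU.basicOpen a) _ e1 y
  obtain ⟨m, t, ht⟩ := exists_basicOpen_mul (hU.basicOpen b) _ e2 y
  obtain ⟨u, v, huv⟩ := exists_pow_mul_add hab (n + m)
  let ra := (X.presheaf.map (homOfLE (X.basicOpen_le a)).op).hom
  let rb := (X.presheaf.map (homOfLE (X.basicOpen_le b)).op).hom
  let r := (X.presheaf.map (homOfLE (inf_le_left.trans (X.basicOpen_le a) :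
    X.basicOpen a ⊓ X.basicOpen b ≤ U)).op).hom
  let qa := (X.presheaf.map (homOfLE (inf_le_left : X.basicOpen a ⊓ X.basicOpen b ≤ _)).op).hom
  let qb := (X.presheaf.map (homOfLE (inf_le_right : X.basicOpen a ⊓ X.basicOpen b ≤ _)).op).hom
  have ea : ∀ z, qa (ra z) = r z := fun z => res _ _ z
  have eb : ∀ z, qb (rb z) = r z := fun z => res _ _ z
  have hs' : qa s = qa (ra b) ^ n * y := hs
  have ht' : qb t = qb (rb a) ^ m * y := ht
  -- Here s extends bⁿy and t extends aᵐy, so v bᵐ s + u aⁿ t restricts to (v b^(n+m) + u a^(n+m)) y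
  -- = y.
  refine ⟨ra (v * b ^ m) * s, -(rb (u * a ^ n) * t), ?_⟩
  change qa (ra (v * b ^ m) * s) - qb (-(rb (u * a ^ n) * t)) = y
  rw [map_neg, qa.map_mul, qb.map_mul, hs', ht', ea, ea, eb, eb]
  have h1 := congrArg r huv
  simp only [map_add, map_mul, map_pow, map_one] at h1 ⊢
  calc _ = (r u * r a ^ (n + m) + r v * r b ^ (n + m)) * y := by ring
    _ = y := by rw [h1, one_mul]

lemma affineAcyclic_structSheaf : AffineAcyclic (structSheaf X) :=
  secSurjTwo_structSheaf.affineAcyclic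

end Affine

/-! ### Localization of the cohomology of the structure sheaf -/

section MayerVietorisInduction

variable {Y : TopCat.{u}} {F G : TopCat.Sheaf AddCommGrpCat.{u} Y} {U V W I : Opens Y}

lemma coh_zero_eq_zero_of_sup (hW : W = U ⊔ V) (x : coh F 0 W)
    (h1 : cohRes F _ (le_sup_left.trans hW.ge) x = 0)
    (h2 : cohRes F _ (le_sup_right.trans hW.ge) x = 0) : x = 0 := by
  obtain ⟨s, rfl⟩ := (cohZero F W).symm.surjective x
  rw [cohRes_cohZero_symm, EmbeddingLike.map_eq_zero_iff] at h1 h2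
  rw [EmbeddingLike.map_eq_zero_iff]
  refine sheaf_eq_of_locally_eq s 0 fun y hy => ?_
  rw [hW] at hy
  rcases hy with hy | hy
  · exact ⟨U, le_sup_left.trans hW.ge, hy, h1.trans (map_zero _).symm⟩
  · exact ⟨V, le_sup_right.trans hW.ge, hy, h2.trans (map_zero _).symm⟩

/-- The five lemma for the Mayer–Vietoris sequences, with degree zero treated separately because
there the sequence starts with an injection. -/
lemma cohMap_bijective_of_sup (φ : F ⟶ G) (hW : W = U ⊔ V) (hI : I = U ⊓ V)
    (hU : ∀ p, Function.Bijective (cohMap φ p U)) (hV : ∀ p, Function.Bijective (cohMap φ p V))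
    (h : ∀ p, Function.Bijective (cohMap φ p I)) (p : ℕ) :
    Function.Bijective (cohMap φ p W) := by
  constructor
  · rw [injective_iff_map_eq_zero]
    intro x hx
    have h1 : cohRes F p (le_sup_left.trans hW.ge) x = 0 := (hU p).1 (by
      rw [cohMap_cohRes, hx, map_zero, map_zero])
    have h2 : cohRes F p (le_sup_right.trans hW.ge) x = 0 := (hV p).1 (by
      rw [cohMap_cohRes, hx, map_zero, map_zero])
    cases p with
    | zero => exact coh_zero_eq_zero_of_sup hW x h1 h2
    | succ p =>
      obtain ⟨y, rfl⟩ := mv_exact_δ hW hI x h1 h2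
      rw [cohMap_mvδ] at hx
      obtain ⟨s, t, hst⟩ := mv_exact_sub hW hI _ hx
      obtain ⟨s, rfl⟩ := (hU p).2 s
      obtain ⟨t, rfl⟩ := (hV p).2 t
      rw [← cohMap_cohRes, ← cohMap_cohRes, ← map_sub] at hst
      rw [← (h p).1 hst, mvδ_sub]
  · intro z
    obtain ⟨a, ha⟩ := (hU p).2 (cohRes G p (le_sup_left.trans hW.ge) z)
    obtain ⟨b, hb⟩ := (hV p).2 (cohRes G p (le_sup_right.trans hW.ge) z)
    obtain ⟨ω, rfl, rfl⟩ := mv_exact_res hW hI a b ((h p).1 (by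
      rw [cohMap_cohRes, cohMap_cohRes, ha, hb, cohRes_cohRes, cohRes_cohRes]))
    rw [cohMap_cohRes] at ha hb
    have h1 : cohRes G p (le_sup_left.trans hW.ge) (z - cohMap φ p W ω) = 0 := by
      rw [map_sub, ha, sub_self]
    have h2 : cohRes G p (le_sup_right.trans hW.ge) (z - cohMap φ p W ω) = 0 := by
      rw [map_sub, hb, sub_self]
    cases p with
    | zero => exact ⟨ω, (sub_eq_zero.1 (coh_zero_eq_zero_of_sup hW _ h1 h2)).symm⟩
    | succ p =>
      obtain ⟨y, hy⟩ := mv_exact_δ hW hI _ h1 h2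
      obtain ⟨y, rfl⟩ := (h p).2 y
      refine ⟨ω + mvδ F p hW hI y, ?_⟩
      rw [map_add, cohMap_mvδ, hy, add_sub_cancel]

end MayerVietorisInduction

/-! ### Cohomology over the locus where an element of the base is invertible -/

section Localization

variable {R : Type u} [CommRing R] {X : Scheme.{u}} (f : X ⟶ Spec (.of R))

lemma isAffineOpen_inf [IsSeparated f] {U V : X.Opens} (hU : IsAffineOpen U)
    (hV : IsAffineOpen V) : IsAffineOpen (U ⊓ V) :=
  isAffineHom_diagonal_iff.mp (inferInstance : IsAffineHom (Limits.pullback.diagonal f)) ⊤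
    (isAffineOpen_top _) U le_top V le_top hU hV

include f in
-- Every open is a finite union of affine opens, and the induction is on their number. Separatedness
-- over an affine base keeps intersections of affine opens affine, so the intersection of one affine
-- open with a union of n others is again a union of n affine opens.
lemma opens_induction [IsNoetherian X] [IsSeparated f] {P : X.Opens → Prop}
    (h1 : ∀ U, IsAffineOpen U → P U)
    (h2 : ∀ U V, P U → P V → P (U ⊓ V) → P (U ⊔ V)) (W : X.Opens) : P W := by
  have key : ∀ l : List X.Opens, (∀ U ∈ l, IsAffineOpen U) → P (l.foldr (· ⊔ ·) ⊥) := by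
    have : ∀ (n : ℕ) (l : List X.Opens), l.length = n → (∀ U ∈ l, IsAffineOpen U) →
        P (l.foldr (· ⊔ ·) ⊥) := by
      intro n
      induction n with
      | zero =>
        intro l hl _
        rw [List.length_eq_zero_iff] at hl
        subst hl
        exact h1 ⊥ (isAffineOpen_bot X)
      | succ n ih =>
        intro l hl hU
        obtain ⟨U, l, rfl⟩ := List.exists_cons_of_length_eq_add_one hl
        have hln : l.length = n := by simpa using hl
        refine h2 U _ (h1 U (hU U (by simp))) (ih l hln fun V hV => hU V (by simp [hV])) ?_
        have e : ∀ m : List X.Opens, U ⊓ m.foldr (· ⊔ ·) ⊥ =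
            (m.map (U ⊓ ·)).foldr (· ⊔ ·) ⊥ := by
          intro m
          induction m with
          | nil => simp
          | cons V m ih => simp [inf_sup_left, ih]
        rw [e]
        refine ih _ (by simpa using hln) fun V hV => ?_
        obtain ⟨V, hV', rfl⟩ := List.mem_map.1 hV
        exact isAffineOpen_inf f (hU U (by simp)) (hU V (by simp [hV']))
    exact fun l => this _ l rfl
  obtain ⟨s, hs, e⟩ := isCompact_and_isOpen_iff_finite_and_eq_biUnion_affineOpens.1
    ⟨NoetherianSpace.isCompact (W : Set X), W.2⟩
  have e' : W = (hs.toFinset.toList.map Subtype.val).foldr (· ⊔ ·) ⊥ := by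
    have : ∀ (m : List X.affineOpens) (x : X),
        x ∈ (m.map Subtype.val).foldr (· ⊔ ·) ⊥ ↔ ∃ U ∈ m, x ∈ U.1 := by
      intro m x
      induction m with
      | nil => simp
      | cons V m ih =>
        rw [List.map_cons, List.foldr_cons]
        change (x ∈ V.1 ∨ x ∈ (m.map Subtype.val).foldr (· ⊔ ·) ⊥) ↔ _
        rw [ih]
        simp
    refine TopologicalSpace.Opens.ext (Set.ext fun x => ?_)
    rw [e]
    refine Iff.trans ?_ (this _ x).symm
    simp
  rw [e']
  refine key _ fun U hU => ?_
  obtain ⟨U, -, rfl⟩ := List.mem_map.1 hU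
  exact U.2

/-- The open subset of `X` over which `h ∈ R` is invertible. -/
def awayOpen (h : R) : X.Opens := f ⁻¹ᵁ (PrimeSpectrum.basicOpen h)

lemma basicOpen_structMap (U : X.Opens) (h : R) :
    X.basicOpen (structMap f U h) = U ⊓ awayOpen f h := by
  refine (Scheme.basicOpen_appLE f U ⊤ le_top ((Scheme.ΓSpecIso (.of R)).inv h)).trans ?_
  rw [basicOpen_eq_of_affine]
  rfl

lemma mulStruct_mul (r s : R) : mulStruct f (r * s) = mulStruct f s ≫ mulStruct f r :=
  ObjectProperty.hom_ext _ (NatTrans.ext (funext fun U => AddCommGrpCat.ext fun (x : Γ(X, U.unop))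
      =>
    (congrArg (· * x) (map_mul (structMap f U.unop) r s)).trans (mul_assoc _ _ _)))

lemma mulStruct_add (r s : R) : mulStruct f (r + s) = mulStruct f r + mulStruct f s :=
  ObjectProperty.hom_ext _ (NatTrans.ext (funext fun U => AddCommGrpCat.ext fun (x : Γ(X, U.unop))
      =>
    (congrArg (· * x) (map_add (structMap f U.unop) r s)).trans (add_mul _ _ _)))

/-- The cohomology of the structure sheaf in degree zero consists of the functions. -/
def structZero (W : X.Opens) : coh (structSheaf X) 0 W ≃+ Γ(X, W) := cohZero (structSheaf X) W

lemma cohRes_structZero_symm {V W : X.Opens} (i : V ≤ W) (s : Γ(X, W)) :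
    cohRes _ 0 i ((structZero W).symm s) =
      (structZero V).symm (X.presheaf.map (homOfLE i).op s) :=
  cohRes_cohZero_symm (F := structSheaf X) i s

/-- The action of `R` on the cohomology of the structure sheaf. -/
def cohAct (r : R) (q : ℕ) (W : X.Opens) : coh (structSheaf X) q W →+ coh (structSheaf X) q W :=
  cohMap (mulStruct f r) q W

variable {f} {q : ℕ} {W : X.Opens}

lemma cohAct_structZero_symm (r : R) (s : Γ(X, W)) :
    cohAct f r 0 W ((structZero W).symm s) = (structZero W).symm (structMap f W r * s) :=
  cohMap_cohZero_symm (mulStruct f r) s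

lemma cohAct_mul (r s : R) (x : coh (structSheaf X) q W) :
    cohAct f (r * s) q W x = cohAct f r q W (cohAct f s q W x) := by
  rw [cohAct, mulStruct_mul, cohMap_comp]
  rfl

lemma cohAct_add (r s : R) (x : coh (structSheaf X) q W) :
    cohAct f (r + s) q W x = cohAct f r q W x + cohAct f s q W x := by
  rw [cohAct, mulStruct_add, cohMap_add]
  rfl

lemma cohAct_cohRes (r : R) {V : X.Opens} (i : V ≤ W) (x : coh (structSheaf X) q W) :
    cohAct f r q V (cohRes _ q i x) = cohRes _ q i (cohAct f r q W x) := cohMap_cohRes _ _ _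

lemma cohAct_mvδ (r : R) {I U V : X.Opens} (hW : W = U ⊔ V) (hI : I = U ⊓ V)
    (x : coh (structSheaf X) q I) : cohAct f r (q + 1) W (mvδ _ q hW hI x) =
      mvδ _ q hW hI (cohAct f r q I x) := cohMap_mvδ _ _ _ _

lemma cohAct_pow_of_le {h : R} {k l : ℕ} (hkl : k ≤ l) {x : coh (structSheaf X) q W}
    (hx : cohAct f (h ^ k) q W x = 0) : cohAct f (h ^ l) q W x = 0 := by
  rw [← Nat.sub_add_cancel hkl, pow_add, cohAct_mul, hx, map_zero]

variable [IsNoetherian X] [IsSeparated f] (h : R)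

/-- Over affine opens inside f⁻¹D(h) the function h is a unit and the higher cohomology vanishes;
the rest is the five lemma. The induction runs over the opens `W ⊓ awayOpen f h` with W arbitrary,
since the induction principle speaks of all opens of X. -/
lemma cohAct_bijective (p : ℕ) (hW : W ≤ awayOpen f h) : Function.Bijective (cohAct f h p W) := by
  have key : ∀ W : X.Opens, ∀ p, Function.Bijective (cohAct f h p (W ⊓ awayOpen f h)) := by
    refine opens_induction f (fun U hU p => ?_) (fun U V hU hV hI p => ?_)
    · have e := basicOpen_structMap f U h
      have hU' : IsAffineOpen (U ⊓ awayOpen f h) := e ▸ hU.basicOpen _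
      cases p with
      | zero =>
        have hu : IsUnit (structMap f (U ⊓ awayOpen f h) h) := by
          rw [← e, ← map_structMap f (homOfLE (X.basicOpen_le (structMap f U h)))]
          exact RingedSpace.isUnit_res_basicOpen _ _
        obtain ⟨v, hv⟩ := hu
        constructor
        · intro x y hxy
          obtain ⟨s, rfl⟩ := (structZero _).symm.surjective x
          obtain ⟨t, rfl⟩ := (structZero _).symm.surjective y
          rw [cohAct_structZero_symm, cohAct_structZero_symm, ← hv] at hxy
          exact congrArg _ ((Units.mul_right_inj v).1 ((structZero _).symm.injective hxy))
        · intro y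
          obtain ⟨t, rfl⟩ := (structZero _).symm.surjective y
          refine ⟨(structZero _).symm (↑v⁻¹ * t), ?_⟩
          rw [cohAct_structZero_symm, ← hv, Units.mul_inv_cancel_left]
      | succ p =>
        have h0 := affineAcyclic_structSheaf p _ hU'
        exact ⟨fun x y _ => (h0 x).trans (h0 y).symm, fun x => ⟨0, by rw [map_zero, h0 x]⟩⟩
    · refine cohMap_bijective_of_sup (mulStruct f h) (U := U ⊓ awayOpen f h)
        (V := V ⊓ awayOpen f h) (I := U ⊓ V ⊓ awayOpen f h) (inf_sup_right _ _ _) ?_ hU hV hI p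
      exact inf_inf_distrib_right _ _ _
  have e : W ⊓ awayOpen f h = W := inf_eq_left.2 hW
  exact e ▸ key W p

/-- Both halves together say that restriction to f⁻¹D(h) is localization at h, in terms of
denominators. The affine case is localization of functions together with affine vanishing; the step
for a union is the five lemma with all denominators cleared by hand. -/
lemma exists_cohAct_localization (W : X.Opens) : ∀ p : ℕ,
    (∀ x : coh (structSheaf X) p W, cohRes _ p (inf_le_left : W ⊓ awayOpen f h ≤ W) x = 0 →
      ∃ k : ℕ, cohAct f (h ^ k) p W x = 0) ∧
    ∀ y : coh (structSheaf X) p (W ⊓ awayOpen f h), ∃ (k : ℕ) (x : coh (structSheaf X) p W),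
      cohRes _ p inf_le_left x = cohAct f (h ^ k) p _ y := by
  revert W
  refine opens_induction f (fun U hU p => ?_) (fun U V hU hV hI p => ?_)
  · have e := basicOpen_structMap f U h
    have hU' : IsAffineOpen (U ⊓ awayOpen f h) := e ▸ hU.basicOpen _
    cases p with
    | zero =>
      constructor
      · intro x hx
        obtain ⟨s, rfl⟩ := (structZero _).symm.surjective x
        rw [cohRes_structZero_symm, EmbeddingLike.map_eq_zero_iff] at hx
        obtain ⟨k, hk⟩ := exists_pow_mul_eq_zero hU (structMap f U h) e.symm s hx
        exact ⟨k, by rw [cohAct_structZero_symm, map_pow, hk, map_zero]⟩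
      · intro y
        obtain ⟨t, rfl⟩ := (structZero _).symm.surjective y
        obtain ⟨k, s, hs⟩ := exists_basicOpen_mul hU (structMap f U h) e.symm t
        refine ⟨k, (structZero _).symm s, ?_⟩
        rw [cohRes_structZero_symm, cohAct_structZero_symm, hs, map_structMap, map_pow]
    | succ p =>
      have h0 := affineAcyclic_structSheaf p _ hU
      have h0' := affineAcyclic_structSheaf p _ hU'
      exact ⟨fun x _ => ⟨0, by rw [h0 x, map_zero]⟩, fun y => ⟨0, 0, by
        rw [h0' y, map_zero, map_zero]⟩⟩
  · set D := awayOpen f h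
    have hW' : (U ⊔ V) ⊓ D = (U ⊓ D) ⊔ (V ⊓ D) := inf_sup_right _ _ _
    have hI' : U ⊓ V ⊓ D = (U ⊓ D) ⊓ (V ⊓ D) := inf_inf_distrib_right _ _ _
    constructor
    · intro x hx
      obtain ⟨k, hk⟩ := (hU p).1 (cohRes _ p le_sup_left x) (by
        rw [cohRes_cohRes, ← cohRes_cohRes (V := (U ⊔ V) ⊓ D) (inf_le_inf_right D le_sup_left)
            inf_le_left, hx,
          map_zero])
      obtain ⟨l, hl⟩ := (hV p).1 (cohRes _ p le_sup_right x) (by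
        rw [cohRes_cohRes, ← cohRes_cohRes (V := (U ⊔ V) ⊓ D) (inf_le_inf_right D le_sup_right)
            inf_le_left, hx,
          map_zero])
      -- The exponents for the two parts are replaced by the common exponent k + l.
      replace hk := cohAct_pow_of_le (Nat.le_add_right k l) hk
      replace hl := cohAct_pow_of_le (Nat.le_add_left l k) hl
      rw [cohAct_cohRes] at hk hl
      cases p with
      | zero => exact ⟨k + l, coh_zero_eq_zero_of_sup (W := U ⊔ V) rfl _ hk hl⟩
      | succ p =>
        -- The class h^(k+l) x is the boundary of some y. The boundary of y over D vanishes, so y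
        -- restricts there to a difference s - t. After multiplication by h^m and h^m' these extend
        -- to s' and t', and h^(m+m') y - (h^m' s' - h^m t') restricts to zero over D, hence is
        -- killed by some hⁿ. Since differences have zero boundary, h^(n+m+m') y has zero boundary
        -- too.
        obtain ⟨y, hy⟩ := mv_exact_δ (W := U ⊔ V) rfl (I := U ⊓ V) rfl _ hk hl
        have h1 : mvδ _ p hW' hI' (cohRes _ p inf_le_left y) = 0 := by
          rw [← cohRes_mvδ (W := U ⊔ V) rfl (I := U ⊓ V) rfl hW' hI' inf_le_left inf_le_left
            inf_le_left, hy, ← cohAct_cohRes, hx, map_zero]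
        obtain ⟨s, t, hst⟩ := mv_exact_sub hW' hI' _ h1
        obtain ⟨m, s', hs⟩ := (hU p).2 s
        obtain ⟨m', t', ht⟩ := (hV p).2 t
        obtain ⟨n, hn⟩ := (hI p).1 (cohAct f (h ^ (m + m')) p _ y -
            (cohRes _ p inf_le_left (cohAct f (h ^ m') p _ s') -
              cohRes _ p inf_le_right (cohAct f (h ^ m) p _ t'))) (by
          have hs2 := congrArg (cohRes _ p (hI'.le.trans inf_le_left)) hs
          have ht2 := congrArg (cohRes _ p (hI'.le.trans inf_le_right)) ht
          rw [cohRes_cohRes] at hs2 ht2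
          rw [map_sub, map_sub, cohRes_cohRes, cohRes_cohRes, ← cohAct_cohRes, ← cohAct_cohRes,
            ← cohAct_cohRes, ← hst, map_sub, hs2, ht2, ← cohAct_cohRes, ← cohAct_cohRes,
            ← cohAct_mul, ← cohAct_mul, ← pow_add, ← pow_add, add_comm m' m, sub_self])
        refine ⟨n + (m + m') + (k + l), ?_⟩
        rw [pow_add, cohAct_mul, ← hy, cohAct_mvδ, pow_add, cohAct_mul, ← sub_add_cancel
          (cohAct f (h ^ (m + m')) p _ y) (cohRes _ p inf_le_left (cohAct f (h ^ m') p _ s') -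
            cohRes _ p inf_le_right (cohAct f (h ^ m) p _ t')), map_add, hn, zero_add, map_sub,
          cohAct_cohRes, cohAct_cohRes]
        exact mvδ_sub rfl rfl _ _
    · intro y
      obtain ⟨k, a, ha⟩ := (hU p).2 (cohRes _ p (inf_le_inf_right D le_sup_left) y)
      obtain ⟨l, b, hb⟩ := (hV p).2 (cohRes _ p (inf_le_inf_right D le_sup_right) y)
      obtain ⟨m, hm⟩ := (hI p).1 (cohRes _ p inf_le_left (cohAct f (h ^ l) p _ a) -
          cohRes _ p inf_le_right (cohAct f (h ^ k) p _ b)) (by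
        have ha2 := congrArg (cohRes _ p (hI'.le.trans inf_le_left)) ha
        have hb2 := congrArg (cohRes _ p (hI'.le.trans inf_le_right)) hb
        rw [cohRes_cohRes] at ha2 hb2
        rw [map_sub, cohRes_cohRes, cohRes_cohRes, ← cohAct_cohRes, ← cohAct_cohRes, ha2, hb2,
          ← cohAct_cohRes, ← cohAct_cohRes, cohRes_cohRes, cohRes_cohRes, ← cohAct_mul,
          ← cohAct_mul, ← pow_add, ← pow_add, add_comm l k, sub_self])
      rw [map_sub, cohAct_cohRes, cohAct_cohRes, ← cohAct_mul, ← cohAct_mul, ← pow_add, ← pow_add,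
        sub_eq_zero] at hm
      -- The glued class w equals h^(m+l+k) y on both parts of W ∩ D. In degree zero this is
      -- equality. In positive degree the discrepancy is the boundary of a class z on the
      -- intersection, and hⁿz extends to z' for some n, so the boundary of z' corrects hⁿw.
      obtain ⟨w, hw1, hw2⟩ := mv_exact_res (W := U ⊔ V) rfl (I := U ⊓ V) rfl _ _ hm
      have h1 : cohRes _ p (le_sup_left.trans hW'.ge) (cohAct f (h ^ (m + l + k)) p _ y -
          cohRes _ p inf_le_left w) = 0 := by
        have := congrArg (cohRes _ p (inf_le_left : U ⊓ D ≤ U)) hw1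
        rw [cohRes_cohRes, ← cohAct_cohRes, ha, ← cohAct_mul, ← pow_add] at this
        rw [map_sub, cohRes_cohRes, this, ← cohAct_cohRes, sub_self]
      have h2 : cohRes _ p (le_sup_right.trans hW'.ge) (cohAct f (h ^ (m + l + k)) p _ y -
          cohRes _ p inf_le_left w) = 0 := by
        have := congrArg (cohRes _ p (inf_le_left : V ⊓ D ≤ V)) hw2
        rw [cohRes_cohRes, ← cohAct_cohRes, hb, ← cohAct_mul, ← pow_add] at this
        rw [map_sub, cohRes_cohRes, this, ← cohAct_cohRes, add_right_comm, sub_self]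
      cases p with
      | zero =>
        exact ⟨m + l + k, w, (sub_eq_zero.1 (coh_zero_eq_zero_of_sup hW' _ h1 h2)).symm⟩
      | succ p =>
        obtain ⟨z, hz⟩ := mv_exact_δ hW' hI' _ h1 h2
        obtain ⟨n, z', hz'⟩ := (hI p).2 z
        refine ⟨n + (m + l + k), cohAct f (h ^ n) _ _ w + mvδ _ p rfl rfl z', ?_⟩
        rw [map_add, cohRes_mvδ (W := U ⊔ V) rfl (I := U ⊓ V) rfl hW' hI' inf_le_left inf_le_left
          inf_le_left inf_le_left, hz', ← cohAct_mvδ, hz, ← cohAct_cohRes, ← map_add,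
          add_sub_cancel, ← cohAct_mul, ← pow_add]

end Localization

/-! ### Cohomology of the structure sheaf over basic open subsets of the base -/

section Base

variable {R : Type u} [CommRing R]

/-- The class of the basic open subsets of `Spec R`. -/
def basicClass (R : Type u) [CommRing R] : Set (Spec (.of R)).Opens :=
  {U | ∃ g : R, U = PrimeSpectrum.basicOpen g}

/-- A function on D(g) becomes the restriction of some r ∈ R after multiplication by a power of g,
which does not change its locus of invertibility inside D(g). -/
lemma exists_basicOpen_eq {U : (Spec (.of R)).Opens} {g : R} (hU : U = PrimeSpectrum.basicOpen g)
    (a : Γ(Spec (.of R), U)) : ∃ r : R,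
      (Spec (.of R)).basicOpen a = PrimeSpectrum.basicOpen (g * r) := by
  have e : U = (Spec (.of R)).basicOpen ((Scheme.ΓSpecIso (.of R)).inv g) := by
    rw [basicOpen_eq_of_affine, hU]
  obtain ⟨n, s, hs⟩ := exists_basicOpen_mul (isAffineOpen_top (Spec (.of R))) _ e a
  obtain ⟨r, rfl⟩ : ∃ r, (Scheme.ΓSpecIso (.of R)).inv r = s :=
    ⟨(Scheme.ΓSpecIso (.of R)).hom s, by
      rw [← ConcreteCategory.comp_apply, Iso.hom_inv_id, ConcreteCategory.id_apply]⟩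
  refine ⟨r, ?_⟩
  have h1 := congrArg (fun t => (Spec (.of R)).basicOpen t) hs
  simp only at h1
  rw [Scheme.basicOpen_res, basicOpen_eq_of_affine, Scheme.basicOpen_mul,
    Scheme.basicOpen_of_isUnit _ (IsUnit.pow n ?_)] at h1
  · rw [inf_eq_right.2 ((Spec (.of R)).basicOpen_le a)] at h1
    rw [← h1]
    refine (congrArg (· ⊓ _) hU).trans ?_
    exact (PrimeSpectrum.basicOpen_mul g r).symm
  · subst e
    exact RingedSpace.isUnit_res_basicOpen _ _

lemma isBasicClass_basicClass : IsBasicClass (basicClass R) where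
  isAffineOpen := by
    rintro U ⟨g, rfl⟩
    have := (isAffineOpen_top (Spec (.of R))).basicOpen ((Scheme.ΓSpecIso (.of R)).inv g)
    rwa [basicOpen_eq_of_affine] at this
  basicOpen_mem := by
    rintro U ⟨g, hU⟩ a
    obtain ⟨r, hr⟩ := exists_basicOpen_eq hU a
    exact ⟨g * r, hr⟩

lemma basicOpen_le_basicOpen_pow (g : R) (m : ℕ) :
    PrimeSpectrum.basicOpen g ≤ PrimeSpectrum.basicOpen (g ^ m) := by
  intro x hx
  exact fun h => hx (x.2.mem_of_pow_mem m h)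

/-- The inclusion of opens says that every prime containing r^k and s^k contains g, so g lies in the
radical of the ideal they generate. -/
lemma exists_pow_eq_of_basicOpen_le {g r s : R}
    (h : PrimeSpectrum.basicOpen g ≤ PrimeSpectrum.basicOpen r ⊔ PrimeSpectrum.basicOpen s)
    (k : ℕ) : ∃ (m : ℕ) (u v : R), g ^ m = u * r ^ k + v * s ^ k := by
  have h1 : g ∈ (Ideal.span {r ^ k, s ^ k}).radical := by
    rw [Ideal.radical_eq_sInf, Ideal.mem_sInf]
    rintro p ⟨hp, hpp⟩
    by_contra hg
    have h2 := h (show (⟨p, hpp⟩ : PrimeSpectrum R) ∈ PrimeSpectrum.basicOpen g from hg)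
    rcases h2 with h2 | h2
    · exact h2 (hpp.mem_of_pow_mem k (hp (Ideal.subset_span (by simp))))
    · exact h2 (hpp.mem_of_pow_mem k (hp (Ideal.subset_span (by simp))))
  obtain ⟨m, hm⟩ := h1
  obtain ⟨u, v, huv⟩ := Ideal.mem_span_pair.1 hm
  exact ⟨m, u, v, huv.symm⟩

variable {X : Scheme.{u}} (f : X ⟶ Spec (.of R))

/-- The inverse image of an open subset of the base. -/
def preim (V : (Spec (.of R)).Opens) : X.Opens := f ⁻¹ᵁ V

lemma preim_monotone : Monotone (preim f) := fun _ _ h _ hx => h hx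

variable {f} in
-- The partition of unity argument for functions, transferred to H^p: localization extends classes
-- after multiplication by powers of s or r, and powers of g may be divided out because they act
-- bijectively over f⁻¹D(g).
lemma exists_sub_of_cover [IsNoetherian X] [IsSeparated f] {g r s : R}
    (hc : PrimeSpectrum.basicOpen g ≤ PrimeSpectrum.basicOpen r ⊔ PrimeSpectrum.basicOpen s)
    (hr : PrimeSpectrum.basicOpen r ≤ PrimeSpectrum.basicOpen g)
    (hs : PrimeSpectrum.basicOpen s ≤ PrimeSpectrum.basicOpen g) (p : ℕ)
    (y : coh (structSheaf X) p (awayOpen f r ⊓ awayOpen f s)) :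
    ∃ (a : coh (structSheaf X) p (awayOpen f r)) (b : coh (structSheaf X) p (awayOpen f s)),
      cohRes _ p inf_le_left a - cohRes _ p inf_le_right b = y := by
  obtain ⟨k, x, hx⟩ := (exists_cohAct_localization s (awayOpen f r) p).2 y
  obtain ⟨l, z, hz⟩ := (exists_cohAct_localization r (awayOpen f s) p).2
    (cohRes _ p (inf_comm (awayOpen f r) (awayOpen f s)).ge y)
  replace hz := congrArg (cohRes _ p (inf_comm (awayOpen f r) (awayOpen f s)).le) hz
  rw [cohRes_cohRes, ← cohAct_cohRes, cohRes_cohRes, cohRes_refl] at hz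
  obtain ⟨m, u, v, huv⟩ := exists_pow_eq_of_basicOpen_le hc (l + k)
  have hg : ∀ W ≤ awayOpen f g, Function.Bijective (cohAct f (g ^ m) p W) := fun W hW =>
    cohAct_bijective _ p (hW.trans (preim_monotone f (basicOpen_le_basicOpen_pow g m)))
  have hr' : awayOpen f r ≤ awayOpen f g := preim_monotone f hr
  have hs' : awayOpen f s ≤ awayOpen f g := preim_monotone f hs
  -- Now x extends s^k y and z extends r^l y, and g^m = u r^(l+k) + v s^(l+k). With a = g^(-m) v s^l
  -- x and b = -g^(-m) u r^k z the difference a - b restricts to y.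
  obtain ⟨a, ha⟩ := (hg _ hr').2 (cohAct f (v * s ^ l) p _ x)
  obtain ⟨b, hb⟩ := (hg _ hs').2 (-cohAct f (u * r ^ k) p _ z)
  refine ⟨a, b, (hg _ (inf_le_left.trans hr')).1 ?_⟩
  rw [map_sub, cohAct_cohRes, cohAct_cohRes, ha, hb, map_neg, ← cohAct_cohRes, ← cohAct_cohRes, hx,
    hz, sub_neg_eq_add, ← cohAct_mul, ← cohAct_mul, ← cohAct_add, huv]
  congr 2
  ring

lemma cohSurjTwo_structSheaf [IsNoetherian X] [IsSeparated f] (p : ℕ) :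
    CohSurjTwo (Y := X) (preim f) (structSheaf X) p (basicClass R) := by
  rintro U ⟨g, hU⟩ a b hab I hI y
  obtain ⟨r, hr⟩ := exists_basicOpen_eq hU a
  obtain ⟨s, hs⟩ := exists_basicOpen_eq hU b
  -- The opens D(a) and D(b) are only propositionally equal to basic opens of elements of R;
  -- generalizing them allows the equalities to be substituted in the types of the classes.
  have key : ∀ (D D' : (Spec (.of R)).Opens) (_ : D = PrimeSpectrum.basicOpen (g * r))
      (_ : D' = PrimeSpectrum.basicOpen (g * s)) (_ : U = D ⊔ D') (hI : I = preim f D ⊓ preim f D'),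
      ∃ (s : coh (structSheaf X) p (preim f D)) (t : coh (structSheaf X) p (preim f D')),
        cohRes _ p (hI.le.trans inf_le_left) s - cohRes _ p (hI.le.trans inf_le_right) t = y := by
    rintro _ _ rfl rfl hc rfl
    rw [hU] at hc
    exact exists_sub_of_cover (f := f) hc.le (le_sup_left.trans hc.ge) (le_sup_right.trans hc.ge) p
        y
  exact key _ _ hr hs (basicOpen_sup_of_add_eq_one hab) hI

end Base

/-! ### Cocycles and the edge map -/

section AbHomology

variable {D D' : ShortComplex AddCommGrpCat.{u}}

/-- The homology class of a cycle. -/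
def homologyMk (D : ShortComplex AddCommGrpCat.{u}) : D.g.hom.ker →+ D.homology :=
  D.homologyπ.hom.comp D.abCyclesIso.inv.hom

lemma homologyMk_surjective : Function.Surjective (homologyMk D) := by
  intro x
  obtain ⟨y, rfl⟩ := (AddCommGrpCat.epi_iff_surjective D.homologyπ).1 inferInstance x
  refine ⟨D.abCyclesIso.hom y, ?_⟩
  exact congrArg D.homologyπ (ConcreteCategory.congr_hom D.abCyclesIso.hom_inv_id y)

lemma iCycles_injective : Function.Injective D.iCycles :=
  (AddCommGrpCat.mono_iff_injective D.iCycles).1 inferInstance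

lemma abCyclesIso_inv_eq (w : D.cycles) (z : D.g.hom.ker) (h : D.iCycles w = z.1) :
    D.abCyclesIso.inv z = w :=
  iCycles_injective ((D.abCyclesIso_inv_apply_iCycles z).trans h.symm)

lemma homologyMk_eq_zero_iff (z : D.g.hom.ker) :
    homologyMk D z = 0 ↔ ∃ y, D.f y = z.1 := by
  have h1 : (ShortComplex.mk D.toCycles D.homologyπ D.toCycles_comp_homologyπ).Exact :=
    ShortComplex.exact_of_g_is_cokernel _ D.homologyIsCokernel
  have h2 : ∀ y, D.iCycles (D.toCycles y) = D.f y := fun y =>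
    ConcreteCategory.congr_hom D.toCycles_i y
  constructor
  · intro h
    obtain ⟨y, hy⟩ := (ShortComplex.ab_exact_iff _).1 h1 _ h
    refine ⟨y, (h2 y).symm.trans ?_⟩
    exact (congrArg D.iCycles hy).trans (D.abCyclesIso_inv_apply_iCycles z)
  · rintro ⟨y, hy⟩
    have h3 : D.abCyclesIso.inv z = D.toCycles y := abCyclesIso_inv_eq _ _ ((h2 y).trans hy)
    refine (congrArg D.homologyπ h3).trans ?_
    exact ConcreteCategory.congr_hom D.toCycles_comp_homologyπ y

lemma homologyMap_homologyMk (t : D ⟶ D') (z : D.g.hom.ker) (z' : D'.g.hom.ker)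
    (h : t.τ₂ z.1 = z'.1) :
    ShortComplex.homologyMap t (homologyMk D z) = homologyMk D' z' := by
  refine (ConcreteCategory.congr_hom (ShortComplex.homologyπ_naturality t)
    (D.abCyclesIso.inv z)).trans ?_
  refine congrArg D'.homologyπ (abCyclesIso_inv_eq _ _ ?_).symm
  refine (ConcreteCategory.congr_hom (ShortComplex.cyclesMap_i t) _).trans ?_
  exact (congrArg t.τ₂ (D.abCyclesIso_inv_apply_iCycles z)).trans h

end AbHomology

/-! ### Homology classes under a left exact functor -/

section Comparison

variable {A : Type*} [Category A] [Abelian A] (G : A ⥤ AddCommGrpCat.{u}) [G.Additive]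
  [Limits.PreservesFiniteLimits G]

omit [G.Additive] in
lemma map_iCycles_injective (C : ShortComplex A) : Function.Injective (G.map C.iCycles) :=
  (AddCommGrpCat.mono_iff_injective _).1 inferInstance

lemma homologyComparison_homologyMk (C : ShortComplex A) (z : (C.map G).g.hom.ker)
    (w : G.obj C.cycles) (hw : G.map C.iCycles w = z.1) :
    homologyComparison G C (homologyMk _ z) = G.map C.homologyπ w := by
  have h : (C.map G).homologyπ ≫ homologyComparison G C =
      cyclesComparison G C ≫ G.map C.homologyπ := ShortComplex.π_descHomology _ _ _
  refine (ConcreteCategory.congr_hom h _).trans (congrArg (G.map C.homologyπ) ?_)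
  refine map_iCycles_injective G C (Eq.trans ?_ hw.symm)
  refine (ConcreteCategory.congr_hom (cyclesComparison_comp G C) _).trans ?_
  exact ShortComplex.abCyclesIso_inv_apply_iCycles _ _

lemma exists_map_iCycles (C : ShortComplex A) (z : (C.map G).g.hom.ker) :
    ∃ w : G.obj C.cycles, G.map C.iCycles w = z.1 := by
  refine ⟨cyclesComparison G C ((C.map G).abCyclesIso.inv z), ?_⟩
  refine (ConcreteCategory.congr_hom (cyclesComparison_comp G C) _).trans ?_
  exact ShortComplex.abCyclesIso_inv_apply_iCycles _ _

end Comparison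

/-! ### Cocycles over an open subset and sections of the homology sheaf -/

section Sections

variable {Y : TopCat.{u}}

/-- The functor of sections over `W`. -/
def secFunctor (W : Opens Y) : TopCat.Sheaf AddCommGrpCat.{u} Y ⥤ AddCommGrpCat.{u} :=
  TopCat.Sheaf.forget AddCommGrpCat.{u} Y ⋙ (evaluation _ _).obj (op W)

instance secFunctor_additive (W : Opens Y) : (secFunctor W).Additive where
  map_add := rfl

instance secFunctor_preservesFiniteLimits (W : Opens Y) :
    Limits.PreservesFiniteLimits (secFunctor W) := by
  have : Limits.PreservesFiniteLimits (TopCat.Sheaf.forget AddCommGrpCat.{u} Y) :=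
    inferInstanceAs (Limits.PreservesFiniteLimits (sheafToPresheaf _ _))
  have : Limits.PreservesFiniteLimits
      ((evaluation (Opens Y)ᵒᵖ AddCommGrpCat.{u}).obj (op W)) :=
    ⟨fun J _ _ => inferInstance⟩
  exact Limits.comp_preservesFiniteLimits _ _

/-- Restriction of sections, as a natural transformation. -/
def secRes {V W : Opens Y} (i : V ≤ W) : secFunctor W ⟶ secFunctor V where
  app F := F.obj.map (homOfLE i).op
  naturality _ _ φ := (φ.hom.naturality (homOfLE i).op).symm

variable (C : ShortComplex (TopCat.Sheaf AddCommGrpCat.{u} Y)) {V W : Opens Y}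

/-- Restriction of cocycles. -/
def cocycleRes (i : V ≤ W) (z : (C.map (secFunctor W)).g.hom.ker) :
    (C.map (secFunctor V)).g.hom.ker :=
  ⟨(secRes i).app C.X₂ z.1, by
    have h := ConcreteCategory.congr_hom ((secRes i).naturality C.g) z.1
    refine Eq.trans h.symm ?_
    exact (congrArg ((secRes i).app C.X₃) z.2).trans (map_zero _)⟩

lemma homologyComparison_cocycleRes (i : V ≤ W) (z : (C.map (secFunctor W)).g.hom.ker) :
    homologyComparison (secFunctor V) C (homologyMk _ (cocycleRes C i z)) =
      (secRes i).app C.homology (homologyComparison (secFunctor W) C (homologyMk _ z)) := by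
  obtain ⟨w, hw⟩ := exists_map_iCycles (secFunctor W) C z
  rw [homologyComparison_homologyMk (secFunctor W) C z w hw,
    homologyComparison_homologyMk (secFunctor V) C _ ((secRes i).app C.cycles w)]
  · exact (ConcreteCategory.congr_hom ((secRes i).naturality C.homologyπ) w).symm
  · refine (ConcreteCategory.congr_hom ((secRes i).naturality C.iCycles) w).symm.trans ?_
    exact congrArg ((secRes i).app C.X₂) hw

/-- The map from cycles to homology is an epimorphism of sheaves, so sections of the homology sheaf
lift locally to cycles. -/
lemma exists_local_homologyMk (x : (secFunctor W).obj C.homology) {y : Y} (hy : y ∈ W) :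
    ∃ (V : Opens Y) (i : V ≤ W), y ∈ V ∧ ∃ z,
      homologyComparison (secFunctor V) C (homologyMk _ z) = (secRes i).app C.homology x := by
  obtain ⟨V, i, hyV, w, hw⟩ := exists_local_lift C.homologyπ x hy
  have h0 : C.iCycles ≫ C.g = 0 := C.iCycles_g
  refine ⟨V, i, hyV, ⟨(secFunctor V).map C.iCycles w, ?_⟩, ?_⟩
  · have h1 := congrArg (fun k => (secFunctor V).map k) h0
    exact ConcreteCategory.congr_hom (((secFunctor V).map_comp _ _).symm.trans h1) w
  · exact (homologyComparison_homologyMk (secFunctor V) C _ w rfl).trans hw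

/-- A cocycle with zero class in the homology sheaf is a section of the image sheaf of the
differential, and such a section comes from a cochain locally. -/
lemma exists_local_boundary (z : (C.map (secFunctor W)).g.hom.ker)
    (hz : homologyComparison (secFunctor W) C (homologyMk _ z) = 0) {y : Y} (hy : y ∈ W) :
    ∃ (V : Opens Y) (i : V ≤ W), y ∈ V ∧ homologyMk _ (cocycleRes C i z) = 0 := by
  obtain ⟨w, hw⟩ := exists_map_iCycles (secFunctor W) C z
  rw [homologyComparison_homologyMk (secFunctor W) C z w hw] at hz
  let C' : ShortComplex (TopCat.Sheaf AddCommGrpCat.{u} Y) :=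
    ShortComplex.mk C.toCycles C.homologyπ C.toCycles_comp_homologyπ
  have hC' : C'.Exact := ShortComplex.exact_of_g_is_cokernel _ C.homologyIsCokernel
  have hepi : Epi C'.toCycles := hC'.epi_toCycles
  obtain ⟨v, hv⟩ := exists_map_iCycles (secFunctor W) C' ⟨w, hz⟩
  obtain ⟨V, i, hyV, t, ht⟩ := exists_local_lift C'.toCycles v hy
  refine ⟨V, i, hyV, (homologyMk_eq_zero_iff _).2 ⟨t, ?_⟩⟩
  have e1 : C.toCycles = C'.toCycles ≫ C'.iCycles := C'.toCycles_i.symm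
  have e2 : C.f = C'.toCycles ≫ C'.iCycles ≫ C.iCycles := by
    rw [← Category.assoc, ← e1, C.toCycles_i]
  have e3 : (secFunctor V).map C.f t = (secFunctor V).map C.iCycles
      ((secFunctor V).map C'.iCycles ((secFunctor V).map C'.toCycles t)) :=
    (congrArg (fun k => (secFunctor V).map k t) e2)
  refine e3.trans ?_
  refine (congrArg (fun k => (secFunctor V).map C.iCycles ((secFunctor V).map C'.iCycles k))
    ht).trans ?_
  have e4 := ConcreteCategory.congr_hom ((secRes i).naturality C'.iCycles) v
  have e5 := ConcreteCategory.congr_hom ((secRes i).naturality C.iCycles) w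
  refine (congrArg ((secFunctor V).map C.iCycles) (e4.symm.trans
    (congrArg ((secRes i).app C.cycles) hv))).trans ?_
  exact e5.symm.trans (congrArg ((secRes i).app C.X₂) hw)

end Sections

/-! ### Ext classes represented by cocycles in an injective resolution -/

section CohMk

open Abelian

/-- There are no coboundaries in degree zero: the resolution, viewed as a complex indexed by ℤ, is
zero in degree -1. -/
lemma extMk_zero_eq_zero {A : Type*} [Category A] [Abelian A] [HasExt.{u} A] {X Z : A}
    (I : InjectiveResolution Z) (k : X ⟶ I.cocomplex.X 0) (m : ℕ) (hm : 0 + 1 = m)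
    (hk : k ≫ I.cocomplex.d 0 m = 0) (h : I.extMk k m hm hk = 0) : k = 0 := by
  rw [← I.extEquivCohomologyClass.apply_eq_iff_eq, I.extEquivCohomologyClass_extMk,
    I.extEquivCohomologyClass_zero, CochainComplex.HomComplex.CohomologyClass.mk_eq_zero_iff,
    CochainComplex.HomComplex.Cocycle.fromSingleMk_mem_coboundaries_iff _ _ _ _ _ (-1) rfl] at h
  obtain ⟨g, hg⟩ := h
  have h0 : Limits.IsZero (I.cochainComplex.X (-1)) :=
    CochainComplex.isZero_of_isStrictlyGE I.cochainComplex 0 (-1) (by lia)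
  rw [h0.eq_of_tgt g 0, Limits.zero_comp] at hg
  exact (cancel_mono (I.cochainComplexXIso 0 0 rfl).inv).1 (hg.symm.trans Limits.zero_comp.symm)

variable {Y : TopCat.{u}} (F : TopCat.Sheaf AddCommGrpCat.{u} Y) (q : ℕ) (W : Opens Y)

/-- The part of degree `q` of an injective resolution. -/
abbrev resSc : ShortComplex (TopCat.Sheaf AddCommGrpCat.{u} Y) :=
  (injectiveResolution F).cocomplex.sc q

/-- The cocycles of degree `q` over `W` of an injective resolution. -/
abbrev Cocycles : AddSubgroup ((secFunctor W).obj (resSc F q).X₂) :=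
  ((resSc F q).map (secFunctor W)).g.hom.ker

variable {F q W} in
/-- The extension class of a homomorphism from a free sheaf to an injective resolution. -/
def extOf (k : freeOn W ⟶ (injectiveResolution F).cocomplex.X q)
    (hk : k ≫ (injectiveResolution F).cocomplex.d q ((ComplexShape.up ℕ).next q) = 0) :
    coh F q W :=
  (injectiveResolution F).extMk k ((ComplexShape.up ℕ).next q) (CochainComplex.next ℕ q).symm hk

variable {F q W} in
lemma extOf_congr {k l : freeOn W ⟶ (injectiveResolution F).cocomplex.X q} (h : k = l)
    (hk : k ≫ (injectiveResolution F).cocomplex.d q ((ComplexShape.up ℕ).next q) = 0)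
    (hl : l ≫ (injectiveResolution F).cocomplex.d q ((ComplexShape.up ℕ).next q) = 0) :
    extOf k hk = extOf l hl := by
  subst h
  rfl

variable {F q W} in
/-- The homomorphism attached to a cocycle. -/
def cocycleHom (z : Cocycles F q W) : freeOn W ⟶ (injectiveResolution F).cocomplex.X q :=
  (secAddEquiv _ W).symm z.1

variable {F q W} in
lemma cocycleHom_comp_d (z : Cocycles F q W) : cocycleHom z ≫
      (injectiveResolution F).cocomplex.d q ((ComplexShape.up ℕ).next q) = 0 := by
  refine (secAddEquiv_symm_comp _ _).trans ?_
  exact (congrArg (secAddEquiv _ W).symm z.2).trans (map_zero _)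

/-- The cohomology class of a cocycle. -/
def cohMk : Cocycles F q W →+ coh F q W :=
  AddMonoidHom.mk' (fun z => extOf (cocycleHom z) (cocycleHom_comp_d z)) (fun z z' => by
    refine (extOf_congr (map_add (secAddEquiv _ W).symm _ _) _ ?_).trans
      (InjectiveResolution.add_extMk _ _ _ _ (CochainComplex.next ℕ q).symm
        (cocycleHom_comp_d z) (cocycleHom_comp_d z')).symm
    rw [Preadditive.add_comp]
    exact (congrArg₂ (· + ·) (cocycleHom_comp_d z) (cocycleHom_comp_d z')).trans (add_zero _))

variable {F q W}

lemma cohMk_surjective : Function.Surjective (cohMk F q W) := by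
  intro x
  obtain ⟨k, hk, rfl⟩ := (injectiveResolution F).extMk_surjective x
    ((ComplexShape.up ℕ).next q) (CochainComplex.next ℕ q).symm
  have h1 : secAddEquiv _ W k ∈ Cocycles F q W := by
    have := congrArg (secAddEquiv _ W) hk
    rw [secAddEquiv_comp, map_zero] at this
    exact this
  exact ⟨⟨_, h1⟩, extOf_congr ((secAddEquiv _ W).symm_apply_apply k)
    (cocycleHom_comp_d ⟨_, h1⟩) hk⟩

lemma cohMk_eq_zero_iff (z : Cocycles F q W) :
    cohMk F q W z = 0 ↔ ∃ y, ((resSc F q).map (secFunctor W)).f y = z.1 := by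
  change extOf (cocycleHom z) (cocycleHom_comp_d z) = 0 ↔ _
  cases q with
  | zero =>
    -- Degree 0 has no predecessor, so `prev 0` is a default index and the incoming differential is
    -- zero by the shape of the complex.
    have hd : ∀ y, ((resSc F 0).map (secFunctor W)).f y = 0 := by
      intro y
      have h : (injectiveResolution F).cocomplex.d ((ComplexShape.up ℕ).prev 0) 0 = 0 :=
        HomologicalComplex.shape _ _ _ (by simp)
      have h2 : (secFunctor W).map
        ((injectiveResolution F).cocomplex.d ((ComplexShape.up ℕ).prev 0) 0) = 0 := by
        rw [h, Functor.map_zero]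
      exact ConcreteCategory.congr_hom h2 y
    constructor
    · intro h
      have h1 := extMk_zero_eq_zero _ _ _ _ _ h
      refine ⟨0, (hd 0).trans ?_⟩
      exact ((secAddEquiv _ W).symm.injective (h1.trans (map_zero _).symm)).symm
    · rintro ⟨y, hy⟩
      have h1 : (secAddEquiv ((injectiveResolution F).cocomplex.X 0) W).symm z.1 = 0 :=
        (congrArg (secAddEquiv _ W).symm (hy.symm.trans (hd y))).trans (map_zero _)
      exact (extOf_congr h1 _ Limits.zero_comp).trans ((injectiveResolution F).extMk_zero
        (X := freeOn W) _ (CochainComplex.next ℕ 0).symm)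
  | succ q =>
    have hp : (ComplexShape.up ℕ).prev (q + 1) + 1 = q + 1 := by simp
    refine (InjectiveResolution.extMk_eq_zero_iff _ _ _ (CochainComplex.next ℕ (q + 1)).symm
      (cocycleHom_comp_d z) _ hp).trans ?_
    constructor
    · rintro ⟨g, hg⟩
      refine ⟨secAddEquiv _ W g, ?_⟩
      refine (secAddEquiv_comp g _).symm.trans ((congrArg (secAddEquiv _ W) hg).trans ?_)
      exact (secAddEquiv _ W).apply_symm_apply _
    · rintro ⟨y, hy⟩
      refine ⟨(secAddEquiv _ W).symm y, (secAddEquiv_symm_comp _ _).trans ?_⟩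
      exact congrArg (secAddEquiv _ W).symm hy

lemma cohRes_cohMk {V : Opens Y} (i : V ≤ W) (z : Cocycles F q W) :
    cohRes F q i (cohMk F q W z) = cohMk F q V (cocycleRes (resSc F q) i z) := by
  refine (InjectiveResolution.mk₀_comp_extMk _ _ _ (CochainComplex.next ℕ q).symm
    (cocycleHom_comp_d z) (freeMap i)).trans ?_
  exact extOf_congr (freeMap_secAddEquiv_symm i _) _
    (cocycleHom_comp_d (cocycleRes (resSc F q) i z))

/-- The morphism of injective resolutions induced by a homomorphism of sheaves. -/
def resHom {G : TopCat.Sheaf AddCommGrpCat.{u} Y} (φ : F ⟶ G) :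
    InjectiveResolution.Hom (injectiveResolution F) (injectiveResolution G) φ where
  hom := InjectiveResolution.desc φ _ _
  ι_f_zero_comp_hom_f_zero := InjectiveResolution.desc_commutes_zero φ _ _

/-- The image of a cocycle under a homomorphism of sheaves. -/
def cocycleMap {G : TopCat.Sheaf AddCommGrpCat.{u} Y} (φ : F ⟶ G) (z : Cocycles F q W) :
    Cocycles G q W :=
  ⟨(secFunctor W).map ((resHom φ).hom.f q) z.1, by
    have h := congrArg (fun k => (secFunctor W).map k)
      ((resHom φ).hom.comm q ((ComplexShape.up ℕ).next q))
    refine (ConcreteCategory.congr_hom h z.1).trans ?_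
    exact (congrArg ((secFunctor W).map ((resHom φ).hom.f _)) z.2).trans (map_zero _)⟩

lemma cohMap_cohMk {G : TopCat.Sheaf AddCommGrpCat.{u} Y} (φ : F ⟶ G) (z : Cocycles F q W) :
    cohMap φ q W (cohMk F q W z) = cohMk G q W (cocycleMap φ z) := by
  refine (InjectiveResolution.extMk_comp_mk₀ _ _ (CochainComplex.next ℕ q).symm
    (cocycleHom_comp_d z) (resHom φ)).trans ?_
  exact extOf_congr (secAddEquiv_symm_comp _ _) _ (cocycleHom_comp_d (cocycleMap φ z))

variable (F q W) in
/-- The homology class attached to a cohomology class. -/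
def cohToHomology : coh F q W →+ ((resSc F q).map (secFunctor W)).homology :=
  (cohMk F q W).liftOfSurjective cohMk_surjective
    ⟨homologyMk ((resSc F q).map (secFunctor W)), fun z hz =>
      (homologyMk_eq_zero_iff (D := (resSc F q).map (secFunctor W)) z).2
        ((cohMk_eq_zero_iff z).1 hz)⟩

lemma cohToHomology_cohMk (z : Cocycles F q W) :
    cohToHomology F q W (cohMk F q W z) = homologyMk ((resSc F q).map (secFunctor W)) z :=
  AddMonoidHom.liftOfRightInverse_comp_apply (cohMk F q W) _ _ _ z

variable (F q W) in
/-- Cohomology is computed by an injective resolution. -/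
def cohEquiv : coh F q W ≃+ ((resSc F q).map (secFunctor W)).homology :=
  AddEquiv.ofBijective (cohToHomology F q W) (by
    constructor
    · rw [injective_iff_map_eq_zero]
      intro x hx
      obtain ⟨z, rfl⟩ := cohMk_surjective x
      rw [cohToHomology_cohMk] at hx
      exact (cohMk_eq_zero_iff z).2 ((homologyMk_eq_zero_iff _).1 hx)
    · intro y
      obtain ⟨z, rfl⟩ := homologyMk_surjective y
      exact ⟨_, cohToHomology_cohMk z⟩)

lemma cohEquiv_cohMk (z : Cocycles F q W) :
    cohEquiv F q W (cohMk F q W z) = homologyMk ((resSc F q).map (secFunctor W)) z :=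
  cohToHomology_cohMk z

end CohMk

/-! ### The map from cohomology of inverse images to sections of the higher direct image -/

section Direct

lemma homologyComparison_naturality {A : Type*} [Category A] [Abelian A]
    (G : A ⥤ AddCommGrpCat.{u}) [G.Additive] [Limits.PreservesFiniteLimits G]
    {C C' : ShortComplex A} (t : C ⟶ C') (z : (C.map G).g.hom.ker) (z' : (C'.map G).g.hom.ker)
    (h : G.map t.τ₂ z.1 = z'.1) :
    homologyComparison G C' (homologyMk _ z') =
      G.map (ShortComplex.homologyMap t) (homologyComparison G C (homologyMk _ z)) := by
  obtain ⟨w, hw⟩ := exists_map_iCycles G C z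
  rw [homologyComparison_homologyMk G C z w hw,
    homologyComparison_homologyMk G C' z' (G.map (ShortComplex.cyclesMap t) w)]
  · have h1 := congrArg (fun k => G.map k) (ShortComplex.homologyπ_naturality t)
    simp only [Functor.map_comp] at h1
    exact (ConcreteCategory.congr_hom h1 w).symm
  · have h1 := congrArg (fun k => G.map k) (ShortComplex.cyclesMap_i t)
    simp only [Functor.map_comp] at h1
    refine (ConcreteCategory.congr_hom h1 w).trans (Eq.trans ?_ h)
    exact congrArg (G.map t.τ₂) hw

variable {Y Z : TopCat.{u}} (f : Y ⟶ Z) (q : ℕ) (F : TopCat.Sheaf AddCommGrpCat.{u} Y)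

/-- The two descriptions of cohomology agree. -/
def derEquiv : (cohomology Y q).obj F ≃+ coh F q (⊤ : Opens Y) :=
  (((injectiveResolution F).isoRightDerivedObj
    (globalSections Y) q).addCommGroupIsoToAddEquiv).trans (cohEquiv F q ⊤).symm

variable {F q} in
lemma derEquiv_naturality {G : TopCat.Sheaf AddCommGrpCat.{u} Y} (φ : F ⟶ G)
    (h : (cohomology Y q).obj F) :
    derEquiv q G ((cohomology Y q).map φ h) = cohMap φ q ⊤ (derEquiv q F h) := by
  refine (cohEquiv G q ⊤).injective (((cohEquiv G q ⊤).apply_symm_apply _).trans ?_)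
  have h1 := ConcreteCategory.congr_hom ((injectiveResolution F).isoRightDerivedObj_hom_naturality φ
    (injectiveResolution G) (resHom φ).hom (InjectiveResolution.desc_commutes_zero φ _ _)
    (globalSections Y) q) h
  refine h1.trans ?_
  obtain ⟨z, hz⟩ := cohMk_surjective (derEquiv q F h)
  have h2 : ((injectiveResolution F).isoRightDerivedObj (globalSections Y) q).hom h =
      homologyMk ((resSc F q).map (secFunctor (⊤ : Opens Y))) z := by
    rw [← cohEquiv_cohMk, hz]
    exact ((cohEquiv F q ⊤).apply_symm_apply _).symm
  rw [← hz, cohMap_cohMk, cohEquiv_cohMk]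
  refine (congrArg _ h2).trans ?_
  exact homologyMap_homologyMk (D := (resSc F q).map (secFunctor (⊤ : Opens Y)))
    (D' := (resSc G q).map (secFunctor (⊤ : Opens Y)))
    ((secFunctor (⊤ : Opens Y)).mapShortComplex.map
      ((HomologicalComplex.shortComplexFunctor _ _ q).map (resHom φ).hom)) z _ rfl

/-- The direct image of the part of degree `q` of an injective resolution. -/
abbrev directSc : ShortComplex (TopCat.Sheaf AddCommGrpCat.{u} Z) :=
  (((TopCat.Sheaf.pushforward AddCommGrpCat.{u} f).mapHomologicalComplex _).obj
        (injectiveResolution F).cocomplex).sc q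

/-- The map from cohomology over inverse images of open subsets to sections of the higher direct
image. -/
def toDirect (V : Opens Z) : coh F q ((Opens.map f).obj V) →+
    ((higherDirectImage f q).obj F).obj.obj (op V) :=
  (((secFunctor V).map ((injectiveResolution F).isoRightDerivedObj
      (TopCat.Sheaf.pushforward AddCommGrpCat.{u} f) q).inv).hom.comp
    (homologyComparison (secFunctor V) (directSc f q F)).hom).comp
      (cohEquiv F q ((Opens.map f).obj V)).toAddMonoidHom

/-- The edge map is defined by the same comparison of homology as `toDirect` over ⊤; only the
identification of derived functors of global sections with Ext intervenes. -/
lemma edgeMap_eq_toDirect (h : (cohomology Y q).obj F) :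
    edgeMap f q F h = toDirect f q F ⊤ (derEquiv q F h) := by
  refine congrArg (fun k => (globalSections Z).map ((injectiveResolution F).isoRightDerivedObj
      (TopCat.Sheaf.pushforward AddCommGrpCat.{u} f) q).inv (homologyComparison (globalSections Z)
      (directSc f q F) k)) ?_
  exact ((cohEquiv F q ⊤).apply_symm_apply _).symm

variable {f q F} {V W : Opens Z}

/-- Evaluation of a homology class of `directSc`. -/
def directClass (f : Y ⟶ Z) (q : ℕ) (F : TopCat.Sheaf AddCommGrpCat.{u} Y) (V : Opens Z)
    (z : Cocycles F q ((Opens.map f).obj V)) : (secFunctor V).obj (directSc f q F).homology :=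
  homologyComparison (secFunctor V) (directSc f q F)
    (homologyMk ((directSc f q F).map (secFunctor V)) z)

lemma toDirect_cohMk (z : Cocycles F q ((Opens.map f).obj V)) :
    toDirect f q F V (cohMk F q _ z) = (secFunctor V).map
      ((injectiveResolution F).isoRightDerivedObj
        (TopCat.Sheaf.pushforward AddCommGrpCat.{u} f) q).inv (directClass f q F V z) := by
  refine congrArg (fun k => (secFunctor V).map ((injectiveResolution F).isoRightDerivedObj
      (TopCat.Sheaf.pushforward AddCommGrpCat.{u} f) q).inv (homologyComparison (secFunctor V)
      (directSc f q F) k)) ?_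
  exact cohEquiv_cohMk z

lemma toDirect_cohRes (i : V ≤ W) (x : coh F q ((Opens.map f).obj W)) :
    toDirect f q F V (cohRes F q ((Opens.map f).map (homOfLE i)).le x) =
      ((higherDirectImage f q).obj F).obj.map (homOfLE i).op (toDirect f q F W x) := by
  obtain ⟨z, rfl⟩ := cohMk_surjective x
  rw [cohRes_cohMk]
  refine (toDirect_cohMk _).trans (Eq.trans ?_ (congrArg _ (toDirect_cohMk z)).symm)
  have h1 := ConcreteCategory.congr_hom ((secRes i).naturality
    ((injectiveResolution F).isoRightDerivedObj
      (TopCat.Sheaf.pushforward AddCommGrpCat.{u} f) q).inv) (directClass f q F W z)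
  refine Eq.trans (congrArg _ ?_) h1.symm
  exact homologyComparison_cocycleRes (directSc f q F) i z

lemma isoRightDerivedObj_inv_injective : Function.Injective ((secFunctor V).map
    ((injectiveResolution F).isoRightDerivedObj
      (TopCat.Sheaf.pushforward AddCommGrpCat.{u} f) q).inv) :=
  (AddCommGrpCat.mono_iff_injective _).1 inferInstance

lemma isoRightDerivedObj_inv_surjective : Function.Surjective ((secFunctor V).map
    ((injectiveResolution F).isoRightDerivedObj
      (TopCat.Sheaf.pushforward AddCommGrpCat.{u} f) q).inv) :=
  (AddCommGrpCat.epi_iff_surjective _).1 inferInstance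

/-- Together with `exists_local_toDirect` this expresses that R^q f_* F is the sheaf associated with
V ↦ H^q(f⁻¹V, F). -/
lemma exists_local_eq_zero_of_toDirect (x : coh F q ((Opens.map f).obj V))
    (hx : toDirect f q F V x = 0) {y : Z} (hy : y ∈ V) : ∃ (V' : Opens Z) (i : V' ≤ V),
      y ∈ V' ∧ cohRes F q ((Opens.map f).map (homOfLE i)).le x = 0 := by
  obtain ⟨z, rfl⟩ := cohMk_surjective x
  rw [toDirect_cohMk] at hx
  have h1 := isoRightDerivedObj_inv_injective (hx.trans (map_zero _).symm)
  obtain ⟨V', i, hy', h2⟩ := exists_local_boundary (directSc f q F) z h1 hy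
  refine ⟨V', i, hy', ?_⟩
  rw [cohRes_cohMk]
  exact (cohMk_eq_zero_iff _).2 ((homologyMk_eq_zero_iff _).1 h2)

lemma exists_local_toDirect (s : ((higherDirectImage f q).obj F).obj.obj (op V)) {y : Z}
    (hy : y ∈ V) : ∃ (V' : Opens Z) (i : V' ≤ V), y ∈ V' ∧ ∃ x,
      toDirect f q F V' x = ((higherDirectImage f q).obj F).obj.map (homOfLE i).op s := by
  obtain ⟨t, rfl⟩ := isoRightDerivedObj_inv_surjective (F := F) (q := q) (f := f) s
  obtain ⟨V', i, hy', z, hz⟩ := exists_local_homologyMk (directSc f q F) t hy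
  refine ⟨V', i, hy', cohMk F q _ z, (toDirect_cohMk _).trans ?_⟩
  refine (congrArg _ hz).trans ?_
  exact (ConcreteCategory.congr_hom ((secRes i).naturality
    ((injectiveResolution F).isoRightDerivedObj
      (TopCat.Sheaf.pushforward AddCommGrpCat.{u} f) q).inv) t).symm

lemma toDirect_naturality {G : TopCat.Sheaf AddCommGrpCat.{u} Y} (φ : F ⟶ G)
    (x : coh F q ((Opens.map f).obj V)) :
    toDirect f q G V (cohMap φ q _ x) =
      ((higherDirectImage f q).map φ).hom.app (op V) (toDirect f q F V x) := by
  obtain ⟨z, rfl⟩ := cohMk_surjective x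
  rw [cohMap_cohMk, toDirect_cohMk, toDirect_cohMk]
  have h1 := congrArg (fun k => (secFunctor V).map k)
    ((injectiveResolution F).isoRightDerivedObj_inv_naturality φ
    (injectiveResolution G) (resHom φ).hom (InjectiveResolution.desc_commutes_zero φ _ _)
    (TopCat.Sheaf.pushforward AddCommGrpCat.{u} f) q)
  refine Eq.trans ?_ (ConcreteCategory.congr_hom h1 (directClass f q F V z)).symm
  refine congrArg ((secFunctor V).map ((injectiveResolution G).isoRightDerivedObj
    (TopCat.Sheaf.pushforward AddCommGrpCat.{u} f) q).inv) ?_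
  exact homologyComparison_naturality (secFunctor V)
    ((HomologicalComplex.shortComplexFunctor _ _ q).map
      (((TopCat.Sheaf.pushforward AddCommGrpCat.{u} f).mapHomologicalComplex _).map
        (resHom φ).hom)) z (cocycleMap φ z) rfl

end Direct

/-! ### Bases of the target on which no sheafification is needed -/

section Bijective

variable {Y : TopCat.{u}} {Z : Scheme.{u}} (f : Y ⟶ (Z : TopCat.{u})) (q : ℕ)
  (F : TopCat.Sheaf AddCommGrpCat.{u} Y) {B : Set Z.Opens}

/-- The inverse image of open subsets. -/
def preimOpens (V : Z.Opens) : Opens Y := (Opens.map f).obj V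

lemma preimOpens_monotone : Monotone (preimOpens f) := fun _ _ h => ((Opens.map f).map (homOfLE
    h)).le

lemma sepTwo_cohPresheaf_zero : SepTwo (cohPresheaf (preimOpens_monotone f) F 0) B := by
  refine ⟨fun x => coh_bot F 0 x, fun U hU a b hab x ha hb => ?_⟩
  exact coh_zero_eq_zero_of_sup (F := F)
    (sup_of_add_eq_one (g := preimOpens f) (fun _ _ => rfl) hab) x ha hb

variable {f q F} (hB : IsBasicClass B) (hs : SepTwo (cohPresheaf (preimOpens_monotone f) F q) B)
include hB hs

lemma toDirect_injective {V : Z.Opens} (hV : V ∈ B) : Function.Injective (toDirect f q F V) := by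
  rw [injective_iff_map_eq_zero]
  intro x hx
  refine hs.eq_zero hB hV x fun z hz => ?_
  exact exists_local_eq_zero_of_toDirect x hx hz

/-- On a class of opens where the cohomology presheaf already satisfies the sheaf condition it
agrees with its associated sheaf: a section of R^q f_* F lifts locally, the lifts agree on overlaps
by injectivity, and they glue. -/
lemma toDirect_bijective (hg : GlueTwo (cohPresheaf (preimOpens_monotone f) F q) B)
    {V : Z.Opens} (hV : V ∈ B) : Function.Bijective (toDirect f q F V) := by
  refine ⟨toDirect_injective hB hs hV, fun s => ?_⟩
  have h1 : ∀ y : V, ∃ (c : Γ(Z, V)) (_ : y.1 ∈ Z.basicOpen c)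
      (x : coh F q (preimOpens f (Z.basicOpen c))), toDirect f q F (Z.basicOpen c) x =
        ((higherDirectImage f q).obj F).obj.map (homOfLE (Z.basicOpen_le c)).op s := by
    intro y
    obtain ⟨V', i, hy, x, hx⟩ := exists_local_toDirect s y.2
    obtain ⟨c, hc, hyc⟩ := (hB.isAffineOpen hV).exists_basicOpen_le ⟨y.1, hy⟩ y.2
    refine ⟨c, hyc, cohRes F q (preimOpens_monotone f hc) x, ?_⟩
    refine (toDirect_cohRes hc x).trans ((congrArg _ hx).trans ?_)
    exact (ConcreteCategory.congr_hom (((higherDirectImage f q).obj F).obj.map_comp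
      (homOfLE i).op (homOfLE hc).op) s).symm
  choose c hc x hx using h1
  obtain ⟨y, hy⟩ := hs.exists_glue hB hg hV c
    (fun z hz => Opens.mem_iSup.2 ⟨⟨z, hz⟩, hc ⟨z, hz⟩⟩) x (by
    intro i j
    have hij : Z.basicOpen (c i) ⊓ Z.basicOpen (c j) ∈ B := by
      rw [← Scheme.basicOpen_mul]
      exact hB.basicOpen_mem hV _
    refine toDirect_injective hB hs hij ?_
    refine (toDirect_cohRes inf_le_left (x i)).trans
      (Eq.trans ?_ (toDirect_cohRes inf_le_right (x j)).symm)
    refine (congrArg _ (hx i)).trans (Eq.trans ?_ (congrArg _ (hx j)).symm)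
    refine (ConcreteCategory.congr_hom (((higherDirectImage f q).obj F).obj.map_comp
      _ _) s).symm.trans ?_
    exact (ConcreteCategory.congr_hom (((higherDirectImage f q).obj F).obj.map_comp
      (homOfLE (Z.basicOpen_le (c j))).op (homOfLE inf_le_right).op) s))
  refine ⟨y, sheaf_eq_of_locally_eq _ _ fun z hz => ?_⟩
  refine ⟨Z.basicOpen (c ⟨z, hz⟩), Z.basicOpen_le _, hc _, ?_⟩
  refine (toDirect_cohRes (Z.basicOpen_le (c ⟨z, hz⟩)) y).symm.trans ?_
  exact (congrArg _ (hy ⟨z, hz⟩)).trans (hx ⟨z, hz⟩)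

end Bijective

/-! ### Torsion in the cohomology of the structure sheaf -/

section Torsion

variable {R : Type u} [CommRing R] {X : Scheme.{u}} (f : X ⟶ Spec (.of R))

lemma structMap_flat [Flat f] {U : X.Opens} (hU : IsAffineOpen U) : (structMap f U).Flat := by
  have h := f.flat_appLE (isAffineOpen_top _) hU le_top
  refine RingHom.Flat.comp ?_ h
  exact RingHom.Flat.of_bijective (ConcreteCategory.bijective_of_isIso
    (Scheme.ΓSpecIso (.of R)).inv)

include f in
-- A nonzero integer is regular on R by flatness over ℤ, hence on the functions of an affine open by
-- flatness over R, hence on all sections by locality.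
lemma section_eq_zero_of_nsmul [Module.Flat ℤ R] [Flat f] {m : ℕ} (hm : m ≠ 0) {U : X.Opens}
    (s : Γ(X, U)) (hs : m • s = 0) : s = 0 := by
  have haff : ∀ (V : X.Opens), IsAffineOpen V → ∀ t : Γ(X, V), m • t = 0 → t = 0 := by
    intro V hV t ht
    let _ := (structMap f V).toAlgebra
    have : Module.Flat R Γ(X, V) := structMap_flat f hV
    have h1 : IsSMulRegular R (m : ℤ) :=
      Module.Flat.isSMulRegular_of_nonZeroDivisors (by simpa using hm)
    have h3 : (m : R) ∈ nonZeroDivisors R := by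
      rw [mem_nonZeroDivisors_iff_right]
      intro x hx
      refine h1 ?_
      simpa [mul_comm] using hx
    have h2 : IsSMulRegular Γ(X, V) (m : R) :=
      Module.Flat.isSMulRegular_of_nonZeroDivisors h3
    refine h2 ?_
    simpa [Algebra.smul_def] using ht
  refine sheaf_eq_of_locally_eq (F := structSheaf X) (W := U) s 0 fun x hx => ?_
  obtain ⟨V, hV, hxV, hVU⟩ := exists_basis_le X.isBasis_affineOpens hx
  refine ⟨V, hVU, hxV, Eq.trans ?_ (map_zero _).symm⟩
  refine haff V hV (X.presheaf.map (homOfLE hVU).op s) ?_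
  rw [← map_nsmul, hs, map_zero]

lemma sepTwo_structSheaf [IsNoetherian X] [IsSeparated f] (q : ℕ) :
    SepTwo (cohPresheaf (preimOpens_monotone f.base) (structSheaf X) q) (basicClass R) := by
  cases q with
  | zero => exact sepTwo_cohPresheaf_zero _ _
  | succ q =>
    exact sepTwo_cohPresheaf _ _ _ (fun _ _ => rfl) rfl (cohSurjTwo_structSheaf f q)

variable {f} in
-- Over basic opens of the base the cohomology embeds into sections of R^q f_* 𝒪_X. These are
-- locally tuples of functions on S, and S has no torsion functions.
lemma coh_structSheaf_eq_zero_of_nsmul [Module.Flat ℤ R] [IsNoetherian X] [IsSeparated f] {q : ℕ}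
    (hf : IsLocallyFreeOfFiniteRank f q) {V : (Spec (.of R)).Opens} (hV : V ∈ basicClass R)
    {m : ℕ} (hm : m ≠ 0) (x : coh (structSheaf X) q (preim f V)) (hx : m • x = 0) : x = 0 := by
  refine toDirect_injective isBasicClass_basicClass (sepTwo_structSheaf f q) hV
    (Eq.trans ?_ (map_zero _).symm)
  have h1 : m • toDirect f.base q (structSheaf X) V x = 0 := by
    refine (map_nsmul (toDirect f.base q (structSheaf X) V) m x).symm.trans ?_
    exact (congrArg _ hx).trans (map_zero _)
  generalize toDirect f.base q (structSheaf X) V x = s at h1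
  refine sheaf_eq_of_locally_eq s 0 fun y hy => ?_
  obtain ⟨U, hyU, n, e, he, -⟩ := hf y
  refine ⟨V ⊓ U, inf_le_left, ⟨hy, hyU⟩, Eq.trans ?_ (map_zero _).symm⟩
  refine (e (V ⊓ U) inf_le_right).injective (funext fun k => ?_)
  rw [map_zero]
  refine section_eq_zero_of_nsmul (𝟙 (Spec (.of R))) hm _ ?_
  have h2 : m • e (V ⊓ U) inf_le_right
      ((directImageStruct f q).obj.map (homOfLE inf_le_left).op s) = 0 := by
    rw [← map_nsmul, ← map_nsmul]
    exact (congrArg _ ((congrArg _ h1).trans (map_zero _))).trans (map_zero _)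
  exact congrFun h2 k

end Torsion

/-! ### Homomorphisms out of truncated algebras -/

section Truncated

open Polynomial

variable {R : Type u} [CommRing R]

/-- This is sharper by one than `truncAlg.inr_x_pow`. The index must be positive: for index 0 the
zeroth power of x is 1 in R ⊕ 0 and does not vanish. -/
lemma truncAlg.inr_x_pow_succ (n : ℕ) :
    ((truncAlg.x R (n + 1) : (truncAlg R (n + 1)).Aug)) ^ (n + 1) = 0 := by
  have h : ∀ k : ℕ, ∃ y : (truncAlg R (n + 1)).carrier,
      ((truncAlg.x R (n + 1) : (truncAlg R (n + 1)).Aug)) ^ (k + 1) =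
        (y : (truncAlg R (n + 1)).Aug) ∧
        (show Ideal.span {TruncPoly.x R (n + 1)} from y : TruncPoly R (n + 1)) =
          TruncPoly.x R (n + 1) ^ (k + 1) := by
    intro k
    induction k with
    | zero => exact ⟨truncAlg.x R (n + 1), by simp, by rw [zero_add, pow_one]; rfl⟩
    | succ k ih =>
      obtain ⟨y, hy, hy'⟩ := ih
      refine ⟨y * truncAlg.x R (n + 1), ?_, ?_⟩
      · rw [pow_succ, hy, Unitization.inr_mul]
      · exact (congrArg (· * TruncPoly.x R (n + 1)) hy').trans (pow_succ _ _).symm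
  obtain ⟨y, hy, hy'⟩ := h n
  have h0 : y = 0 := Subtype.ext (hy'.trans (TruncPoly.x_pow R (n + 1)))
  rw [hy, h0, Unitization.inr_zero]

/-- The homomorphism `R[x] / x ^ m → R ⊕ N` with `x ↦ ν`. -/
def TruncPoly.toAug (N : NilAlg R) (ν : N.carrier) (m : ℕ) (h : (ν : N.Aug) ^ m = 0) :
    TruncPoly R m →ₐ[R] N.Aug :=
  Ideal.Quotient.liftₐ _ (aeval (ν : N.Aug)) (fun a ha => by
    obtain ⟨b, rfl⟩ := Ideal.mem_span_singleton'.1 ha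
    rw [map_mul, map_pow, aeval_X, h, mul_zero])

lemma TruncPoly.toAug_x (N : NilAlg R) (ν : N.carrier) (m : ℕ) (h : (ν : N.Aug) ^ m = 0) :
    TruncPoly.toAug N ν m h (TruncPoly.x R m) = ν := by
  refine (Ideal.Quotient.liftₐ_apply _ _ _ _).trans ?_
  exact (Ideal.Quotient.lift_mk _ _ _).trans (aeval_X _)

lemma TruncPoly.toAug_fst (N : NilAlg R) (ν : N.carrier) (m : ℕ) (h : (ν : N.Aug) ^ m = 0)
    (a : (truncAlg R m).carrier) :
    (TruncPoly.toAug N ν m h (show Ideal.span {TruncPoly.x R m} from a).1).fst = 0 := by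
  obtain ⟨b, hb⟩ := Ideal.mem_span_singleton'.1 (show Ideal.span {TruncPoly.x R m} from a).2
  rw [← hb, map_mul, TruncPoly.toAug_x]
  simp

/-- The homomorphism `x R[x] / x ^ m R[x] → N` with `x ↦ ν`. -/
def truncAlg.lift (N : NilAlg R) (ν : N.carrier) (m : ℕ) (h : (ν : N.Aug) ^ m = 0) :
    truncAlg R m ⟶ N :=
  ({ toFun := fun a => (TruncPoly.toAug N ν m h (show Ideal.span {TruncPoly.x R m} from a).1).snd
     map_smul' := fun r a => by
       refine (congrArg (fun a : N.Aug => a.snd) (map_smul (TruncPoly.toAug N ν m h) r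
        (show Ideal.span {TruncPoly.x R m} from a).1)).trans ?_
       exact Unitization.snd_smul _ _
     map_zero' := congrArg (fun a : N.Aug => a.snd) (map_zero (TruncPoly.toAug N ν m h))
     map_add' := fun a b => congrArg (fun a : N.Aug => a.snd) (map_add (TruncPoly.toAug N ν m h)
        (show Ideal.span {TruncPoly.x R m} from a).1 (show Ideal.span {TruncPoly.x R m} from b).1)
     map_mul' := fun a b => by
       refine (congrArg (fun a : N.Aug => a.snd) (map_mul (TruncPoly.toAug N ν m h)
        (show Ideal.span {TruncPoly.x R m} from a).1
        (show Ideal.span {TruncPoly.x R m} from b).1)).trans ?_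
       rw [Unitization.snd_mul, TruncPoly.toAug_fst, TruncPoly.toAug_fst, zero_smul, zero_smul,
         zero_add, zero_add] } :
    (truncAlg R m).carrier →ₙₐ[R] N.carrier)

lemma truncAlg.lift_x (N : NilAlg R) (ν : N.carrier) (m : ℕ) (h : (ν : N.Aug) ^ m = 0) :
    NilAlg.hom (truncAlg.lift N ν m h) (truncAlg.x R m) = ν :=
  congrArg (fun a : N.Aug => a.snd) (TruncPoly.toAug_x N ν m h)

/-- The homomorphism `R ⊕ x R[x] / x ^ n R[x] → R[x] / x ^ n`. -/
def truncAlg.augToPoly (R : Type u) [CommRing R] (n : ℕ) :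
    (truncAlg R n).Aug →ₐ[R] TruncPoly R n :=
  Unitization.lift
    ({ toFun := fun a => (show Ideal.span {TruncPoly.x R n} from a).1
       map_smul' := fun _ _ => rfl
       map_zero' := rfl
       map_add' := fun _ _ => rfl
       map_mul' := fun _ _ => rfl } : (truncAlg R n).carrier →ₙₐ[R] TruncPoly R n)

lemma truncAlg.augToPoly_inr (n : ℕ) (a : (truncAlg R n).carrier) :
    truncAlg.augToPoly R n (a : (truncAlg R n).Aug) =
      (show Ideal.span {TruncPoly.x R n} from a).1 := by
  simp [truncAlg.augToPoly]
  rfl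

lemma truncAlg.augToPoly_inl (n : ℕ) (r : R) :
    truncAlg.augToPoly R n (Unitization.inl r) = algebraMap R _ r :=
  (truncAlg.augToPoly R n).commutes r

lemma truncAlg.augToPoly_aeval (n : ℕ) (P : R[X]) : truncAlg.augToPoly R n
    (aeval (truncAlg.x R n : (truncAlg R n).Aug) P) = Ideal.Quotient.mk _ P := by
  rw [← Polynomial.aeval_algHom_apply, truncAlg.augToPoly_inr]
  have : (aeval (TruncPoly.x R n) : R[X] →ₐ[R] _) = Ideal.Quotient.mkₐ R _ := by
    ext
    simp [TruncPoly.x]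
  exact congrArg (fun φ : R[X] →ₐ[R] TruncPoly R n => φ P) this

lemma truncAlg.exists_aeval (n : ℕ) (a : (truncAlg R n).carrier) : ∃ P : R[X],
    aeval (truncAlg.x R n : (truncAlg R n).Aug) P = (a : (truncAlg R n).Aug) := by
  obtain ⟨b, hb⟩ := Ideal.mem_span_singleton'.1 (show Ideal.span {TruncPoly.x R n} from a).2
  obtain ⟨P, rfl⟩ := Ideal.Quotient.mk_surjective b
  have h1 : (aeval (truncAlg.x R n : (truncAlg R n).Aug) (P * X)).fst = 0 := by
    rw [map_mul, aeval_X]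
    simp
  have h2 := truncAlg.augToPoly_aeval n (P * X)
  refine ⟨P * X, Unitization.ext (h1.trans (Unitization.fst_inr _ _).symm) (Subtype.ext ?_)⟩
  rw [← Unitization.inl_fst_add_inr_snd_eq
      (aeval (truncAlg.x R n : (truncAlg R n).Aug) (P * X)), h1, Unitization.inl_zero,
      zero_add, truncAlg.augToPoly_inr] at h2
  exact h2.trans ((map_mul _ _ _).trans hb)

/-- A homomorphism out of `R ⊕ x R[x] / x ^ n R[x]` is determined by its restriction to `R` and its
value at `x`. -/
lemma truncAlg.ringHom_ext {n : ℕ} {B : Type*} [Semiring B] {g h : (truncAlg R n).Aug →+* B}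
    (h1 : ∀ r : R, g (Unitization.inl r) = h (Unitization.inl r))
    (h2 : g (truncAlg.x R n : (truncAlg R n).Aug) = h (truncAlg.x R n : (truncAlg R n).Aug)) :
    g = h := by
  have h3 : g.comp (aeval (truncAlg.x R n : (truncAlg R n).Aug) : R[X] →ₐ[R] _).toRingHom =
      h.comp (aeval (truncAlg.x R n : (truncAlg R n).Aug) : R[X] →ₐ[R] _).toRingHom := by
    refine Polynomial.ringHom_ext (fun r => ?_) ?_
    · have h4 : aeval (truncAlg.x R n : (truncAlg R n).Aug) (C r) = Unitization.inl r :=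
        aeval_C _ _
      exact (congrArg g h4).trans ((h1 r).trans (congrArg h h4).symm)
    · simpa using h2
  refine RingHom.ext fun a => ?_
  rw [← Unitization.inl_fst_add_inr_snd_eq a, map_add, map_add, h1]
  obtain ⟨P, hP⟩ := truncAlg.exists_aeval n a.snd
  rw [← hP]
  exact congrArg _ (RingHom.congr_fun h3 P)

lemma truncAlg.hom_ext {n : ℕ} {N : NilAlg R} {g h : truncAlg R n ⟶ N}
    (h2 : NilAlg.hom g (truncAlg.x R n) = NilAlg.hom h (truncAlg.x R n)) : g = h := by
  have h3 : (NilAlg.augMap g : (truncAlg R n).Aug →+* N.Aug) = NilAlg.augMap h := by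
    refine truncAlg.ringHom_ext (fun r => ?_) ?_
    · exact ((NilAlg.augMap g).commutes r).trans ((NilAlg.augMap h).commutes r).symm
    · exact (NilAlg.augMap_inr g _).trans ((congrArg _ h2).trans (NilAlg.augMap_inr h _).symm)
  refine NonUnitalAlgHom.ext fun a => ?_
  have h4 := RingHom.congr_fun h3 (a : (truncAlg R n).Aug)
  exact Unitization.inr_injective
    ((NilAlg.augMap_inr g a).symm.trans (h4.trans (NilAlg.augMap_inr h a)))

end Truncated

/-! ### Functions on the thickenings of affine opens -/

section Thickening

variable {R : Type u} [CommRing R] {X : Scheme.{u}} (f : X ⟶ Spec (.of R))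

/-- The functions on `X_N` over the open `U` of `X`. -/
abbrev thickeningRing (N : NilAlg R) (U : X.Opens) : CommRingCat.{u} :=
  Γ(thickening f N, thickeningFst f N ⁻¹ᵁ U)

/-- The homomorphism `R ⊕ N → Γ(X_N, U)`. -/
abbrev augStruct (N : NilAlg R) (U : X.Opens) : N.Aug →+* thickeningRing f N U :=
  structMap (thickeningSnd f N) (thickeningFst f N ⁻¹ᵁ U)

lemma structMap_comp_ΓSpecIso_hom {A : Type u} [CommRing A] {Y : Scheme.{u}}
    (g : Y ⟶ Spec (.of A)) (V : Y.Opens) :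
    (Scheme.ΓSpecIso (.of A)).hom ≫ CommRingCat.ofHom (structMap g V) = g.appLE ⊤ V le_top := by
  have h : CommRingCat.ofHom (structMap g V) =
      (Scheme.ΓSpecIso (.of A)).inv ≫ g.appLE ⊤ V le_top := rfl
  rw [h, Iso.hom_inv_id_assoc]

lemma app_structMap (N : NilAlg R) (U : X.Opens) (r : R) :
    (thickeningFst f N).app U (structMap f U r) = augStruct f N U (Unitization.inl r) := by
  have h1 : (Scheme.ΓSpecIso (.of R)).inv ≫ f.appLE ⊤ U le_top ≫ (thickeningFst f N).app U =
      CommRingCat.ofHom (algebraMap R N.Aug) ≫ CommRingCat.ofHom (augStruct f N U) := by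
    have h2 : CommRingCat.ofHom (augStruct f N U) = (Scheme.ΓSpecIso (.of N.Aug)).inv ≫
      (thickeningSnd f N).appLE ⊤ (thickeningFst f N ⁻¹ᵁ U) le_top := rfl
    rw [h2, Scheme.ΓSpecIso_inv_naturality_assoc, Scheme.Hom.app_eq_appLE]
    congr 1
    refine (Scheme.Hom.appLE_comp_appLE (thickeningFst f N) f ⊤ U _ le_top le_rfl).trans ?_
    have h3 : ∀ (k l : thickening f N ⟶ Spec (.of R)) (_ : k = l) e e',
        k.appLE ⊤ (thickeningFst f N ⁻¹ᵁ U) e = l.appLE ⊤ (thickeningFst f N ⁻¹ᵁ U) e' := by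
      rintro _ _ rfl _ _
      rfl
    have h4 : (N.toSpec).appTop ≫ (thickeningSnd f N).appLE ⊤ (thickeningFst f N ⁻¹ᵁ U) le_top =
        (thickeningSnd f N ≫ N.toSpec).appLE ⊤ (thickeningFst f N ⁻¹ᵁ U) le_top := by
      exact (Scheme.Hom.comp_appLE _ _ ⊤ _ _).symm
    refine Eq.trans ?_ h4.symm
    exact h3 _ _ Limits.pullback.condition _ _
  exact ConcreteCategory.congr_hom h1 r

/-- Affine base change: over an affine open U the functions on X_N are the tensor product of Γ(X, U)
and R ⊕ N over R. The two lemmas that follow are its universal property in terms of elements. -/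
lemma isPushout_thickening (N : NilAlg R) {U : X.Opens} (hU : IsAffineOpen U) :
    IsPushout (f.appLE ⊤ U le_top) (N.toSpec.appLE ⊤ ⊤ le_top) ((thickeningFst f N).app U)
      ((thickeningSnd f N).appLE ⊤ (thickeningFst f N ⁻¹ᵁ U) le_top) := by
  have h := (isIso_pushoutSection_iff (IsPullback.of_hasPullback f N.toSpec)
    (US := ⊤) (UT := ⊤) (UX := U) le_top le_top (UY := thickeningFst f N ⁻¹ᵁ U) (by simp)).1
    (isIso_pushoutSection_of_isAffineOpen _ _ _ _ (isAffineOpen_top _) (isAffineOpen_top _) hU)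
  rw [Scheme.Hom.app_eq_appLE]
  exact h

variable {f} in
lemma thickeningRing_hom_ext {N : NilAlg R} {U : X.Opens} (hU : IsAffineOpen U) {E : Type u}
    [CommRing E] {g h : thickeningRing f N U →+* E}
    (h1 : ∀ s, g ((thickeningFst f N).app U s) = h ((thickeningFst f N).app U s))
    (h2 : ∀ c, g (augStruct f N U c) = h (augStruct f N U c)) : g = h := by
  have key : CommRingCat.ofHom g = CommRingCat.ofHom h := by
    refine (isPushout_thickening f N hU).hom_ext ?_ ?_
    · exact CommRingCat.hom_ext (RingHom.ext h1)
    · rw [← structMap_comp_ΓSpecIso_hom, Category.assoc, Category.assoc]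
      congr 1
      exact CommRingCat.hom_ext (RingHom.ext h2)
  exact congrArg CommRingCat.Hom.hom key

variable {f} in
lemma exists_thickeningRing_hom {N : NilAlg R} {U : X.Opens} (hU : IsAffineOpen U) {E : Type u}
    [CommRing E] (a : Γ(X, U) →+* E) (b : N.Aug →+* E)
    (hab : ∀ r, a (structMap f U r) = b (Unitization.inl r)) :
    ∃ g : thickeningRing f N U →+* E, (∀ s, g ((thickeningFst f N).app U s) = a s) ∧
      ∀ c, g (augStruct f N U c) = b c := by
  have w : f.appLE ⊤ U le_top ≫ CommRingCat.ofHom a =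
      N.toSpec.appLE ⊤ ⊤ le_top ≫ (Scheme.ΓSpecIso (.of N.Aug)).hom ≫ CommRingCat.ofHom b := by
    rw [← cancel_epi (Scheme.ΓSpecIso (.of R)).inv]
    have h1 : N.toSpec.appLE ⊤ ⊤ le_top = N.toSpec.appTop := (Scheme.Hom.app_eq_appLE _).symm
    rw [h1, ← Scheme.ΓSpecIso_inv_naturality_assoc, Iso.inv_hom_id_assoc]
    exact CommRingCat.hom_ext (RingHom.ext hab)
  refine ⟨((isPushout_thickening f N hU).desc _ _ w).hom, fun s => ?_, fun c => ?_⟩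
  · exact ConcreteCategory.congr_hom ((isPushout_thickening f N hU).inl_desc _ _ w) s
  · have h2 := (isPushout_thickening f N hU).inr_desc _ _ w
    refine (ConcreteCategory.congr_hom h2 ((Scheme.ΓSpecIso (.of N.Aug)).inv c)).trans ?_
    exact congrArg b (ConcreteCategory.congr_hom (Scheme.ΓSpecIso (.of N.Aug)).inv_hom_id c)

lemma nilEval_coe {A B : Type u} [CommRing A] [CommRing B] (φ : A →+* B) (ξ : B) (m : ℕ)
    (hξ : ξ ^ m = 0) (P : Polynomial A) :
    nilEval φ ξ m hξ (P : PowerSeries A) = P.eval₂ φ ξ := by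
  rw [nilEval_apply, Polynomial.eval₂_eq_sum_range' φ (n := P.natDegree + 1 + (m + 1)) (by omega)]
  simp only [Polynomial.coeff_coe]
  refine Finset.sum_subset (Finset.range_mono (by omega)) fun i _ hi => ?_
  rw [Finset.mem_range, not_lt] at hi
  rw [pow_eq_zero_of_le (by omega : m ≤ i) hξ, mul_zero]

lemma xi_pow_eq_zero {n m : ℕ} (U : X.Opens) (h : n + 1 ≤ m) : xi f (n + 1) U ^ m = 0 := by
  refine pow_eq_zero_of_le h ?_
  rw [xi, ← map_pow, truncAlg.inr_x_pow_succ, map_zero]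

lemma truncEval_apply (n : ℕ) (U : X.Opens) (p : PowerSeries Γ(X, U)) :
    truncEval f n U p = ∑ i ∈ Finset.range (n + 2),
      (thickeningFst f (truncAlg R n)).app U (PowerSeries.coeff i p) * xi f n U ^ i :=
  nilEval_apply _ _ _ _ _

lemma truncEval_eq_zero {n : ℕ} {U : X.Opens} {p : PowerSeries Γ(X, U)}
    (h : ∀ i ≤ n, PowerSeries.coeff i p = 0) : truncEval f (n + 1) U p = 0 := by
  rw [truncEval_apply]
  refine Finset.sum_eq_zero fun i _ => ?_
  by_cases hi : i ≤ n
  · rw [h i hi, map_zero, zero_mul]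
  · rw [xi_pow_eq_zero f U (by omega), mul_zero]

variable {f} in
-- The universal property of the tensor product gives a map back to Γ(X, U)[x]/x^(n+1), from which
-- the coefficients of a truncated series can be read off.
lemma exists_truncEval_inverse {n : ℕ} {U : X.Opens} (hU : IsAffineOpen U) :
    ∃ g : thickeningRing f (truncAlg R (n + 1)) U →+* TruncPoly Γ(X, U) (n + 1),
      (∀ s, g ((thickeningFst f (truncAlg R (n + 1))).app U s) =
        Ideal.Quotient.mk _ (Polynomial.C s)) ∧
      g (xi f (n + 1) U) = Ideal.Quotient.mk _ Polynomial.X := by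
  let c : TruncPoly R (n + 1) →+* TruncPoly Γ(X, U) (n + 1) :=
    Ideal.Quotient.lift _ ((Ideal.Quotient.mk _).comp (Polynomial.mapRingHom (structMap f U)))
      (fun a ha => by
        obtain ⟨b, rfl⟩ := Ideal.mem_span_singleton'.1 ha
        rw [RingHom.comp_apply, Ideal.Quotient.eq_zero_iff_mem]
        refine Ideal.mem_span_singleton'.2 ⟨b.map (structMap f U), ?_⟩
        simp)
  obtain ⟨g, h1, h2⟩ := exists_thickeningRing_hom (f := f) (N := truncAlg R (n + 1)) hU
    (E := TruncPoly Γ(X, U) (n + 1)) ((Ideal.Quotient.mk _).comp Polynomial.C)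
    (c.comp (truncAlg.augToPoly R (n + 1)).toRingHom) (fun r => by
      refine Eq.trans ?_ (congrArg c (truncAlg.augToPoly_inl (n + 1) r)).symm
      refine Eq.trans ?_ (Ideal.Quotient.lift_mk _ _ _).symm
      simp)
  refine ⟨g, h1, (h2 _).trans ?_⟩
  refine (congrArg c (truncAlg.augToPoly_inr (n + 1) (truncAlg.x R (n + 1)))).trans ?_
  refine (Ideal.Quotient.lift_mk _ _ _).trans ?_
  simp

variable {f} in
lemma truncEval_eq_zero_iff {n : ℕ} {U : X.Opens} (hU : IsAffineOpen U)
    {p : PowerSeries Γ(X, U)} :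
    truncEval f (n + 1) U p = 0 ↔ ∀ i ≤ n, PowerSeries.coeff i p = 0 := by
  refine ⟨fun h i hi => ?_, truncEval_eq_zero f⟩
  obtain ⟨g, h1, h2⟩ := exists_truncEval_inverse (f := f) (n := n) hU
  have h3 : Ideal.Quotient.mk (Ideal.span {(Polynomial.X : Polynomial Γ(X, U)) ^ (n + 1)})
      (∑ j ∈ Finset.range (n + 3), Polynomial.C (PowerSeries.coeff j p) * Polynomial.X ^ j) = 0 :=
          by
    refine Eq.trans ?_ ((congrArg g h).trans (map_zero g))
    rw [truncEval_apply, map_sum, map_sum]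
    refine Finset.sum_congr rfl fun j _ => ?_
    rw [map_mul, map_pow, map_mul, map_pow, h1, h2]
  rw [Ideal.Quotient.eq_zero_iff_mem, Ideal.mem_span_singleton, Polynomial.X_pow_dvd_iff] at h3
  have h4 := h3 i (by omega)
  rw [Polynomial.finsetSum_coeff, Finset.sum_eq_single i] at h4
  · simpa using h4
  · intro j _ hj
    rw [Polynomial.coeff_C_mul_X_pow, if_neg hj.symm]
  · intro h
    exact absurd (Finset.mem_range.2 (by omega)) h

variable {f} in
lemma truncEval_surjective {n : ℕ} {U : X.Opens} (hU : IsAffineOpen U) :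
    Function.Surjective (truncEval f (n + 1) U) := by
  intro d
  obtain ⟨g, h1, h2⟩ := exists_truncEval_inverse (f := f) (n := n) hU
  let σ : TruncPoly Γ(X, U) (n + 1) →+* thickeningRing f (truncAlg R (n + 1)) U :=
    Ideal.Quotient.lift _ (Polynomial.eval₂RingHom
      ((thickeningFst f (truncAlg R (n + 1))).app U).hom (xi f (n + 1) U)) (fun a ha => by
        obtain ⟨b, rfl⟩ := Ideal.mem_span_singleton'.1 ha
        rw [Polynomial.coe_eval₂RingHom, Polynomial.eval₂_mul, Polynomial.eval₂_X_pow,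
          xi_pow_eq_zero f U le_rfl, mul_zero])
  have hσ : ∀ P : Polynomial Γ(X, U), σ (Ideal.Quotient.mk _ P) = truncEval f (n + 1) U P :=
    fun P => (Ideal.Quotient.lift_mk _ _ _).trans (nilEval_coe _ _ _ _ P).symm
  have hC : ∀ s, σ (g ((thickeningFst f (truncAlg R (n + 1))).app U s)) =
      (thickeningFst f (truncAlg R (n + 1))).app U s := by
    intro s
    rw [h1]
    refine (Ideal.Quotient.lift_mk _ _ _).trans ?_
    simp
  -- Both sides agree on Γ(X, U) and on R ⊕ N, and the latter is generated over R by x.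
  have hid : σ.comp g = RingHom.id _ := by
    refine thickeningRing_hom_ext (f := f) hU hC fun c => ?_
    have h5 : (σ.comp g).comp (augStruct f (truncAlg R (n + 1)) U) =
        augStruct f (truncAlg R (n + 1)) U := by
      refine truncAlg.ringHom_ext (fun r => ?_) ?_
      · have h6 := app_structMap f (truncAlg R (n + 1)) U r
        rw [RingHom.comp_apply, ← h6]
        exact hC _
      · refine (congrArg σ h2).trans ?_
        refine (Ideal.Quotient.lift_mk _ _ _).trans ?_
        simp [xi]
    exact RingHom.congr_fun h5 c
  obtain ⟨P, hP⟩ := Ideal.Quotient.mk_surjective (g d)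
  exact ⟨P, ((hσ P).symm.trans (congrArg σ hP)).trans (RingHom.congr_fun hid d)⟩

end Thickening

/-! ### The reduced part of the sheaves `Ẽ_T` -/

section Kernel

lemma sheafHom_congr {Y : TopCat.{u}} {F G : TopCat.Sheaf AddCommGrpCat.{u} Y} {φ ψ : F ⟶ G}
    (h : φ = ψ) (U : Opens Y) (s : F.obj.obj (op U)) :
    φ.hom.app (op U) s = ψ.hom.app (op U) s := by
  rw [h]

variable {Y : TopCat.{u}} {P Q : TopCat.Sheaf AddCommGrpCat.{u} Y} (g : P ⟶ Q) {U : Opens Y}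

lemma kernel_ι_injective : Function.Injective ((Limits.kernel.ι g).hom.app (op U)) := by
  intro s t h
  apply (secAddEquiv _ U).symm.injective
  rw [← cancel_mono (Limits.kernel.ι g), secAddEquiv_symm_comp, secAddEquiv_symm_comp, h]

lemma exists_kernel_section (s : P.obj.obj (op U)) (h : g.hom.app (op U) s = 0) :
    ∃ t, (Limits.kernel.ι g).hom.app (op U) t = s := by
  have h1 : (secAddEquiv P U).symm s ≫ g = 0 := by
    rw [secAddEquiv_symm_comp, h, map_zero]
  refine ⟨secAddEquiv _ U (Limits.kernel.lift g _ h1), ?_⟩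
  apply (secAddEquiv _ U).symm.injective
  rw [← secAddEquiv_symm_comp, AddEquiv.symm_apply_apply, Limits.kernel.lift_ι]

end Kernel

/-! ### The kernel of Ẽ_T ⟶ Ẽ_S as a direct summand of Ẽ_T, and its sections as truncated Witt
vectors -/

section RedTilde

variable {R : Type u} [CommRing R] {X : Scheme.{u}} (f : X ⟶ Spec (.of R))

/-- The map `0 → N`. -/
def NilAlg.fromZero (N : NilAlg R) : NilAlg.zero R ⟶ N := (0 : PUnit.{u + 1} →ₙₐ[R] N.carrier)

lemma NilAlg.toZero_comp {N : NilAlg R} (φ : NilAlg.zero R ⟶ NilAlg.zero R) :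
    N.toZero ≫ φ = N.toZero :=
  NonUnitalAlgHom.ext fun _ => rfl

/-- The functor `N ↦ ker(Ẽ_T ⟶ Ẽ_S)`, `T = Spec (R ⊕ N)`, with values in sheaves on `X`. -/
def redTilde : NilAlg R ⥤ TopCat.Sheaf AddCommGrpCat.{u} X where
  obj N := Limits.kernel ((pushTilde f).map N.toZero)
  map {N N'} φ := Limits.kernel.lift _ (Limits.kernel.ι _ ≫ (pushTilde f).map φ) (by
    rw [Category.assoc, ← Functor.map_comp, NilAlg.comp_toZero, Limits.kernel.condition])
  map_id N := by
    rw [← cancel_mono (Limits.kernel.ι _), Limits.kernel.lift_ι, CategoryTheory.Functor.map_id,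
        Category.comp_id,
      Category.id_comp]
  map_comp φ ψ := by
    rw [← cancel_mono (Limits.kernel.ι _), Limits.kernel.lift_ι, Functor.map_comp, Category.assoc,
      Limits.kernel.lift_ι, ← Category.assoc, ← Category.assoc, Limits.kernel.lift_ι]

/-- The inclusion of `redTilde` into `pushTilde`. -/
def redTildeι (N : NilAlg R) : (redTilde f).obj N ⟶ (pushTilde f).obj N := Limits.kernel.ι _

instance redTildeι_mono (N : NilAlg R) : Mono (redTildeι f N) :=
  inferInstanceAs (Mono (Limits.kernel.ι _))

lemma redTilde_map_ι {N N' : NilAlg R} (φ : N ⟶ N') :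
    (redTilde f).map φ ≫ redTildeι f N' = redTildeι f N ≫ (pushTilde f).map φ :=
  Limits.kernel.lift_ι _ _ _

lemma redTildeι_toZero (N : NilAlg R) : redTildeι f N ≫ (pushTilde f).map N.toZero = 0 :=
  Limits.kernel.condition _

/-- The projection of `pushTilde` onto `redTilde`. -/
def redTildeπ (N : NilAlg R) : (pushTilde f).obj N ⟶ (redTilde f).obj N :=
  Limits.kernel.lift _ (𝟙 _ - (pushTilde f).map (N.toZero ≫ N.fromZero)) (by
    rw [Preadditive.sub_comp, Category.id_comp, ← Functor.map_comp, Category.assoc,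
      NilAlg.toZero_comp, sub_self])

/-- The composite N → 0 → N induces an idempotent, and `redTilde` is the complementary direct
summand. Additive functors such as R^q f_* therefore commute with taking the reduced part, with no
exactness needed. -/
lemma redTildeπ_ι (N : NilAlg R) : redTildeπ f N ≫ redTildeι f N =
    𝟙 _ - (pushTilde f).map N.toZero ≫ (pushTilde f).map N.fromZero := by
  rw [← Functor.map_comp]
  exact Limits.kernel.lift_ι _ _ _

lemma redTildeι_π (N : NilAlg R) : redTildeι f N ≫ redTildeπ f N = 𝟙 _ := by
  rw [← cancel_mono (redTildeι f N), Category.assoc, redTildeπ_ι, Preadditive.comp_sub,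
    Category.comp_id, ← Category.assoc, redTildeι_toZero, Limits.zero_comp, sub_zero,
    Category.id_comp]

/-- The function on `X_N` underlying a section of `Ẽ_T`. -/
def tildeVal (N : NilAlg R) (U : X.Opens) (s : ((pushTilde f).obj N).obj.obj (op U)) :
    thickeningRing f N U :=
  ((Additive.toMul (show Additive ↥(unitsKer (redι (thickening f N)) (thickeningFst f N ⁻¹ᵁ U) ⊓
      unitsKer (baseChangeRed f N.toSpec) (thickeningFst f N ⁻¹ᵁ U)) from s)).1 :
        (thickeningRing f N U)ˣ)

variable {f} in
lemma tildeVal_injective {N : NilAlg R} {U : X.Opens} : Function.Injective (tildeVal f N U) :=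
  fun _ _ h => Additive.toMul.injective (Subtype.ext (Units.ext h))

lemma tildeVal_zero (N : NilAlg R) (U : X.Opens) : tildeVal f N U 0 = 1 := rfl

lemma tildeVal_add (N : NilAlg R) (U : X.Opens) (s t) :
    tildeVal f N U (s + t) = tildeVal f N U s * tildeVal f N U t := rfl

/-- The homomorphism `Γ(X_N, U) → Γ(X_N', U)` induced by `N → N'`. -/
def thickeningRingMap {N N' : NilAlg R} (φ : N ⟶ N') (U : X.Opens) :
    thickeningRing f N U →+* thickeningRing f N' U :=
  ((thickeningMap f φ).appLE _ _ (le_thickeningMap f φ U)).hom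

lemma tildeVal_map {N N' : NilAlg R} (φ : N ⟶ N') (U : X.Opens) (s) :
    tildeVal f N' U (((pushTilde f).map φ).hom.app (op U) s) =
      thickeningRingMap f φ U (tildeVal f N U s) := rfl

/-- The restriction homomorphism `Γ(X_N, U) → Γ(X_N, V)`. -/
def thickeningRes (N : NilAlg R) {U V : X.Opens} (i : V ⟶ U) :
    thickeningRing f N U →+* thickeningRing f N V :=
  ((thickening f N).presheaf.map ((Opens.map (thickeningFst f N).base).map i).op).hom

lemma thickeningRingMap_app {N N' : NilAlg R} (φ : N ⟶ N') (U : X.Opens) (s : Γ(X, U)) :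
    thickeningRingMap f φ U ((thickeningFst f N).app U s) = (thickeningFst f N').app U s := by
  have h : (thickeningFst f N).app U ≫
      (thickeningMap f φ).appLE _ _ (le_thickeningMap f φ U) = (thickeningFst f N').app U := by
    rw [Scheme.Hom.app_eq_appLE, Scheme.Hom.app_eq_appLE, Scheme.Hom.appLE_comp_appLE]
    have h3 : ∀ (k l : thickening f N' ⟶ X) (_ : k = l) e e',
        k.appLE U (thickeningFst f N' ⁻¹ᵁ U) e = l.appLE U (thickeningFst f N' ⁻¹ᵁ U) e' := by
      rintro _ _ rfl _ _
      rfl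
    exact h3 _ _ (thickeningMap_fst f φ) _ _
  exact ConcreteCategory.congr_hom h s

lemma thickeningRingMap_augStruct {N N' : NilAlg R} (φ : N ⟶ N') (U : X.Opens) (c : N.Aug) :
    thickeningRingMap f φ U (augStruct f N U c) = augStruct f N' U (NilAlg.augMap φ c) := by
  have h3 : ∀ (k l : thickening f N' ⟶ Spec (.of N.Aug)) (_ : k = l) e e',
      k.appLE ⊤ (thickeningFst f N' ⁻¹ᵁ U) e = l.appLE ⊤ (thickeningFst f N' ⁻¹ᵁ U) e' := by
    rintro _ _ rfl _ _
    rfl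
  have h1 : (Scheme.ΓSpecIso (.of N.Aug)).inv ≫
      (thickeningSnd f N).appLE ⊤ (thickeningFst f N ⁻¹ᵁ U) le_top ≫
        (thickeningMap f φ).appLE _ _ (le_thickeningMap f φ U) =
      CommRingCat.ofHom (NilAlg.augMap φ : N.Aug →+* N'.Aug) ≫
        CommRingCat.ofHom (augStruct f N' U) := by
    have h2 : CommRingCat.ofHom (augStruct f N' U) = (Scheme.ΓSpecIso (.of N'.Aug)).inv ≫
      (thickeningSnd f N').appLE ⊤ (thickeningFst f N' ⁻¹ᵁ U) le_top := rfl
    rw [h2, Scheme.ΓSpecIso_inv_naturality_assoc]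
    congr 1
    refine (Scheme.Hom.appLE_comp_appLE (thickeningMap f φ) (thickeningSnd f N) ⊤ _ _ le_top
      (le_thickeningMap f φ U)).trans ?_
    refine (h3 _ _ (thickeningMap_snd f φ) _ le_top).trans ?_
    exact Scheme.Hom.comp_appLE _ _ ⊤ _ _
  exact ConcreteCategory.congr_hom h1 c

lemma thickeningRes_app (N : NilAlg R) {U V : X.Opens} (i : V ⟶ U) (s : Γ(X, U)) :
    thickeningRes f N i ((thickeningFst f N).app U s) =
      (thickeningFst f N).app V (X.presheaf.map i.op s) :=
  (ConcreteCategory.congr_hom ((thickeningFst f N).naturality i.op) s).symm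

lemma thickeningRes_augStruct (N : NilAlg R) {U V : X.Opens} (i : V ⟶ U) (c : N.Aug) :
    thickeningRes f N i (augStruct f N U c) = augStruct f N V c :=
  map_structMap _ _ _

lemma thickeningFst_zero_injective (U : X.Opens) :
    Function.Injective ((thickeningFst f (NilAlg.zero R)).app U) := by
  have h : ∀ (k : X ⟶ X) (_ : k = 𝟙 X) (e : U ≤ k ⁻¹ᵁ U), k.appLE U U e = 𝟙 _ := by
    rintro _ rfl e
    exact Scheme.Hom.appLE_eq_app _
  have e : U ≤ thickeningSection f (NilAlg.zero R) ⁻¹ᵁ (thickeningFst f (NilAlg.zero R) ⁻¹ᵁ U) := by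
    rw [← Scheme.Hom.comp_preimage, thickeningSection_fst]
    exact le_rfl
  have h1 : (thickeningFst f (NilAlg.zero R)).app U ≫
      (thickeningSection f (NilAlg.zero R)).appLE _ _ e = 𝟙 _ := by
    rw [Scheme.Hom.app_eq_appLE, Scheme.Hom.appLE_comp_appLE]
    exact h _ (thickeningSection_fst f _) _
  intro s t hst
  have h2 := congrArg ((thickeningSection f (NilAlg.zero R)).appLE _ _ e) hst
  exact (ConcreteCategory.congr_hom h1 s).symm.trans (h2.trans (ConcreteCategory.congr_hom h1 t))

/-- The function on `X_N` underlying a section of `redTilde`. -/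
def redVal (N : NilAlg R) (U : X.Opens) (s : ((redTilde f).obj N).obj.obj (op U)) :
    thickeningRing f N U :=
  tildeVal f N U ((redTildeι f N).hom.app (op U) s)

variable {f} in
lemma redVal_injective {N : NilAlg R} {U : X.Opens} : Function.Injective (redVal f N U) :=
  fun _ _ h => kernel_ι_injective _ (tildeVal_injective h)

lemma redVal_zero (N : NilAlg R) (U : X.Opens) : redVal f N U 0 = 1 :=
  (congrArg (tildeVal f N U) (map_zero _)).trans (tildeVal_zero f N U)

lemma redVal_add (N : NilAlg R) (U : X.Opens) (s t) :
    redVal f N U (s + t) = redVal f N U s * redVal f N U t :=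
  (congrArg (tildeVal f N U) (map_add _ s t)).trans (tildeVal_add f N U _ _)

lemma redVal_map {N N' : NilAlg R} (φ : N ⟶ N') (U : X.Opens) (s) :
    redVal f N' U (((redTilde f).map φ).hom.app (op U) s) =
      thickeningRingMap f φ U (redVal f N U s) := by
  refine Eq.trans ?_ (tildeVal_map f φ U _)
  exact congrArg (tildeVal f N' U) (sheafHom_congr (redTilde_map_ι f φ) U s)

lemma thickeningRingMap_toZero_redVal (N : NilAlg R) (U : X.Opens)
    (s : ((redTilde f).obj N).obj.obj (op U)) :
    thickeningRingMap f N.toZero U (redVal f N U s) = 1 :=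
  congrArg (tildeVal f (NilAlg.zero R) U) (sheafHom_congr (redTildeι_toZero f N) U s)

lemma thickeningRingMap_truncEval {n : ℕ} {N : NilAlg R} (φ : truncAlg R n ⟶ N) (U : X.Opens)
    (p : PowerSeries Γ(X, U)) : thickeningRingMap f φ U (truncEval f n U p) =
      ∑ i ∈ Finset.range (n + 2), (thickeningFst f N).app U (PowerSeries.coeff i p) *
        augStruct f N U (NilAlg.hom φ (truncAlg.x R n) : N.Aug) ^ i := by
  rw [truncEval_apply, map_sum]
  refine Finset.sum_congr rfl fun i _ => ?_
  rw [map_mul, map_pow, thickeningRingMap_app, xi, thickeningRingMap_augStruct, NilAlg.augMap_inr]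

lemma thickeningRingMap_toZero_xi (n : ℕ) (U : X.Opens) :
    thickeningRingMap f (truncAlg R n).toZero U (xi f n U) = 0 := by
  rw [xi, thickeningRingMap_augStruct, NilAlg.augMap_inr]
  exact map_zero _

lemma thickeningRingMap_toZero_truncEval {n : ℕ} (U : X.Opens)
    (p : PowerSeries Γ(X, U)) : thickeningRingMap f (truncAlg R n).toZero U (truncEval f n U p) =
      (thickeningFst f (NilAlg.zero R)).app U (PowerSeries.constantCoeff p) := by
  rw [truncEval_apply, map_sum, Finset.sum_eq_single 0]
  · rw [map_mul, thickeningRingMap_app, pow_zero, map_one, mul_one,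
      PowerSeries.coeff_zero_eq_constantCoeff_apply]
  · intro i _ hi
    rw [map_mul, map_pow, thickeningRingMap_toZero_xi, zero_pow hi, mul_zero]
  · simp

/-- The homomorphism `𝕎𝒪_X ⟶ ker(Ẽ_T ⟶ Ẽ_S)` for `T = Spec (R[x] / x ^ n)`. -/
def wittToRed (n : ℕ) : wittSheaf X ⟶ (redTilde f).obj (truncAlg R n) :=
  Limits.kernel.lift _ (wittToTilde f n) (by
    refine ObjectProperty.hom_ext _ (NatTrans.ext (funext fun U => AddCommGrpCat.ext fun s =>
      tildeVal_injective ?_))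
    refine (thickeningRingMap_toZero_truncEval f U.unop _).trans ?_
    exact (congrArg _ (mem_wittSubgroup.1 (Additive.toMul s).2)).trans (map_one _))

lemma wittToRed_ι (n : ℕ) : wittToRed f n ≫ redTildeι f _ = wittToTilde f n :=
  Limits.kernel.lift_ι _ _ _

/-- The power series underlying a big Witt vector. -/
def wittVal (U : X.Opens) (ω : (wittSheaf X).obj.obj (op U)) : PowerSeries Γ(X, U) :=
  ((Additive.toMul (show Additive (wittSubgroup Γ(X, U)) from ω)).1 : (PowerSeries Γ(X, U))ˣ)

lemma wittVal_injective {U : X.Opens} : Function.Injective (wittVal U) :=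
  fun _ _ h => Additive.toMul.injective (Subtype.ext (Units.ext h))

lemma constantCoeff_wittVal (U : X.Opens) (ω) : PowerSeries.constantCoeff (wittVal (X := X) U ω) =
    1 :=
  mem_wittSubgroup.1 (Additive.toMul (show Additive (wittSubgroup Γ(X, U)) from ω)).2

lemma exists_wittVal {U : X.Opens} (p : PowerSeries Γ(X, U))
    (h : PowerSeries.constantCoeff p = 1) : ∃ ω, wittVal U ω = p := by
  have h2 : IsUnit p := by
    rw [PowerSeries.isUnit_iff_constantCoeff, h]
    exact isUnit_one
  exact ⟨Additive.ofMul (⟨h2.unit, mem_wittSubgroup.2 h⟩ : wittSubgroup Γ(X, U)), rfl⟩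

lemma redVal_wittToRed (n : ℕ) (U : X.Opens) (ω) :
    redVal f (truncAlg R n) U ((wittToRed f n).hom.app (op U) ω) =
      truncEval f n U (wittVal U ω) :=
  congrArg (tildeVal f (truncAlg R n) U) (sheafHom_congr (wittToRed_ι f n) U ω)

lemma wittToRed_proj (n : ℕ) :
    wittToRed f (n + 1) ≫ (redTilde f).map (truncAlg.proj R n) = wittToRed f n := by
  refine ObjectProperty.hom_ext _ (NatTrans.ext (funext fun U => AddCommGrpCat.ext fun s =>
    redVal_injective ?_))
  refine (redVal_map f _ _ _).trans ?_
  refine (congrArg _ (redVal_wittToRed f (n + 1) U.unop s)).trans ?_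
  refine Eq.trans ?_ (redVal_wittToRed f n U.unop s).symm
  rw [thickeningRingMap_truncEval, truncAlg.proj_x, truncEval_apply, Finset.sum_range_succ]
  have h := xi_pow f n U.unop
  refine (congrArg (_ + ·) ?_).trans (add_zero _)
  refine (congrArg (_ * ·) (pow_eq_zero_of_le (Nat.le_succ _) h)).trans (mul_zero _)

variable {f} in
lemma wittToRed_surjective {n : ℕ} {U : X.Opens} (hU : IsAffineOpen U) :
    Function.Surjective ((wittToRed f (n + 1)).hom.app (op U)) := by
  intro s
  obtain ⟨p, hp⟩ := truncEval_surjective (f := f) (n := n) hU (redVal f _ U s)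
  -- A section of the kernel restricts to 1 along N → 0, which forces the constant coefficient of
  -- the lifted series to be 1.
  have h := thickeningRingMap_toZero_redVal f _ U s
  rw [← hp, thickeningRingMap_toZero_truncEval] at h
  obtain ⟨ω, hω⟩ := exists_wittVal p
    (thickeningFst_zero_injective f U (h.trans (map_one _).symm))
  refine ⟨ω, redVal_injective ?_⟩
  rw [redVal_wittToRed, hω, hp]

variable {f} in
lemma wittToRed_eq_iff {n : ℕ} {U : X.Opens} (hU : IsAffineOpen U)
    (ω ω' : (wittSheaf X).obj.obj (op U)) :
    (wittToRed f (n + 1)).hom.app (op U) ω = (wittToRed f (n + 1)).hom.app (op U) ω' ↔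
      ∀ i ≤ n, PowerSeries.coeff i (wittVal U ω) = PowerSeries.coeff i (wittVal U ω') := by
  rw [← redVal_injective.eq_iff, redVal_wittToRed, redVal_wittToRed, ← sub_eq_zero, ← map_sub,
    truncEval_eq_zero_iff hU]
  simp only [map_sub, sub_eq_zero]

end RedTilde

/-! ### The graded pieces of the truncated Witt vectors -/

section Layer

variable {R : Type u} [CommRing R] {X : Scheme.{u}} (f : X ⟶ Spec (.of R))

/-- The sheaf `ker(Ẽ_T ⟶ Ẽ_S)` for `T = Spec (R[x] / x ^ n)`. -/
abbrev redTrunc (n : ℕ) : TopCat.Sheaf AddCommGrpCat.{u} X := (redTilde f).obj (truncAlg R n)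

/-- The transition map between the sheaves `redTrunc`. -/
abbrev redProj (n : ℕ) : redTrunc f (n + 1) ⟶ redTrunc f n :=
  (redTilde f).map (truncAlg.proj R n)

lemma constantCoeff_one_add {A : Type u} [CommRing A] (n : ℕ) (b : A) :
    PowerSeries.constantCoeff
      ((1 + Polynomial.C b * Polynomial.X ^ (n + 1) : Polynomial A) : PowerSeries A) = 1 := by
  simp

lemma isUnit_one_add {A : Type u} [CommRing A] (n : ℕ) (b : A) : IsUnit
    ((1 + Polynomial.C b * Polynomial.X ^ (n + 1) : Polynomial A) : PowerSeries A) := by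
  rw [PowerSeries.isUnit_iff_constantCoeff, constantCoeff_one_add]
  exact isUnit_one

/-- The big Witt vector `1 + b x ^ (n + 1)`. -/
def wittOne {A : Type u} [CommRing A] (n : ℕ) (b : A) : wittSubgroup A :=
  ⟨(isUnit_one_add n b).unit, mem_wittSubgroup.2 (constantCoeff_one_add n b)⟩

lemma wittOne_coe {A : Type u} [CommRing A] (k : ℕ) (b : A) :
    ((wittOne k b).1.1 : PowerSeries A) =
      ((1 + Polynomial.C b * Polynomial.X ^ (k + 1) : Polynomial A) : PowerSeries A) := rfl

lemma truncEval_wittOne (n k : ℕ) (U : X.Opens) (b : Γ(X, U)) :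
    truncEval f n U (wittOne k b).1.1 =
      1 + (thickeningFst f (truncAlg R n)).app U b * xi f n U ^ (k + 1) := by
  rw [wittOne_coe, truncEval, nilEval_coe]
  rw [Polynomial.eval₂_add, Polynomial.eval₂_one, Polynomial.eval₂_mul, Polynomial.eval₂_C,
    Polynomial.eval₂_pow, Polynomial.eval₂_X]

/-- The cross term in the product is divisible by x^(2k+2), which vanishes modulo x^(k+2). So the
last layer turns addition into multiplication. -/
lemma truncEval_wittOne_add (k : ℕ) (U : X.Opens) (b c : Γ(X, U)) :
    truncEval f (k + 2) U (wittOne k (b + c)).1.1 =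
      truncEval f (k + 2) U (wittOne k b).1.1 * truncEval f (k + 2) U (wittOne k c).1.1 := by
  rw [truncEval_wittOne, truncEval_wittOne, truncEval_wittOne, map_add]
  have h : xi f (k + 2) U ^ (k + 1) * xi f (k + 2) U ^ (k + 1) = 0 := by
    rw [← pow_add]
    exact xi_pow_eq_zero f U (by omega)
  linear_combination -((thickeningFst f (truncAlg R (k + 2))).app U b *
    (thickeningFst f (truncAlg R (k + 2))).app U c) * h

/-- The homomorphism `𝒪_X ⟶ Ẽ_T`, `b ↦ 1 + b x ^ (k + 1)`, for `T = Spec (R[x] / x ^ (k + 2))`. -/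
def layerTilde (k : ℕ) : structSheaf X ⟶ (pushTilde f).obj (truncAlg R (k + 2)) :=
  ⟨{ app := fun U => AddCommGrpCat.ofHom (AddMonoidHom.mk' (fun b : Γ(X, U.unop) =>
        (wittToTilde f (k + 2)).hom.app (op U.unop) (Additive.ofMul (wittOne k b)))
        (fun b c => tildeVal_injective (truncEval_wittOne_add f k U.unop b c)))
     naturality := fun U V i => by
       refine AddCommGrpCat.ext fun b : Γ(X, U.unop) => tildeVal_injective ?_
       refine (truncEval_wittOne f _ _ _ _).trans ?_
       refine Eq.trans ?_ (congrArg (thickeningRes f _ i.unop)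
        (truncEval_wittOne f _ _ _ b)).symm
       rw [map_add, map_one, map_mul, map_pow, thickeningRes_app, xi, xi,
         thickeningRes_augStruct]
       rfl }⟩

/-- The homomorphism `𝒪_X ⟶ ker(Ẽ_T ⟶ Ẽ_S)`, `b ↦ 1 + b x ^ (k + 1)`, for
`T = Spec (R[x] / x ^ (k + 2))`. -/
def layer (k : ℕ) : structSheaf X ⟶ redTrunc f (k + 2) :=
  Limits.kernel.lift _ (layerTilde f k) (by
    refine ObjectProperty.hom_ext _ (NatTrans.ext (funext fun U => AddCommGrpCat.ext fun s =>
      tildeVal_injective ?_))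
    refine (thickeningRingMap_toZero_truncEval f U.unop _).trans ?_
    exact (congrArg _ (constantCoeff_one_add k _)).trans (map_one _))

lemma layer_ι (k : ℕ) : layer f k ≫ redTildeι f _ = layerTilde f k :=
  Limits.kernel.lift_ι _ _ _

lemma redVal_layer (k : ℕ) (U : X.Opens) (b : Γ(X, U)) :
    redVal f _ U ((layer f k).hom.app (op U) b) =
      1 + (thickeningFst f (truncAlg R (k + 2))).app U b * xi f (k + 2) U ^ (k + 1) :=
  (congrArg (tildeVal f (truncAlg R (k + 2)) U) (sheafHom_congr (layer_ι f k) U b)).trans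
      (truncEval_wittOne f (k + 2) k U b)

lemma redVal_layer_eq_wittOne (k : ℕ) (U : X.Opens) (b : Γ(X, U)) :
    redVal f _ U ((layer f k).hom.app (op U) b) = truncEval f (k + 2) U (wittOne k b).1.1 :=
  (redVal_layer f k U b).trans (truncEval_wittOne f (k + 2) k U b).symm

lemma coeff_wittOne {A : Type u} [CommRing A] (k : ℕ) (b : A) (i : ℕ) :
    PowerSeries.coeff i ((wittOne k b).1.1 : PowerSeries A) =
      (if i = 0 then 1 else 0) + (if i = k + 1 then b else 0) := by
  rw [wittOne_coe, Polynomial.coeff_coe, Polynomial.coeff_add, Polynomial.coeff_one,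
    Polynomial.coeff_C_mul_X_pow]

lemma layer_eq_wittToRed (k : ℕ) (U : X.Opens) (b : Γ(X, U)) :
    (layer f k).hom.app (op U) b =
      (wittToRed f (k + 2)).hom.app (op U) (Additive.ofMul (wittOne k b)) := by
  apply redVal_injective (f := f)
  rw [redVal_layer_eq_wittOne]
  exact (redVal_wittToRed f (k + 2) U _).symm

lemma layer_redProj (k : ℕ) : layer f k ≫ redProj f (k + 1) = 0 := by
  refine ObjectProperty.hom_ext _ (NatTrans.ext (funext fun U =>
    AddCommGrpCat.ext fun s : Γ(X, U.unop) => redVal_injective (f := f) ?_))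
  refine (redVal_map f _ U.unop _).trans (Eq.trans ?_ (redVal_zero f _ U.unop).symm)
  refine (congrArg (thickeningRingMap f _ U.unop) (redVal_layer f k U.unop s)).trans ?_
  rw [map_add, map_one, map_mul, map_pow, xi, thickeningRingMap_augStruct,
    NilAlg.augMap_inr, truncAlg.proj_x]
  refine (congrArg (fun z => 1 + _ * z) (xi_pow_eq_zero f (n := k) U.unop le_rfl)).trans ?_
  rw [mul_zero, add_zero]

/-- The short complex `𝒪_X ⟶ redTrunc (k + 2) ⟶ redTrunc (k + 1)`. -/
abbrev layerComplex (k : ℕ) : ShortComplex (TopCat.Sheaf AddCommGrpCat.{u} X) :=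
  ShortComplex.mk (layer f k) (redProj f (k + 1)) (layer_redProj f k)

lemma wittToRed_redProj (n : ℕ) (U : X.Opens) (ω : (wittSheaf X).obj.obj (op U)) :
    (redProj f n).hom.app (op U) ((wittToRed f (n + 1)).hom.app (op U) ω) =
      (wittToRed f n).hom.app (op U) ω :=
  sheafHom_congr (wittToRed_proj f n) U ω

lemma coeff_zero_wittVal (U : X.Opens) (ω) : PowerSeries.coeff 0 (wittVal (X := X) U ω) = 1 := by
  rw [PowerSeries.coeff_zero_eq_constantCoeff_apply, constantCoeff_wittVal]

/-- Over affine opens the sections are truncated series, and the statement is read off from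
coefficients: the kernel of truncation consists of the series 1 + b x^(k+1). -/
lemma layerComplex_shortExact (k : ℕ) : (layerComplex f k).ShortExact := by
  refine shortExact_of_basis X.isBasis_affineOpens _ ?_ ?_ ?_
  · intro U hU (b : Γ(X, U)) hb
    have h1 : (wittToRed f (k + 2)).hom.app (op U) (Additive.ofMul (wittOne k b)) =
      (wittToRed f (k + 2)).hom.app (op U) 0 :=
      (layer_eq_wittToRed f k U b).symm.trans (hb.trans (map_zero _).symm)
    have h2 : PowerSeries.coeff (k + 1) ((wittOne k b).1.1 : PowerSeries Γ(X, U)) =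
        PowerSeries.coeff (k + 1) 1 := (wittToRed_eq_iff hU _ _).1 h1 (k + 1) le_rfl
    have h3 : b = 0 := by simpa [coeff_wittOne, PowerSeries.coeff_one] using h2
    exact h3
  · intro U hU s hs
    obtain ⟨ω, rfl⟩ := wittToRed_surjective (f := f) hU s
    have h1 : (wittToRed f (k + 1)).hom.app (op U) ω = (wittToRed f (k + 1)).hom.app (op U) 0 :=
      (wittToRed_redProj f (k + 1) U ω).symm.trans (hs.trans (map_zero _).symm)
    have h2 := (wittToRed_eq_iff hU _ _).1 h1
    refine ⟨(PowerSeries.coeff (k + 1) (wittVal U ω) : Γ(X, U)), ?_⟩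
    refine (layer_eq_wittToRed f k U _).trans ?_
    refine (wittToRed_eq_iff hU _ _).2 fun i hi => ?_
    refine (coeff_wittOne k _ i).trans ?_
    by_cases hi0 : i = 0
    · subst hi0
      rw [coeff_zero_wittVal]
      simp
    · by_cases hik : i = k + 1
      · subst hik
        simp
      · have h3 : PowerSeries.coeff i (wittVal U ω) = PowerSeries.coeff i 1 := h2 i (by omega)
        rw [h3, PowerSeries.coeff_one]
        simp [hi0, hik]
  · intro U hU s
    obtain ⟨ω, rfl⟩ := wittToRed_surjective (f := f) hU s
    exact ⟨_, wittToRed_redProj f (k + 1) U ω⟩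

/-- A Witt vector modulo x is its constant coefficient 1, so this sheaf is zero. It is the start of
every induction along the tower. -/
lemma redTrunc_one_eq_zero {q : ℕ} {W : X.Opens} (x : coh (redTrunc f 1) q W) : x = 0 := by
  have h : 𝟙 (redTrunc f 1) = 0 := by
    refine ObjectProperty.hom_ext _ (NatTrans.ext (funext fun U => AddCommGrpCat.ext fun s => ?_))
    change s = 0
    refine sheaf_eq_of_locally_eq (F := redTrunc f 1) (W := U.unop) s 0 fun x hx => ?_
    obtain ⟨V, hV, hxV, hVU⟩ := exists_basis_le X.isBasis_affineOpens hx
    refine ⟨V, hVU, hxV, Eq.trans ?_ (map_zero _).symm⟩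
    obtain ⟨ω, hω⟩ := wittToRed_surjective (f := f) hV ((redTrunc f 1).obj.map (homOfLE hVU).op s)
    rw [← hω]
    refine Eq.trans ((wittToRed_eq_iff (n := 0) hV ω 0).2 fun i hi => ?_) (map_zero _)
    obtain rfl : i = 0 := by omega
    rw [coeff_zero_wittVal, coeff_zero_wittVal]
  rw [← cohMap_id x, h, cohMap_zero]

lemma affineAcyclic_redTrunc (n : ℕ) : AffineAcyclic (redTrunc f (n + 1)) := by
  induction n with
  | zero => exact fun q U _ x => redTrunc_one_eq_zero f x
  | succ n ih =>
    intro q U hU x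
    obtain ⟨y, rfl⟩ := cohMap_exact (layerComplex_shortExact f n) x (ih q U hU _)
    exact (congrArg _ (affineAcyclic_structSheaf q U hU y)).trans (map_zero _)

/-- The endomorphism `x ↦ m x` of `x R[x] / x ^ (n + 1) R[x]`. -/
def truncScale (R : Type u) [CommRing R] (n m : ℕ) : truncAlg R (n + 1) ⟶ truncAlg R (n + 1) :=
  truncAlg.lift _ (m • truncAlg.x R (n + 1)) (n + 1) (by
    rw [Unitization.inr_smul, smul_pow, truncAlg.inr_x_pow_succ, smul_zero])

lemma truncScale_x (n m : ℕ) : NilAlg.hom (truncScale R n m) (truncAlg.x R (n + 1)) =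
    m • truncAlg.x R (n + 1) :=
  truncAlg.lift_x _ _ _ _

lemma truncScale_proj (n m : ℕ) : truncScale R (n + 1) m ≫ truncAlg.proj R (n + 1) =
    truncAlg.proj R (n + 1) ≫ truncScale R n m := by
  refine truncAlg.hom_ext ?_
  change NilAlg.hom (truncAlg.proj R (n + 1)) (NilAlg.hom (truncScale R (n + 1) m) _) =
    NilAlg.hom (truncScale R n m) (NilAlg.hom (truncAlg.proj R (n + 1)) _)
  rw [truncScale_x, map_nsmul, truncAlg.proj_x, truncScale_x]

/-- The endomorphism `x ↦ 2 x` of `redTrunc (n + 1)`. -/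
abbrev redScale (n : ℕ) : redTrunc f (n + 1) ⟶ redTrunc f (n + 1) :=
  (redTilde f).map (truncScale R n 2)

lemma redScale_redProj (n : ℕ) :
    redScale f (n + 1) ≫ redProj f (n + 1) = redProj f (n + 1) ≫ redScale f n := by
  rw [← Functor.map_comp, ← Functor.map_comp, truncScale_proj]

/-- The substitution x ↦ 2x gives the layer spanned by x^(k+1) the weight 2^(k+1). That different
layers have different weights is the reason why connecting maps are torsion. -/
lemma layer_redScale (k : ℕ) :
    layer f k ≫ redScale f (k + 1) = (2 ^ (k + 1) • 𝟙 (structSheaf X)) ≫ layer f k := by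
  refine ObjectProperty.hom_ext _ (NatTrans.ext (funext fun U =>
    AddCommGrpCat.ext fun s : Γ(X, U.unop) => redVal_injective (f := f) ?_))
  refine (redVal_map f _ U.unop _).trans ?_
  have h1 : ∀ m : ℕ, (m • 𝟙 (structSheaf X)).hom.app U s = m • s := by
    intro m
    induction m with
    | zero =>
      rw [zero_nsmul, zero_nsmul]
      rfl
    | succ m ih =>
      rw [succ_nsmul, succ_nsmul, ← ih]
      rfl
  refine Eq.trans ?_ ((congrArg (fun z => redVal f _ U.unop ((layer f k).hom.app (op U.unop) z))
    (h1 _)).trans (redVal_layer f k U.unop _)).symm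
  refine (congrArg (thickeningRingMap f _ U.unop) (redVal_layer f k U.unop s)).trans ?_
  rw [map_add, map_one, map_mul, map_pow, xi, thickeningRingMap_augStruct,
    NilAlg.augMap_inr, truncScale_x, Unitization.inr_smul, map_nsmul, smul_pow,
    thickeningRingMap_app, map_nsmul]
  rw [mul_smul_comm, smul_mul_assoc]

end Layer

/-! ### The cohomology of the truncated Witt vectors -/

section ScaleProd

variable {A B : Type*} [AddCommGroup A] [AddCommGroup B]

/-- The product of the endomorphisms `ψ - 2 ^ i`, `1 ≤ i ≤ k`. -/
def scaleProd (ψ : A →+ A) : ℕ → A →+ A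
  | 0 => AddMonoidHom.id A
  | k + 1 => ψ.comp (scaleProd ψ k) - 2 ^ (k + 1) • scaleProd ψ k

lemma scaleProd_succ (ψ : A →+ A) (k : ℕ) (a : A) : scaleProd ψ (k + 1) a =
    ψ (scaleProd ψ k a) - 2 ^ (k + 1) • scaleProd ψ k a := rfl

lemma map_scaleProd (g : A →+ B) {ψ : A →+ A} {ψ' : B →+ B} (h : ∀ a, g (ψ a) = ψ' (g a)) (k : ℕ)
    (a : A) : g (scaleProd ψ k a) = scaleProd ψ' k (g a) := by
  induction k with
  | zero => rfl
  | succ k ih => rw [scaleProd_succ, scaleProd_succ, map_sub, map_nsmul, h, ih]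

lemma scaleProd_nsmul {ψ : A →+ A} {c : ℕ} (h : ∀ a, ψ a = c • a) (k : ℕ) (a : A) :
    scaleProd ψ k a = (∏ i ∈ Finset.range k, ((c : ℤ) - 2 ^ (i + 1))) • a := by
  induction k with
  | zero => simp [scaleProd]
  | succ k ih =>
    rw [scaleProd_succ, h, ih, Finset.prod_range_succ, mul_comm, mul_smul, sub_smul]
    simp [← natCast_zsmul]

/-- The weight 2^(k+1) of the new layer differs from the weights 2, …, 2^k of the layers below it.
-/
lemma prod_two_pow_sub_ne_zero (k : ℕ) :
    ∏ i ∈ Finset.range k, (((2 ^ (k + 1) : ℕ) : ℤ) - 2 ^ (i + 1)) ≠ 0 := by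
  refine Finset.prod_ne_zero_iff.2 fun i hi => sub_ne_zero.2 fun h => ?_
  have h1 : (2 : ℕ) ^ (k + 1) = 2 ^ (i + 1) := by exact_mod_cast h
  have h2 := Nat.pow_right_injective le_rfl h1
  have h3 := Finset.mem_range.1 hi
  omega

end ScaleProd

/-- The group `H^q(W, F)` is torsion free. -/
def CohTorsionFree {Y : TopCat.{u}} (F : TopCat.Sheaf AddCommGrpCat.{u} Y) (q : ℕ) (W : Opens Y) :
    Prop :=
  ∀ m : ℕ, m ≠ 0 → ∀ x : coh F q W, m • x = 0 → x = 0

/-! ### Vanishing connecting maps and their consequences for the truncations -/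

section Tower

variable {R : Type u} [CommRing R] {X : Scheme.{u}} (f : X ⟶ Spec (.of R)) {q : ℕ} {W : X.Opens}

lemma cohMap_redScale_redProj (k : ℕ) (y : coh (redTrunc f (k + 2)) q W) :
    cohMap (redProj f (k + 1)) q W (cohMap (redScale f (k + 1)) q W y) =
      cohMap (redScale f k) q W (cohMap (redProj f (k + 1)) q W y) := by
  rw [← cohMap_comp, ← cohMap_comp, redScale_redProj]

lemma cohMap_redScale_layer (k : ℕ) (b : coh (structSheaf X) q W) :
    cohMap (redScale f (k + 1)) q W (cohMap (layer f k) q W b) =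
      2 ^ (k + 1) • cohMap (layer f k) q W b := by
  rw [← cohMap_comp, layer_redScale, cohMap_comp, cohMap_nsmul, cohMap_id, map_nsmul]

/-- Each factor removes one layer: by induction the first k factors map a class into the image of
the top layer, where ψ is multiplication by 2^(k+1). -/
lemma scaleProd_redScale (k : ℕ) (y : coh (redTrunc f (k + 1)) q W) :
    scaleProd (cohMap (redScale f k) q W) k y = 0 := by
  induction k with
  | zero => exact redTrunc_one_eq_zero f _
  | succ k ih =>
    have h1 := map_scaleProd (cohMap (redProj f (k + 1)) q W)
      (ψ := cohMap (redScale f (k + 1)) q W) (cohMap_redScale_redProj f k) k y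
    rw [ih] at h1
    obtain ⟨b, hb⟩ := cohMap_exact (layerComplex_shortExact f k) _ h1
    rw [scaleProd_succ, ← hb]
    exact sub_eq_zero.2 (cohMap_redScale_layer f k b)

variable {f} in
-- The connecting map commutes with the scaling, which is multiplication by 2^(k+1) on its target.
-- The operator `scaleProd` is zero on the source and a nonzero integer on the target, so the image
-- is torsion, hence zero.
lemma cohδ_layerComplex_eq_zero (h : CohTorsionFree (structSheaf X) (q + 1) W) (k : ℕ)
    (y : coh (redTrunc f (k + 1)) q W) : cohδ (layerComplex_shortExact f k) q W y = 0 := by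
  let t : layerComplex f k ⟶ layerComplex f k :=
    { τ₁ := 2 ^ (k + 1) • 𝟙 _
      τ₂ := redScale f (k + 1)
      τ₃ := redScale f k
      comm₁₂ := (layer_redScale f k).symm
      comm₂₃ := redScale_redProj f k }
  have h1 : ∀ z : coh (redTrunc f (k + 1)) q W,
      cohδ (layerComplex_shortExact f k) q W (cohMap (redScale f k) q W z) =
        (2 ^ (k + 1) • AddMonoidHom.id _) (cohδ (layerComplex_shortExact f k) q W z) := by
    intro z
    refine (cohδ_naturality (layerComplex_shortExact f k) (layerComplex_shortExact f k) t z).trans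
        ?_
    refine (cohMap_nsmul (2 ^ (k + 1)) (𝟙 (structSheaf X)) _).trans ?_
    rw [cohMap_id]
    rfl
  have h2 := map_scaleProd (cohδ (layerComplex_shortExact f k) q W) h1 k y
  rw [scaleProd_redScale, map_zero, scaleProd_nsmul (c := 2 ^ (k + 1)) (fun _ => rfl)] at h2
  refine h _ (Int.natAbs_ne_zero.2 (prod_two_pow_sub_ne_zero k)) _ ?_
  have h3 := h2.symm
  rcases Int.natAbs_eq (∏ i ∈ Finset.range k, (((2 ^ (k + 1) : ℕ) : ℤ) - 2 ^ (i + 1))) with he | he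
  · rw [he, natCast_zsmul] at h3
    exact h3
  · rw [he, neg_smul, neg_eq_zero, natCast_zsmul] at h3
    exact h3

variable {f} in
lemma cohMap_redProj_surjective (h : CohTorsionFree (structSheaf X) (q + 1) W) (k : ℕ) :
    Function.Surjective (cohMap (redProj f (k + 1)) q W) :=
  fun y => cohδ_exact₃ (layerComplex_shortExact f k) y (cohδ_layerComplex_eq_zero h k y)

variable {f} in
lemma cohMap_layer_injective (h : CohTorsionFree (structSheaf X) q W) (k : ℕ) :
    Function.Injective (cohMap (layer f k) q W) := by
  rw [injective_iff_map_eq_zero]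
  intro b hb
  cases q with
  | zero => exact cohMap_zero_injective (layerComplex_shortExact f k) b hb
  | succ q =>
    obtain ⟨y, rfl⟩ := cohδ_exact₁ (layerComplex_shortExact f k) b hb
    exact cohδ_layerComplex_eq_zero h k y

variable {f} in
-- The vanishing of the connecting maps makes H^q(F_(k+2)) an extension of a subgroup of
-- H^q(F_(k+1)) by H^q(𝒪_X), and torsion freeness passes through extensions.
lemma cohTorsionFree_redTrunc (h : CohTorsionFree (structSheaf X) q W) (k : ℕ) :
    CohTorsionFree (redTrunc f (k + 1)) q W := by
  induction k with
  | zero => exact fun _ _ x _ => redTrunc_one_eq_zero f x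
  | succ k ih =>
    intro m hm x hx
    have h1 : cohMap (redProj f (k + 1)) q W x = 0 := by
      refine ih m hm _ ?_
      rw [← map_nsmul, hx, map_zero]
    obtain ⟨b, rfl⟩ := cohMap_exact (layerComplex_shortExact f k) x h1
    have h2 : cohMap (layer f k) q W (m • b) = 0 := (map_nsmul _ _ _).trans hx
    have h3 := h m hm b (cohMap_layer_injective h k (h2.trans (map_zero _).symm))
    rw [h3]
    exact map_zero _

variable {f} in
-- A class on the intersection is first decomposed in the quotient F_(k+1). The two parts lift to
-- F_(k+2) because connecting maps vanish over D(a) and D(b), and the error comes from 𝒪_X, where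
-- the decomposition is known.
lemma cohSurjTwo_redTrunc [IsNoetherian X] [IsSeparated f]
    (h : ∀ V ∈ basicClass R, CohTorsionFree (structSheaf X) (q + 1) (preim f V)) (k : ℕ) :
    CohSurjTwo (Y := X) (preim f) (redTrunc f (k + 1)) q (basicClass R) := by
  induction k with
  | zero =>
    intro U hU a b hab I hI y
    exact ⟨0, 0, (redTrunc_one_eq_zero f _).trans (redTrunc_one_eq_zero f _).symm⟩
  | succ k ih =>
    intro U hU a b hab I hI y
    obtain ⟨s, t, hst⟩ := ih U hU a b hab I hI (cohMap (redProj f (k + 1)) q I y)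
    obtain ⟨s, rfl⟩ := cohMap_redProj_surjective
      (h _ (isBasicClass_basicClass.basicOpen_mem hU a)) k s
    obtain ⟨t, rfl⟩ := cohMap_redProj_surjective
      (h _ (isBasicClass_basicClass.basicOpen_mem hU b)) k t
    rw [← cohMap_cohRes, ← cohMap_cohRes, ← map_sub] at hst
    obtain ⟨c, hc⟩ := cohMap_exact (layerComplex_shortExact f k) (y -
      (cohRes _ q (hI.le.trans inf_le_left) s - cohRes _ q (hI.le.trans inf_le_right) t)) (by
        refine (map_sub _ _ _).trans ?_
        exact sub_eq_zero.2 hst.symm)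
    obtain ⟨s', t', rfl⟩ := cohSurjTwo_structSheaf f q U hU a b hab I hI c
    refine ⟨s + cohMap (layer f k) q _ s', t + cohMap (layer f k) q _ t', ?_⟩
    rw [map_add, map_add, ← cohMap_cohRes, ← cohMap_cohRes, add_sub_add_comm, ← map_sub]
    exact eq_sub_iff_add_eq'.1 hc

variable {f} in
lemma sepTwo_redTrunc [IsNoetherian X] [IsSeparated f]
    (h : ∀ V ∈ basicClass R, CohTorsionFree (structSheaf X) q (preim f V)) (k : ℕ) :
    SepTwo (cohPresheaf (preimOpens_monotone f.base) (redTrunc f (k + 1)) q) (basicClass R) := by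
  cases q with
  | zero => exact sepTwo_cohPresheaf_zero _ _
  | succ q => exact sepTwo_cohPresheaf _ _ _ (fun _ _ => rfl) rfl (cohSurjTwo_redTrunc h k)

lemma top_mem_basicClass : (⊤ : (Spec (.of R)).Opens) ∈ basicClass R :=
  ⟨1, PrimeSpectrum.basicOpen_one.symm⟩

variable {f} in
lemma toDirect_redTrunc_bijective [IsNoetherian X] [IsSeparated f]
    (h : ∀ V ∈ basicClass R, CohTorsionFree (structSheaf X) q (preim f V)) (k : ℕ) :
    Function.Bijective (toDirect f.base q (redTrunc f (k + 1)) ⊤) :=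
  toDirect_bijective isBasicClass_basicClass (sepTwo_redTrunc h k)
    (glueTwo_cohPresheaf _ _ _ (fun _ _ => rfl) (fun _ _ => rfl)) top_mem_basicClass

end Tower

/-! ### The cohomology of products -/

section Sections

variable {Y : TopCat.{u}} {S : ShortComplex (TopCat.Sheaf AddCommGrpCat.{u} Y)}
  (hS : S.ShortExact) {U : Opens Y}
include hS

lemma section_injective (s : S.X₁.obj.obj (op U)) (h : S.f.hom.app (op U) s = 0) : s = 0 := by
  apply (cohZero S.X₁ U).symm.injective
  rw [map_zero]
  refine cohMap_zero_injective hS _ ?_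
  rw [cohMap_cohZero_symm, h, map_zero]

lemma section_exact (s : S.X₂.obj.obj (op U)) (h : S.g.hom.app (op U) s = 0) :
    ∃ t, S.f.hom.app (op U) t = s := by
  obtain ⟨y, hy⟩ := cohMap_exact (q := 0) hS ((cohZero S.X₂ U).symm s) (by
    rw [cohMap_cohZero_symm, h, map_zero])
  obtain ⟨t, rfl⟩ := (cohZero S.X₁ U).symm.surjective y
  rw [cohMap_cohZero_symm] at hy
  exact ⟨t, (cohZero S.X₂ U).symm.injective hy⟩

lemma section_surjective (hU : ∀ x : coh S.X₁ 1 U, x = 0) (s : S.X₃.obj.obj (op U)) :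
    ∃ t, S.g.hom.app (op U) t = s := by
  obtain ⟨y, hy⟩ := cohδ_exact₃ hS ((cohZero S.X₃ U).symm s) (hU _)
  obtain ⟨t, rfl⟩ := (cohZero S.X₂ U).symm.surjective y
  rw [cohMap_cohZero_symm] at hy
  exact ⟨t, (cohZero S.X₃ U).symm.injective hy⟩

end Sections

/-! ### Sections of countable products of sheaves -/

section Product

instance sheaf_hasProduct {Y : TopCat.{u}} (F : ℕ → TopCat.Sheaf AddCommGrpCat.{u} Y) :
    Limits.HasProduct F :=
  have : Limits.HasLimitsOfSize.{0, 0} (TopCat.Sheaf AddCommGrpCat.{u} Y) :=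
    inferInstanceAs (Limits.HasLimitsOfSize.{0, 0} (Sheaf _ AddCommGrpCat.{u}))
  inferInstance

variable {Y : TopCat.{u}} {F G : ℕ → TopCat.Sheaf AddCommGrpCat.{u} Y} {U : Opens Y}

lemma prod_section_ext {s t : (∏ᶜ F).obj.obj (op U)}
    (h : ∀ n, (Limits.Pi.π F n).hom.app (op U) s = (Limits.Pi.π F n).hom.app (op U) t) :
    s = t := by
  apply (secAddEquiv _ U).symm.injective
  refine Limits.Pi.hom_ext _ _ fun n => ?_
  rw [secAddEquiv_symm_comp, secAddEquiv_symm_comp, h]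

lemma exists_prod_section (s : ∀ n, (F n).obj.obj (op U)) :
    ∃ t : (∏ᶜ F).obj.obj (op U), ∀ n, (Limits.Pi.π F n).hom.app (op U) t = s n := by
  refine ⟨secAddEquiv _ U (Limits.Pi.lift fun n => (secAddEquiv _ U).symm (s n)), fun n => ?_⟩
  apply (secAddEquiv _ U).symm.injective
  rw [← secAddEquiv_symm_comp, AddEquiv.symm_apply_apply, Limits.Pi.lift_π]

lemma prod_section_map (φ : ∀ n, F n ⟶ G n) (n : ℕ) (s : (∏ᶜ F).obj.obj (op U)) :
    (Limits.Pi.π G n).hom.app (op U) ((Limits.Pi.map φ).hom.app (op U) s) =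
      (φ n).hom.app (op U) ((Limits.Pi.π F n).hom.app (op U) s) :=
  sheafHom_congr (Limits.Pi.map_π φ n) U s

end Product

/-! ### Cohomology commutes with countable products of sheaves without higher cohomology on affine
opens -/

section CohProduct

variable {X : Scheme.{u}}

lemma affineAcyclic_injective (I : TopCat.Sheaf AddCommGrpCat.{u} X) [Injective I] :
    AffineAcyclic I :=
  fun _ _ _ _ => Abelian.Ext.eq_zero_of_injective _

lemma affineAcyclic_cokernel {S : ShortComplex (TopCat.Sheaf AddCommGrpCat.{u} X)}
    (hS : S.ShortExact) (h1 : AffineAcyclic S.X₁) (h2 : AffineAcyclic S.X₂) :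
    AffineAcyclic S.X₃ := by
  intro q U hU x
  obtain ⟨y, rfl⟩ := cohδ_exact₃ hS x (h1 (q + 1) U hU _)
  exact (congrArg _ (h2 q U hU y)).trans (map_zero _)

/-- The product of the short complexes `injComplex`. -/
abbrev prodInjComplex (F : ℕ → TopCat.Sheaf AddCommGrpCat.{u} X) :
    ShortComplex (TopCat.Sheaf AddCommGrpCat.{u} X) :=
  ShortComplex.mk (Limits.Pi.map fun n => (injComplex (F n)).f)
    (Limits.Pi.map fun n => (injComplex (F n)).g) (by
      refine Limits.Pi.hom_ext _ _ fun n => ?_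
      rw [Category.assoc, Limits.Pi.map_π, ← Category.assoc, Limits.Pi.map_π, Category.assoc,
        (injComplex (F n)).zero, Limits.comp_zero, Limits.zero_comp])

/-- Products of sheaves are not exact in general. Here each I_n → I_n/F_n is surjective on sections
over affine opens because H¹(U, F_n) = 0, so componentwise lifts over the same U assemble. -/
lemma prodInjComplex_shortExact {F : ℕ → TopCat.Sheaf AddCommGrpCat.{u} X}
    (hF : ∀ n, AffineAcyclic (F n)) : (prodInjComplex F).ShortExact := by
  refine shortExact_of_basis X.isBasis_affineOpens _ ?_ ?_ ?_
  · intro U hU s hs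
    refine prod_section_ext (F := F) fun n => Eq.trans ?_ (map_zero _).symm
    refine section_injective (injComplex_shortExact (F n)) _ ?_
    exact (prod_section_map (fun n => (injComplex (F n)).f) n s).symm.trans
      ((congrArg _ hs).trans (map_zero _))
  · intro U hU s hs
    have h1 : ∀ n, ∃ t, (injComplex (F n)).f.hom.app (op U) t =
        (Limits.Pi.π (fun n => (injComplex (F n)).X₂) n).hom.app (op U) s := by
      intro n
      refine section_exact (injComplex_shortExact (F n)) _ ?_
      exact (prod_section_map (fun n => (injComplex (F n)).g) n s).symm.trans
        ((congrArg _ hs).trans (map_zero _))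
    choose t ht using h1
    obtain ⟨t', ht'⟩ := exists_prod_section (F := F) t
    refine ⟨t', prod_section_ext (F := fun n => (injComplex (F n)).X₂) fun n => ?_⟩
    exact (prod_section_map (fun n => (injComplex (F n)).f) n t').trans
      ((congrArg _ (ht' n)).trans (ht n))
  · intro U hU s
    have h1 : ∀ n, ∃ t, (injComplex (F n)).g.hom.app (op U) t =
        (Limits.Pi.π (fun n => (injComplex (F n)).X₃) n).hom.app (op U) s :=
      fun n => section_surjective (injComplex_shortExact (F n)) (hF n 0 U hU) _
    choose t ht using h1
    obtain ⟨t', ht'⟩ := exists_prod_section (F := fun n => (injComplex (F n)).X₂) t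
    refine ⟨t', prod_section_ext (F := fun n => (injComplex (F n)).X₃) fun n => ?_⟩
    exact (prod_section_map (fun n => (injComplex (F n)).g) n t').trans
      ((congrArg _ (ht' n)).trans (ht n))

/-- The projection of `prodInjComplex` onto a factor. -/
def prodInjComplexπ (F : ℕ → TopCat.Sheaf AddCommGrpCat.{u} X) (n : ℕ) :
    prodInjComplex F ⟶ injComplex (F n) where
  τ₁ := Limits.Pi.π F n
  τ₂ := Limits.Pi.π (fun n => (injComplex (F n)).X₂) n
  τ₃ := Limits.Pi.π (fun n => (injComplex (F n)).X₃) n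
  comm₁₂ := (Limits.Pi.map_π (fun n => (injComplex (F n)).f) n).symm
  comm₂₃ := (Limits.Pi.map_π (fun n => (injComplex (F n)).g) n).symm

/-- Dimension shifting with the product of the injective hulls, which is again injective. The
quotients remain acyclic on affine opens, so the induction applies to them. -/
lemma coh_prod (q : ℕ) (W : X.Opens) (F : ℕ → TopCat.Sheaf AddCommGrpCat.{u} X)
    (hF : ∀ n, AffineAcyclic (F n)) :
    (∀ x : coh (∏ᶜ F) q W, (∀ n, cohMap (Limits.Pi.π F n) q W x = 0) → x = 0) ∧
    ∀ x : ∀ n, coh (F n) q W, ∃ y : coh (∏ᶜ F) q W, ∀ n, cohMap (Limits.Pi.π F n) q W y = x n := by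
  induction q generalizing F with
  | zero =>
    refine ⟨fun x hx => ?_, fun x => ?_⟩
    · obtain ⟨s, rfl⟩ := (cohZero _ W).symm.surjective x
      have h : s = 0 := by
        refine prod_section_ext (F := F) fun n => ?_
        apply (cohZero _ W).symm.injective
        rw [← cohMap_cohZero_symm, ← cohMap_cohZero_symm, hx, map_zero, map_zero]
      rw [h, map_zero]
    · obtain ⟨s, hs⟩ := exists_prod_section (F := F) fun n => cohZero _ W (x n)
      refine ⟨(cohZero _ W).symm s, fun n => ?_⟩
      rw [cohMap_cohZero_symm, hs, AddEquiv.symm_apply_apply]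
  | succ q ih =>
    have hI : ∀ n, AffineAcyclic (injComplex (F n)).X₂ := fun n =>
      affineAcyclic_injective (Injective.under (F n))
    have hQ : ∀ n, AffineAcyclic (injComplex (F n)).X₃ := fun n =>
      affineAcyclic_cokernel (injComplex_shortExact (F n)) (hF n) (hI n)
    have hS := prodInjComplex_shortExact hF
    refine ⟨fun x hx => ?_, fun x => ?_⟩
    · have hinj : Injective (prodInjComplex F).X₂ :=
        inferInstanceAs (Injective (∏ᶜ fun n => Injective.under (F n)))
      obtain ⟨y, rfl⟩ := cohδ_exact₁ hS x (Abelian.Ext.eq_zero_of_injective _)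
      have h1 : ∀ n, ∃ z, cohMap (injComplex (F n)).g q W z =
          cohMap (Limits.Pi.π (fun n => (injComplex (F n)).X₃) n) q W y := by
        intro n
        refine cohδ_exact₃ (injComplex_shortExact (F n)) _ ?_
        exact (cohδ_naturality hS (injComplex_shortExact (F n)) (prodInjComplexπ F n) y).trans
          (hx n)
      choose z hz using h1
      -- The components of y lift separately to the middle terms. The induction hypothesis for the
      -- middle terms assembles the lifts, and for the quotients it shows that the assembled class
      -- maps to y.
      obtain ⟨z', hz'⟩ := (ih _ hI).2 z
      have h2 : cohMap (prodInjComplex F).g q W z' = y := by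
        refine sub_eq_zero.1 ((ih _ hQ).1 _ fun n => ?_)
        rw [map_sub, sub_eq_zero, ← hz n, ← hz' n, ← cohMap_comp, ← cohMap_comp]
        exact congrArg (fun k => cohMap k q W z')
          (Limits.Pi.map_π (fun n => (injComplex (F n)).g) n)
      rw [← h2]
      exact cohδ_cohMap hS z'
    · choose y hy using fun n => exists_cohδ_injComplex (x n)
      obtain ⟨y', hy'⟩ := (ih _ hQ).2 y
      refine ⟨cohδ hS q W y', fun n => ?_⟩
      refine (cohδ_naturality hS (injComplex_shortExact (F n)) (prodInjComplexπ F n) y').symm.trans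
          ?_
      exact (congrArg _ (hy' n)).trans (hy n)

end CohProduct

/-! ### Witt vector cohomology as an inverse limit -/

section Milnor

/-- This is the vanishing of lim¹ for surjective transition maps: starting from s₀ = 0, a preimage
of sₙ - tₙ serves as the next term. -/
lemma exists_sub_shift_eq {A : ℕ → Type*} [∀ n, AddCommGroup (A n)] (p : ∀ n, A (n + 1) →+ A n)
    (hp : ∀ n, Function.Surjective (p n)) (t : ∀ n, A n) :
    ∃ s : ∀ n, A n, ∀ n, s n - p n (s (n + 1)) = t n := by
  choose l hl using hp
  let s : ∀ n, A n := fun n => Nat.rec (0 : A 0) (fun n a => l n (a - t n)) n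
  refine ⟨s, fun n => ?_⟩
  have h : s (n + 1) = l n (s n - t n) := rfl
  rw [h, hl, sub_sub_cancel]

variable {R : Type u} [CommRing R] {X : Scheme.{u}} (f : X ⟶ Spec (.of R))

variable {f} in
lemma exists_witt_of_compatible {U : X.Opens} (hU : IsAffineOpen U)
    (s : ∀ n, (redTrunc f (n + 1)).obj.obj (op U))
    (hs : ∀ n, (redProj f (n + 1)).hom.app (op U) (s (n + 1)) = s n) :
    ∃ ω, ∀ n, (wittToRed f (n + 1)).hom.app (op U) ω = s n := by
  choose ω hω using fun n => wittToRed_surjective (f := f) (n := n) hU (s n)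
  have h1 : ∀ n i, i ≤ n → PowerSeries.coeff i (wittVal U (ω (n + 1))) =
      PowerSeries.coeff i (wittVal U (ω n)) := by
    intro n i hi
    refine (wittToRed_eq_iff (f := f) hU _ _).1 ?_ i hi
    rw [← wittToRed_redProj, hω, hω, hs]
  have h2 : ∀ i n, i ≤ n → PowerSeries.coeff i (wittVal U (ω n)) =
      PowerSeries.coeff i (wittVal U (ω i)) := by
    intro i n hi
    induction n, hi using Nat.le_induction with
    | base => rfl
    | succ n hn ih => rw [h1 n i hn, ih]
  obtain ⟨η, hη⟩ := exists_wittVal (U := U)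
    (PowerSeries.mk fun i => PowerSeries.coeff i (wittVal U (ω i))) (by
      rw [← PowerSeries.coeff_zero_eq_constantCoeff_apply, PowerSeries.coeff_mk,
        coeff_zero_wittVal])
  refine ⟨η, fun n => ?_⟩
  rw [← hω n]
  refine (wittToRed_eq_iff hU _ _).2 fun i hi => ?_
  rw [hη, PowerSeries.coeff_mk, h2 i n hi]

variable {f} in
lemma witt_ext {U : X.Opens} {ω ω' : (wittSheaf X).obj.obj (op U)}
    (h : ∀ n, (wittToRed f (n + 1)).hom.app (op U) ω = (wittToRed f (n + 1)).hom.app (op U) ω') :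
    ω = ω' := by
  refine sheaf_eq_of_locally_eq (F := wittSheaf X) ω ω' fun x hx => ?_
  obtain ⟨V, hV, hxV, hVU⟩ := exists_basis_le X.isBasis_affineOpens hx
  refine ⟨V, hVU, hxV, wittVal_injective (PowerSeries.ext fun i => ?_)⟩
  refine (wittToRed_eq_iff (f := f) hV _ _).1 ?_ i le_rfl
  have h1 := fun ω => ConcreteCategory.congr_hom ((wittToRed f (i + 1)).hom.naturality
    (homOfLE hVU).op) ω
  exact (h1 ω).trans ((congrArg _ (h i)).trans (h1 ω').symm)

/-- The map `(sₙ) ↦ (sₙ - p(sₙ₊₁))` on the product of the sheaves `redTrunc`. -/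
def redShift : (∏ᶜ fun n => redTrunc f (n + 1)) ⟶ ∏ᶜ fun n => redTrunc f (n + 1) :=
  Limits.Pi.lift fun n => Limits.Pi.π (fun n => redTrunc f (n + 1)) n -
    Limits.Pi.π (fun n => redTrunc f (n + 1)) (n + 1) ≫ redProj f (n + 1)

lemma redShift_π (n : ℕ) : redShift f ≫ Limits.Pi.π (fun n => redTrunc f (n + 1)) n =
    Limits.Pi.π (fun n => redTrunc f (n + 1)) n -
      Limits.Pi.π (fun n => redTrunc f (n + 1)) (n + 1) ≫ redProj f (n + 1) :=
  Limits.Pi.lift_π _ _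

/-- The map from the Witt vectors to the product of the sheaves `redTrunc`. -/
def wittToProd : wittSheaf X ⟶ ∏ᶜ fun n => redTrunc f (n + 1) :=
  Limits.Pi.lift fun n => wittToRed f (n + 1)

lemma wittToProd_π (n : ℕ) : wittToProd f ≫ Limits.Pi.π (fun n => redTrunc f (n + 1)) n =
    wittToRed f (n + 1) :=
  Limits.Pi.lift_π _ _

/-- The Milnor sequence of the Witt vectors. -/
abbrev milnorComplex : ShortComplex (TopCat.Sheaf AddCommGrpCat.{u} X) :=
  ShortComplex.mk (wittToProd f) (redShift f) (by
    refine Limits.Pi.hom_ext _ _ fun n => ?_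
    rw [Category.assoc, redShift_π, Preadditive.comp_sub, wittToProd_π, ← Category.assoc,
      wittToProd_π, wittToRed_proj, sub_self, Limits.zero_comp])

lemma redShift_section (n : ℕ) (U : X.Opens)
    (s : (∏ᶜ fun n => redTrunc f (n + 1)).obj.obj (op U)) :
    (Limits.Pi.π (fun n => redTrunc f (n + 1)) n).hom.app (op U) ((redShift f).hom.app (op U) s) =
      (Limits.Pi.π (fun n => redTrunc f (n + 1)) n).hom.app (op U) s -
        (redProj f (n + 1)).hom.app (op U)
          ((Limits.Pi.π (fun n => redTrunc f (n + 1)) (n + 1)).hom.app (op U) s) :=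
  sheafHom_congr (redShift_π f n) U s

/-- Over affine opens, compatible truncated series are one power series, and the transition maps are
surjective on sections, so the shift map is surjective there. -/
lemma milnorComplex_shortExact : (milnorComplex f).ShortExact := by
  refine shortExact_of_basis X.isBasis_affineOpens _ ?_ ?_ ?_
  · intro U hU ω hω
    refine witt_ext (f := f) fun n => ?_
    refine (sheafHom_congr (wittToProd_π f n) U ω).symm.trans (Eq.trans ?_ (map_zero _).symm)
    exact (congrArg ((Limits.Pi.π (fun n => redTrunc f (n + 1)) n).hom.app (op U)) hω).trans
      (map_zero _)
  · intro U hU s hs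
    obtain ⟨ω, hω⟩ := exists_witt_of_compatible (f := f) hU
      (fun n => (Limits.Pi.π (fun n => redTrunc f (n + 1)) n).hom.app (op U) s) (fun n => by
        have h := redShift_section f n U s
        exact (sub_eq_zero.1 (h.symm.trans ((congrArg _ hs).trans (map_zero _)))).symm)
    refine ⟨ω, prod_section_ext (F := fun n => redTrunc f (n + 1)) fun n => ?_⟩
    exact (sheafHom_congr (wittToProd_π f n) U ω).trans (hω n)
  · intro U hU t
    obtain ⟨s, hs⟩ := exists_sub_shift_eq (fun n => ((redProj f (n + 1)).hom.app (op U)).hom)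
      (fun n y => section_surjective (layerComplex_shortExact f n)
        (affineAcyclic_structSheaf 0 U hU) y)
      (fun n => (Limits.Pi.π (fun n => redTrunc f (n + 1)) n).hom.app (op U) t)
    obtain ⟨s', hs'⟩ := exists_prod_section (F := fun n => redTrunc f (n + 1)) s
    refine ⟨s', prod_section_ext (F := fun n => redTrunc f (n + 1)) fun n => ?_⟩
    refine (redShift_section f n U s').trans ?_
    rw [hs', hs']
    exact hs n

lemma cohMap_redShift {q : ℕ} {W : X.Opens} (n : ℕ)
    (s : coh (∏ᶜ fun n => redTrunc f (n + 1)) q W) :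
    cohMap (Limits.Pi.π (fun n => redTrunc f (n + 1)) n) q W (cohMap (redShift f) q W s) =
      cohMap (Limits.Pi.π (fun n => redTrunc f (n + 1)) n) q W s -
        cohMap (redProj f (n + 1)) q W
          (cohMap (Limits.Pi.π (fun n => redTrunc f (n + 1)) (n + 1)) q W s) := by
  rw [← cohMap_comp, ← cohMap_comp, redShift_π, eq_sub_iff_add_eq, ← cohMap_add, sub_add_cancel]

variable {f} {q : ℕ} {W : X.Opens}

/-- The kernel is the lim¹ of the groups in degree q - 1. Their transition maps are surjective
because H^q(𝒪_X) is torsion free; in degree zero there is no such term. -/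
lemma cohMap_wittToRed_injective (h : CohTorsionFree (structSheaf X) q W)
    (x : coh (wittSheaf X) q W) (hx : ∀ n, cohMap (wittToRed f (n + 1)) q W x = 0) : x = 0 := by
  have hS := milnorComplex_shortExact f
  have hac := affineAcyclic_redTrunc f
  have h1 : cohMap (milnorComplex f).f q W x = 0 := by
    refine (coh_prod q W _ hac).1 _ fun n => ?_
    rw [← cohMap_comp, ← hx n]
    exact congrArg (fun k => cohMap k q W x) (wittToProd_π f n)
  cases q with
  | zero => exact cohMap_zero_injective hS x h1
  | succ q =>
    obtain ⟨y, rfl⟩ := cohδ_exact₁ hS x h1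
    obtain ⟨z, hz⟩ := exists_sub_shift_eq (fun n => cohMap (redProj f (n + 1)) q W)
      (fun n => cohMap_redProj_surjective h n)
      (fun n => cohMap (Limits.Pi.π (fun n => redTrunc f (n + 1)) n) q W y)
    obtain ⟨z', hz'⟩ := (coh_prod q W _ hac).2 z
    have h2 : cohMap (redShift f) q W z' = y := by
      refine sub_eq_zero.1 ((coh_prod q W _ hac).1 _ fun n => ?_)
      rw [map_sub, sub_eq_zero, cohMap_redShift, hz', hz', hz]
    rw [← h2]
    exact cohδ_cohMap hS z'

variable (f) in
-- A compatible family is a class of the product killed by the shift map, so it lifts along the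
-- Milnor sequence.
lemma exists_cohMap_wittToRed (x : ∀ n, coh (redTrunc f (n + 1)) q W)
    (hx : ∀ n, cohMap (redProj f (n + 1)) q W (x (n + 1)) = x n) :
    ∃ y : coh (wittSheaf X) q W, ∀ n, cohMap (wittToRed f (n + 1)) q W y = x n := by
  have hac := affineAcyclic_redTrunc f
  obtain ⟨z, hz⟩ := (coh_prod q W _ hac).2 x
  obtain ⟨y, hy⟩ := cohMap_exact (milnorComplex_shortExact f) z (by
    refine (coh_prod q W _ hac).1 _ fun n => ?_
    refine (cohMap_redShift f n z).trans ?_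
    rw [hz, hz, hx, sub_self])
  refine ⟨y, fun n => ?_⟩
  rw [← hz n, ← hy, ← cohMap_comp]
  exact congrArg (fun k => cohMap k q W y) (wittToProd_π f n).symm

end Milnor

/-! ### Logarithmic derivatives of power series -/

section LogDeriv

/-- The logarithmic derivative, as a homomorphism on the group of units. -/
def unitsLogDeriv {A B : Type*} [CommRing A] [CommRing B] [Algebra A B] (D : Derivation A B B) :
    Bˣ →* Multiplicative B where
  toFun u := Multiplicative.ofAdd ((↑u⁻¹ : B) * D u)
  map_one' := by simp
  map_mul' u v := by
    rw [← ofAdd_add]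
    congr 1
    rw [Units.val_mul, D.leibniz, mul_inv, Units.val_mul, smul_eq_mul, smul_eq_mul]
    linear_combination (↑v⁻¹ * D ↑v) * (u.inv_mul) + (↑u⁻¹ * D ↑u) * (v.inv_mul)

variable {A : Type u} [CommRing A]

lemma isUnit_one_sub_monomial (i : ℕ) (a : A) : IsUnit
    ((1 - Polynomial.C a * Polynomial.X ^ (i + 1) : Polynomial A) : PowerSeries A) := by
  rw [PowerSeries.isUnit_iff_constantCoeff]
  simp

/-- The unit `1 - a x ^ (i + 1)` of `A[[x]]`. -/
def seriesMono (i : ℕ) (a : A) : (PowerSeries A)ˣ := (isUnit_one_sub_monomial i a).unit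

lemma seriesMono_coe (i : ℕ) (a : A) : (seriesMono i a : PowerSeries A) =
    ((1 - Polynomial.C a * Polynomial.X ^ (i + 1) : Polynomial A) : PowerSeries A) := rfl

lemma coeff_unitsLogDeriv_seriesMono (i : ℕ) (a : A) (k : ℕ) :
    PowerSeries.coeff k (Multiplicative.toAdd
      (unitsLogDeriv (PowerSeries.derivative A) (seriesMono i a))) =
      if i + 1 ∣ k + 1 then -((i + 1 : ℕ) * a ^ ((k + 1) / (i + 1))) else 0 := by
  -- The expansion of -(i+1) a xⁱ / (1 - a x^(i+1)) as a geometric series; multiplying by the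
  -- denominator verifies it.
  let g : PowerSeries A := PowerSeries.mk fun k =>
    if i + 1 ∣ k + 1 then -((i + 1 : ℕ) * a ^ ((k + 1) / (i + 1))) else 0
  have h : (seriesMono i a : PowerSeries A) * g =
      PowerSeries.derivative A (seriesMono i a : PowerSeries A) := by
    ext k
    rw [PowerSeries.coeff_derivative]
    have h1 : (seriesMono i a : PowerSeries A) =
        1 - PowerSeries.C a * PowerSeries.X ^ (i + 1) := by
      rw [seriesMono_coe]
      simp
    rw [h1, sub_mul, one_mul, mul_assoc, map_sub, map_sub, PowerSeries.coeff_C_mul,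
      PowerSeries.coeff_C_mul, PowerSeries.coeff_X_pow_mul', PowerSeries.coeff_X_pow,
      PowerSeries.coeff_one, PowerSeries.coeff_mk]
    by_cases hk : i + 1 ≤ k
    · obtain ⟨l, rfl⟩ := Nat.exists_eq_add_of_le hk
      have h2 : i + 1 + l + 1 = l + 1 + (i + 1) := by omega
      rw [if_pos hk, PowerSeries.coeff_mk, Nat.add_sub_cancel_left, h2, Nat.add_div_right _ (by
          omega),
        if_neg (show ¬ l + 1 + (i + 1) = 0 by omega),
        if_neg (show ¬ l + 1 + (i + 1) = i + 1 by omega)]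
      simp only [Nat.dvd_add_self_right]
      split_ifs
      · rw [pow_succ]
        ring
      · simp
    · rw [if_neg hk]
      by_cases hki : k = i
      · subst hki
        simp
        ring
      · have h3 : ¬ i + 1 ∣ k + 1 := fun hd => by
          have := Nat.le_of_dvd (by omega) hd
          omega
        rw [if_neg h3, if_neg (by omega), if_neg (by omega)]
        simp
  have h2 : Multiplicative.toAdd (unitsLogDeriv (PowerSeries.derivative A) (seriesMono i a)) = g :=
      by
    change (↑(seriesMono i a)⁻¹ : PowerSeries A) * PowerSeries.derivative A _ = g
    rw [← h, Units.inv_mul_cancel_left]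
  rw [h2, PowerSeries.coeff_mk]

/-- From F' = F · dlog F the low coefficients of F' vanish, and the coefficient of x^k in F' is (k +
1) times that of x^(k+1) in F. -/
lemma coeff_eq_zero_of_unitsLogDeriv (hA : ∀ m : ℕ, m ≠ 0 → ∀ a : A, m • a = 0 → a = 0)
    {F : (PowerSeries A)ˣ} {n : ℕ} (h : ∀ k < n, PowerSeries.coeff k (Multiplicative.toAdd
      (unitsLogDeriv (PowerSeries.derivative A) F)) = 0) {k : ℕ} (hk : k < n) :
    PowerSeries.coeff (k + 1) (F : PowerSeries A) = 0 := by
  have h1 : (F : PowerSeries A) * Multiplicative.toAdd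
      (unitsLogDeriv (PowerSeries.derivative A) F) = PowerSeries.derivative A (F : PowerSeries A) :=
    Units.mul_inv_cancel_left _ _
  have h2 := congrArg (PowerSeries.coeff k) h1
  rw [PowerSeries.coeff_derivative, PowerSeries.coeff_mul, Finset.sum_eq_zero] at h2
  · refine hA (k + 1) (Nat.succ_ne_zero k) _ ?_
    rw [nsmul_eq_mul, mul_comm]
    push_cast
    exact h2.symm
  · intro x hx
    have h3 := Finset.HasAntidiagonal.mem_antidiagonal.1 hx
    rw [h _ (by omega), mul_zero]

/-- The linear system for prescribed power sums has the Vandermonde matrix of 0, …, n, whose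
determinant m is nonzero; the adjugate solves it over ℤ up to the factor m. -/
lemma exists_vandermonde (n : ℕ) (t : ℕ → ℤ) : ∃ (m : ℤ) (_ : m ≠ 0) (c : Fin (n + 1) → ℤ),
    ∀ k ≤ n, ∑ j, c j * (j : ℤ) ^ k = m * t k := by
  let V : Matrix (Fin (n + 1)) (Fin (n + 1)) ℤ :=
    (Matrix.vandermonde fun j : Fin (n + 1) => ((j : ℕ) : ℤ)).transpose
  refine ⟨V.det, ?_, V.adjugate.mulVec fun k => t k, fun k hk => ?_⟩
  · rw [Matrix.det_transpose, Matrix.det_vandermonde_ne_zero_iff]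
    intro i j hij
    have h : ((i : ℕ) : ℤ) = ((j : ℕ) : ℤ) := hij
    exact Fin.ext (by exact_mod_cast h)
  · have h : V.mulVec (V.adjugate.mulVec fun k => t k) = V.det • fun k : Fin (n + 1) => t k := by
      rw [Matrix.mulVec_mulVec, Matrix.mul_adjugate, Matrix.smul_mulVec, Matrix.one_mulVec]
    have h1 := congrFun h ⟨k, by omega⟩
    rw [Pi.smul_apply, smul_eq_mul] at h1
    rw [← h1, Matrix.mulVec, dotProduct]
    refine Finset.sum_congr rfl fun j _ => ?_
    rw [mul_comm]
    rfl

/-- A power of `1 - x ^ (i + 1)` is a product of powers of the series `1 - j x`, up to order `n`. -/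
lemma exists_prod_seriesMono (hA : ∀ m : ℕ, m ≠ 0 → ∀ a : A, m • a = 0 → a = 0) (n i : ℕ) :
    ∃ (m : ℤ) (_ : m ≠ 0) (c : Fin (n + 1) → ℤ), ∀ k < n, PowerSeries.coeff (k + 1)
      (((∏ j : Fin (n + 1), seriesMono 0 ((j : ℕ) : A) ^ c j) * (seriesMono i (1 : A) ^ m)⁻¹ :
        (PowerSeries A)ˣ) : PowerSeries A) = 0 := by
  -- In the logarithmic derivatives the coefficient of x^(k-1) is -∑ c_j j^k for ∏ (1 - jx)^(c_j),
  -- and for the m-th power of 1 - x^(i+1) it is -m(i+1) if i + 1 divides k and 0 otherwise. The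
  -- prescribed power sums make these equal.
  obtain ⟨m, hm, c, hc⟩ := exists_vandermonde n fun k => if i + 1 ∣ k then (i + 1 : ℕ) else 0
  refine ⟨m, hm, c, fun k hk => coeff_eq_zero_of_unitsLogDeriv hA (n := n) (fun k hk => ?_) hk⟩
  rw [map_mul, map_inv, map_prod, map_zpow, toAdd_mul, toAdd_inv, toAdd_prod, toAdd_zpow]
  simp only [map_zpow, toAdd_zpow, map_add, map_neg, map_sum, map_zsmul,
    coeff_unitsLogDeriv_seriesMono]
  have h1 := congrArg (Int.cast : ℤ → A) (hc (k + 1) hk)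
  push_cast at h1
  simp only [zero_add, Nat.cast_one, one_mul, one_pow, Nat.div_one, isUnit_one, IsUnit.dvd, if_true,
    zsmul_eq_mul, mul_neg, Finset.sum_neg_distrib, h1]
  split_ifs <;> (push_cast; ring)

end LogDeriv

/-! ### Generators of `Λ` -/

section Generators

open Polynomial

variable {R : Type u} [CommRing R]

/-- The element `1 - ν t ^ (i + 1)` of `Λ(N)`. -/
def lambdaMono (N : NilAlg R) (ν : N.carrier) (i : ℕ) : lambdaSubgroup N :=
  ⟨(show IsUnit (1 - C (ν : N.Aug) * X ^ (i + 1)) from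
      IsNilpotent.isUnit_one_sub (Commute.isNilpotent_mul_right (Commute.all _ _)
        ((NilAlg.isNilpotent_of_fst _ _ rfl).map C))).unit, by
    refine mem_lambdaSubgroup.2 ⟨by simp, fun j hj => ?_⟩
    rw [IsUnit.unit_spec, coeff_sub, coeff_one, if_neg hj, coeff_C_mul, coeff_X_pow]
    split_ifs <;> simp⟩

lemma lambdaMono_coe (N : NilAlg R) (ν : N.carrier) (i : ℕ) :
    ((lambdaMono N ν i).1 : N.Aug[X]) = 1 - C (ν : N.Aug) * X ^ (i + 1) := rfl

lemma lambdaElt_eq_lambdaMono (n : ℕ) :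
    lambdaElt R n = lambdaMono (truncAlg R n) (truncAlg.x R n) 0 := by
  apply Subtype.ext
  apply Units.ext
  rw [lambdaMono_coe, zero_add, pow_one]
  rfl

lemma lambdaMap_lambdaMono {N N' : NilAlg R} (φ : N ⟶ N') (ν : N.carrier) (i : ℕ) :
    lambdaMap φ (lambdaMono N ν i) = lambdaMono N' (NilAlg.hom φ ν) i := by
  apply Subtype.ext
  apply Units.ext
  rw [lambdaMap_coe, lambdaMono_coe, lambdaMono_coe]
  simp [NilAlg.augMap_inr]

lemma prod_one_add_sub_mem {A : Type*} [CommRing A] {J : Ideal A} {ι : Type*} (s : Finset ι)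
    (c : ι → A) (hc : ∀ i ∈ s, c i ∈ J) :
    ∏ i ∈ s, (1 + c i) - (1 + ∑ i ∈ s, c i) ∈ J ^ 2 := by
  classical
  induction s using Finset.induction_on with
  | empty => simp
  | insert a s ha ih =>
    have h1 := ih fun i hi => hc i (Finset.mem_insert_of_mem hi)
    have h2 : c a * ∑ i ∈ s, c i ∈ J ^ 2 := by
      rw [pow_two]
      exact Ideal.mul_mem_mul (hc a (Finset.mem_insert_self a s))
        (Ideal.sum_mem _ fun i hi => hc i (Finset.mem_insert_of_mem hi))
    rw [Finset.prod_insert ha, Finset.sum_insert ha]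
    have h3 : (1 + c a) * ∏ i ∈ s, (1 + c i) - (1 + (c a + ∑ i ∈ s, c i)) =
        (1 + c a) * (∏ i ∈ s, (1 + c i) - (1 + ∑ i ∈ s, c i)) + c a * ∑ i ∈ s, c i := by ring
    rw [h3]
    exact add_mem (Ideal.mul_mem_left _ _ h1) h2

/-- Successive approximation along the powers of the nilpotent ideal I: if p ≡ 1 modulo I^(k+1),
then p agrees with the product of its monomial factors modulo I^(k+2). -/
lemma lambda_mem_of_lambdaMono_mem (N : NilAlg R) (K : Subgroup (lambdaSubgroup N))
    (hK : ∀ ν i, lambdaMono N ν i ∈ K) (p : lambdaSubgroup N) : p ∈ K := by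
  let I : Ideal N.Aug := RingHom.ker (Unitization.fstHom R N.carrier)
  obtain ⟨d, hd⟩ := N.nilpotent
  -- Descending induction on the order k of approximation, with l = d - k steps left.
  have key : ∀ l k : ℕ, l + k = d → ∀ p : lambdaSubgroup N,
      (p.1 : N.Aug[X]) - 1 ∈ (I ^ (k + 1)).map C → p ∈ K := by
    intro l
    induction l with
    | zero =>
      intro k hk p hp
      have h1 : I ^ (k + 1) = ⊥ := by
        rw [show k = d by omega, pow_succ, show I ^ d = 0 from hd, zero_mul]
        rfl
      rw [h1, Ideal.map_bot, Ideal.mem_bot, sub_eq_zero] at hp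
      have h2 : p = 1 := Subtype.ext (Units.ext hp)
      rw [h2]
      exact K.one_mem
    | succ l ih =>
      intro k hk p hp
      have hp0 := mem_lambdaSubgroup.1 p.2
      let P : N.Aug[X] := p.1
      have hsnd : ∀ i, (((P.coeff (i + 1)).snd : N.carrier) : N.Aug) = P.coeff (i + 1) := by
        intro i
        refine Unitization.ext ?_ rfl
        rw [Unitization.fst_inr]
        exact (hp0.2 (i + 1) (Nat.succ_ne_zero i)).symm
      -- The sign compensates for the minus in `lambdaMono`, so that g is the product of the 1 +
      -- P_(i+1) t^(i+1). It differs from P by products of at least two coefficients, which lie in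
      -- I^(2k+2).
      let g : lambdaSubgroup N := ∏ i ∈ Finset.range P.natDegree,
        lambdaMono N (-(P.coeff (i + 1)).snd) i
      have hg : (g.1 : N.Aug[X]) = ∏ i ∈ Finset.range P.natDegree,
          (1 + C (P.coeff (i + 1)) * X ^ (i + 1)) := by
        change ((Units.coeHom N.Aug[X]).comp (lambdaSubgroup N).subtype) g = _
        rw [map_prod]
        refine Finset.prod_congr rfl fun i _ => ?_
        refine (lambdaMono_coe _ _ _).trans ?_
        rw [Unitization.inr_neg, hsnd, map_neg]
        ring
      have hP : P = 1 + ∑ i ∈ Finset.range P.natDegree, C (P.coeff (i + 1)) * X ^ (i + 1) := by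
        conv_lhs => rw [P.as_sum_range_C_mul_X_pow, Finset.sum_range_succ']
        rw [pow_zero, mul_one, show P.coeff 0 = 1 from hp0.1, map_one, add_comm]
      have hc : ∀ i, C (P.coeff (i + 1)) * X ^ (i + 1) ∈ (I ^ (k + 1)).map C := by
        intro i
        refine Ideal.mul_mem_right _ _ (Ideal.mem_map_of_mem _ ?_)
        have h1 := Ideal.mem_map_C_iff.1 hp (i + 1)
        rw [coeff_sub, coeff_one, if_neg (Nat.succ_ne_zero i), sub_zero] at h1
        exact h1
      have h1 := prod_one_add_sub_mem (Finset.range P.natDegree) _ fun i _ => hc i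
      rw [← hP, ← hg, ← Ideal.map_pow, ← pow_mul] at h1
      have h2 : (g.1 : N.Aug[X]) - P ∈ (I ^ (k + 1 + 1)).map C :=
        Ideal.map_mono (Ideal.pow_le_pow_right (by omega)) h1
      have hgK : g ∈ K := 
        Finset.prod_induction _ (· ∈ K) (fun _ _ => K.mul_mem) K.one_mem fun i _ => hK _ _
      have h3 : p * g⁻¹ ∈ K := by
        refine ih (k + 1) (by omega) _ ?_
        have h4 : (((p * g⁻¹ : lambdaSubgroup N).1 : (N.Aug[X])ˣ) : N.Aug[X]) - 1 =
            -((g.1 : N.Aug[X]) - P) * (↑(g.1⁻¹) : N.Aug[X]) := by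
          rw [neg_sub, sub_mul, Units.mul_inv]
          rfl
        rw [h4]
        exact Ideal.mul_mem_right _ _ (neg_mem h2)
      simpa using K.mul_mem h3 hgK
  refine key d 0 (by omega) p (Ideal.mem_map_C_iff.2 fun i => ?_)
  rw [zero_add, pow_one]
  have hp0 := mem_lambdaSubgroup.1 p.2
  change (((p.1 : N.Aug[X]) - 1).coeff i).fst = 0
  rw [coeff_sub, coeff_one]
  by_cases hi : i = 0
  · rw [hi, hp0.1]
    simp
  · rw [if_neg hi, sub_zero, hp0.2 i hi]

/-- The element `ν ^ (i + 1)` of `N`. -/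
def NilAlg.powSucc (N : NilAlg R) (ν : N.carrier) (i : ℕ) : N.carrier := ((ν : N.Aug) ^ (i + 1)).snd

lemma NilAlg.inr_powSucc (N : NilAlg R) (ν : N.carrier) (i : ℕ) :
    (N.powSucc ν i : N.Aug) = (ν : N.Aug) ^ (i + 1) := by
  have h := map_pow (Unitization.fstHom R N.carrier) (ν : N.Aug) (i + 1)
  refine Unitization.ext ((Unitization.fst_inr _ _).trans (Eq.trans ?_ h.symm)) rfl
  exact (zero_pow (Nat.succ_ne_zero i)).symm

lemma xt_pow (n : ℕ) :
    (C (truncAlg.x R (n + 1) : (truncAlg R (n + 1)).Aug) * X) ^ (n + 1) = 0 := by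
  rw [mul_pow, ← map_pow, truncAlg.inr_x_pow_succ, map_zero, zero_mul]

/-- The homomorphism `R[[x]] → (R ⊕ N)[t]`, `x ↦ x t`, for `N = x R[x] / x ^ (n + 1) R[x]`. -/
def seriesEval (R : Type u) [CommRing R] (n : ℕ) :
    PowerSeries R →+* (truncAlg R (n + 1)).Aug[X] :=
  nilEval (C.comp (algebraMap R (truncAlg R (n + 1)).Aug)) _ (n + 1) (xt_pow n)

lemma seriesEval_seriesMono (n i : ℕ) (a : R) : seriesEval R n (seriesMono i a : PowerSeries R) =
    1 - C (algebraMap R (truncAlg R (n + 1)).Aug a) *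
      (C (truncAlg.x R (n + 1) : (truncAlg R (n + 1)).Aug) * X) ^ (i + 1) := by
  rw [seriesMono_coe, seriesEval, nilEval_coe, Polynomial.eval₂_sub, Polynomial.eval₂_one,
    Polynomial.eval₂_mul, Polynomial.eval₂_C, Polynomial.eval₂_pow, Polynomial.eval₂_X]
  rfl

/-- The identity of power series up to order n is transported along x ↦ xt, which is well defined on
series because (xt)^(n+1) = 0. -/
lemma exists_prod_lambdaMono (hR : ∀ m : ℕ, m ≠ 0 → ∀ a : R, m • a = 0 → a = 0) (n i : ℕ) :
    ∃ (m : ℤ) (_ : m ≠ 0) (c : Fin (n + 1) → ℤ),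
      ∏ j : Fin (n + 1), lambdaMono (truncAlg R (n + 1)) ((j : ℕ) • truncAlg.x R (n + 1)) 0 ^ c j =
        lambdaMono (truncAlg R (n + 1)) (NilAlg.powSucc _ (truncAlg.x R (n + 1)) i) i ^ m := by
  obtain ⟨m, hm, c, hc⟩ := exists_prod_seriesMono hR n i
  refine ⟨m, hm, c, ?_⟩
  set F : (PowerSeries R)ˣ :=
    (∏ j : Fin (n + 1), seriesMono 0 ((j : ℕ) : R) ^ c j) * (seriesMono i (1 : R) ^ m)⁻¹ with hF
  have hF0 : PowerSeries.constantCoeff (F : PowerSeries R) = 1 := by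
    have h0 : ∀ (i : ℕ) (a : R), Units.map (PowerSeries.constantCoeff (R := R)).toMonoidHom
        (seriesMono i a) = 1 := by
      intro i a
      refine Units.ext ?_
      change PowerSeries.constantCoeff (seriesMono i a : PowerSeries R) = 1
      rw [seriesMono_coe]
      simp
    have h1 : Units.map (PowerSeries.constantCoeff (R := R)).toMonoidHom F = 1 := by
      rw [hF, map_mul, map_inv, map_prod, map_zpow, h0, one_zpow, inv_one, mul_one]
      refine Finset.prod_eq_one fun j _ => ?_
      rw [map_zpow, h0, one_zpow]
    exact congrArg Units.val h1
  have hF1 : seriesEval R n (F : PowerSeries R) = 1 := by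
    rw [seriesEval, nilEval_apply, Finset.sum_eq_single 0]
    · rw [PowerSeries.coeff_zero_eq_constantCoeff_apply, hF0]
      simp
    · intro k _ hk
      obtain ⟨k, rfl⟩ := Nat.exists_eq_succ_of_ne_zero hk
      by_cases hkn : k < n
      · rw [hc k hkn, map_zero, zero_mul]
      · rw [pow_eq_zero_of_le (by omega) (xt_pow n), mul_zero]
    · simp
  have hF2 : Units.map (seriesEval R n).toMonoidHom F = 1 := Units.ext hF1
  rw [hF, map_mul, map_inv, mul_inv_eq_one, map_prod, map_zpow] at hF2
  have hu : ∀ j : ℕ, Units.map (seriesEval R n).toMonoidHom (seriesMono 0 (j : R)) =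
      (lambdaMono (truncAlg R (n + 1)) (j • truncAlg.x R (n + 1)) 0).1 := by
    intro j
    refine Units.ext ((seriesEval_seriesMono n 0 (j : R)).trans ?_)
    rw [lambdaMono_coe, zero_add, pow_one, pow_one, Unitization.inr_smul, map_natCast, map_natCast,
      nsmul_eq_mul, map_mul, map_natCast, mul_assoc]
  have hv : Units.map (seriesEval R n).toMonoidHom (seriesMono i (1 : R)) =
      (lambdaMono (truncAlg R (n + 1)) (NilAlg.powSucc _ (truncAlg.x R (n + 1)) i) i).1 := by
    refine Units.ext ((seriesEval_seriesMono n i 1).trans ?_)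
    rw [lambdaMono_coe, NilAlg.inr_powSucc, map_one, map_one, one_mul, mul_pow, map_pow]
  apply (lambdaSubgroup (truncAlg R (n + 1))).subtype_injective
  rw [map_prod, map_zpow, Subgroup.subtype_apply, ← hv, ← hF2]
  refine Finset.prod_congr rfl fun j _ => ?_
  rw [map_zpow, map_zpow, Subgroup.subtype_apply, ← hu]

end Generators

/-! ### Injectivity of the evaluation at `1 - x t` -/

section EvalInjective

variable {R : Type u} [CommRing R]

lemma isNilpotent_inr (N : NilAlg R) (ν : N.carrier) : ∃ l : ℕ, (ν : N.Aug) ^ (l + 1) = 0 := by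
  obtain ⟨k, hk⟩ := N.isNilpotent_of_fst (ν : N.Aug) (Unitization.fst_inr _ _)
  exact ⟨k, by rw [pow_succ, hk, zero_mul]⟩

lemma lambda_naturality {H : NilAlg R ⥤ AddCommGrpCat.{u}} (φ : Lambda R ⟶ H) {N N' : NilAlg R}
    (θ : N ⟶ N') (p : lambdaSubgroup N) :
    φ.app N' (Additive.ofMul (lambdaMap θ p)) = H.map θ (φ.app N (Additive.ofMul p)) :=
  ConcreteCategory.congr_hom (φ.naturality θ) (Additive.ofMul p)

/-- The homomorphism `Λ(N) → H(N)` given by `φ : Λ ⟶ H`. -/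
def lambdaEval {H : NilAlg R ⥤ AddCommGrpCat.{u}} (φ : Lambda R ⟶ H) (N : NilAlg R) :
    lambdaSubgroup N →* Multiplicative (H.obj N) where
  toFun p := Multiplicative.ofAdd (φ.app N (Additive.ofMul p))
  map_one' := congrArg Multiplicative.ofAdd (map_zero (φ.app N).hom)
  map_mul' p p' := congrArg Multiplicative.ofAdd
    (map_add (φ.app N).hom (Additive.ofMul p) (Additive.ofMul p'))

/-- A homomorphism `φ : Λ ⟶ H` is determined by its values at `1 - x t` if the values of `H` at the
truncated algebras are torsion free and the maps `x ↦ x ^ (i + 1)` induce injections. -/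
theorem evalCurve_injective (hR : ∀ m : ℕ, m ≠ 0 → ∀ a : R, m • a = 0 → a = 0)
    (H : NilAlg R ⥤ AddCommGrpCat.{u})
    (htf : ∀ (n m : ℕ), m ≠ 0 → ∀ z : H.obj (truncAlg R (n + 1)), m • z = 0 → z = 0)
    (hpow : ∀ (i l m : ℕ), m = (i + 1) * l → ∀ θ : truncAlg R (l + 1) ⟶ truncAlg R (m + 1),
      (NilAlg.hom θ (truncAlg.x R (l + 1)) : (truncAlg R (m + 1)).Aug) =
        (truncAlg.x R (m + 1) : (truncAlg R (m + 1)).Aug) ^ (i + 1) →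
      Function.Injective (H.map θ)) :
    Function.Injective (evalCurve H) := by
  rw [injective_iff_map_eq_zero]
  intro φ hφ
  have h0 : ∀ n, φ.app (truncAlg R n) (Additive.ofMul (lambdaElt R n)) = 0 :=
    fun n => congrFun (congrArg Subtype.val hφ) n
  -- The element 1 - jxt is the image of 1 - xt under the substitution x ↦ jx.
  have h1 : ∀ n j : ℕ, φ.app _ (Additive.ofMul (lambdaMono (truncAlg R (n + 1))
      (j • truncAlg.x R (n + 1)) 0)) = 0 := by
    intro n j
    rw [← truncScale_x, ← lambdaMap_lambdaMono, ← lambdaElt_eq_lambdaMono, lambda_naturality, h0,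
      map_zero]
  -- A nonzero power of 1 - (xt)^(i+1) is a product of powers of the elements in `h1`, and H has no
  -- torsion at the truncated algebras.
  have h2 : ∀ n i : ℕ, φ.app _ (Additive.ofMul (lambdaMono (truncAlg R (n + 1))
      (NilAlg.powSucc _ (truncAlg.x R (n + 1)) i) i)) = 0 := by
    intro n i
    obtain ⟨m, hm, c, hc⟩ := exists_prod_lambdaMono hR n i
    have h3 : m • φ.app _ (Additive.ofMul (lambdaMono (truncAlg R (n + 1))
        (NilAlg.powSucc _ (truncAlg.x R (n + 1)) i) i)) = 0 := by
      have h5 := congrArg (lambdaEval φ _) hc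
      rw [map_prod, map_zpow, Finset.prod_eq_one] at h5
      · exact (congrArg Multiplicative.toAdd h5).symm
      · intro j _
        rw [map_zpow, show lambdaEval φ _ _ = 1 from congrArg Multiplicative.ofAdd (h1 n j),
          one_zpow]
    refine htf n m.natAbs (Int.natAbs_ne_zero.2 hm) _ ?_
    rcases Int.natAbs_eq m with he | he
    · rw [he, natCast_zsmul] at h3
      exact h3
    · rw [he, neg_smul, neg_eq_zero, natCast_zsmul] at h3
      exact h3
  -- The substitution x ↦ x^(i+1) takes 1 - x t^(i+1) to the element in `h2`, and H maps it to an
  -- injection.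
  have h4 : ∀ l i : ℕ, φ.app _ (Additive.ofMul (lambdaMono (truncAlg R (l + 1))
      (truncAlg.x R (l + 1)) i)) = 0 := by
    intro l i
    let ν := NilAlg.powSucc _ (truncAlg.x R ((i + 1) * l + 1)) i
    have hν : (ν : (truncAlg R ((i + 1) * l + 1)).Aug) ^ (l + 1) = 0 := by
      rw [NilAlg.inr_powSucc, ← pow_mul]
      exact pow_eq_zero_of_le (by rw [mul_add]; omega) (truncAlg.inr_x_pow_succ _)
    refine hpow i l _ rfl (truncAlg.lift _ ν (l + 1) hν) ?_ ?_
    · rw [truncAlg.lift_x, NilAlg.inr_powSucc]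
    · rw [← lambda_naturality, lambdaMap_lambdaMono, truncAlg.lift_x, h2, map_zero]
  -- Every generator 1 - νt^(i+1) of Λ(N) is the image of 1 - x t^(i+1) under x ↦ ν from a truncated
  -- algebra.
  refine NatTrans.ext (funext fun N => AddCommGrpCat.ext fun p => ?_)
  refine lambda_mem_of_lambdaMono_mem N
    (AddSubgroup.toSubgroup' (φ.app N).hom.ker) (fun ν i => ?_) (Additive.toMul p)
  obtain ⟨l, hl⟩ := isNilpotent_inr N ν
  change φ.app N (Additive.ofMul (lambdaMono N ν i)) = 0
  have h5 := lambda_naturality φ (truncAlg.lift N ν (l + 1) hl)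
    (lambdaMono (truncAlg R (l + 1)) (truncAlg.x R (l + 1)) i)
  rw [lambdaMap_lambdaMono, truncAlg.lift_x, h4, map_zero] at h5
  exact h5

end EvalInjective

/-! ### The maps `x ↦ x ^ i` on the cohomology of the truncated Witt vectors -/

section Power

variable {R : Type u} [CommRing R] {X : Scheme.{u}} {f : X ⟶ Spec (.of R)} {q : ℕ} {W : X.Opens}

lemma layer_map_of_pow {i k l : ℕ} (h : k + 1 = (i + 1) * (l + 1))
    (θ : truncAlg R (l + 2) ⟶ truncAlg R (k + 2))
    (hθ : (NilAlg.hom θ (truncAlg.x R (l + 2)) : (truncAlg R (k + 2)).Aug) =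
      (truncAlg.x R (k + 2) : (truncAlg R (k + 2)).Aug) ^ (i + 1)) :
    layer f l ≫ (redTilde f).map θ = layer f k := by
  refine ObjectProperty.hom_ext _ (NatTrans.ext (funext fun U =>
    AddCommGrpCat.ext fun s : Γ(X, U.unop) => redVal_injective (f := f) ?_))
  refine (redVal_map f _ U.unop _).trans ?_
  refine Eq.trans ?_ (redVal_layer f k U.unop s).symm
  refine (congrArg (thickeningRingMap f _ U.unop) (redVal_layer f l U.unop s)).trans ?_
  rw [map_add, map_one, map_mul, map_pow, xi, thickeningRingMap_augStruct, NilAlg.augMap_inr, hθ,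
    map_pow, ← pow_mul, ← h, thickeningRingMap_app]
  rfl

/-- Induction on the layers: x ↦ x^(i+1) carries the layer of weight l + 1 onto that of weight (i +
1)(l + 1), and cohomology of layers injects into that of the truncations. -/
lemma cohMap_pow_injective (h : CohTorsionFree (structSheaf X) q W) (i l m : ℕ)
    (hm : m = (i + 1) * l) (θ : truncAlg R (l + 1) ⟶ truncAlg R (m + 1))
    (hθ : (NilAlg.hom θ (truncAlg.x R (l + 1)) : (truncAlg R (m + 1)).Aug) =
      (truncAlg.x R (m + 1) : (truncAlg R (m + 1)).Aug) ^ (i + 1)) :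
    Function.Injective (cohMap ((redTilde f).map θ) q W) := by
  rw [injective_iff_map_eq_zero]
  induction l generalizing m with
  | zero => exact fun y _ => redTrunc_one_eq_zero f y
  | succ l ih =>
    intro y hy
    have hν : ((NilAlg.powSucc _ (truncAlg.x R ((i + 1) * l + 1)) i :
        (truncAlg R ((i + 1) * l + 1)).carrier) :
          (truncAlg R ((i + 1) * l + 1)).Aug) ^ (l + 1) = 0 := by
      rw [NilAlg.inr_powSucc, ← pow_mul]
      exact pow_eq_zero_of_le (by rw [mul_add]; omega) (truncAlg.inr_x_pow_succ _)
    let θ' : truncAlg R (l + 1) ⟶ truncAlg R ((i + 1) * l + 1) := truncAlg.lift _ _ _ hν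
    have hθ' : NilAlg.hom θ' (truncAlg.x R (l + 1)) = NilAlg.powSucc _ (truncAlg.x R _) i :=
      truncAlg.lift_x _ _ _ _
    -- Reduction of the target to the order that matches l. It makes θ compatible with the
    -- substitution θ' one layer below, to which the induction hypothesis applies.
    let p : truncAlg R (m + 1) ⟶ truncAlg R ((i + 1) * l + 1) :=
      truncAlg.lift _ (truncAlg.x R _) _
        (pow_eq_zero_of_le (by rw [hm, mul_add]; omega) (truncAlg.inr_x_pow_succ _))
    have hp : NilAlg.hom p (truncAlg.x R (m + 1)) = truncAlg.x R _ := truncAlg.lift_x _ _ _ _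
    have hcomm : θ ≫ p = truncAlg.proj R (l + 1) ≫ θ' := by
      refine truncAlg.hom_ext (Unitization.inr_injective (R := R) ?_)
      change (NilAlg.hom p (NilAlg.hom θ _) : (truncAlg R ((i + 1) * l + 1)).Aug) =
        (NilAlg.hom θ' (NilAlg.hom (truncAlg.proj R (l + 1)) _) :
          (truncAlg R ((i + 1) * l + 1)).Aug)
      rw [truncAlg.proj_x, hθ', NilAlg.inr_powSucc, ← NilAlg.augMap_inr, hθ, map_pow,
        NilAlg.augMap_inr, hp]
    have h1 : cohMap (redProj f (l + 1)) q W y = 0 := by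
      refine ih _ rfl θ' (by rw [hθ', NilAlg.inr_powSucc]) _ ?_
      rw [← cohMap_comp, ← Functor.map_comp, ← hcomm, Functor.map_comp, cohMap_comp, hy, map_zero]
    obtain ⟨b, rfl⟩ := cohMap_exact (layerComplex_shortExact f l) y h1
    obtain ⟨k, rfl⟩ : ∃ k, m = k + 1 :=
      Nat.exists_eq_succ_of_ne_zero (by rw [hm]; exact Nat.mul_ne_zero (by omega) (by omega))
    have h2 : cohMap (layer f k) q W b = 0 := by
      rw [← layer_map_of_pow hm θ hθ, cohMap_comp]
      exact hy
    rw [cohMap_layer_injective h k (h2.trans (map_zero _).symm)]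
    exact map_zero _

lemma cohTorsionFree_structSheaf_zero [Module.Flat ℤ R] [Flat f] (W : X.Opens) :
    CohTorsionFree (structSheaf X) 0 W := by
  intro m hm x hx
  obtain ⟨s, rfl⟩ := (cohZero _ W).symm.surjective x
  rw [← map_nsmul] at hx
  have h1 : m • s = 0 := (cohZero _ W).symm.injective (hx.trans (map_zero _).symm)
  have h2 : s = 0 := section_eq_zero_of_nsmul f hm (s : Γ(X, W)) h1
  rw [h2, map_zero]

lemma eq_zero_of_nsmul_of_flat [Module.Flat ℤ R] (m : ℕ) (hm : m ≠ 0) (a : R) (ha : m • a = 0) :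
    a = 0 := by
  have h1 : IsSMulRegular R (m : ℤ) :=
    Module.Flat.isSMulRegular_of_nonZeroDivisors (by simpa using hm)
  refine h1 ?_
  simpa using ha

end Power

/-! ### Comparison of functors on nilpotent algebras -/

section Compare

variable {R : Type u} [CommRing R] {X : Scheme.{u}} {f : X ⟶ Spec (.of R)} {q : ℕ} {W : X.Opens}

/-- `evalCurve_injective` for a functor whose values at the truncated algebras are compared with the
cohomology of `redTilde`. -/
lemma evalCurve_injective_of_coh [Module.Flat ℤ R] (h : CohTorsionFree (structSheaf X) q W)
    (H : NilAlg R ⥤ AddCommGrpCat.{u}) (τ : ∀ N, coh ((redTilde f).obj N) q W →+ H.obj N)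
    (hτ : ∀ {N N'} (θ : N ⟶ N') (z), τ N' (cohMap ((redTilde f).map θ) q W z) = H.map θ (τ N z))
    (hbij : ∀ n, Function.Bijective (τ (truncAlg R (n + 1)))) :
    Function.Injective (evalCurve H) := by
  refine evalCurve_injective eq_zero_of_nsmul_of_flat H ?_ ?_
  · intro n m hm z hz
    obtain ⟨y, rfl⟩ := (hbij n).2 z
    have h1 : m • y = 0 := by
      apply (hbij n).1
      rw [map_nsmul, map_zero]
      exact hz
    rw [cohTorsionFree_redTrunc h n m hm y h1, map_zero]
  · intro i l m hm θ hθ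
    rw [injective_iff_map_eq_zero]
    intro z hz
    obtain ⟨y, rfl⟩ := (hbij l).2 z
    rw [← hτ] at hz
    have h1 := (hbij m).1 (hz.trans (map_zero _).symm)
    rw [cohMap_pow_injective h i l m hm θ hθ (h1.trans (map_zero _).symm), map_zero]

end Compare

lemma rightDerived_additive {A B : Type*} [Category A] [Category B] [Abelian A] [Abelian B]
    [HasInjectiveResolutions A] (F : A ⥤ B) [F.Additive] (n : ℕ) : (F.rightDerived n).Additive where
  map_add {X Y g h} := by
    have key : ∀ k : X ⟶ Y, (F.rightDerived n).map k =
        ((injectiveResolution X).isoRightDerivedObj F n).hom ≫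
          (F.mapHomologicalComplex _ ⋙ HomologicalComplex.homologyFunctor _ _ n).map
            (InjectiveResolution.desc k _ _) ≫
          ((injectiveResolution Y).isoRightDerivedObj F n).inv :=
      fun k => F.rightDerived_map_eq n k _ (InjectiveResolution.desc_commutes k _ _)
    rw [F.rightDerived_map_eq n (g + h)
      (InjectiveResolution.desc g (injectiveResolution Y) (injectiveResolution X) +
        InjectiveResolution.desc h (injectiveResolution Y) (injectiveResolution X)) (by
        rw [Preadditive.comp_add, InjectiveResolution.desc_commutes,
          InjectiveResolution.desc_commutes, Functor.map_add, Preadditive.add_comp]),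
      key g, key h, Functor.map_add, Preadditive.add_comp, Preadditive.comp_add]

instance higherDirectImage_additive {Y Z : TopCat.{u}} (f : Y ⟶ Z) (q : ℕ) :
    (higherDirectImage f q).Additive :=
  rightDerived_additive _ q

section Comparison

variable {R : Type u} [CommRing R] {X : Scheme.{u}} (f : X ⟶ Spec (.of R))

/-! ### The functor of sections -/

/-- The map from `H^0(U, ker(Ẽ_T ⟶ Ẽ_S))` to `ker(Ẽ_T(U) → Ẽ_S(U))`. -/
def cohToTilde (U : X.Opens) (N : NilAlg R) :
    coh ((redTilde f).obj N) 0 U →+ (tildeNil f U).obj N :=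
  (((redTildeι f N).hom.app (op U)).hom.comp (cohZero _ U).toAddMonoidHom).codRestrict
    ((pushTilde f ⋙ TopCat.Sheaf.forget AddCommGrpCat.{u} X ⋙
      (evaluation _ _).obj (op U)).map N.toZero).hom.ker
    (fun z => sheafHom_congr (redTildeι_toZero f N) U (cohZero _ U z))

lemma cohToTilde_coe (U : X.Opens) (N : NilAlg R) (z : coh ((redTilde f).obj N) 0 U) :
    (cohToTilde f U N z).1 = (redTildeι f N).hom.app (op U) (cohZero _ U z) := rfl

lemma cohToTilde_naturality (U : X.Opens) {N N' : NilAlg R} (θ : N ⟶ N')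
    (z : coh ((redTilde f).obj N) 0 U) :
    cohToTilde f U N' (cohMap ((redTilde f).map θ) 0 U z) =
      (tildeNil f U).map θ (cohToTilde f U N z) := by
  refine Subtype.ext ?_
  refine (congrArg ((redTildeι f N').hom.app (op U)) (cohZero_cohMap _ _)).trans ?_
  exact sheafHom_congr (redTilde_map_ι f θ) U (cohZero _ U z)

lemma cohToTilde_bijective (U : X.Opens) (N : NilAlg R) :
    Function.Bijective (cohToTilde f U N) := by
  refine ⟨fun z z' h => ?_, fun s => ?_⟩
  · exact (cohZero _ U).injective (kernel_ι_injective _ (congrArg Subtype.val h))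
  · obtain ⟨t, ht⟩ := exists_kernel_section ((pushTilde f).map N.toZero) s.1 s.2
    refine ⟨(cohZero _ U).symm t, Subtype.ext ?_⟩
    refine Eq.trans ?_ ht
    exact congrArg ((redTildeι f N).hom.app (op U)) ((cohZero _ U).apply_symm_apply t)

lemma evalCurve_tildeNil_injective [Module.Flat ℤ R] [Flat f] (U : X.Opens) :
    Function.Injective (evalCurve (tildeNil f U)) :=
  evalCurve_injective_of_coh (cohTorsionFree_structSheaf_zero (f := f) U) _ (cohToTilde f U)
    (cohToTilde_naturality f U) (fun _ => cohToTilde_bijective f U _)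

/-! ### The functor `Φ^q` -/

/-- The group `Γ(S, R^q f_* F)`. -/
abbrev directSections (q : ℕ) (F : TopCat.Sheaf AddCommGrpCat.{u} X) : AddCommGrpCat.{u} :=
  (globalSections (Spec (.of R))).obj ((higherDirectImage f.base q).obj F)

/-- The functoriality of `Γ(S, R^q f_* F)`. -/
abbrev directMap (q : ℕ) {F G : TopCat.Sheaf AddCommGrpCat.{u} X} (ψ : F ⟶ G) :
    directSections f q F ⟶ directSections f q G :=
  (globalSections (Spec (.of R))).map ((higherDirectImage f.base q).map ψ)

lemma directMap_comp (q : ℕ) {F G K : TopCat.Sheaf AddCommGrpCat.{u} X} (ψ : F ⟶ G) (χ : G ⟶ K) :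
    directMap f q (ψ ≫ χ) = directMap f q ψ ≫ directMap f q χ := by
  rw [directMap, Functor.map_comp, Functor.map_comp]

lemma phi_map_phiIso (q : ℕ) {N N' : NilAlg R} (θ : N ⟶ N')
    y :
    (phi f q).map θ ((phiIso f q N).hom y) =
      (phiIso f q N').hom (directMap f q ((pushTilde f).map θ) y) := by
  have h : (phiIso f q N).hom ≫ (phi f q).map θ =
      directMap f q ((pushTilde f).map θ) ≫ (phiIso f q N').hom := by
    change (phiIso f q N).hom ≫ ((phiIso f q N).inv ≫ _ ≫ (phiIso f q N').hom) = _
    rw [Iso.hom_inv_id_assoc]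
    rfl
  exact ConcreteCategory.congr_hom h y

lemma directMap_redTildeι_toZero (q : ℕ) (N : NilAlg R) :
    directMap f q (redTildeι f N) ≫ directMap f q ((pushTilde f).map N.toZero) = 0 := by
  rw [← directMap_comp, redTildeι_toZero, directMap, Functor.map_zero, Functor.map_zero]

lemma directMap_redTildeι_π (q : ℕ) (N : NilAlg R) :
    directMap f q (redTildeι f N) ≫ directMap f q (redTildeπ f N) = 𝟙 _ := by
  rw [← directMap_comp, redTildeι_π, directMap, CategoryTheory.Functor.map_id,
    CategoryTheory.Functor.map_id]

lemma directMap_redTildeπ_ι (q : ℕ) (N : NilAlg R) :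
    directMap f q (redTildeπ f N) ≫ directMap f q (redTildeι f N) = 𝟙 _ -
      directMap f q ((pushTilde f).map N.toZero) ≫ directMap f q ((pushTilde f).map N.fromZero) :=
          by
  rw [← directMap_comp, redTildeπ_ι, ← directMap_comp, directMap, Functor.map_sub, Functor.map_sub,
    CategoryTheory.Functor.map_id, CategoryTheory.Functor.map_id]

/-- The map from `H^q(X, ker(Ẽ_T ⟶ Ẽ_S))` to `ker(Φ^q(T) → Φ^q(S))`. -/
def cohToPhi (q : ℕ) (N : NilAlg R) :
    coh ((redTilde f).obj N) q (⊤ : X.Opens) →+ (phiNil f q).obj N :=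
  (((phiIso f q N).hom.hom.comp (directMap f q (redTildeι f N)).hom).comp
    (toDirect f.base q ((redTilde f).obj N) ⊤)).codRestrict ((phi f q).map N.toZero).hom.ker
    (fun z => by
      refine (phi_map_phiIso f q N.toZero _).trans ?_
      refine (congrArg (phiIso f q _).hom (ConcreteCategory.congr_hom
        (directMap_redTildeι_toZero f q N) (toDirect f.base q ((redTilde f).obj N) ⊤ z))).trans ?_
      exact map_zero (phiIso f q _).hom.hom)

lemma cohToPhi_naturality (q : ℕ) {N N' : NilAlg R} (θ : N ⟶ N')
    (z : coh ((redTilde f).obj N) q (⊤ : X.Opens)) :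
    cohToPhi f q N' (cohMap ((redTilde f).map θ) q ⊤ z) =
      (phiNil f q).map θ (cohToPhi f q N z) := by
  refine Subtype.ext ?_
  refine Eq.trans ?_ (phi_map_phiIso f q θ _).symm
  refine congrArg (phiIso f q N').hom ?_
  refine (congrArg (directMap f q (redTildeι f N'))
    (toDirect_naturality (f := f.base) (V := ⊤) ((redTilde f).map θ) z)).trans ?_
  have h : directMap f q ((redTilde f).map θ) ≫ directMap f q (redTildeι f N') =
      directMap f q (redTildeι f N) ≫ directMap f q ((pushTilde f).map θ) := by
    rw [← directMap_comp, redTilde_map_ι, directMap_comp]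
  exact ConcreteCategory.congr_hom h (toDirect f.base q ((redTilde f).obj N) ⊤ z)

/-- Since `redTilde` is a direct summand of `pushTilde`, its direct image is the kernel of the map
to the value at 0; the isomorphisms `phiIso` then identify this with the kernel for Φ^q. -/
lemma cohToPhi_bijective {q : ℕ} {N : NilAlg R}
    (h : Function.Bijective (toDirect f.base q ((redTilde f).obj N) ⊤)) :
    Function.Bijective (cohToPhi f q N) := by
  have hinj : Function.Injective (phiIso f q N).hom := fun a b hab => by
    have := congrArg (phiIso f q N).inv hab
    exact (ConcreteCategory.congr_hom (phiIso f q N).hom_inv_id a).symm.trans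
      (this.trans (ConcreteCategory.congr_hom (phiIso f q N).hom_inv_id b))
  refine ⟨fun z z' hz => h.1 ?_, fun s => ?_⟩
  · have h1 := hinj (congrArg Subtype.val hz)
    have h2 := congrArg (directMap f q (redTildeπ f N)) h1
    exact (ConcreteCategory.congr_hom (directMap_redTildeι_π f q N) _).symm.trans
      (h2.trans (ConcreteCategory.congr_hom (directMap_redTildeι_π f q N) _))
  · obtain ⟨y, hy⟩ : ∃ y : directSections f q ((pushTilde f).obj N), (phiIso f q N).hom y = s.1 :=
      ⟨(phiIso f q N).inv s.1, ConcreteCategory.congr_hom (phiIso f q N).inv_hom_id s.1⟩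
    have hinj0 : Function.Injective (phiIso f q (NilAlg.zero R)).hom := fun a b hab => by
      have := congrArg (phiIso f q _).inv hab
      exact (ConcreteCategory.congr_hom (phiIso f q _).hom_inv_id a).symm.trans
        (this.trans (ConcreteCategory.congr_hom (phiIso f q _).hom_inv_id b))
    have h0 : directMap f q ((pushTilde f).map N.toZero) y = 0 := by
      apply hinj0
      refine (phi_map_phiIso f q N.toZero y).symm.trans ?_
      refine (congrArg ((phi f q).map N.toZero) hy).trans ?_
      exact s.2.trans (map_zero (phiIso f q _).hom.hom).symm
    obtain ⟨z, hz⟩ := h.2 (directMap f q (redTildeπ f N) y)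
    refine ⟨z, Subtype.ext ?_⟩
    refine Eq.trans (congrArg (phiIso f q N).hom ?_) hy
    refine (congrArg (directMap f q (redTildeι f N)) hz).trans ?_
    refine (ConcreteCategory.congr_hom (directMap_redTildeπ_ι f q N) y).trans ?_
    refine (congrArg (fun v => y -
      directMap f q ((pushTilde f).map N.fromZero) v) h0).trans ?_
    refine (congrArg (fun v => y - v) (map_zero
      (directMap f q ((pushTilde f).map N.fromZero)).hom)).trans ?_
    exact sub_zero y

lemma cohTorsionFree_top {q : ℕ}
    (h : ∀ V ∈ basicClass R, CohTorsionFree (structSheaf X) q (preim f V)) :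
    CohTorsionFree (structSheaf X) q (⊤ : X.Opens) :=
  h ⊤ top_mem_basicClass

lemma cohToPhi_truncAlg_bijective [IsNoetherian X] [IsSeparated f] {q : ℕ}
    (h : ∀ V ∈ basicClass R, CohTorsionFree (structSheaf X) q (preim f V)) (n : ℕ) :
    Function.Bijective (cohToPhi f q (truncAlg R (n + 1))) :=
  cohToPhi_bijective f (toDirect_redTrunc_bijective h n)

lemma wittToPhi_eq_cohToPhi (q n : ℕ) (x : (cohomology X q).obj (wittSheaf X)) :
    wittToPhi f q n x =
      (cohToPhi f q (truncAlg R n) (cohMap (wittToRed f n) q ⊤ (derEquiv q _ x))).1 := by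
  refine congrArg (phiIso f q (truncAlg R n)).hom ?_
  refine (congrArg (fun k => edgeMap f.base q _ ((cohomology X q).map k x))
    (wittToRed_ι f n).symm).trans ?_
  refine (edgeMap_eq_toDirect _ _ _ _).trans ?_
  rw [derEquiv_naturality, cohMap_comp]
  exact toDirect_naturality (redTildeι f _) _

end Comparison

/-! ### The pairing of power series with invertible polynomials -/

section Pairing

open Polynomial

variable {D E : Type*} [CommRing D] [CommRing E]

/-- The resultant with a monic P is the norm of g modulo P, so only the residue class of g matters.
The formal degrees are irrelevant because the leading coefficient of P is 1. -/
lemma resultant_eq_of_dvd_sub {P g g' : D[X]} {r n n' : ℕ} (hP : P.natDegree ≤ r)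
    (hP1 : P.coeff r = 1) (hg : g.natDegree ≤ n) (hg' : g'.natDegree ≤ n') (h : P ∣ g - g') :
    resultant P g r n = resultant P g' r n' := by
  nontriviality D
  obtain ⟨Q, hQ⟩ := h
  have hm : P.Monic := monic_of_natDegree_le_of_coeff_eq_one r hP hP1
  have hr : P.natDegree = r := le_antisymm hP (le_natDegree_of_ne_zero (by rw [hP1]; exact
      one_ne_zero))
  -- Both formal degrees are raised to n + n' + r, which leaves room for the multiple of P that is
  -- added.
  have hQd : Q.natDegree + r ≤ n + (n' + r) := by
    by_cases hQ0 : Q = 0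
    · rw [hQ0, natDegree_zero]
      omega
    · have h1 := congrArg natDegree hQ
      rw [hm.natDegree_mul' hQ0, hr] at h1
      have h2 := natDegree_sub_le_of_le hg hg'
      have h3 : max n n' ≤ n + n' := max_le (by omega) (by omega)
      omega
  have h1 : resultant P g r (n + (n' + r)) = resultant P g r n := by
    rw [resultant_add_right_deg _ _ _ _ _ hg, hP1, one_pow, one_mul]
  have h2 : resultant P g' r (n' + (n + r)) = resultant P g' r n' := by
    rw [resultant_add_right_deg _ _ _ _ _ hg', hP1, one_pow, one_mul]
  rw [← h1, ← h2, show n' + (n + r) = n + (n' + r) by omega, ← resultant_add_mul_right P g' Q _ _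
      hQd hP,
    ← hQ, add_sub_cancel]

lemma resultant_mul_left_of_coeff {P Q g : D[X]} {r s n : ℕ} (hP : P.natDegree ≤ r)
    (hP1 : P.coeff r = 1) (hQ : Q.natDegree ≤ s) (hQ1 : Q.coeff s = 1) (hg : g.natDegree ≤ n) :
    resultant (P * Q) g (r + s) n = resultant P g r n * resultant Q g s n := by
  nontriviality D
  have hr : P.natDegree = r := le_antisymm hP (le_natDegree_of_ne_zero (by rw [hP1]; exact
      one_ne_zero))
  have hs : Q.natDegree = s := le_antisymm hQ (le_natDegree_of_ne_zero (by rw [hQ1]; exact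
      one_ne_zero))
  subst hr hs
  exact resultant_mul_left P Q g n hg

lemma natDegree_reflect_le_of_le {p : D[X]} {r : ℕ} (h : p.natDegree ≤ r) :
    (p.reflect r).natDegree ≤ r := by
  rw [natDegree_le_iff_coeff_eq_zero]
  intro i hi
  rw [coeff_reflect, revAt_eq_self_of_lt hi]
  exact coeff_eq_zero_of_natDegree_lt (h.trans_lt hi)

lemma coeff_reflect_self (p : D[X]) (r : ℕ) : (p.reflect r).coeff r = p.coeff 0 := by
  rw [coeff_reflect, revAt_le le_rfl, Nat.sub_self]

lemma reflect_add_right {p : D[X]} {r : ℕ} (h : p.natDegree ≤ r) (k : ℕ) :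
    p.reflect (r + k) = p.reflect r * X ^ k := by
  rw [← reflect_one k, ← reflect_mul p 1 h (by simp), mul_one]

/-- Reversing p p' = 1 gives a factorization of a power of X. So power series have well defined
residues modulo the reversal of an invertible polynomial. -/
lemma reflect_dvd_X_pow {p p' : D[X]} (hp : p * p' = 1) {r n : ℕ} (h : p.natDegree ≤ r)
    (hn : r + p'.natDegree ≤ n) : p.reflect r ∣ X ^ n := by
  refine Dvd.dvd.trans ⟨p'.reflect p'.natDegree, ?_⟩ (pow_dvd_pow X hn)
  rw [← reflect_mul p p' h le_rfl, hp, reflect_one]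

lemma X_pow_dvd_trunc_sub_trunc (ω : PowerSeries D) {a b c : ℕ} (hb : a ≤ b) (hc : a ≤ c) :
    (X : D[X]) ^ a ∣ PowerSeries.trunc b ω - PowerSeries.trunc c ω := by
  rw [X_pow_dvd_iff]
  intro i hi
  rw [coeff_sub, PowerSeries.coeff_trunc, PowerSeries.coeff_trunc, if_pos (by omega),
    if_pos (by omega), sub_self]

lemma natDegree_trunc_le (n : ℕ) (ω : PowerSeries D) :
    (PowerSeries.trunc (n + 1) ω).natDegree ≤ n :=
  Nat.lt_succ_iff.1 (PowerSeries.natDegree_trunc_lt ω n)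

/-- The resultant of the reversed polynomial `t ^ r p(1 / t)` and of the truncation of `ω`. -/
def truncResultant (r n : ℕ) (p : D[X]) (ω : PowerSeries D) : D :=
  resultant (p.reflect r) (PowerSeries.trunc (n + 1) ω) r n

lemma truncResultant_map (ψ : D →+* E) (r n : ℕ) (p : D[X]) (ω : PowerSeries D) :
    ψ (truncResultant r n p ω) = truncResultant r n (p.map ψ) (PowerSeries.map ψ ω) := by
  rw [truncResultant, truncResultant, reflect_map, PowerSeries.trunc_map, resultant_map_map]

/-- The pairing of power series with an invertible polynomial `p` with constant coefficient `1`. If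
`p = ∏ (1 - ξᵢ t)`, then it sends `ω` to `∏ ω(ξᵢ)`. -/
def pairing (p : (D[X])ˣ) (h0 : (p : D[X]).coeff 0 = 1) : PowerSeries D →* D where
  -- The truncation order is deg p + deg p⁻¹ + 1, large enough for the reversal of p to divide that
  -- power of X.
  toFun := truncResultant (p : D[X]).natDegree
    ((p : D[X]).natDegree + (↑p⁻¹ : D[X]).natDegree) p
  map_one' := by
    rw [truncResultant, PowerSeries.trunc_one, resultant_one_right, coeff_reflect_self, h0, one_pow]
  map_mul' ω ω' := by
    have hP := natDegree_reflect_le_of_le (p := (p : D[X])) le_rfl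
    have hP1 := (coeff_reflect_self (p : D[X]) (p : D[X]).natDegree).trans h0
    set n := (p : D[X]).natDegree + (↑p⁻¹ : D[X]).natDegree
    -- Hence the truncation of ωω' and the product of the truncations agree modulo the reversal of
    -- p, and the resultant does not see the difference.
    have hd : (p : D[X]).reflect (p : D[X]).natDegree ∣ X ^ (n + 1) :=
      reflect_dvd_X_pow p.mul_inv le_rfl (Nat.le_succ _)
    have h1 : ∀ g : D[X], ∀ m, g.natDegree ≤ m →
        resultant ((p : D[X]).reflect (p : D[X]).natDegree) g (p : D[X]).natDegree m =
          resultant ((p : D[X]).reflect (p : D[X]).natDegree) g (p : D[X]).natDegree g.natDegree :=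
      fun g m hm => resultant_eq_of_dvd_sub hP hP1 hm le_rfl (by rw [sub_self]; exact dvd_zero _)
    rw [truncResultant, truncResultant, truncResultant, h1 _ _ (natDegree_trunc_le n ω),
      h1 _ _ (natDegree_trunc_le n ω'), ← resultant_mul_right _ _ _ _ hP]
    refine resultant_eq_of_dvd_sub hP hP1 (natDegree_trunc_le n _) natDegree_mul_le
      (hd.trans ?_)
    rw [X_pow_dvd_iff]
    intro i hi
    rw [coeff_sub, PowerSeries.coeff_trunc, if_pos hi,
      PowerSeries.coeff_mul_eq_coeff_trunc_mul_trunc _ _ hi, ← Polynomial.coe_mul,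
      Polynomial.coeff_coe, sub_self]

/-- A larger r multiplies the reversal by a power of X, whose resultant with ω is a power of ω(0) =
1; another admissible n changes the truncation by a multiple of the reversal. -/
lemma truncResultant_eq_pairing {p : (D[X])ˣ} (h0 : (p : D[X]).coeff 0 = 1) {ω : PowerSeries D}
    (hω : PowerSeries.constantCoeff ω = 1) {r n : ℕ} (hr : (p : D[X]).natDegree ≤ r)
    (hd : (p : D[X]).reflect r ∣ X ^ (n + 1)) : truncResultant r n p ω = pairing p h0 ω := by
  obtain ⟨k, rfl⟩ := Nat.exists_eq_add_of_le hr
  set s := (p : D[X]).natDegree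
  have hP := natDegree_reflect_le_of_le (p := (p : D[X])) (r := s) le_rfl
  have hP1 := (coeff_reflect_self (p : D[X]) s).trans h0
  have h1 : truncResultant (s + k) n p ω = truncResultant s n p ω := by
    rw [truncResultant, reflect_add_right le_rfl, resultant_mul_left_of_coeff hP hP1
      (natDegree_X_pow_le k) (by rw [coeff_X_pow, if_pos rfl]) (natDegree_trunc_le n ω),
      resultant_X_pow_left _ _ _ (natDegree_trunc_le n ω), PowerSeries.coeff_trunc,
      if_pos (Nat.succ_pos n), PowerSeries.coeff_zero_eq_constantCoeff_apply, hω, one_pow, mul_one,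
      truncResultant]
  rw [reflect_add_right le_rfl] at hd
  have hd1 := (dvd_mul_right _ _).trans hd
  have hd2 : (p : D[X]).reflect s ∣ X ^ (s + (↑p⁻¹ : D[X]).natDegree + 1) :=
    reflect_dvd_X_pow p.mul_inv le_rfl (Nat.le_succ _)
  rw [h1]
  refine resultant_eq_of_dvd_sub hP hP1 (natDegree_trunc_le n ω) (natDegree_trunc_le _ ω) ?_
  rcases le_total n (s + (↑p⁻¹ : D[X]).natDegree) with h | h
  · exact hd1.trans (X_pow_dvd_trunc_sub_trunc ω le_rfl (by omega))
  · exact hd2.trans (X_pow_dvd_trunc_sub_trunc ω (by omega) le_rfl)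

lemma pairing_mul_left {p p' : (D[X])ˣ} (h0 : (p : D[X]).coeff 0 = 1)
    (h0' : (p' : D[X]).coeff 0 = 1) (h0'' : (↑(p * p') : D[X]).coeff 0 = 1) {ω : PowerSeries D}
    (hω : PowerSeries.constantCoeff ω = 1) :
    pairing (p * p') h0'' ω = pairing p h0 ω * pairing p' h0' ω := by
  set r := (p : D[X]).natDegree
  set s := (p' : D[X]).natDegree
  have hd := reflect_dvd_X_pow p.mul_inv (r := r) le_rfl
    (n := r + s + ((↑p⁻¹ : D[X]).natDegree + (↑p'⁻¹ : D[X]).natDegree) + 1) (by omega)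
  have hd' := reflect_dvd_X_pow p'.mul_inv (r := s) le_rfl
    (n := r + s + ((↑p⁻¹ : D[X]).natDegree + (↑p'⁻¹ : D[X]).natDegree) + 1) (by omega)
  have hle : (↑(p * p')⁻¹ : D[X]).natDegree ≤
      (↑p⁻¹ : D[X]).natDegree + (↑p'⁻¹ : D[X]).natDegree := by
    rw [mul_inv, Units.val_mul]
    exact natDegree_mul_le
  have hd'' := reflect_dvd_X_pow (p * p').mul_inv (r := r + s) natDegree_mul_le
    (n := r + s + ((↑p⁻¹ : D[X]).natDegree + (↑p'⁻¹ : D[X]).natDegree) + 1) (by omega)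
  rw [← truncResultant_eq_pairing h0 hω le_rfl hd, ← truncResultant_eq_pairing h0' hω le_rfl hd',
    ← truncResultant_eq_pairing h0'' hω natDegree_mul_le hd'', truncResultant, Units.val_mul,
    reflect_mul _ _ le_rfl le_rfl]
  exact resultant_mul_left_of_coeff (natDegree_reflect_le_of_le le_rfl)
    ((coeff_reflect_self _ _).trans h0) (natDegree_reflect_le_of_le le_rfl)
    ((coeff_reflect_self _ _).trans h0') (natDegree_trunc_le _ ω)

lemma pairing_one {ω : PowerSeries D} (hω : PowerSeries.constantCoeff ω = 1)
    (h0 : ((1 : (D[X])ˣ) : D[X]).coeff 0 = 1) : pairing 1 h0 ω = 1 := by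
  have h := truncResultant_eq_pairing h0 hω (r := 0) (n := 0) (by simp) (by simp)
  rw [← h, truncResultant, resultant_zero_right_deg, pow_zero]

/-- Degrees may drop under ψ, so the two sides are computed with different parameters; independence
of the parameters is what makes the pairing compatible with base change. -/
lemma map_pairing (ψ : D →+* E) {p : (D[X])ˣ} {p' : (E[X])ˣ} (h : (p' : E[X]) = (p : D[X]).map ψ)
    (h0 : (p : D[X]).coeff 0 = 1) (h0' : (p' : E[X]).coeff 0 = 1) {ω : PowerSeries D}
    (hω : PowerSeries.constantCoeff ω = 1) :
    ψ (pairing p h0 ω) = pairing p' h0' (PowerSeries.map ψ ω) := by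
  have hω' : PowerSeries.constantCoeff (PowerSeries.map ψ ω) = 1 := by
    rw [← PowerSeries.coeff_zero_eq_constantCoeff_apply, PowerSeries.coeff_map,
      PowerSeries.coeff_zero_eq_constantCoeff_apply, hω, map_one]
  refine (truncResultant_map ψ _ _ _ _).trans ?_
  rw [← h]
  refine truncResultant_eq_pairing h0' hω' (h ▸ natDegree_map_le) ?_
  have hd : (p : D[X]).reflect (p : D[X]).natDegree ∣ X ^
      ((p : D[X]).natDegree + (↑p⁻¹ : D[X]).natDegree + 1) :=
    reflect_dvd_X_pow p.mul_inv le_rfl (Nat.le_succ _)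
  have h2 := map_dvd (mapRingHom ψ) hd
  rw [map_pow, coe_mapRingHom, map_X, ← reflect_map, ← h] at h2
  exact h2

/-- The reversal of 1 - ξt is X - ξ, and the resultant with it is evaluation at ξ. So pairing with 1
- xt is reduction of the series modulo a power of x. -/
lemma pairing_linear {p : (D[X])ˣ} (h0 : (p : D[X]).coeff 0 = 1) {ξ : D} {m : ℕ} (hξ : ξ ^ m = 0)
    (hp : (p : D[X]) = 1 - C ξ * X) {ω : PowerSeries D} (hω : PowerSeries.constantCoeff ω = 1) :
    pairing p h0 ω = ∑ i ∈ Finset.range (m + 1), PowerSeries.coeff i ω * ξ ^ i := by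
  have h1 : (p : D[X]).natDegree ≤ 1 := by
    rw [hp]
    refine (natDegree_sub_le _ _).trans (max_le (by simp) ?_)
    exact (natDegree_C_mul_le _ _).trans natDegree_X_le
  have h2 : (p : D[X]).reflect 1 = X - C ξ := by
    rw [hp, reflect_sub, reflect_one, reflect_C_mul, reflect_one_X, pow_one, mul_one]
  rw [← truncResultant_eq_pairing h0 hω h1 (reflect_dvd_X_pow p.mul_inv h1
    (n := m + (1 + (↑p⁻¹ : D[X]).natDegree) + 1) (by omega)), truncResultant, h2,
    resultant_X_sub_C_left _ _ _ (natDegree_trunc_le _ ω), Polynomial.eval,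
    PowerSeries.eval₂_trunc_eq_sum_range]
  refine (Finset.sum_subset (Finset.range_mono (by omega)) fun i _ hi => ?_).symm
  rw [Finset.mem_range, not_lt] at hi
  rw [pow_eq_zero_of_le (by omega) hξ, mul_zero]

end Pairing

/-! ### The homomorphisms `𝕎𝒪_X ⟶ Ẽ_T` given by the elements of `Λ(N)` -/

section LambdaHom

open Polynomial

variable {R : Type u} [CommRing R] {X : Scheme.{u}} (f : X ⟶ Spec (.of R))

/-- The polynomial over `Γ(X_N, U)` given by an element of `Λ(N)`. -/
def lambdaPoly (N : NilAlg R) (U : X.Opens) (p : lambdaSubgroup N) : ((thickeningRing f N U)[X])ˣ :=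
  Units.map (mapRingHom (augStruct f N U)).toMonoidHom p.1

lemma lambdaPoly_coe (N : NilAlg R) (U : X.Opens) (p : lambdaSubgroup N) :
    (lambdaPoly f N U p : (thickeningRing f N U)[X]) =
      ((p : (N.Aug[X])ˣ) : N.Aug[X]).map (augStruct f N U) := rfl

lemma coeff_zero_lambdaPoly (N : NilAlg R) (U : X.Opens) (p : lambdaSubgroup N) :
    (lambdaPoly f N U p : (thickeningRing f N U)[X]).coeff 0 = 1 := by
  rw [lambdaPoly_coe, coeff_map, (mem_lambdaSubgroup.1 p.2).1, map_one]

lemma lambdaPoly_mul (N : NilAlg R) (U : X.Opens) (p p' : lambdaSubgroup N) :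
    lambdaPoly f N U (p * p') = lambdaPoly f N U p * lambdaPoly f N U p' :=
  map_mul (Units.map (mapRingHom (augStruct f N U)).toMonoidHom) p.1 p'.1

lemma map_lambdaPoly_eq_one {N : NilAlg R} {U : X.Opens} {E : Type*} [CommRing E]
    (ψ : thickeningRing f N U →+* E)
    (hψ : ∀ ν : N.carrier, ψ (augStruct f N U (ν : N.Aug)) = 0) (p : lambdaSubgroup N) :
    (lambdaPoly f N U p : (thickeningRing f N U)[X]).map ψ = 1 := by
  obtain ⟨h0, h1⟩ := mem_lambdaSubgroup.1 p.2
  refine Polynomial.ext fun i => ?_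
  rw [lambdaPoly_coe, coeff_map, coeff_map]
  by_cases hi : i = 0
  · rw [hi, h0, map_one, map_one, coeff_one_zero]
  · rw [coeff_one, if_neg hi, ← Unitization.inl_fst_add_inr_snd_eq (Polynomial.coeff _ i), h1 i hi,
      Unitization.inl_zero, zero_add, hψ]

/-- The power series over `Γ(X_N, U)` given by a big Witt vector. -/
def wittSeries (N : NilAlg R) (U : X.Opens) : PowerSeries Γ(X, U) →+*
    PowerSeries (thickeningRing f N U) :=
  PowerSeries.map ((thickeningFst f N).app U).hom

variable {f} in
lemma constantCoeff_wittSeries {N : NilAlg R} {U : X.Opens} {w : PowerSeries Γ(X, U)}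
    (hw : PowerSeries.constantCoeff w = 1) :
    PowerSeries.constantCoeff (wittSeries f N U w) = 1 := by
  rw [wittSeries, ← PowerSeries.coeff_zero_eq_constantCoeff_apply, PowerSeries.coeff_map,
      PowerSeries.coeff_zero_eq_constantCoeff_apply, hw, map_one]

/-- The pairing of `Γ(X, U)[[x]]` with an element of `Λ(N)`. -/
def lambdaPairing (N : NilAlg R) (U : X.Opens) (p : lambdaSubgroup N) :
    PowerSeries Γ(X, U) →* thickeningRing f N U :=
  (pairing (lambdaPoly f N U p) (coeff_zero_lambdaPoly f N U p)).comp
    (wittSeries f N U).toMonoidHom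

lemma lambdaPairing_apply (N : NilAlg R) (U : X.Opens) (p : lambdaSubgroup N)
    (w : PowerSeries Γ(X, U)) : lambdaPairing f N U p w =
      pairing (lambdaPoly f N U p) (coeff_zero_lambdaPoly f N U p) (wittSeries f N U w) := rfl

lemma map_lambdaPairing_eq_one {N : NilAlg R} {U : X.Opens} {E : Type*} [CommRing E]
    (ψ : thickeningRing f N U →+* E)
    (hψ : ∀ ν : N.carrier, ψ (augStruct f N U (ν : N.Aug)) = 0) (p : lambdaSubgroup N)
    {w : PowerSeries Γ(X, U)} (hw : PowerSeries.constantCoeff w = 1) :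
    ψ (lambdaPairing f N U p w) = 1 := by
  have hw' := constantCoeff_wittSeries (f := f) (N := N) hw
  refine (map_pairing (p' := 1) ψ (map_lambdaPoly_eq_one f ψ hψ p).symm
    (coeff_zero_lambdaPoly f N U p) (by simp) hw').trans ?_
  refine pairing_one ?_ _
  rw [← PowerSeries.coeff_zero_eq_constantCoeff_apply, PowerSeries.coeff_map,
      PowerSeries.coeff_zero_eq_constantCoeff_apply, hw', map_one]

lemma red_augStruct (N : NilAlg R) (U : X.Opens) (ν : N.carrier) :
    ((redι (thickening f N)).app (thickeningFst f N ⁻¹ᵁ U)).hom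
      (augStruct f N U (ν : N.Aug)) = 0 :=
  IsNilpotent.eq_zero (IsNilpotent.map (IsNilpotent.map (N.isNilpotent_of_fst _ rfl) _) _)

lemma baseChangeRed_augStruct (N : NilAlg R) (U : X.Opens) (ν : N.carrier) :
    ((baseChangeRed f N.toSpec).app (thickeningFst f N ⁻¹ᵁ U)).hom
      (augStruct f N U (ν : N.Aug)) = 0 := by
  have h : (redι (Spec (.of N.Aug))).app ⊤ ((Scheme.ΓSpecIso (.of N.Aug)).inv.hom (ν : N.Aug)) = 0
      :=
    IsNilpotent.eq_zero (IsNilpotent.map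
      (IsNilpotent.map (N.isNilpotent_of_fst (ν : N.Aug) rfl)
        (Scheme.ΓSpecIso (.of N.Aug)).inv.hom) ((redι (Spec (.of N.Aug))).app ⊤).hom)
  exact app_appLE_eq_zero Limits.pullback.condition _ _ h

/-- The homomorphism `1 + x Γ(X, U)[[x]] → Ẽ_T(U)` given by an element of `Λ(N)`. -/
def lambdaHomApp (N : NilAlg R) (p : lambdaSubgroup N) (U : X.Opens) : wittSubgroup Γ(X, U) →*
    ↥(unitsKer (redι (thickening f N)) (thickeningFst f N ⁻¹ᵁ U) ⊓
      unitsKer (baseChangeRed f N.toSpec) (thickeningFst f N ⁻¹ᵁ U)) :=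
  ((Units.map (lambdaPairing f N U p)).comp (Subgroup.subtype _)).codRestrict _ (fun w =>
    ⟨mem_unitsKer.2 (map_lambdaPairing_eq_one f ((redι (thickening f N)).app _).hom
        (red_augStruct f N U) p (mem_wittSubgroup.1 w.2)),
      mem_unitsKer.2 (map_lambdaPairing_eq_one f ((baseChangeRed f N.toSpec).app _).hom
        (baseChangeRed_augStruct f N U) p (mem_wittSubgroup.1 w.2))⟩)

lemma lambdaPairing_res (N : NilAlg R) (p : lambdaSubgroup N) {U V : X.Opens} (i : V ⟶ U)
    {w : PowerSeries Γ(X, U)} (hw : PowerSeries.constantCoeff w = 1) :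
    lambdaPairing f N V p (PowerSeries.map (X.presheaf.map i.op).hom w) =
      thickeningRes f N i (lambdaPairing f N U p w) := by
  have h1 : (lambdaPoly f N V p : (thickeningRing f N V)[X]) =
      (lambdaPoly f N U p : (thickeningRing f N U)[X]).map (thickeningRes f N i) := by
    rw [lambdaPoly_coe, lambdaPoly_coe, Polynomial.map_map]
    congr 1
    exact (RingHom.ext fun c => thickeningRes_augStruct f N i c).symm
  have h2 : wittSeries f N V (PowerSeries.map (X.presheaf.map i.op).hom w) =
      PowerSeries.map (thickeningRes f N i) (wittSeries f N U w) := by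
    refine PowerSeries.ext fun k => ?_
    simp only [wittSeries, PowerSeries.coeff_map]
    exact (thickeningRes_app f N i _).symm
  rw [lambdaPairing_apply, lambdaPairing_apply, h2]
  exact (map_pairing (thickeningRes f N i) h1 _ _ (constantCoeff_wittSeries hw)).symm

lemma lambdaPairing_map {N N' : NilAlg R} (θ : N ⟶ N') (p : lambdaSubgroup N) (U : X.Opens)
    {w : PowerSeries Γ(X, U)} (hw : PowerSeries.constantCoeff w = 1) :
    thickeningRingMap f θ U (lambdaPairing f N U p w) =
      lambdaPairing f N' U (lambdaMap θ p) w := by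
  have h1 : (lambdaPoly f N' U (lambdaMap θ p) : (thickeningRing f N' U)[X]) =
      (lambdaPoly f N U p : (thickeningRing f N U)[X]).map (thickeningRingMap f θ U) := by
    rw [lambdaPoly_coe, lambdaPoly_coe, lambdaMap_coe, Polynomial.map_map, Polynomial.map_map]
    congr 1
    exact (RingHom.ext fun c => thickeningRingMap_augStruct f θ U c).symm
  have h2 : wittSeries f N' U w =
      PowerSeries.map (thickeningRingMap f θ U) (wittSeries f N U w) := by
    refine PowerSeries.ext fun k => ?_
    simp only [wittSeries, PowerSeries.coeff_map]
    exact (thickeningRingMap_app f θ U _).symm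
  rw [lambdaPairing_apply, lambdaPairing_apply, h2]
  exact map_pairing (thickeningRingMap f θ U) h1 _ _ (constantCoeff_wittSeries hw)

lemma lambdaPairing_mul (N : NilAlg R) (p p' : lambdaSubgroup N) (U : X.Opens)
    {w : PowerSeries Γ(X, U)} (hw : PowerSeries.constantCoeff w = 1) :
    lambdaPairing f N U (p * p') w = lambdaPairing f N U p w * lambdaPairing f N U p' w := by
  have h : ∀ P (hP : P = lambdaPoly f N U p * lambdaPoly f N U p') h0,
      pairing P h0 (wittSeries f N U w) = lambdaPairing f N U p w * lambdaPairing f N U p' w := by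
    rintro _ rfl h0
    exact pairing_mul_left (coeff_zero_lambdaPoly f N U p) (coeff_zero_lambdaPoly f N U p') _
      (constantCoeff_wittSeries hw)
  exact h _ (lambdaPoly_mul f N U p p') (coeff_zero_lambdaPoly f N U (p * p'))

lemma lambdaPairing_lambdaElt (n : ℕ) (U : X.Opens)
    {w : PowerSeries Γ(X, U)} (hw : PowerSeries.constantCoeff w = 1) :
    lambdaPairing f (truncAlg R n) U (lambdaElt R n) w = truncEval f n U w := by
  rw [lambdaPairing_apply, pairing_linear _ (xi_pow f n U) ?_ (constantCoeff_wittSeries hw),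
    truncEval_apply]
  · refine Finset.sum_congr rfl fun i _ => ?_
    rw [wittSeries, PowerSeries.coeff_map]
  · rw [lambdaPoly_coe]
    simp [lambdaElt, xi]

/-- The homomorphism `𝕎𝒪_X ⟶ Ẽ_T` given by an element of `Λ(N)`. -/
def lambdaToTilde (N : NilAlg R) (p : lambdaSubgroup N) : wittSheaf X ⟶ (pushTilde f).obj N :=
  ⟨{ app := fun U => AddCommGrpCat.ofHom (lambdaHomApp f N p U.unop).toAdditive
     naturality := fun U V i => by
       refine AddCommGrpCat.ext fun w => Additive.toMul.injective (Subtype.ext (Units.ext ?_))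
       exact lambdaPairing_res f N p i.unop (mem_wittSubgroup.1 (Additive.toMul w).2) }⟩

lemma lambdaToTilde_toZero (N : NilAlg R) (p : lambdaSubgroup N) :
    lambdaToTilde f N p ≫ (pushTilde f).map N.toZero = 0 := by
  refine ObjectProperty.hom_ext _ (NatTrans.ext (funext fun U => AddCommGrpCat.ext fun s =>
    tildeVal_injective ?_))
  refine map_lambdaPairing_eq_one f (thickeningRingMap f N.toZero U.unop) (fun ν => ?_) p
    (constantCoeff_wittVal U.unop s)
  rw [thickeningRingMap_augStruct, NilAlg.augMap_inr]
  exact map_zero _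

/-- The homomorphism `𝕎𝒪_X ⟶ ker(Ẽ_T ⟶ Ẽ_S)` given by an element of `Λ(N)`. -/
def lambdaHom (N : NilAlg R) (p : lambdaSubgroup N) : wittSheaf X ⟶ (redTilde f).obj N :=
  Limits.kernel.lift _ (lambdaToTilde f N p) (lambdaToTilde_toZero f N p)

lemma lambdaHom_ι (N : NilAlg R) (p : lambdaSubgroup N) :
    lambdaHom f N p ≫ redTildeι f N = lambdaToTilde f N p :=
  Limits.kernel.lift_ι _ _ _

lemma redVal_lambdaHom (N : NilAlg R) (p : lambdaSubgroup N) (U : X.Opens)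
    (ω : (wittSheaf X).obj.obj (op U)) :
    redVal f N U ((lambdaHom f N p).hom.app (op U) ω) =
      lambdaPairing f N U p (wittVal U ω) :=
  congrArg (tildeVal f N U) (sheafHom_congr (lambdaHom_ι f N p) U ω)

lemma lambdaHom_mul (N : NilAlg R) (p p' : lambdaSubgroup N) :
    lambdaHom f N (p * p') = lambdaHom f N p + lambdaHom f N p' := by
  refine ObjectProperty.hom_ext _ (NatTrans.ext (funext fun U => AddCommGrpCat.ext fun s =>
    redVal_injective ?_))
  refine (redVal_lambdaHom f N _ U.unop s).trans ?_
  refine Eq.trans ?_ (redVal_add f N U.unop _ _).symm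
  refine (lambdaPairing_mul f N p p' U.unop (constantCoeff_wittVal U.unop s)).trans ?_
  exact congrArg₂ (· * ·) (redVal_lambdaHom f N p U.unop s).symm
    (redVal_lambdaHom f N p' U.unop s).symm

lemma lambdaHom_map {N N' : NilAlg R} (θ : N ⟶ N') (p : lambdaSubgroup N) :
    lambdaHom f N p ≫ (redTilde f).map θ = lambdaHom f N' (lambdaMap θ p) := by
  refine ObjectProperty.hom_ext _ (NatTrans.ext (funext fun U => AddCommGrpCat.ext fun s =>
    redVal_injective ?_))
  refine (redVal_map f θ U.unop _).trans ?_
  refine Eq.trans ?_ (redVal_lambdaHom f N' _ U.unop s).symm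
  refine (congrArg (thickeningRingMap f θ U.unop) (redVal_lambdaHom f N p U.unop s)).trans ?_
  exact lambdaPairing_map f θ p U.unop (constantCoeff_wittVal U.unop s)

lemma lambdaHom_lambdaElt (n : ℕ) :
    lambdaHom f (truncAlg R n) (lambdaElt R n) = wittToRed f n := by
  refine ObjectProperty.hom_ext _ (NatTrans.ext (funext fun U => AddCommGrpCat.ext fun s =>
    redVal_injective ?_))
  refine (redVal_lambdaHom f _ _ U.unop s).trans ?_
  refine Eq.trans ?_ (redVal_wittToRed f n U.unop s).symm
  exact lambdaPairing_lambdaElt f n U.unop (constantCoeff_wittVal U.unop s)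

end LambdaHom

/-! ### Curves and Witt vector cohomology -/

section Curves

variable {R : Type u} [CommRing R]

/-- The component at 0 is the image of the component at 1, so only the positive indices, where the
truncations are under control, have to be compared. -/
lemma curves_ext {H : NilAlg R ⥤ AddCommGrpCat.{u}} {c d : curves H}
    (h : ∀ n, c.1 (n + 1) = d.1 (n + 1)) : c = d := by
  refine Subtype.ext (funext fun n => ?_)
  rw [← c.2 n, ← d.2 n, h]

variable {X : Scheme.{u}} {f : X ⟶ Spec (.of R)} {q : ℕ} {W : X.Opens}
  {H : NilAlg R ⥤ AddCommGrpCat.{u}} (τ : ∀ N, coh ((redTilde f).obj N) q W →+ H.obj N)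
  (hτ : ∀ {N N'} (θ : N ⟶ N') (z), τ N' (cohMap ((redTilde f).map θ) q W z) = H.map θ (τ N z))

/-- The homomorphism `Λ ⟶ H` given by a cohomology class of `𝕎𝒪_X`. -/
def cohLambda (y : coh (wittSheaf X) q W) : Lambda R ⟶ H where
  app N := AddCommGrpCat.ofHom (AddMonoidHom.mk'
    (fun p : Additive (lambdaSubgroup N) => τ N (cohMap (lambdaHom f N (Additive.toMul p)) q W y))
    (fun p p' => by rw [toMul_add, lambdaHom_mul, cohMap_add, map_add]))
  naturality N N' θ := by
    refine AddCommGrpCat.ext fun p => ?_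
    refine Eq.trans ?_ (hτ θ (cohMap (lambdaHom f N (Additive.toMul p)) q W y))
    rw [← cohMap_comp, lambdaHom_map]
    rfl

lemma cohLambda_app (y : coh (wittSheaf X) q W) (N : NilAlg R) (p : lambdaSubgroup N) :
    (cohLambda τ hτ y).app N (Additive.ofMul p) = τ N (cohMap (lambdaHom f N p) q W y) := rfl

/-- The curve given by a cohomology class of `𝕎𝒪_X`. -/
def cohCurve : coh (wittSheaf X) q W →+ curves H where
  toFun y := ⟨fun n => τ _ (cohMap (wittToRed f n) q W y), fun n => by
    rw [← hτ, ← cohMap_comp, wittToRed_proj]⟩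
  map_zero' := Subtype.ext (funext fun n => by simp only [map_zero]; rfl)
  map_add' y y' := Subtype.ext (funext fun n => by simp only [map_add]; rfl)

lemma cohCurve_coe (y : coh (wittSheaf X) q W) (n : ℕ) :
    (cohCurve τ hτ y).1 n = τ _ (cohMap (wittToRed f n) q W y) := rfl

lemma evalCurve_cohLambda (y : coh (wittSheaf X) q W) :
    evalCurve H (cohLambda τ hτ y) = cohCurve τ hτ y := by
  refine Subtype.ext (funext fun n => ?_)
  refine (cohLambda_app τ hτ y _ _).trans ?_
  rw [lambdaHom_lambdaElt, cohCurve_coe]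

variable (hbij : ∀ n, Function.Bijective (τ (truncAlg R (n + 1))))
  (hc : CohTorsionFree (structSheaf X) q W)

include hbij in
lemma cohCurve_surjective : Function.Surjective (cohCurve τ hτ) := by
  intro c
  choose x hx using fun n => (hbij n).2 (c.1 (n + 1))
  obtain ⟨y, hy⟩ := exists_cohMap_wittToRed f x (fun n => (hbij n).1 (by
    refine (hτ (truncAlg.proj R (n + 1)) (x (n + 1))).trans ?_
    rw [hx, hx]
    exact c.2 (n + 1)))
  refine ⟨y, curves_ext fun n => ?_⟩
  rw [cohCurve_coe, hy, hx]

include hbij hc in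
lemma cohCurve_bijective : Function.Bijective (cohCurve τ hτ) := by
  refine ⟨?_, cohCurve_surjective τ hτ hbij⟩
  rw [injective_iff_map_eq_zero]
  intro y hy
  refine cohMap_wittToRed_injective (f := f) hc y fun n => (hbij n).1 ?_
  rw [map_zero]
  exact congrFun (congrArg Subtype.val hy) (n + 1)

include hτ hbij hc in
-- A curve comes from a class of 𝕎𝒪_X by passage to the limit, and pairing this class with Λ extends
-- the curve to a homomorphism.
lemma evalCurve_bijective [Module.Flat ℤ R] : Function.Bijective (evalCurve H) := by
  refine ⟨evalCurve_injective_of_coh hc H τ hτ hbij, fun c => ?_⟩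
  obtain ⟨y, rfl⟩ := cohCurve_surjective τ hτ hbij c
  exact ⟨cohLambda τ hτ y, evalCurve_cohLambda τ hτ y⟩

end Curves

/-! ### The action of the Cartier ring on the sheaf of Witt vectors -/

section Action

variable {R : Type u} [CommRing R] {X : Scheme.{u}} (f : X ⟶ Spec (.of R))

/-- The image of `1 - x t` under an endomorphism of `Λ`. -/
def lambdaEndElt (a : End (Lambda R)) (n : ℕ) : lambdaSubgroup (truncAlg R n) :=
  Additive.toMul (a.app (truncAlg R n) (Additive.ofMul (lambdaElt R n)))

lemma lambdaMap_lambdaEndElt (a : End (Lambda R)) (n : ℕ) :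
    lambdaMap (truncAlg.proj R n) (lambdaEndElt a (n + 1)) = lambdaEndElt a n := by
  have h := lambda_naturality a (truncAlg.proj R n) (lambdaElt R (n + 1))
  rw [lambdaMap_lambdaElt] at h
  exact congrArg Additive.toMul h.symm

lemma sheafHom_comp_apply {Y : TopCat.{u}} {F G K : TopCat.Sheaf AddCommGrpCat.{u} Y} (φ : F ⟶ G)
    (ψ : G ⟶ K) (U : Opens Y) (s : F.obj.obj (op U)) :
    (φ ≫ ψ).hom.app (op U) s = ψ.hom.app (op U) (φ.hom.app (op U) s) := rfl

lemma lambdaHom_redProj (a : End (Lambda R)) (n : ℕ) :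
    lambdaHom f _ (lambdaEndElt a (n + 1)) ≫ redProj f n = lambdaHom f _ (lambdaEndElt a n) :=
  (lambdaHom_map f (truncAlg.proj R n) _).trans
    (congrArg (lambdaHom f (truncAlg R n)) (lambdaMap_lambdaEndElt a n))

/-- Pairing ω with the elements a(1 - xt) gives compatible sections of the truncations. Over an
arbitrary open they form a Witt vector by the Milnor sequence in degree zero. -/
lemma exists_cartier (a : End (Lambda R)) {U : X.Opens} (ω : (wittSheaf X).obj.obj (op U)) :
    ∃ ω' : (wittSheaf X).obj.obj (op U), ∀ n, (wittToRed f (n + 1)).hom.app (op U) ω' =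
      (lambdaHom f _ (lambdaEndElt a (n + 1))).hom.app (op U) ω := by
  have hs : ∀ n, (redProj f (n + 1)).hom.app (op U)
      ((lambdaHom f (truncAlg R (n + 1 + 1)) (lambdaEndElt a (n + 1 + 1))).hom.app (op U) ω) =
        (lambdaHom f (truncAlg R (n + 1)) (lambdaEndElt a (n + 1))).hom.app (op U) ω :=
    fun n => (sheafHom_comp_apply (lambdaHom f (truncAlg R (n + 1 + 1))
      (lambdaEndElt a (n + 1 + 1))) (redProj f (n + 1)) U ω).symm.trans
        (sheafHom_congr (lambdaHom_redProj f a (n + 1)) U ω)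
  obtain ⟨y, hy⟩ := exists_cohMap_wittToRed f (q := 0) (W := U)
    (fun n => (cohZero (redTrunc f (n + 1)) U).symm
      ((lambdaHom f _ (lambdaEndElt a (n + 1))).hom.app (op U) ω))
    (fun n => (cohMap_cohZero_symm (redProj f (n + 1)) _).trans
      (congrArg (cohZero (redTrunc f (n + 1)) U).symm (hs n)))
  obtain ⟨ω', rfl⟩ := (cohZero _ U).symm.surjective y
  refine ⟨ω', fun n => (cohZero _ U).symm.injective ?_⟩
  exact (cohMap_cohZero_symm (wittToRed f (n + 1)) ω').symm.trans (hy n)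

/-- The endomorphism of `𝕎𝒪_X` on sections given by an endomorphism of `Λ`. -/
def cartierFun (a : End (Lambda R)) (U : X.Opens) (ω : (wittSheaf X).obj.obj (op U)) :
    (wittSheaf X).obj.obj (op U) :=
  (exists_cartier f a ω).choose

lemma wittToRed_cartierFun (a : End (Lambda R)) (U : X.Opens) (ω : (wittSheaf X).obj.obj (op U))
    (n : ℕ) : (wittToRed f (n + 1)).hom.app (op U) (cartierFun f a U ω) =
      (lambdaHom f _ (lambdaEndElt a (n + 1))).hom.app (op U) ω :=
  (exists_cartier f a ω).choose_spec n

/-- The endomorphism of `𝕎𝒪_X` given by an endomorphism of `Λ`. -/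
def cartierHom (a : End (Lambda R)) : wittSheaf X ⟶ wittSheaf X :=
  ⟨{ app := fun U => AddCommGrpCat.ofHom (AddMonoidHom.mk' (cartierFun f a U.unop)
       (fun ω ω' => witt_ext (f := f) fun n => by
         refine (wittToRed_cartierFun f a U.unop _ n).trans ?_
         refine (map_add _ ω ω').trans ?_
         refine Eq.trans ?_ (map_add _ _ _).symm
         exact congrArg₂ (· + ·) (wittToRed_cartierFun f a U.unop ω n).symm
           (wittToRed_cartierFun f a U.unop ω' n).symm))
     naturality := fun U V i => by
       refine AddCommGrpCat.ext fun ω => witt_ext (f := f) fun n => ?_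
       refine (wittToRed_cartierFun f a V.unop _ n).trans ?_
       refine (ConcreteCategory.congr_hom
         ((lambdaHom f _ (lambdaEndElt a (n + 1))).hom.naturality i) ω).trans ?_
       refine Eq.trans ?_ (ConcreteCategory.congr_hom
         ((wittToRed f (n + 1)).hom.naturality i) (cartierFun f a U.unop ω)).symm
       exact congrArg (((redTilde f).obj _).obj.map i)
         (wittToRed_cartierFun f a U.unop ω n).symm }⟩

lemma cartierHom_wittToRed_succ (a : End (Lambda R)) (n : ℕ) :
    cartierHom f a ≫ wittToRed f (n + 1) = lambdaHom f _ (lambdaEndElt a (n + 1)) :=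
  ObjectProperty.hom_ext _ (NatTrans.ext (funext fun U => AddCommGrpCat.ext fun ω =>
    wittToRed_cartierFun f a U.unop ω n))

lemma cartierHom_wittToRed (a : End (Lambda R)) (n : ℕ) :
    cartierHom f a ≫ wittToRed f n = lambdaHom f _ (lambdaEndElt a n) := by
  rw [← wittToRed_proj, ← Category.assoc, cartierHom_wittToRed_succ, lambdaHom_map,
    lambdaMap_lambdaEndElt]

variable {f} in
lemma wittHom_ext {F : TopCat.Sheaf AddCommGrpCat.{u} X} {g h : F ⟶ wittSheaf X}
    (w : ∀ n, g ≫ wittToRed f (n + 1) = h ≫ wittToRed f (n + 1)) : g = h :=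
  ObjectProperty.hom_ext _ (NatTrans.ext (funext fun U => AddCommGrpCat.ext fun s =>
    witt_ext (f := f) fun n => sheafHom_congr (w n) U.unop s))

/-- By construction this holds for p = 1 - xt. For general p, both sides come from homomorphisms out
of Λ into the functor of sections over U, and these agree because they have the same curve. -/
lemma cartierHom_lambdaHom [Module.Flat ℤ R] [Flat f] (a : End (Lambda R)) (N : NilAlg R)
    (p : lambdaSubgroup N) : cartierHom f a ≫ lambdaHom f N p =
      lambdaHom f N (Additive.toMul (a.app N (Additive.ofMul p))) := by
  refine ObjectProperty.hom_ext _ (NatTrans.ext (funext fun U => AddCommGrpCat.ext fun ω => ?_))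
  have hnat := fun {N N' : NilAlg R} => cohToTilde_naturality f U.unop (N := N) (N' := N')
  let y := (cohZero (wittSheaf X) U.unop).symm ω
  have key : cohLambda (cohToTilde f U.unop) hnat (cohMap (cartierHom f a) 0 U.unop y) =
      a ≫ cohLambda (cohToTilde f U.unop) hnat y := by
    apply evalCurve_tildeNil_injective f U.unop
    rw [evalCurve_cohLambda]
    refine Subtype.ext (funext fun n => ?_)
    rw [cohCurve_coe, ← cohMap_comp, cartierHom_wittToRed]
    rfl
  have h2 : cohToTilde f U.unop N (cohMap (lambdaHom f N p) 0 U.unop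
      (cohMap (cartierHom f a) 0 U.unop y)) = cohToTilde f U.unop N (cohMap (lambdaHom f N
        (Additive.toMul (a.app N (Additive.ofMul p)))) 0 U.unop y) :=
    congrArg (fun φ : Lambda R ⟶ tildeNil f U.unop => φ.app N (Additive.ofMul p)) key
  have h3 := (cohToTilde_bijective f U.unop N).1 h2
  rw [← cohMap_comp] at h3
  refine (cohZero _ U.unop).symm.injective ?_
  exact (cohMap_cohZero_symm _ _).symm.trans (h3.trans (cohMap_cohZero_symm _ _))

/-- The action of the Cartier ring on `𝕎𝒪_X`. -/
def cartierAction [Module.Flat ℤ R] [Flat f] : CartierRing R →+* End (wittSheaf X) where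
  toFun a := cartierHom f a.unop
  map_one' := wittHom_ext (f := f) fun n => by
    rw [cartierHom_wittToRed]
    refine (lambdaHom_lambdaElt f (n + 1)).trans ?_
    exact (Category.id_comp _).symm
  -- The assignment a ↦ `cartierHom f a` reverses composition, which matches the opposite ring in
  -- the definition of the Cartier ring.
  map_mul' a b := wittHom_ext (f := f) fun n => by
    rw [cartierHom_wittToRed, End.mul_def, Category.assoc, cartierHom_wittToRed,
      cartierHom_lambdaHom]
    rfl
  map_zero' := wittHom_ext (f := f) fun n => by
    rw [cartierHom_wittToRed, Limits.zero_comp]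
    have h : lambdaHom f _ (1 * 1 : lambdaSubgroup (truncAlg R (n + 1))) = _ := lambdaHom_mul f _ 1
        1
    rw [mul_one, left_eq_add] at h
    exact h
  map_add' a b := wittHom_ext (f := f) fun n => by
    rw [cartierHom_wittToRed, Preadditive.add_comp, cartierHom_wittToRed, cartierHom_wittToRed,
      ← lambdaHom_mul]
    rfl

lemma smul_cohLambda [Module.Flat ℤ R] [Flat f] {q : ℕ} {W : X.Opens}
    {H : NilAlg R ⥤ AddCommGrpCat.{u}} (τ : ∀ N, coh ((redTilde f).obj N) q W →+ H.obj N)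
    (hτ : ∀ {N N'} (θ : N ⟶ N') (z), τ N' (cohMap ((redTilde f).map θ) q W z) = H.map θ (τ N z))
    (a : CartierRing R) (y : coh (wittSheaf X) q W) :
    a • cohLambda τ hτ y = cohLambda τ hτ (cohMap (cartierAction f a) q W y) := by
  refine NatTrans.ext (funext fun N => AddCommGrpCat.ext fun p => ?_)
  refine Eq.trans ?_ (cohLambda_app τ hτ _ N (Additive.toMul p)).symm
  rw [← cohMap_comp]
  refine Eq.trans ?_ (congrArg (fun k => τ N (cohMap k q W y))
    (cartierHom_lambdaHom f a.unop N (Additive.toMul p)).symm)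
  rfl

lemma isWittVectorOf_iff {U : X.Opens} (φ : Lambda R ⟶ tildeNil f U)
    (ω : (wittSheaf X).obj.obj (op U)) : IsWittVectorOf f φ ω ↔ evalCurve (tildeNil f U) φ =
      cohCurve (cohToTilde f U) (cohToTilde_naturality f U) ((cohZero _ U).symm ω) := by
  have h : ∀ n, ((cohCurve (cohToTilde f U) (cohToTilde_naturality f U)
      ((cohZero _ U).symm ω)).1 n).1 = (wittToTilde f n).hom.app (op U) ω := by
    intro n
    refine (cohToTilde_coe f U _ _).trans ?_
    refine (congrArg (fun k => (redTildeι f _).hom.app (op U) (cohZero _ U k))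
      (cohMap_cohZero_symm _ _)).trans ?_
    refine (congrArg ((redTildeι f _).hom.app (op U)) ((cohZero _ U).apply_symm_apply _)).trans ?_
    exact sheafHom_congr (wittToRed_ι f n) U ω
  constructor
  · intro h1
    exact Subtype.ext (funext fun n => Subtype.ext ((h1 n).trans (h n).symm))
  · intro h1 n
    rw [h1]
    exact h n

lemma isCartierAction [Module.Flat ℤ R] [Flat f] : IsCartierAction f (cartierAction f) where
  existsUnique_witt U φ := by
    obtain ⟨y, hy, huniq⟩ := (cohCurve_bijective (cohToTilde f U) (cohToTilde_naturality f U)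
      (fun _ => cohToTilde_bijective f U _)
      (cohTorsionFree_structSheaf_zero (f := f) U)).existsUnique (evalCurve (tildeNil f U) φ)
    refine ⟨cohZero _ U y, ?_, fun ω hω => ?_⟩
    · refine (isWittVectorOf_iff f φ _).2 ?_
      rw [AddEquiv.symm_apply_apply, hy]
    · rw [← huniq _ ((isWittVectorOf_iff f φ _).1 hω).symm, AddEquiv.apply_symm_apply]
  existsUnique_hom U ω := by
    obtain ⟨φ, hφ, huniq⟩ := (evalCurve_bijective (cohToTilde f U) (cohToTilde_naturality f U)
      (fun _ => cohToTilde_bijective f U _)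
      (cohTorsionFree_structSheaf_zero (f := f) U)).existsUnique
        (cohCurve (cohToTilde f U) (cohToTilde_naturality f U) ((cohZero _ U).symm ω))
    exact ⟨φ, (isWittVectorOf_iff f φ ω).2 hφ, fun φ' hφ' =>
      huniq φ' ((isWittVectorOf_iff f φ' ω).1 hφ')⟩
  smul U φ ω a h := by
    rw [isWittVectorOf_iff, ← evalCurve_cohLambda] at h
    have h1 := evalCurve_tildeNil_injective f U h
    rw [isWittVectorOf_iff, h1, smul_cohLambda, evalCurve_cohLambda, cohMap_cohZero_symm]

end Action

end CartierWitt

end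

theorem proposition4p1p7 {R : Type u} [CommRing R] [IsNoetherianRing R] [Module.Flat ℤ R]
    {X : Scheme.{u}} [IsNoetherian X] (f : X ⟶ Spec (.of R)) [Flat f] [IsSeparated f] (q₀ : ℕ)
    (hf : ∀ q, q₀ ≤ q → CartierWitt.IsLocallyFreeOfFiniteRank f q) :
    Function.Bijective (CartierWitt.evalCurve (CartierWitt.phiNil f q₀)) ∧
    ∃ (ρ : CartierWitt.CartierRing R →+* End (CartierWitt.wittSheaf X))
      (e : (CartierWitt.cohomology X q₀).obj (CartierWitt.wittSheaf X) ≃+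
        CartierWitt.curves (CartierWitt.phiNil f q₀)),
      CartierWitt.IsCartierAction f ρ ∧
      (∀ h n, ((e h).1 n).1 = CartierWitt.wittToPhi f q₀ n h) ∧
      ∀ (a : CartierWitt.CartierRing R) (φ : CartierWitt.Lambda R ⟶ CartierWitt.phiNil f q₀)
        (h : (CartierWitt.cohomology X q₀).obj (CartierWitt.wittSheaf X)),
        CartierWitt.evalCurve (CartierWitt.phiNil f q₀) φ = e h →
        CartierWitt.evalCurve (CartierWitt.phiNil f q₀) (a • φ) =
          e ((CartierWitt.cohomology X q₀).map (ρ a) h) := by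
  have hc : ∀ V ∈ CartierWitt.basicClass R, CartierWitt.CohTorsionFree
      (CartierWitt.structSheaf X) q₀ (CartierWitt.preim f V) := fun V hV m hm x hx =>
    CartierWitt.coh_structSheaf_eq_zero_of_nsmul (hf q₀ le_rfl) hV hm x hx
  have hnat := fun {N N' : CartierWitt.NilAlg R} =>
    CartierWitt.cohToPhi_naturality f q₀ (N := N) (N' := N')
  have hbij := CartierWitt.cohToPhi_truncAlg_bijective f hc
  have htop := CartierWitt.cohTorsionFree_top f hc
  have hev := CartierWitt.evalCurve_bijective (CartierWitt.cohToPhi f q₀) hnat hbij htop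
  refine ⟨hev, CartierWitt.cartierAction f,
    (CartierWitt.derEquiv q₀ (CartierWitt.wittSheaf X)).trans (AddEquiv.ofBijective
      (CartierWitt.cohCurve (CartierWitt.cohToPhi f q₀) hnat)
      (CartierWitt.cohCurve_bijective _ hnat hbij htop)),
    CartierWitt.isCartierAction f, fun h n => ?_, fun a φ h hφ => ?_⟩
  · exact (CartierWitt.wittToPhi_eq_cohToPhi f q₀ n h).symm
  -- By injectivity of evaluation φ is the homomorphism attached to the class h, and on such
  -- homomorphisms the Cartier ring acts through its action on the class.
  · have h1 : φ = CartierWitt.cohLambda (CartierWitt.cohToPhi f q₀) hnat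
        (CartierWitt.derEquiv q₀ _ h) :=
      hev.1 (hφ.trans (CartierWitt.evalCurve_cohLambda _ hnat _).symm)
    rw [h1, CartierWitt.smul_cohLambda, CartierWitt.evalCurve_cohLambda,
      ← CartierWitt.derEquiv_naturality]
    rfl
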